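/- Let $\mathcal V$ be the vertex superalgebra of symplectic fermions over $\mathbb C$: it is generated by two odd fields $\psi(z)=\sum_{n\in\mathbb Z}\psi_nz^{-n-1}$, $\bar\psi(z)=\sum_{n\in\mathbb Z}\bar\psi_nz^{-n-1}$ acting on the Fock space with vacuum annihilated by $\psi_n,\bar\psi_n$ ($n\ge 0$), with $\{\psi_m,\bar\psi_n\}=m\,\delta_{m,-n}$ and $\{\psi_m,\psi_n\}=\{\bar\psi_m,\bar\psi_n\}=0$. The group $\mathrm{SL}_2(\mathbb C)$ acts on $\mathcal V$ by automorphisms through its action on $\mathbb C\psi\oplus\mathbb C\bar\psi$. For $r,t\in\mathbb C$ consider, in the ordered basis $\psi,\bar\psi$ (columns are images), the derivations $$s=\begin{pmatrix} r&0\\0&-r\end{pmatrix},\qquad x=\begin{pmatrix}0&0\\-2t&0\end{pmatrix},$$ and let $g=e^{-2\pi i s}e^{-2\pi i x}$, or, if $2r\notin\mathbb Z$, alternatively $g=e^{-2\pi i(s+x)}$ (these agree if $rt=0$). A $g$-twisted module is a vector superspace $M$ with a parity preserving linear map $a\mapsto Y(a,z)=\sum_{n\in\mathbb C,\,k\in\mathbb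 N}a_{n,k}\,z^{-n-1}(\log z)^k$ from $\mathcal V$ to mutually local logarithmic fields on $M$, which maps the vacuum to $\mathrm{id}_M$, satisfies $Y(a_{(j)}b,z)=Y(a,z)_{(j)}Y(b,z)$ for all $j\in\mathbb Z$, and has monodromy $Y(ga,z)=e^{2\pi i z\partial_z}Y(a,z)$. (A logarithmic field has exponents in finitely many cosets of $\mathbb Z$ and, on each vector, is bounded below in $z$ and polynomial in $\log z$; for fields local of order $N$ the products are $a(z)_{(j)}b(z)=\frac1{(N-1-j)!}\partial_z^{N-1-j}\big((z-w)^Na(z)b(w)\big)|_{w=z}$ for $j<N$ and $0$ for $j\ge N$.) For $n\in r+\mathbb Z$ let $\psi^g_n$, and for $n\in -r+\mathbb Z$ let $\bar\psi_n^g$, be the coefficient of $z^{-n-1}(\log z)^0$ in $Y(\psi,z)$, resp. $Y(\bar\psi,z)$. Then the algebra of twisted mode operators is the associative algebra $\mathcal A_{r,t}$ generated by $\psi^g_n$ ($n\in r+\mathbb Z$) and $\bar\psi^g_n$ ($n\in -r+\mathbb Z$) with the relations $$\{\psi^g_m,\psi^g_n\}=2t\,\delta_{m,-n},\qquad \{\psi^g_m,\bar\psi^g_n\}=m\,\delta_{m,-n},\qquad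 \{\bar\psi^g_m,\bar\psi^g_n\}=0 .$$ That is: (1) on every $g$-twisted module the twisted modes satisfy these relations, are odd, and every vector is annihilated by all modes with index of sufficiently large real part; (2) conversely, every representation of $\mathcal A_{r,t}$ on a vector superspace with the last two properties comes from a unique $g$-twisted module structure; (3) an element of $\mathcal A_{r,t}$ that acts by zero on all $g$-twisted modules is zero. Moreover, (4) let $\omega=\bar\psi_{(-1)}\psi$. On every $g$-twisted module $Y(\omega,z)=\sum_{n\in\mathbb Z}L_nz^{-n-2}$, the $L_n$ satisfy the relations of the Virasoro algebra with central charge $-2$, and, with all sums finite on every vector, $$L_n=\sum_{i+j=n}\bar\psi^g_i\psi^g_j\quad(n\neq 0),$$ $$L_0=\sum_{j>0}\bar\psi^g_{-j}\psi^g_j+\tfrac12\big(\bar\psi^g_0\psi^g_0-\psi^g_0\bar\psi^g_0\big)-\sum_{i>0}\psi^g_{-i}\bar\psi^g_i+\binom{s_0}{2},$$ where $\binom{s_0}{2}=\frac{s_0(s_0-1)}2$ for the representative $s_0\in r+\mathbb Z$ with $0\le\mathrm{Re}(s_0)<1$, the terms with index $0$ occur only if $r\in\mathbb Z$, and for non-real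 $r$ the condition $j>0$ (for $j\in r+\mathbb Z$) means $\mathrm{Re}(j)\ge 0$, $j\neq 0$, and $i>0$ (for $i\in-r+\mathbb Z$) means $\mathrm{Re}(i)>0$. -/

import Mathlib

open scoped Matrix

noncomputable section

namespace SymplecticFermions

/-! ### The mode algebras -/

/-- Symbols for the modes: `psi k` stands for `ψ_{r+k}` and `psibar k` for `ψ̄_{-r+k}`, `k ∈ ℤ`. -/
inductive Gen : Type
  | psi (k : ℤ) : Gen
  | psibar (k : ℤ) : Gen

/-- The relations `{ψ_m, ψ_n} = 2t δ_{m,-n}`, `{ψ_m, ψ̄_n} = m δ_{m,-n}`, `{ψ̄_m, ψ̄_n} = 0`, where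
the index of `ψ` runs over `r + ℤ` and the index of `ψ̄` over `-r + ℤ`. -/
inductive ModeRel (r t : ℂ) : FreeAlgebra ℂ Gen → FreeAlgebra ℂ Gen → Prop
  | psi_psi (k l : ℤ) : ModeRel r t
      (FreeAlgebra.ι ℂ (Gen.psi k) * FreeAlgebra.ι ℂ (Gen.psi l)
        + FreeAlgebra.ι ℂ (Gen.psi l) * FreeAlgebra.ι ℂ (Gen.psi k))
      (algebraMap ℂ _ (open Classical in if r + k = -(r + l) then 2 * t else 0))
  | psi_psibar (k l : ℤ) : ModeRel r t
      (FreeAlgebra.ι ℂ (Gen.psi k) * FreeAlgebra.ι ℂ (Gen.psibar l)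
        + FreeAlgebra.ι ℂ (Gen.psibar l) * FreeAlgebra.ι ℂ (Gen.psi k))
      (algebraMap ℂ _ (open Classical in if r + k = -(-r + l) then r + k else 0))
  | psibar_psibar (k l : ℤ) : ModeRel r t
      (FreeAlgebra.ι ℂ (Gen.psibar k) * FreeAlgebra.ι ℂ (Gen.psibar l)
        + FreeAlgebra.ι ℂ (Gen.psibar l) * FreeAlgebra.ι ℂ (Gen.psibar k))
      0

/-- The associative algebra generated by `ψ_n` (`n ∈ r + ℤ`) and `ψ̄_n` (`n ∈ -r + ℤ`) with the
relations `ModeRel r t`. For `r = t = 0` it is the mode algebra of the symplectic fermions. -/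
def ModeAlgebra (r t : ℂ) : Type := RingQuot (ModeRel r t)

instance (r t : ℂ) : Ring (ModeAlgebra r t) := inferInstanceAs (Ring (RingQuot (ModeRel r t)))

instance (r t : ℂ) : Algebra ℂ (ModeAlgebra r t) :=
  inferInstanceAs (Algebra ℂ (RingQuot (ModeRel r t)))

/-- The quotient map from the free algebra. -/
def mkMode (r t : ℂ) : FreeAlgebra ℂ Gen →ₐ[ℂ] ModeAlgebra r t :=
  RingQuot.mkAlgHom ℂ (ModeRel r t)

theorem mkMode_rel {r t : ℂ} {x y : FreeAlgebra ℂ Gen} (h : ModeRel r t x y) :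
    mkMode r t x = mkMode r t y :=
  RingQuot.mkAlgHom_rel ℂ h

/-- The generator `ψ_{r+k}`. -/
def psi (r t : ℂ) (k : ℤ) : ModeAlgebra r t :=
  mkMode r t (FreeAlgebra.ι ℂ (Gen.psi k))

/-- The generator `ψ̄_{-r+k}`. -/
def psibar (r t : ℂ) (k : ℤ) : ModeAlgebra r t :=
  mkMode r t (FreeAlgebra.ι ℂ (Gen.psibar k))

theorem psi_psi (r t : ℂ) (k l : ℤ) :
    psi r t k * psi r t l + psi r t l * psi r t k
      = algebraMap ℂ _ (open Classical in if r + k = -(r + l) then 2 * t else 0) := by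
  have h := mkMode_rel (ModeRel.psi_psi (r := r) (t := t) k l)
  simpa only [map_add, map_mul, AlgHom.commutes, psi, psibar] using h

theorem psi_psibar (r t : ℂ) (k l : ℤ) :
    psi r t k * psibar r t l + psibar r t l * psi r t k
      = algebraMap ℂ _ (open Classical in if r + k = -(-r + l) then r + k else 0) := by
  have h := mkMode_rel (ModeRel.psi_psibar (r := r) (t := t) k l)
  simpa only [map_add, map_mul, AlgHom.commutes, psi, psibar] using h

theorem psibar_psibar (r t : ℂ) (k l : ℤ) :
    psibar r t k * psibar r t l + psibar r t l * psibar r t k = 0 := by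
  have h := mkMode_rel (ModeRel.psibar_psibar (r := r) (t := t) k l)
  simpa only [map_add, map_mul, map_zero, psibar] using h

/-! ### The Fock space and the action of `SL₂` on it -/

/-- The left ideal generated by the `ψ_n`, `ψ̄_n` with `n ≥ 0`. -/
def vacuumIdeal : Ideal (ModeAlgebra 0 0) :=
  Ideal.span {a | ∃ k : ℤ, 0 ≤ k ∧ (a = psi 0 0 k ∨ a = psibar 0 0 k)}

/-- The Fock space of the symplectic fermions: the (untwisted) module generated by a vacuum vector
that is annihilated by all `ψ_n`, `ψ̄_n` with `n ≥ 0`. -/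
def Fock : Type := ModeAlgebra 0 0 ⧸ vacuumIdeal

instance : AddCommGroup Fock := inferInstanceAs (AddCommGroup (ModeAlgebra 0 0 ⧸ vacuumIdeal))

instance : Module (ModeAlgebra 0 0) Fock :=
  inferInstanceAs (Module (ModeAlgebra 0 0) (ModeAlgebra 0 0 ⧸ vacuumIdeal))

instance : Module ℂ Fock := inferInstanceAs (Module ℂ (ModeAlgebra 0 0 ⧸ vacuumIdeal))

instance : IsScalarTower ℂ (ModeAlgebra 0 0) Fock :=
  inferInstanceAs (IsScalarTower ℂ (ModeAlgebra 0 0) (ModeAlgebra 0 0 ⧸ vacuumIdeal))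

/-- The action of the mode algebra on the Fock space. -/
def fockAction : ModeAlgebra 0 0 →ₐ[ℂ] Module.End ℂ Fock := Algebra.lsmul ℂ ℂ Fock

/-- The image of a generator under `g`; the matrix acts on the span of `ψ, ψ̄` in this ordered basis,
so that `g ψ = g₀₀ ψ + g₁₀ ψ̄` and `g ψ̄ = g₀₁ ψ + g₁₁ ψ̄`. -/
def genImage (g : Matrix.SpecialLinearGroup (Fin 2) ℂ) : Gen → ModeAlgebra 0 0
  | Gen.psi k => g 0 0 • psi 0 0 k + g 1 0 • psibar 0 0 k
  | Gen.psibar k => g 0 1 • psi 0 0 k + g 1 1 • psibar 0 0 k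

theorem genImage_anticomm (a b c d : ℂ) (k l : ℤ) :
    (a • psi 0 0 k + b • psibar 0 0 k) * (c • psi 0 0 l + d • psibar 0 0 l)
      + (c • psi 0 0 l + d • psibar 0 0 l) * (a • psi 0 0 k + b • psibar 0 0 k)
      = algebraMap ℂ (ModeAlgebra 0 0)
        (open Classical in if (0 : ℂ) + k = -(-0 + l) then (a * d - b * c) * (0 + k) else 0) := by
  have h1 := psi_psi 0 0 k l
  have h2 := psi_psibar 0 0 k l
  have h3 := psi_psibar 0 0 l k
  have h4 := psibar_psibar 0 0 k l
  have e : (a • psi 0 0 k + b • psibar 0 0 k) * (c • psi 0 0 l + d • psibar 0 0 l)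
      + (c • psi 0 0 l + d • psibar 0 0 l) * (a • psi 0 0 k + b • psibar 0 0 k)
      = (a * c) • (psi 0 0 k * psi 0 0 l + psi 0 0 l * psi 0 0 k)
        + (a * d) • (psi 0 0 k * psibar 0 0 l + psibar 0 0 l * psi 0 0 k)
        + (b * c) • (psi 0 0 l * psibar 0 0 k + psibar 0 0 k * psi 0 0 l)
        + (b * d) • (psibar 0 0 k * psibar 0 0 l + psibar 0 0 l * psibar 0 0 k) := by
    simp only [mul_add, add_mul, smul_mul_assoc, mul_smul_comm, smul_add, smul_smul]
    rw [mul_comm c a, mul_comm d a, mul_comm c b, mul_comm d b]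
    abel
  rw [e, h1, h2, h3, h4]
  simp only [Algebra.algebraMap_eq_smul_one, smul_smul, smul_zero, ← add_smul, add_zero]
  congr 1
  by_cases hkl : k = -l
  · subst hkl
    simp
    ring
  · have hc : ¬ ((k : ℂ) = -(l : ℂ)) := by exact_mod_cast hkl
    have hc' : ¬ ((l : ℂ) = -(k : ℂ)) := fun h => hc (by rw [h, neg_neg])
    simp [hc, hc']

theorem genImage_rel (g : Matrix.SpecialLinearGroup (Fin 2) ℂ) {x y : FreeAlgebra ℂ Gen}
    (h : ModeRel 0 0 x y) :
    FreeAlgebra.lift ℂ (genImage g) x = FreeAlgebra.lift ℂ (genImage g) y := by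
  have hdet : g 0 0 * g 1 1 - g 0 1 * g 1 0 = 1 := by
    have := g.det_coe
    rwa [Matrix.det_fin_two] at this
  cases h with
  | psi_psi k l =>
    simp only [map_add, map_mul, FreeAlgebra.lift_ι_apply, AlgHom.commutes, genImage]
    rw [genImage_anticomm]
    congr 1
    split_ifs <;> ring
  | psi_psibar k l =>
    simp only [map_add, map_mul, FreeAlgebra.lift_ι_apply, AlgHom.commutes, genImage]
    rw [genImage_anticomm]
    congr 1
    split_ifs
    · linear_combination ((0 : ℂ) + k) * hdet
    · rfl
  | psibar_psibar k l =>
    simp only [map_add, map_mul, FreeAlgebra.lift_ι_apply, map_zero, genImage]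
    rw [genImage_anticomm]
    rw [show (g 0 1 * g 1 1 - g 1 1 * g 0 1 : ℂ) = 0 by ring]
    simp

/-- The automorphism of the untwisted mode algebra defined by `g ∈ SL₂`. -/
def modeAut (g : Matrix.SpecialLinearGroup (Fin 2) ℂ) : ModeAlgebra 0 0 →ₐ[ℂ] ModeAlgebra 0 0 :=
  RingQuot.liftAlgHom ℂ (s := ModeRel 0 0)
    ⟨FreeAlgebra.lift ℂ (genImage g), fun _ _ h => genImage_rel g h⟩

theorem modeAut_mkMode (g : Matrix.SpecialLinearGroup (Fin 2) ℂ) (a : FreeAlgebra ℂ Gen) :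
    modeAut g (mkMode 0 0 a) = FreeAlgebra.lift ℂ (genImage g) a :=
  RingQuot.liftAlgHom_mkAlgHom_apply ℂ _ (fun _ _ h => genImage_rel g h) a

theorem modeAut_psi (g : Matrix.SpecialLinearGroup (Fin 2) ℂ) (k : ℤ) :
    modeAut g (psi 0 0 k) = g 0 0 • psi 0 0 k + g 1 0 • psibar 0 0 k := by
  rw [psi, modeAut_mkMode, FreeAlgebra.lift_ι_apply, genImage, psi]

theorem modeAut_psibar (g : Matrix.SpecialLinearGroup (Fin 2) ℂ) (k : ℤ) :
    modeAut g (psibar 0 0 k) = g 0 1 • psi 0 0 k + g 1 1 • psibar 0 0 k := by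
  rw [psibar, modeAut_mkMode, FreeAlgebra.lift_ι_apply, genImage, psibar]

theorem modeAut_mem (g : Matrix.SpecialLinearGroup (Fin 2) ℂ) (a : ModeAlgebra 0 0)
    (ha : a ∈ vacuumIdeal) : modeAut g a ∈ vacuumIdeal := by
  have hsm : ∀ (c : ℂ) (b : ModeAlgebra 0 0), b ∈ vacuumIdeal → c • b ∈ vacuumIdeal := by
    intro c b hb
    rw [Algebra.smul_def]
    exact vacuumIdeal.mul_mem_left _ hb
  induction ha using Submodule.span_induction with
  | mem x hx =>
    obtain ⟨k, hk, h⟩ := hx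
    have h1 : psi 0 0 k ∈ vacuumIdeal := Ideal.subset_span ⟨k, hk, Or.inl rfl⟩
    have h2 : psibar 0 0 k ∈ vacuumIdeal := Ideal.subset_span ⟨k, hk, Or.inr rfl⟩
    rcases h with rfl | rfl
    · rw [modeAut_psi]
      exact vacuumIdeal.add_mem (hsm _ _ h1) (hsm _ _ h2)
    · rw [modeAut_psibar]
      exact vacuumIdeal.add_mem (hsm _ _ h1) (hsm _ _ h2)
  | zero => simp
  | add x y _ _ hx hy => rw [map_add]; exact vacuumIdeal.add_mem hx hy
  | smul b x _ hx =>
    rw [smul_eq_mul, map_mul]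
    exact vacuumIdeal.mul_mem_left _ hx

/-- The action of `g ∈ SL₂` on the Fock space; it fixes the vacuum. -/
def fockAut (g : Matrix.SpecialLinearGroup (Fin 2) ℂ) : Module.End ℂ Fock :=
  Submodule.mapQ (vacuumIdeal.restrictScalars ℂ) (vacuumIdeal.restrictScalars ℂ)
    (modeAut g).toLinearMap (modeAut_mem g)

/-- The parity operator of the Fock space, given by `-1 ∈ SL₂`. -/
def fockParity : Module.End ℂ Fock := fockAut (-1)

/-! ### Logarithmic fields -/

/-- Formal expressions `a(z) = ∑ a_{n,k} z^{-n-1} (log z)^k` with `n ∈ ℂ`, `k ∈ ℕ` and coefficients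
`a n k` in `End M`. -/
abbrev FormalField (M : Type*) [AddCommGroup M] [Module ℂ M] : Type _ :=
  ℂ → ℕ → Module.End ℂ M

section Fields

variable {M : Type*} [AddCommGroup M] [Module ℂ M]

/-- `a(z)` is a logarithmic field: its exponents lie in finitely many cosets of `ℤ`, and for every
vector `v`, `a(z) v` has only finitely many negative powers of `z` in each coset and is
polynomial in `log z`. -/
def IsLogField (a : FormalField M) : Prop :=
  ∃ S : Finset ℂ, ∀ v : M, ∃ (N : ℤ) (K : ℕ), ∀ (n : ℂ) (k : ℕ), a n k v ≠ 0 →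
    k ≤ K ∧ ∃ α ∈ S, ∃ j : ℤ, j ≤ N ∧ n = α + j

/-- The identity field `id_M z^0`. -/
def oneField (M : Type*) [AddCommGroup M] [Module ℂ M] : FormalField M :=
  open Classical in fun n k => if n = -1 ∧ k = 0 then 1 else 0

/-- The field `∑_{n ∈ ℤ} u_n z^{-n-1}`. -/
def ofIntModes (u : ℤ → Module.End ℂ M) : FormalField M :=
  open Classical in fun n k => if n = (⌊n.re⌋ : ℂ) ∧ k = 0 then u ⌊n.re⌋ else 0

/-- With respect to the parity operator `π` the field `a` is homogeneous, even if `p` is even and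
odd if `p` is odd. -/
def HasParity (π : Module.End ℂ M) (p : ℕ) (a : FormalField M) : Prop :=
  ∀ (n : ℂ) (k : ℕ), π * a n k = (-1 : ℂ) ^ p • (a n k * π)

/-- The coefficient of `z^{-m-1} (log z)^k w^{-n-1} (log w)^l` in `(z - w)^N a(z) b(w)`. -/
def mulCoeff (N : ℕ) (a b : FormalField M) (m : ℂ) (k : ℕ) (n : ℂ) (l : ℕ) : Module.End ℂ M :=
  ∑ i ∈ Finset.range (N + 1),
    ((-1 : ℂ) ^ i * (N.choose i : ℂ)) • (a (m + N - i) k * b (n + i) l)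

/-- The coefficient of `z^{-m-1} (log z)^k w^{-n-1} (log w)^l` in `(z - w)^N b(w) a(z)`. -/
def mulCoeffOp (N : ℕ) (a b : FormalField M) (m : ℂ) (k : ℕ) (n : ℂ) (l : ℕ) : Module.End ℂ M :=
  ∑ i ∈ Finset.range (N + 1),
    ((-1 : ℂ) ^ i * (N.choose i : ℂ)) • (b (n + i) l * a (m + N - i) k)

/-- Locality for fields `a`, `b` of parities `p`, `q`:
`(z - w)^N a(z) b(w) = (-1)^{pq} (z - w)^N b(w) a(z)`. -/
def IsLocal (p q N : ℕ) (a b : FormalField M) : Prop :=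
  ∀ (m : ℂ) (k : ℕ) (n : ℂ) (l : ℕ),
    mulCoeff N a b m k n l = (-1 : ℂ) ^ (p * q) • mulCoeffOp N a b m k n l

/-- The derivative with respect to `z` (with `∂_z log z = z⁻¹`) of a formal expression
`∑ C_{m,k,n,l} z^{-m-1} (log z)^k w^{-n-1} (log w)^l`. -/
def derivZ (C : ℂ → ℕ → ℂ → ℕ → Module.End ℂ M) : ℂ → ℕ → ℂ → ℕ → Module.End ℂ M :=
  fun m k n l => (-m) • C (m - 1) k n l + ((k : ℂ) + 1) • C (m - 1) (k + 1) n l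

/-- The coefficient of `z^{-n-1} (log z)^e` in the restriction to `w = z` of
`∑ C_{m,k,n,l} z^{-m-1} (log z)^k w^{-n-1} (log w)^l v`. -/
def diagCoeff (C : ℂ → ℕ → ℂ → ℕ → Module.End ℂ M) (n : ℂ) (e : ℕ) (v : M) : M :=
  ∑ᶠ m : ℂ, ∑ k ∈ Finset.range (e + 1), C m k (n - 1 - m) (e - k) v

/-- `c` is the `j`-th product `a_{(j)} b` of the mutually local fields `a`, `b` of parities `p`, `q`:
if they are local of order `N`, then `a_{(j)} b = 0` for `j ≥ N`, and for `j = N - 1 - d`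
`(a_{(j)} b)(z) = (1/d!) ∂_z^d ((z - w)^N a(z) b(w))|_{w = z}`. -/
def IsNProduct (p q : ℕ) (j : ℤ) (a b c : FormalField M) : Prop :=
  ∃ N : ℕ, IsLocal p q N a b ∧ ((N : ℤ) ≤ j → c = 0) ∧
    ∀ d : ℕ, j + 1 + d = N → ∀ (n : ℂ) (e : ℕ) (v : M),
      c n e v = ((d.factorial : ℂ))⁻¹ • diagCoeff (derivZ^[d] (mulCoeff N a b)) n e v

end Fields

/-! ### The vertex superalgebra of symplectic fermions -/

/-- The field `ψ(z) = ∑_{n ∈ ℤ} ψ_n z^{-n-1}` on the Fock space. -/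
def psiField : FormalField Fock := ofIntModes fun k => fockAction (psi 0 0 k)

/-- The field `ψ̄(z) = ∑_{n ∈ ℤ} ψ̄_n z^{-n-1}` on the Fock space. -/
def psibarField : FormalField Fock := ofIntModes fun k => fockAction (psibar 0 0 k)

/-- A space of fields on the Fock space that contains the identity field, `ψ(z)` and `ψ̄(z)` and is
closed under all `j`-th products. -/
structure IsClosedFieldSpace (W : Submodule ℂ (FormalField Fock)) : Prop where
  one_mem : oneField Fock ∈ W
  psi_mem : psiField ∈ W
  psibar_mem : psibarField ∈ W
  nProduct_mem : ∀ (p q : ℕ) (j : ℤ) (a b c : FormalField Fock), a ∈ W → b ∈ W →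
    HasParity fockParity p a → HasParity fockParity q b → IsNProduct p q j a b c → c ∈ W

/-- The vertex superalgebra of symplectic fermions: the space of fields generated by `ψ(z)` and
`ψ̄(z)` under the `j`-th products, with the identity field as vacuum. -/
def SF : Submodule ℂ (FormalField Fock) := sInf {W | IsClosedFieldSpace W}

/-- The vacuum. -/
def SF.one : SF := ⟨oneField Fock, Submodule.mem_sInf.mpr fun _ h => h.one_mem⟩

/-- The generator `ψ`. -/
def SF.psi : SF := ⟨psiField, Submodule.mem_sInf.mpr fun _ h => h.psi_mem⟩

/-- The generator `ψ̄`. -/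
def SF.psibar : SF := ⟨psibarField, Submodule.mem_sInf.mpr fun _ h => h.psibar_mem⟩

/-- `a' = g a` for the action of `SL₂` on fields by conjugation, that is
`a'(z) = g a(z) g⁻¹`; in particular `g ψ = g₀₀ ψ + g₁₀ ψ̄`, `g ψ̄ = g₀₁ ψ + g₁₁ ψ̄`. -/
def IsImage (g : Matrix.SpecialLinearGroup (Fin 2) ℂ) (a a' : SF) : Prop :=
  ∀ (n : ℂ) (k : ℕ), a'.1 n k * fockAut g = fockAut g * a.1 n k

/-! ### Twisted modules -/

section Twisted

variable {M : Type*} [AddCommGroup M] [Module ℂ M]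

/-- A `g`-twisted module structure over the symplectic fermions on a vector superspace `M` with
parity operator `π`: a linear map `a ↦ Y(a, z)` to mutually local logarithmic fields that preserves
parity, vacuum and all `j`-th products, and whose monodromy around `z = 0` is given by `g`. -/
structure IsTwistedModule (g : Matrix.SpecialLinearGroup (Fin 2) ℂ) (π : Module.End ℂ M)
    (Y : SF →ₗ[ℂ] FormalField M) : Prop where
  isLogField : ∀ a : SF, IsLogField (Y a)
  parity : ∀ (p : ℕ) (a : SF), HasParity fockParity p a.1 → HasParity π p (Y a)
  vacuum : Y SF.one = oneField M
  isLocal : ∀ (p q : ℕ) (a b : SF), HasParity fockParity p a.1 → HasParity fockParity q b.1 →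
    ∃ N : ℕ, IsLocal p q N (Y a) (Y b)
  nProduct : ∀ (p q : ℕ) (j : ℤ) (a b c : SF), HasParity fockParity p a.1 →
    HasParity fockParity q b.1 → IsNProduct p q j a.1 b.1 c.1 → IsNProduct p q j (Y a) (Y b) (Y c)
  /-- `Y(g a, z) = e^{2πi z∂_z} Y(a, z)`, where `e^{2πi z∂_z}` maps `z^{-n-1} (log z)^l` to
  `e^{-2πi n} z^{-n-1} (log z + 2πi)^l`. -/
  monodromy : ∀ a a' : SF, IsImage g a a' → ∀ (n : ℂ) (k : ℕ) (v : M),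
    Y a' n k v = Complex.exp (-(2 * Real.pi * Complex.I) * n) •
      ∑ᶠ l : ℕ, ((l.choose k : ℂ) * (2 * Real.pi * Complex.I) ^ (l - k)) • Y a n l v

/-- The twisted mode `ψ_n^g`: the coefficient of `z^{-n-1}` (without logarithm) in `Y(ψ, z)`. -/
def psiMode (Y : SF →ₗ[ℂ] FormalField M) (n : ℂ) : Module.End ℂ M := Y SF.psi n 0

/-- The twisted mode `ψ̄_n^g`: the coefficient of `z^{-n-1}` (without logarithm) in `Y(ψ̄, z)`. -/
def psibarMode (Y : SF →ₗ[ℂ] FormalField M) (n : ℂ) : Module.End ℂ M := Y SF.psibar n 0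

/-- The representation `ρ` of the algebra with generators `ψ_n`, `ψ̄_n` is given by the twisted mode
operators of `Y`. -/
def IsModeAction (r t : ℂ) (Y : SF →ₗ[ℂ] FormalField M)
    (ρ : ModeAlgebra r t →ₐ[ℂ] Module.End ℂ M) : Prop :=
  ∀ k : ℤ, ρ (psi r t k) = psiMode Y (r + k) ∧ ρ (psibar r t k) = psibarMode Y (-r + k)

/-- Representations in which every vector is annihilated by all `ψ_n`, `ψ̄_n` with `Re n` large. -/
def IsRestricted (r t : ℂ) (ρ : ModeAlgebra r t →ₐ[ℂ] Module.End ℂ M) : Prop :=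
  ∀ v : M, ∃ N : ℤ, ∀ k : ℤ, N ≤ k → ρ (psi r t k) v = 0 ∧ ρ (psibar r t k) v = 0

/-- The generators act by odd operators on the vector superspace `M`. -/
def IsSuperRep (r t : ℂ) (π : Module.End ℂ M) (ρ : ModeAlgebra r t →ₐ[ℂ] Module.End ℂ M) : Prop :=
  ∀ k : ℤ, π * ρ (psi r t k) = -(ρ (psi r t k) * π) ∧
    π * ρ (psibar r t k) = -(ρ (psibar r t k) * π)

/-- The summands of `∑_{i+j=n} ψ̄_i ψ_j v`, with `j = r + k`. -/
def virSummand (r : ℂ) (Y : SF →ₗ[ℂ] FormalField M) (n : ℤ) (v : M) (k : ℤ) : M :=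
  psibarMode Y (n - (r + k)) (psiMode Y (r + k) v)

/-- The summands of `∑_{j>0} ψ̄_{-j} ψ_j v`, with `j = r + k`. For non-real `r` the condition `j > 0`
is read as `Re j ≥ 0`, `j ≠ 0`. -/
def virZeroSummand (r : ℂ) (Y : SF →ₗ[ℂ] FormalField M) (v : M) (k : ℤ) : M :=
  open Classical in
  if 0 ≤ (r + k).re ∧ r + k ≠ 0 then psibarMode Y (-(r + k)) (psiMode Y (r + k) v) else 0

/-- The summands of `∑_{i>0} ψ_{-i} ψ̄_i v`, with `i = -r + k`. For non-real `r` the condition `i > 0`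
is read as `Re i > 0`. -/
def virZeroSummand' (r : ℂ) (Y : SF →ₗ[ℂ] FormalField M) (v : M) (k : ℤ) : M :=
  open Classical in
  if 0 < (-r + k).re then psiMode Y (-(-r + k)) (psibarMode Y (-r + k) v) else 0

/-- The representative of the coset `r + ℤ` with real part in `[0, 1)`. -/
def cosetRep (r : ℂ) : ℂ := r - ⌊r.re⌋

/-- The Virasoro mode `L_n`: the coefficient of `z^{-n-2}` in `Y(ω, z)`. -/
def virMode (Y : SF →ₗ[ℂ] FormalField M) (ω : SF) (n : ℤ) : Module.End ℂ M := Y ω (n + 1) 0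

/-- The field `Y(ω, z)` has the form `∑_{n ∈ ℤ} L_n z^{-n-2}`, the `L_n` satisfy the relations of
the Virasoro algebra with central charge `-2`, and they are given by the explicit bilinear
expressions in the twisted modes (all sums being finite on every vector). -/
structure IsTwistedVirasoro (r : ℂ) (Y : SF →ₗ[ℂ] FormalField M) (ω : SF) : Prop where
  expansion : ∀ (n : ℂ) (k : ℕ), (k ≠ 0 ∨ ∀ j : ℤ, n ≠ j) → Y ω n k = 0
  virasoro : ∀ m n : ℤ,
    virMode Y ω m * virMode Y ω n - virMode Y ω n * virMode Y ω m
      = ((m : ℂ) - n) • virMode Y ω (m + n)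
        + (if m + n = 0 then (-2 : ℂ) / 12 * ((m : ℂ) ^ 3 - m) else 0) • (1 : Module.End ℂ M)
  finite : ∀ (n : ℤ), n ≠ 0 → ∀ v : M, (Function.support (virSummand r Y n v)).Finite
  finite_zero : ∀ v : M, (Function.support (virZeroSummand r Y v)).Finite
  finite_zero' : ∀ v : M, (Function.support (virZeroSummand' r Y v)).Finite
  formula : ∀ n : ℤ, n ≠ 0 → ∀ v : M, virMode Y ω n v = ∑ᶠ k : ℤ, virSummand r Y n v k
  /-- The terms with index `0` occur only for `r ∈ ℤ`. -/
  formula_zero : ∀ v : M, virMode Y ω 0 v =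
    ∑ᶠ k : ℤ, virZeroSummand r Y v k
      + (open Classical in if ∃ k : ℤ, r = k then
          (1 / 2 : ℂ) • (psibarMode Y 0 (psiMode Y 0 v) - psiMode Y 0 (psibarMode Y 0 v)) else 0)
      - ∑ᶠ k : ℤ, virZeroSummand' r Y v k
      + (cosetRep r * (cosetRep r - 1) / 2) • v

end Twisted

/-! ### The twist -/

/-- The semisimple derivation `s`: `s ψ = r ψ`, `s ψ̄ = -r ψ̄`. -/
def sMat (r : ℂ) : Matrix (Fin 2) (Fin 2) ℂ := !![r, 0; 0, -r]

/-- The nilpotent derivation `x`: `x ψ = -2t ψ̄`, `x ψ̄ = 0`. -/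
def xMat (t : ℂ) : Matrix (Fin 2) (Fin 2) ℂ := !![0, 0; -2 * t, 0]

/-- The automorphisms `g` defined by `s` and `x`: `g = e^{-2πi s} e^{-2πi x}`, or, if `2r ∉ ℤ`,
`g = e^{-2πi (s + x)}` (the two agree if `r t = 0`). -/
def IsTwist (r t : ℂ) (g : Matrix.SpecialLinearGroup (Fin 2) ℂ) : Prop :=
  (g : Matrix (Fin 2) (Fin 2) ℂ)
      = NormedSpace.exp (-(2 * Real.pi * Complex.I) • sMat r)
        * NormedSpace.exp (-(2 * Real.pi * Complex.I) • xMat t) ∨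
  (∀ n : ℤ, 2 * r ≠ n) ∧ (g : Matrix (Fin 2) (Fin 2) ℂ)
      = NormedSpace.exp (-(2 * Real.pi * Complex.I) • (sMat r + xMat t))

end SymplecticFermions

end

set_option linter.unusedSectionVars false
noncomputable section
namespace SymplecticFermions

/-! ### Formal logarithmic series in one and two variables -/

/-! The key is a normal form for the two twisted fields. The matrix of `g` is lower triangular with
diagonal entries `q = e^{-2πir}` and `q⁻¹`. If `2r ∉ ℤ`, these differ, `g` is diagonalizable, and `ψ
+ cψ̄` is an eigenvector for a suitable `c`; put `τ = 0`. If `2r ∈ ℤ`, put `c = 0` and `τ = t`.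
(`IsTwist.exists_data` finds these parameters; for `2r ∉ ℤ` the condition `m = -n` never holds in `r
+ ℤ`, so the constant `2t` in the relations is irrelevant.) Twisted modules are then the same as
pairs of logarithm-free odd fields `a`, `b` with exponents in `r + ℤ` and `-r + ℤ`, through `ψ(z) =
a(z) - c b(z) + 2τ log(z) b(z)` and `ψ̄(z) = b(z)` (`pairFields`). The mode relations of `a` and `b`
(`ModePair`) correspond to the operator products of symplectic fermions for `ψ`, `ψ̄`: the simple
pole `2τ z⁻¹` of `a` with itself is compensated by the derivative of the logarithm.

From modules to modes: the monodromy forces `b` and `a = ψ + cψ̄ - 2τ log(z) ψ̄` to be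
logarithm-free with one coset of exponents (`suppCoset_of_isMonodromy`). The module axioms give all
nonnegative products of `ψ`, `ψ̄`, hence those of `a`, `b`, and a discrete residue argument turns
these into anticommutators (`canonAnticomm_of_nprod`). Since `c` and `τ` depend only on `g`, the
modes determine the module.

From modes to modules: the modes give a pair of fields with the right operator products
(`ModePair.freePair`). The products `x_(n)` with these fields act on the space of all fields local
to them; Dong's lemma (`Loc.nprod`) keeps this space stable and `LocTriple.commutator` shows that
the untwisted mode relations hold. The identity field behaves as a vacuum, so the Fock space maps to
fields on `M` (`FreePair.fields`). Applied to the Fock space itself, the construction identifies the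
vertex superalgebra with the Fock space (`FreePair.fields_state`), and the composite is `Y`. That
`Y` preserves products follows by treating two free pairs at once: a product of generated fields is
the field of a state that is the same for both (`FreePair.exists_nprod`). The monodromy is
compatible with products, so it needs checking on generators only.

No further relations: an element of the algebra involves only modes of index below some `K`. For
large `K` the remaining modes anticommute with each other and can act by contractions on the
exterior algebra over the low symbols. Acting on `1` there is the linear isomorphism of a Clifford
algebra with the exterior algebra (`rep_lowHom`), so nonzero elements act nontrivially.

Virasoro action: `b_(-1)b` and `b_(-1)(log b)` vanish, so `Y(ω, z)` is the (-1)-product of `b` and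
`a` alone; comparing it with a normally ordered product yields the bilinear formulas and the
constant `s(s-1)/2`. The Virasoro relations are then a computation with modes
(`ModeSystem.virasoro`). -/

/-- Formal series `∑ f_{n,k} z^{-n-1} (log z)^k` with coefficients in `M`. -/
abbrev Ser1 (M : Type*) : Type _ := ℂ → ℕ → M

/-- Formal series in `z`, `w` and their logarithms with coefficients in `M`. -/
abbrev Ser2 (M : Type*) : Type _ := ℂ → ℕ → ℂ → ℕ → M

section Calculus

variable {M : Type*} [AddCommGroup M] [Module ℂ M]
variable {V : Type*} [AddCommGroup V] [Module ℂ V]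

/-- Multiplication by `z` in one variable. -/
def shift : Module.End ℂ (Ser1 M) where
  toFun f := fun n k => f (n + 1) k
  map_add' _ _ := rfl
  map_smul' _ _ := rfl

/-- The derivative in one variable. -/
def deriv1 : Module.End ℂ (Ser1 M) where
  toFun f := fun n k => (-n) • f (n - 1) k + ((k : ℂ) + 1) • f (n - 1) (k + 1)
  map_add' f g := by
    funext n k; simp only [Pi.add_apply, smul_add]; abel
  map_smul' c f := by
    funext n k; simp only [Pi.smul_apply, RingHom.id_apply, smul_add, smul_comm c]

/-- Multiplication by `log z` in one variable. -/
def logMul : Module.End ℂ (Ser1 M) where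
  toFun f := fun n k => if k = 0 then 0 else f n (k - 1)
  map_add' f g := by
    funext n k; by_cases h : k = 0 <;> simp [h]
  map_smul' c f := by
    funext n k; by_cases h : k = 0 <;> simp [h]

/-- Multiplication by `z`. -/
def shiftZ : Module.End ℂ (Ser2 M) where
  toFun f := fun m k n l => f (m + 1) k n l
  map_add' _ _ := rfl
  map_smul' _ _ := rfl

/-- Multiplication by `w`. -/
def shiftW : Module.End ℂ (Ser2 M) where
  toFun f := fun m k n l => f m k (n + 1) l
  map_add' _ _ := rfl
  map_smul' _ _ := rfl

/-- Multiplication by `z - w`. -/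
def zw : Module.End ℂ (Ser2 M) := shiftZ - shiftW

/-- The derivative `∂_z`. -/
def dZ : Module.End ℂ (Ser2 M) where
  toFun f := fun m k n l => (-m) • f (m - 1) k n l + ((k : ℂ) + 1) • f (m - 1) (k + 1) n l
  map_add' f g := by
    funext m k n l; simp only [Pi.add_apply, smul_add]; abel
  map_smul' c f := by
    funext m k n l; simp only [Pi.smul_apply, RingHom.id_apply, smul_add, smul_comm c]

/-- The derivative `∂_w`. -/
def dW : Module.End ℂ (Ser2 M) where
  toFun f := fun m k n l => (-n) • f m k (n - 1) l + ((l : ℂ) + 1) • f m k (n - 1) (l + 1)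
  map_add' f g := by
    funext m k n l; simp only [Pi.add_apply, smul_add]; abel
  map_smul' c f := by
    funext m k n l; simp only [Pi.smul_apply, RingHom.id_apply, smul_add, smul_comm c]

@[simp] theorem shift_apply (f : Ser1 M) (n : ℂ) (k : ℕ) : shift f n k = f (n + 1) k := rfl
theorem deriv1_apply (f : Ser1 M) (n : ℂ) (k : ℕ) :
    deriv1 f n k = (-n) • f (n - 1) k + ((k : ℂ) + 1) • f (n - 1) (k + 1) := rfl
theorem logMul_apply (f : Ser1 M) (n : ℂ) (k : ℕ) :
    logMul f n k = if k = 0 then 0 else f n (k - 1) := rfl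
@[simp] theorem shiftZ_apply (f : Ser2 M) (m : ℂ) (k : ℕ) (n : ℂ) (l : ℕ) :
    shiftZ f m k n l = f (m + 1) k n l := rfl
@[simp] theorem shiftW_apply (f : Ser2 M) (m : ℂ) (k : ℕ) (n : ℂ) (l : ℕ) :
    shiftW f m k n l = f m k (n + 1) l := rfl
theorem zw_apply (f : Ser2 M) (m : ℂ) (k : ℕ) (n : ℂ) (l : ℕ) :
    zw f m k n l = f (m + 1) k n l - f m k (n + 1) l := rfl
theorem dZ_apply (f : Ser2 M) (m : ℂ) (k : ℕ) (n : ℂ) (l : ℕ) :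
    dZ f m k n l = (-m) • f (m - 1) k n l + ((k : ℂ) + 1) • f (m - 1) (k + 1) n l := rfl
theorem dW_apply (f : Ser2 M) (m : ℂ) (k : ℕ) (n : ℂ) (l : ℕ) :
    dW f m k n l = (-n) • f m k (n - 1) l + ((l : ℂ) + 1) • f m k (n - 1) (l + 1) := rfl

/-! ### Restriction to the diagonal. -/

/-- The restriction to `w = z`. -/
def diag (f : Ser2 M) : Ser1 M := fun n e =>
  ∑ᶠ m : ℂ, ∑ k ∈ Finset.range (e + 1), f m k (n - 1 - m) (e - k)

/-- For every total exponent only finitely many powers of `z` occur. -/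
def DiagFinite (f : Ser2 M) : Prop := ∀ n : ℂ, {m : ℂ | ∃ k l, f m k (n - m) l ≠ 0}.Finite

theorem DiagFinite.of_imp {f : Ser2 M} {g : Ser2 V} (hf : DiagFinite f)
    (h : ∀ m k n l, g m k n l ≠ 0 → ∃ k' l', f m k' n l' ≠ 0) : DiagFinite g := fun n =>
  (hf n).subset fun m ⟨k, l, hm⟩ => h m k _ l hm

theorem diagFinite_zero : DiagFinite (0 : Ser2 M) := fun n => by simp

theorem DiagFinite.add {f g : Ser2 M} (hf : DiagFinite f) (hg : DiagFinite g) :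
    DiagFinite (f + g) := fun n => by
  refine ((hf n).union (hg n)).subset ?_
  rintro m ⟨k, l, h⟩
  by_contra hc
  simp only [Set.mem_union, Set.mem_ofPred_eq, not_or, not_exists, not_not] at hc
  exact h (by simp [hc.1 k l, hc.2 k l])

theorem DiagFinite.smul {f : Ser2 M} (c : ℂ) (hf : DiagFinite f) : DiagFinite (c • f) :=
  hf.of_imp fun m k n l h => ⟨k, l, fun h0 => h (by simp [h0])⟩

theorem DiagFinite.neg {f : Ser2 M} (hf : DiagFinite f) : DiagFinite (-f) :=
  hf.of_imp fun m k n l h => ⟨k, l, fun h0 => h (by simp [h0])⟩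

theorem DiagFinite.sub {f g : Ser2 M} (hf : DiagFinite f) (hg : DiagFinite g) :
    DiagFinite (f - g) := by
  rw [sub_eq_add_neg]; exact hf.add hg.neg

theorem DiagFinite.map {f : Ser2 M} (hf : DiagFinite f) (g : M →ₗ[ℂ] V) :
    DiagFinite (fun m k n l => g (f m k n l)) :=
  hf.of_imp fun m k n l h => ⟨k, l, fun h0 => h (by simp [h0])⟩

theorem DiagFinite.shiftZ {f : Ser2 M} (hf : DiagFinite f) : DiagFinite (shiftZ f) := fun n => by
  refine ((hf (n + 1)).preimage (f := fun m => m + 1) (add_left_injective _).injOn).subset ?_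
  rintro m ⟨k, l, h⟩
  refine ⟨k, l, ?_⟩
  rw [shiftZ_apply] at h
  rwa [show n + 1 - (m + 1) = n - m by ring]

theorem DiagFinite.shiftW {f : Ser2 M} (hf : DiagFinite f) : DiagFinite (shiftW f) := fun n => by
  refine (hf (n + 1)).subset ?_
  rintro m ⟨k, l, h⟩
  refine ⟨k, l, ?_⟩
  rw [shiftW_apply] at h
  rwa [show n + 1 - m = n - m + 1 by ring]

theorem DiagFinite.zw {f : Ser2 M} (hf : DiagFinite f) : DiagFinite (zw f) :=
  hf.shiftZ.sub hf.shiftW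

theorem DiagFinite.dZ {f : Ser2 M} (hf : DiagFinite f) : DiagFinite (dZ f) := fun n => by
  refine ((hf (n - 1)).preimage (f := fun m => m - 1) (sub_left_injective).injOn).subset ?_
  rintro m ⟨k, l, h⟩
  by_contra hc
  simp only [Set.mem_preimage, Set.mem_ofPred_eq, not_exists, not_not,
    show n - 1 - (m - 1) = n - m by ring] at hc
  exact h (by rw [dZ_apply, hc, hc]; simp)

theorem DiagFinite.dW {f : Ser2 M} (hf : DiagFinite f) : DiagFinite (dW f) := fun n => by
  refine (hf (n - 1)).subset ?_
  rintro m ⟨k, l, h⟩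
  by_contra hc
  simp only [Set.mem_ofPred_eq, not_exists, not_not,
    show n - 1 - m = n - m - 1 by ring] at hc
  exact h (by rw [dW_apply, hc, hc]; simp)

theorem DiagFinite.zw_pow {f : Ser2 M} (hf : DiagFinite f) (N : ℕ) : DiagFinite ((SymplecticFermions.zw ^ N) f) := by
  induction N with
  | zero => simpa using hf
  | succ N ih => rw [pow_succ', Module.End.mul_apply]; exact ih.zw

theorem DiagFinite.dZ_pow {f : Ser2 M} (hf : DiagFinite f) (N : ℕ) : DiagFinite ((SymplecticFermions.dZ ^ N) f) := by
  induction N with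
  | zero => simpa using hf
  | succ N ih => rw [pow_succ', Module.End.mul_apply]; exact ih.dZ

theorem DiagFinite.support {f : Ser2 M} (hf : DiagFinite f) (n : ℂ) (e : ℕ) :
    (Function.support fun m : ℂ =>
      ∑ k ∈ Finset.range (e + 1), f m k (n - 1 - m) (e - k)).Finite := by
  refine (hf (n - 1)).subset ?_
  intro m hm
  by_contra hc
  simp only [Set.mem_ofPred_eq, not_exists, not_not] at hc
  exact hm (Finset.sum_eq_zero fun k _ => hc _ _)

theorem diag_add {f g : Ser2 M} (hf : DiagFinite f) (hg : DiagFinite g) :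
    diag (f + g) = diag f + diag g := by
  funext n e
  simp only [diag, Pi.add_apply, Finset.sum_add_distrib]
  exact finsum_add_distrib (hf.support n e) (hg.support n e)

theorem diag_smul (c : ℂ) (f : Ser2 M) : diag (c • f) = c • diag f := by
  funext n e
  simp only [diag, Pi.smul_apply, ← Finset.smul_sum]
  exact (smul_finsum c _).symm

theorem diag_zero : diag (0 : Ser2 M) = 0 := by
  funext n e; simp [diag]

theorem diag_neg (f : Ser2 M) : diag (-f) = -diag f := by
  have := diag_smul (-1) f
  simpa using this

theorem diag_sub {f g : Ser2 M} (hf : DiagFinite f) (hg : DiagFinite g) :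
    diag (f - g) = diag f - diag g := by
  rw [sub_eq_add_neg, diag_add hf hg.neg, diag_neg, sub_eq_add_neg]

theorem diag_map {f : Ser2 M} (hf : DiagFinite f) (g : M →ₗ[ℂ] V) :
    diag (fun m k n l => g (f m k n l)) = fun n e => g (diag f n e) := by
  funext n e
  simp only [diag]
  rw [map_finsum g (hf.support n e)]
  simp only [map_sum]

theorem diag_swap (f : Ser2 M) : diag (fun m k n l => f n l m k) = diag f := by
  funext n e
  simp only [diag]
  rw [← finsum_comp_equiv (Equiv.subLeft (n - 1))]
  refine finsum_congr fun m => ?_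
  rw [← Finset.sum_range_reflect]
  refine Finset.sum_congr rfl fun k hk => ?_
  have hk' : k ≤ e := by simpa [Nat.lt_succ_iff] using hk
  simp only [Equiv.subLeft_apply, sub_sub_cancel]
  rw [show e + 1 - 1 - k = e - k by omega, show e - (e - k) = k by omega]

theorem diag_shiftW (f : Ser2 M) : diag (shiftW f) = shift (diag f) := by
  funext n e
  simp only [diag, shiftW_apply, shift_apply]
  refine finsum_congr fun m => Finset.sum_congr rfl fun k _ => ?_
  rw [show n - 1 - m + 1 = n + 1 - 1 - m by ring]

theorem diag_shiftZ (f : Ser2 M) : diag (shiftZ f) = shift (diag f) := by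
  rw [← diag_swap f, ← diag_shiftW]
  exact (diag_swap (shiftZ f)).symm

theorem diag_zw {f : Ser2 M} (hf : DiagFinite f) : diag (zw f) = 0 := by
  rw [zw, LinearMap.sub_apply, diag_sub hf.shiftZ hf.shiftW, diag_shiftZ, diag_shiftW, sub_self]

/-- This is the chain rule for `F(z, z)`. After the substitution `m ↦ m + 1` in the `∂_z` part both
sums involve the same coefficients, and the weights `-(m + 1)` and `-(n - 1 - m)` add up to `-n`. -/
theorem diag_dZ_add_dW {f : Ser2 M} (hf : DiagFinite f) :
    diag (dZ f + dW f) = deriv1 (diag f) := by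
  rw [diag_add hf.dZ hf.dW]
  have h1 : diag (dZ f) = fun n e => ∑ᶠ m : ℂ, ∑ k ∈ Finset.range (e + 1),
      ((-(m + 1)) • f m k (n - 2 - m) (e - k)
        + ((k : ℂ) + 1) • f m (k + 1) (n - 2 - m) (e - k)) := by
    funext n e
    simp only [diag, dZ_apply]
    rw [← finsum_comp_equiv (Equiv.addRight (1 : ℂ))]
    refine finsum_congr fun m => Finset.sum_congr rfl fun k _ => ?_
    simp only [Equiv.coe_addRight, add_sub_cancel_right]
    rw [show n - 1 - (m + 1) = n - 2 - m by ring]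
  funext n e
  rw [Pi.add_apply, Pi.add_apply, h1, deriv1_apply]
  simp only [diag, dW_apply]
  rw [smul_finsum, smul_finsum]
  have hfin : {m : ℂ | ∃ k l, f m k (n - 2 - m) l ≠ 0}.Finite := hf (n - 2)
  have key : ∀ (F : ℂ → M), (∀ m, (∀ k l, f m k (n - 2 - m) l = 0) → F m = 0) →
      (Function.support F).Finite := by
    intro F hF
    refine hfin.subset fun m hm => ?_
    by_contra hc
    simp only [Set.mem_ofPred_eq, not_exists, not_not] at hc
    exact hm (hF m hc)
  have e1 : ∀ m : ℂ, n - 1 - m - 1 = n - 2 - m := fun m => by ring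
  have e2 : ∀ m : ℂ, n - 1 - 1 - m = n - 2 - m := fun m => by ring
  simp only [e1, e2]
  rw [← finsum_add_distrib (key _ ?_) (key _ ?_), ← finsum_add_distrib (key _ ?_) (key _ ?_)]
  · refine finsum_congr fun m => ?_
    rw [Finset.smul_sum, Finset.smul_sum, ← Finset.sum_add_distrib]
    have hk : ∀ k ∈ Finset.range (e + 1), ((k : ℂ) + 1) • f m (k + 1) (n - 2 - m) (e - k)
        = (((k + 1 : ℕ) : ℂ)) • f m (k + 1) (n - 2 - m) (e + 1 - (k + 1)) := by
      intro k hk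
      rw [show e + 1 - (k + 1) = e - k by omega, Nat.cast_succ]
    have hl : ∀ k ∈ Finset.range (e + 1), (((e - k : ℕ) : ℂ) + 1) • f m k (n - 2 - m) (e - k + 1)
        = (((e + 1 - k : ℕ) : ℂ)) • f m k (n - 2 - m) (e + 1 - k) := by
      intro k hk
      have : k ≤ e := by simpa [Nat.lt_succ_iff] using hk
      rw [show e + 1 - k = e - k + 1 by omega]
      push_cast
      rfl
    -- The derivatives of the logarithms weight the term `(log z)^k (log w)^(e+1-k)` with `k` and
    -- with `e + 1 - k`; together this is `e + 1`, independently of `k`.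
    have h3 : ∑ k ∈ Finset.range (e + 1), ((k : ℂ) + 1) • f m (k + 1) (n - 2 - m) (e - k)
        + ∑ k ∈ Finset.range (e + 1), (((e - k : ℕ) : ℂ) + 1) • f m k (n - 2 - m) (e - k + 1)
        = ∑ k ∈ Finset.range (e + 1 + 1), ((e : ℂ) + 1) • f m k (n - 2 - m) (e + 1 - k) := by
      rw [Finset.sum_congr rfl hk, Finset.sum_congr rfl hl]
      have h4 := Finset.sum_range_succ' (fun k : ℕ => (k : ℂ) • f m k (n - 2 - m) (e + 1 - k)) (e + 1)
      have h5 := Finset.sum_range_succ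
        (fun k : ℕ => ((e + 1 - k : ℕ) : ℂ) • f m k (n - 2 - m) (e + 1 - k)) (e + 1)
      simp only [Nat.cast_zero, zero_smul, add_zero, Nat.sub_self] at h4 h5
      rw [← h4, ← h5, ← Finset.sum_add_distrib]
      refine Finset.sum_congr rfl fun k hk => ?_
      have : k ≤ e + 1 := by simpa [Nat.lt_succ_iff] using hk
      rw [← add_smul, Nat.cast_sub this]
      congr 1
      push_cast
      ring
    rw [← h3, ← Finset.sum_add_distrib, ← Finset.sum_add_distrib]
    refine Finset.sum_congr rfl fun k _ => ?_
    have : (-n) • f m k (n - 2 - m) (e - k) = (-(m + 1)) • f m k (n - 2 - m) (e - k)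
        + (-(n - 1 - m)) • f m k (n - 2 - m) (e - k) := by
      rw [← add_smul]; congr 1; ring
    rw [this]
    abel
  all_goals
    intro m hm
    simp [hm]

/-! ### Commutation rules and Taylor coefficients along the diagonal. -/

theorem commute_shiftZ_shiftW : Commute (shiftZ : Module.End ℂ (Ser2 M)) shiftW := rfl

theorem dZ_zw (f : Ser2 M) : dZ (zw f) = zw (dZ f) + f := by
  funext m k n l
  simp only [dZ_apply, zw_apply, Pi.add_apply, sub_add_cancel, add_sub_cancel_right, neg_add, add_smul,
    smul_sub, neg_smul, one_smul]
  abel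

theorem dW_zw (f : Ser2 M) : dW (zw f) = zw (dW f) - f := by
  funext m k n l
  simp only [dW_apply, zw_apply, Pi.sub_apply, sub_add_cancel, add_sub_cancel_right, neg_add, add_smul,
    smul_sub, neg_smul, one_smul]
  abel

theorem dZ_dW (f : Ser2 M) : dZ (dW f) = dW (dZ f) := by
  funext m k n l
  simp only [dZ_apply, dW_apply, smul_add, smul_smul]
  simp only [mul_comm, neg_mul, mul_neg, neg_neg]
  abel

theorem commute_dZ_dW : Commute (dZ : Module.End ℂ (Ser2 M)) dW := LinearMap.ext dZ_dW

theorem commute_dZ_shiftW : Commute (dZ : Module.End ℂ (Ser2 M)) shiftW := rfl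

theorem dZ_pow_zw (d : ℕ) (f : Ser2 M) :
    (dZ ^ (d + 1)) (zw f) = zw ((dZ ^ (d + 1)) f) + ((d : ℂ) + 1) • (dZ ^ d) f := by
  induction d with
  | zero => simp [dZ_zw]
  | succ d ih =>
    rw [pow_succ' _ (d + 1), Module.End.mul_apply, ih, map_add, dZ_zw, ← Module.End.mul_apply dZ,
      ← pow_succ', map_smul, ← Module.End.mul_apply dZ, ← pow_succ', add_assoc]
    congr 1
    push_cast
    simp only [add_smul, one_smul]
    abel

/-- The `d`-th Taylor coefficient of a series along the diagonal, `(1/d!) ∂_z^d f |_{w = z}`. -/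
def taylor (d : ℤ) (f : Ser2 M) : Ser1 M :=
  if 0 ≤ d then ((d.toNat.factorial : ℂ))⁻¹ • diag ((dZ ^ d.toNat) f) else 0

theorem taylor_of_neg {d : ℤ} (hd : d < 0) (f : Ser2 M) : taylor d f = 0 := by
  rw [taylor, if_neg (by omega)]

theorem taylor_natCast (d : ℕ) (f : Ser2 M) :
    taylor d f = ((d.factorial : ℂ))⁻¹ • diag ((dZ ^ d) f) := by
  rw [taylor, if_pos (by omega), Int.toNat_natCast]

theorem taylor_zero_eq (f : Ser2 M) : taylor 0 f = diag f := by
  have := taylor_natCast 0 f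
  simpa using this

theorem taylor_add (d : ℤ) {f g : Ser2 M} (hf : DiagFinite f) (hg : DiagFinite g) :
    taylor d (f + g) = taylor d f + taylor d g := by
  unfold taylor
  split_ifs
  · rw [map_add, diag_add (hf.dZ_pow _) (hg.dZ_pow _), smul_add]
  · simp

theorem taylor_smul (d : ℤ) (c : ℂ) (f : Ser2 M) : taylor d (c • f) = c • taylor d f := by
  unfold taylor
  split_ifs
  · rw [map_smul, diag_smul, smul_comm]
  · simp

theorem taylor_neg (d : ℤ) (f : Ser2 M) : taylor d (-f) = -taylor d f := by
  simpa using taylor_smul d (-1) f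

theorem taylor_map_zero (d : ℤ) : taylor d (0 : Ser2 M) = 0 := by
  simpa using taylor_smul d 0 (0 : Ser2 M)

theorem taylor_sub (d : ℤ) {f g : Ser2 M} (hf : DiagFinite f) (hg : DiagFinite g) :
    taylor d (f - g) = taylor d f - taylor d g := by
  rw [sub_eq_add_neg, taylor_add d hf hg.neg, taylor_neg, sub_eq_add_neg]

theorem dZ_pow_map (g : M →ₗ[ℂ] V) (d : ℕ) (f : Ser2 M) :
    (dZ ^ d) (fun m k n l => g (f m k n l)) = fun m k n l => g ((dZ ^ d) f m k n l) := by
  induction d with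
  | zero => rfl
  | succ d ih =>
    simp only [pow_succ', Module.End.mul_apply, ih]
    funext m k n l
    simp [dZ_apply]

theorem zw_pow_map (g : M →ₗ[ℂ] V) (d : ℕ) (f : Ser2 M) :
    (zw ^ d) (fun m k n l => g (f m k n l)) = fun m k n l => g ((zw ^ d) f m k n l) := by
  induction d with
  | zero => rfl
  | succ d ih =>
    simp only [pow_succ', Module.End.mul_apply, ih]
    funext m k n l
    simp [zw_apply]

theorem taylor_map (d : ℤ) {f : Ser2 M} (hf : DiagFinite f) (g : M →ₗ[ℂ] V) :
    taylor d (fun m k n l => g (f m k n l)) = fun n e => g (taylor d f n e) := by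
  unfold taylor
  split_ifs
  · rw [dZ_pow_map, diag_map (hf.dZ_pow _)]
    funext n e
    simp
  · funext n e; simp

/-- By the Leibniz rule only the summand without the factor `z - w` survives on the diagonal. The
convention that coefficients of negative index vanish makes the rule hold for all integers `d`; it
also encodes `a_(j) b = 0` for `j ≥ N`. -/
theorem taylor_zw (d : ℤ) {f : Ser2 M} (hf : DiagFinite f) :
    taylor d (zw f) = taylor (d - 1) f := by
  rcases lt_or_ge d 0 with hd | hd
  · rw [taylor_of_neg hd, taylor_of_neg (by omega)]
  · lift d to ℕ using hd
    rcases d with _ | d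
    · rw [taylor_of_neg (d := ((0 : ℕ) : ℤ) - 1) (by norm_num), taylor_natCast]
      simp [diag_zw hf]
    · rw [taylor_natCast, show (((d + 1 : ℕ) : ℤ) - 1) = (d : ℤ) by push_cast; ring,
        taylor_natCast, dZ_pow_zw, diag_add (hf.dZ_pow _).zw ((hf.dZ_pow _).smul _),
        diag_zw (hf.dZ_pow _), zero_add, diag_smul, smul_smul]
      congr 1
      have h1 : ((d : ℂ) + 1) ≠ 0 := by exact_mod_cast Nat.succ_ne_zero d
      have h2 : ((d.factorial : ℂ)) ≠ 0 := by exact_mod_cast Nat.factorial_ne_zero d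
      rw [Nat.factorial_succ]
      push_cast
      field_simp

theorem taylor_zw_pow (d : ℤ) {f : Ser2 M} (hf : DiagFinite f) (N : ℕ) :
    taylor d ((zw ^ N) f) = taylor (d - N) f := by
  induction N generalizing d with
  | zero => simp
  | succ N ih =>
    rw [pow_succ', Module.End.mul_apply, taylor_zw _ (hf.zw_pow N), ih]
    congr 1
    push_cast
    ring

/-- Only the factorials have to be compared; at `d = -1` the factor `d + 1` is zero, in agreement
with the convention for negative index. -/
theorem taylor_dZ (d : ℤ) (f : Ser2 M) :
    taylor d (dZ f) = ((d : ℂ) + 1) • taylor (d + 1) f := by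
  rcases lt_or_ge d 0 with hd | hd
  · rw [taylor_of_neg hd]
    rcases eq_or_ne d (-1) with rfl | h
    · simp
    · rw [taylor_of_neg (by omega), smul_zero]
  · lift d to ℕ using hd
    rw [taylor_natCast, show ((d : ℤ) + 1) = ((d + 1 : ℕ) : ℤ) by push_cast; ring, taylor_natCast,
      smul_smul, pow_succ, Module.End.mul_apply]
    congr 1
    have h1 : ((d : ℂ) + 1) ≠ 0 := by exact_mod_cast Nat.succ_ne_zero d
    have h2 : ((d.factorial : ℂ)) ≠ 0 := by exact_mod_cast Nat.factorial_ne_zero d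
    rw [Nat.factorial_succ]
    push_cast
    field_simp

/-- The operator `∂_z + ∂_w` commutes with `∂_z^d` and becomes the derivative on the diagonal. -/
theorem deriv1_taylor (d : ℤ) {f : Ser2 M} (hf : DiagFinite f) :
    deriv1 (taylor d f) = taylor d (dZ f + dW f) := by
  unfold taylor
  split_ifs
  · rw [map_smul, ← diag_dZ_add_dW (hf.dZ_pow _)]
    congr 2
    have h : Commute (dZ ^ d.toNat : Module.End ℂ (Ser2 M)) (dZ + dW) :=
      ((Commute.refl _).add_right commute_dZ_dW).pow_left _
    exact (congrArg (fun g : Module.End ℂ (Ser2 M) => g f) h.eq).symm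
  · simp

theorem taylor_shiftW (d : ℤ) (f : Ser2 M) : taylor d (shiftW f) = shift (taylor d f) := by
  unfold taylor
  split_ifs
  · rw [map_smul, ← diag_shiftW]
    congr 2
    exact congrArg (fun g : Module.End ℂ (Ser2 M) => g f) (commute_dZ_shiftW.pow_left _).eq
  · simp

end Calculus
end SymplecticFermions
end

set_option linter.unusedSectionVars false
noncomputable section
namespace SymplecticFermions

/-! ### Products of fields -/

section Products

variable {M : Type*} [AddCommGroup M] [Module ℂ M]

/-- The series `a(z) b(w) v`. -/
def comp (a b : FormalField M) (v : M) : Ser2 M := fun m k n l => a m k (b n l v)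

/-- The series `b(w) a(z) v`. -/
def compOp (a b : FormalField M) (v : M) : Ser2 M := fun m k n l => b n l (a m k v)

theorem shiftZ_pow_apply (i : ℕ) (f : Ser2 M) (m : ℂ) (k : ℕ) (n : ℂ) (l : ℕ) :
    (shiftZ ^ i) f m k n l = f (m + i) k n l := by
  induction i generalizing m with
  | zero => simp
  | succ i ih =>
    rw [pow_succ', Module.End.mul_apply, shiftZ_apply, ih]
    push_cast
    rw [show m + 1 + (i : ℂ) = m + (i + 1) by ring]

theorem shiftW_pow_apply (i : ℕ) (f : Ser2 M) (m : ℂ) (k : ℕ) (n : ℂ) (l : ℕ) :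
    (shiftW ^ i) f m k n l = f m k (n + i) l := by
  induction i generalizing n with
  | zero => simp
  | succ i ih =>
    rw [pow_succ', Module.End.mul_apply, shiftW_apply, ih]
    push_cast
    rw [show n + 1 + (i : ℂ) = n + (i + 1) by ring]

/-- The two shifts commute, so this is the binomial theorem. It identifies the explicit sums in
`mulCoeff` and `mulCoeffOp` with powers of a single operator. -/
theorem zw_pow_apply (N : ℕ) (f : Ser2 M) (m : ℂ) (k : ℕ) (n : ℂ) (l : ℕ) :
    (zw ^ N) f m k n l = ∑ i ∈ Finset.range (N + 1),
      ((-1 : ℂ) ^ i * (N.choose i : ℂ)) • f (m + N - i) k (n + i) l := by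
  have h : (zw ^ N : Module.End ℂ (Ser2 M)) = ∑ i ∈ Finset.range (N + 1),
      ((-1 : ℂ) ^ i * (N.choose i : ℂ)) • (shiftZ ^ (N - i) * shiftW ^ i) := by
    have hc : Commute (-shiftW : Module.End ℂ (Ser2 M)) shiftZ :=
      Commute.neg_left (commute_shiftZ_shiftW (M := M)).symm
    rw [zw, sub_eq_neg_add, hc.add_pow]
    refine Finset.sum_congr rfl fun i _ => ?_
    rw [neg_pow (shiftW : Module.End ℂ (Ser2 M)) i, mul_smul]
    have h2 : (shiftW ^ i * shiftZ ^ (N - i) : Module.End ℂ (Ser2 M))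
        = shiftZ ^ (N - i) * shiftW ^ i := (commute_shiftZ_shiftW.symm.pow_pow _ _).eq
    rw [mul_assoc ((-1 : Module.End ℂ (Ser2 M)) ^ i), h2]
    have h1 : ((-1 : Module.End ℂ (Ser2 M)) ^ i) = algebraMap ℂ _ ((-1) ^ i) := by simp
    have h3 : ((N.choose i : ℕ) : Module.End ℂ (Ser2 M)) = algebraMap ℂ _ (N.choose i : ℂ) := by simp
    rw [h1, h3, Algebra.smul_def ((-1 : ℂ) ^ i), Algebra.smul_def ((N.choose i : ℂ)), mul_assoc,
      ← Algebra.commutes (N.choose i : ℂ)]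
  rw [h, LinearMap.sum_apply]
  simp only [Finset.sum_apply]
  refine Finset.sum_congr rfl fun i hi => ?_
  have hi' : i ≤ N := by simpa [Nat.lt_succ_iff] using hi
  rw [LinearMap.smul_apply, Module.End.mul_apply]
  simp only [Pi.smul_apply]
  rw [shiftZ_pow_apply, shiftW_pow_apply, Nat.cast_sub hi', add_sub_assoc]

theorem mulCoeff_apply (N : ℕ) (a b : FormalField M) (m : ℂ) (k : ℕ) (n : ℂ) (l : ℕ) (v : M) :
    mulCoeff N a b m k n l v = (zw ^ N) (comp a b v) m k n l := by
  rw [zw_pow_apply, mulCoeff, LinearMap.sum_apply]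
  rfl

theorem mulCoeffOp_apply (N : ℕ) (a b : FormalField M) (m : ℂ) (k : ℕ) (n : ℂ) (l : ℕ) (v : M) :
    mulCoeffOp N a b m k n l v = (zw ^ N) (compOp a b v) m k n l := by
  rw [zw_pow_apply, mulCoeffOp, LinearMap.sum_apply]
  rfl

theorem derivZ_iterate_apply (d : ℕ) (C : ℂ → ℕ → ℂ → ℕ → Module.End ℂ M) (m : ℂ) (k : ℕ) (n : ℂ)
    (l : ℕ) (v : M) :
    (derivZ^[d] C) m k n l v = (dZ ^ d) (fun m k n l => C m k n l v) m k n l := by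
  induction d generalizing m k n l with
  | zero => rfl
  | succ d ih =>
    rw [Function.iterate_succ_apply', pow_succ', Module.End.mul_apply, dZ_apply, ← ih, ← ih]
    rfl

/-- `(z - w)^N a(z) b(w) = (z - w)^N b'(w) a'(z)`. -/
def Loc (N : ℕ) (a b b' a' : FormalField M) : Prop :=
  ∀ v : M, (zw ^ N) (comp a b v) = (zw ^ N) (compOp a' b' v : Ser2 M)

/-- `(z - w)^N a(z) b(w)` can be restricted to the diagonal, also after taking derivatives. -/
def Good (N : ℕ) (a b : FormalField M) : Prop := ∀ v, DiagFinite ((zw ^ N) (comp a b v))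

theorem zw_pow_add_apply (i N : ℕ) (f : Ser2 M) : (zw ^ (i + N)) f = (zw ^ i) ((zw ^ N) f) := by
  rw [pow_add, Module.End.mul_apply]

theorem Loc.mono {N N' : ℕ} (hN : N ≤ N') {a b b' a' : FormalField M} (h : Loc N a b b' a') :
    Loc N' a b b' a' := fun v => by
  obtain ⟨i, rfl⟩ := Nat.exists_eq_add_of_le' hN
  rw [zw_pow_add_apply, h v, zw_pow_add_apply]

theorem Good.mono {N N' : ℕ} (hN : N ≤ N') {a b : FormalField M} (h : Good N a b) :
    Good N' a b := fun v => by
  obtain ⟨i, rfl⟩ := Nat.exists_eq_add_of_le' hN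
  rw [zw_pow_add_apply]
  exact (h v).zw_pow i

theorem compOp_smul (c : ℂ) (a b : FormalField M) (v : M) :
    compOp a (c • b) v = c • compOp a b v := rfl

/-- The sign is absorbed into the third field, so that later arguments about `Loc` need no
bookkeeping of parities. -/
theorem isLocal_iff {p q N : ℕ} {a b : FormalField M} :
    IsLocal p q N a b ↔ Loc N a b ((-1 : ℂ) ^ (p * q) • b) a := by
  constructor
  · intro h v
    funext m k n l
    rw [← mulCoeff_apply, h, compOp_smul, map_smul, LinearMap.smul_apply, mulCoeffOp_apply]
    rfl
  · intro h m k n l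
    refine LinearMap.ext fun v => ?_
    rw [mulCoeff_apply, h v, compOp_smul, map_smul, LinearMap.smul_apply, mulCoeffOp_apply]
    rfl

/-- The two clauses `j ≥ N` and `j = N - 1 - d` merge into one formula because Taylor coefficients
of negative index are zero. -/
theorem isNProduct_iff {p q : ℕ} {j : ℤ} {a b c : FormalField M} :
    IsNProduct p q j a b c ↔ ∃ N : ℕ, Loc N a b ((-1 : ℂ) ^ (p * q) • b) a ∧
      ∀ (n : ℂ) (e : ℕ) (v : M), c n e v = taylor ((N : ℤ) - 1 - j) ((zw ^ N) (comp a b v)) n e := by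
  unfold IsNProduct
  refine exists_congr fun N => ?_
  rw [isLocal_iff]
  refine and_congr_right fun _ => ?_
  have hd : ∀ (d : ℕ) (n : ℂ) (e : ℕ) (v : M), diagCoeff (derivZ^[d] (mulCoeff N a b)) n e v
      = diag ((dZ ^ d) ((zw ^ N) (comp a b v))) n e := by
    intro d n e v
    simp only [diagCoeff, diag, derivZ_iterate_apply]
    simp only [mulCoeff_apply]
  constructor
  · rintro ⟨h1, h2⟩ n e v
    rcases lt_or_ge j N with hj | hj
    · obtain ⟨d, hd'⟩ := Int.eq_ofNat_of_zero_le (show 0 ≤ (N : ℤ) - 1 - j by omega)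
      rw [hd', taylor_natCast, h2 d (by omega), hd]
      rfl
    · rw [h1 hj, taylor_of_neg (by omega)]
      rfl
  · intro h
    refine ⟨fun hj => ?_, fun d hd' n e v => ?_⟩
    · funext n e
      refine LinearMap.ext fun v => ?_
      rw [h, taylor_of_neg (by omega)]
      rfl
    · rw [h, show (N : ℤ) - 1 - j = (d : ℤ) by omega, taylor_natCast, hd]
      rfl

theorem comp_add_right (a b b' : FormalField M) (v : M) :
    comp a (b + b') v = comp a b v + comp a b' v := by
  funext m k n l; simp [comp]

theorem comp_add_left (a a' b : FormalField M) (v : M) :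
    comp (a + a') b v = comp a b v + comp a' b v := by
  funext m k n l; simp [comp]

theorem comp_smul_right (c : ℂ) (a b : FormalField M) (v : M) :
    comp a (c • b) v = c • comp a b v := by
  funext m k n l; simp [comp]

theorem comp_smul_left (c : ℂ) (a b : FormalField M) (v : M) :
    comp (c • a) b v = c • comp a b v := rfl

theorem comp_add (a b : FormalField M) (v w : M) : comp a b (v + w) = comp a b v + comp a b w := by
  funext m k n l; simp [comp]

theorem comp_smul (a b : FormalField M) (c : ℂ) (v : M) : comp a b (c • v) = c • comp a b v := by
  funext m k n l; simp [comp]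

theorem Good.add_right {N : ℕ} {a b b' : FormalField M} (h : Good N a b) (h' : Good N a b') :
    Good N a (b + b') := fun v => by
  rw [comp_add_right, map_add]; exact (h v).add (h' v)

theorem Good.add_left {N : ℕ} {a a' b : FormalField M} (h : Good N a b) (h' : Good N a' b) :
    Good N (a + a') b := fun v => by
  rw [comp_add_left, map_add]; exact (h v).add (h' v)

theorem Good.smul_right {N : ℕ} {a b : FormalField M} (c : ℂ) (h : Good N a b) :
    Good N a (c • b) := fun v => by
  rw [comp_smul_right, map_smul]; exact (h v).smul c

theorem Good.smul_left {N : ℕ} {a b : FormalField M} (c : ℂ) (h : Good N a b) :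
    Good N (c • a) b := fun v => by
  rw [comp_smul_left, map_smul]; exact (h v).smul c

open Classical in
/-- The product `a_{(j)} b` of two fields, defined if some `(z - w)^N a(z) b(w)` can be restricted to
the diagonal. -/
def nprod (j : ℤ) (a b : FormalField M) : FormalField M :=
  if h : ∃ N, Good N a b then fun n e =>
    { toFun := fun v => taylor ((h.choose : ℤ) - 1 - j) ((zw ^ h.choose) (comp a b v)) n e
      map_add' := fun v w => by
        rw [comp_add, map_add, taylor_add _ (h.choose_spec v) (h.choose_spec w)]; rfl
      map_smul' := fun c v => by
        rw [comp_smul, map_smul, taylor_smul]; rfl }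
  else 0

/-- Additional factors `z - w` shift the Taylor index by exactly the amount by which `N` grows.
Hence the exponent chosen in the definition of `nprod` does not matter. -/
theorem taylor_comp_eq {N N' : ℕ} {a b : FormalField M} (h : Good N a b) (h' : Good N' a b) (j : ℤ)
    (v : M) : taylor ((N : ℤ) - 1 - j) ((zw ^ N) (comp a b v))
      = taylor ((N' : ℤ) - 1 - j) ((zw ^ N') (comp a b v)) := by
  wlog hN : N ≤ N' generalizing N N'
  · exact (this h' h (by omega)).symm
  · obtain ⟨i, rfl⟩ := Nat.exists_eq_add_of_le' hN
    rw [zw_pow_add_apply, taylor_zw_pow _ (h v)]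
    congr 1
    push_cast
    ring

theorem nprod_apply {N : ℕ} {a b : FormalField M} (h : Good N a b) (j : ℤ) (n : ℂ) (e : ℕ) (v : M) :
    nprod j a b n e v = taylor ((N : ℤ) - 1 - j) ((zw ^ N) (comp a b v)) n e := by
  have h' : ∃ N, Good N a b := ⟨N, h⟩
  rw [nprod, dif_pos h']
  exact congrFun (congrFun (taylor_comp_eq h'.choose_spec h j v) n) e

theorem nprod_apply' {N : ℕ} {a b : FormalField M} (h : Good N a b) (j : ℤ) (v : M) :
    (fun n e => nprod j a b n e v) = taylor ((N : ℤ) - 1 - j) ((zw ^ N) (comp a b v)) := by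
  funext n e; exact nprod_apply h j n e v

theorem nprod_eq_zero {N : ℕ} {a b : FormalField M} (h : Good N a b) {j : ℤ} (hj : N ≤ j) :
    nprod j a b = 0 := by
  funext n e
  refine LinearMap.ext fun v => ?_
  rw [nprod_apply h, taylor_of_neg (by omega)]
  rfl

theorem nprod_add_right {N N' : ℕ} {a b b' : FormalField M} (h : Good N a b) (h' : Good N' a b')
    (j : ℤ) : nprod j a (b + b') = nprod j a b + nprod j a b' := by
  funext n e
  refine LinearMap.ext fun v => ?_
  have h1 := h.mono (le_max_left N N')
  have h2 := h'.mono (le_max_right N N')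
  simp only [Pi.add_apply, LinearMap.add_apply]
  rw [nprod_apply (h1.add_right h2), nprod_apply h1, nprod_apply h2, comp_add_right, map_add,
    taylor_add _ (h1 v) (h2 v)]
  rfl

theorem nprod_add_left {N N' : ℕ} {a a' b : FormalField M} (h : Good N a b) (h' : Good N' a' b)
    (j : ℤ) : nprod j (a + a') b = nprod j a b + nprod j a' b := by
  funext n e
  refine LinearMap.ext fun v => ?_
  have h1 := h.mono (le_max_left N N')
  have h2 := h'.mono (le_max_right N N')
  simp only [Pi.add_apply, LinearMap.add_apply]
  rw [nprod_apply (h1.add_left h2), nprod_apply h1, nprod_apply h2, comp_add_left, map_add,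
    taylor_add _ (h1 v) (h2 v)]
  rfl

theorem nprod_smul_right {N : ℕ} {a b : FormalField M} (h : Good N a b) (c : ℂ) (j : ℤ) :
    nprod j a (c • b) = c • nprod j a b := by
  funext n e
  refine LinearMap.ext fun v => ?_
  simp only [Pi.smul_apply, LinearMap.smul_apply]
  rw [nprod_apply (h.smul_right c), nprod_apply h, comp_smul_right, map_smul, taylor_smul]
  rfl

theorem nprod_smul_left {N : ℕ} {a b : FormalField M} (h : Good N a b) (c : ℂ) (j : ℤ) :
    nprod j (c • a) b = c • nprod j a b := by
  funext n e
  refine LinearMap.ext fun v => ?_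
  simp only [Pi.smul_apply, LinearMap.smul_apply]
  rw [nprod_apply (h.smul_left c), nprod_apply h, comp_smul_left, map_smul, taylor_smul]
  rfl

theorem dW_zw_pow (N : ℕ) (f : Ser2 M) :
    dW ((zw ^ (N + 1)) f) = (zw ^ (N + 1)) (dW f) - ((N : ℂ) + 1) • (zw ^ N) f := by
  induction N with
  | zero => simp [dW_zw]
  | succ N ih =>
    rw [pow_succ' _ (N + 1), Module.End.mul_apply, dW_zw, ih, map_sub, map_smul,
      ← Module.End.mul_apply zw (zw ^ N), ← pow_succ', Module.End.mul_apply]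
    push_cast
    simp only [add_smul, one_smul]
    abel

theorem comp_deriv1_right (a b : FormalField M) (v : M) :
    comp a (deriv1 b) v = dW (comp a b v) := by
  funext m k n l
  simp [comp, dW_apply, deriv1_apply]

/-- One more power is needed because `∂_w` also differentiates the factor: `(z - w)^(N+1) ∂_w`
differs from `∂_w (z - w)^(N+1)` by a multiple of `(z - w)^N`. -/
theorem Good.deriv1_right {N : ℕ} {a b : FormalField M} (h : Good N a b) :
    Good (N + 1) a (deriv1 b) := fun v => by
  have h1 := dW_zw_pow N (comp a b v)
  rw [comp_deriv1_right, ← sub_add_cancel ((zw ^ (N + 1)) (dW (comp a b v)))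
    (((N : ℂ) + 1) • (zw ^ N) (comp a b v)), ← h1]
  refine DiagFinite.add ?_ ((h v).smul _)
  rw [pow_succ', Module.End.mul_apply]
  exact (h v).zw.dW

/-- The derivative on the diagonal is `∂_z + ∂_w`. The part `∂_z` raises the Taylor index by one;
the part `∂_w` hits `b` and the power of `z - w`, and the latter contribution combines with the
first to the coefficient `-j`. -/
theorem deriv1_nprod {N : ℕ} {a b : FormalField M} (h : Good N a b) (j : ℤ) :
    deriv1 (nprod j a b) = (-(j : ℂ)) • nprod (j - 1) a b + nprod j a (deriv1 b) := by
  have key : ∀ v, deriv1 (fun n e => nprod j a b n e v)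
      = (-(j : ℂ)) • (fun n e => nprod (j - 1) a b n e v) + fun n e => nprod j a (deriv1 b) n e v := by
    intro v
    have h1 : Good (N + 1) a b := h.mono (by omega)
    rw [nprod_apply' h1, nprod_apply' h1, nprod_apply' h.deriv1_right, deriv1_taylor _ (h1 v),
      taylor_add _ (h1 v).dZ (h1 v).dW, taylor_dZ, dW_zw_pow, ← comp_deriv1_right,
      taylor_sub _ (h.deriv1_right v) ((h v).smul _), taylor_smul]
    -- Both contributions are brought to the same exponent `N + 1`, so that only their scalar
    -- factors differ.
    have h2 : taylor (((N + 1 : ℕ) : ℤ) - 1 - j) ((zw ^ N) (comp a b v))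
        = taylor (((N + 1 : ℕ) : ℤ) - 1 - j + 1) ((zw ^ (N + 1)) (comp a b v)) := by
      rw [pow_succ', Module.End.mul_apply, taylor_zw _ (h v)]
      congr 1
      ring
    rw [h2, show (((N + 1 : ℕ) : ℤ) - 1 - (j - 1)) = ((N + 1 : ℕ) : ℤ) - 1 - j + 1 by ring]
    push_cast
    module
  funext n e
  refine LinearMap.ext fun v => ?_
  exact congrFun (congrFun (key v) n) e

theorem deriv1_oneField : deriv1 (oneField M) = 0 := by
  funext n k
  simp only [deriv1_apply, oneField, Nat.succ_ne_zero, and_false, if_false, smul_zero, add_zero]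
  split_ifs with h
  · have : n = 0 := by linear_combination h.1
    simp [this]
  · simp

theorem oneField_apply (n : ℂ) (k : ℕ) (v : M) :
    oneField M n k v = open Classical in if n = -1 ∧ k = 0 then v else 0 := by
  unfold oneField
  split_ifs <;> rfl

theorem good_one (a : FormalField M) : Good 0 a (oneField M) := fun v n => by
  refine (Set.finite_singleton (n + 1)).subset ?_
  rintro m ⟨k, l, h⟩
  rw [pow_zero, Module.End.one_apply, comp, oneField_apply] at h
  split_ifs at h with h1
  · rw [Set.mem_singleton_iff]; linear_combination - h1.1
  · simp at h

theorem nprod_one_nonneg (a : FormalField M) {j : ℤ} (hj : 0 ≤ j) : nprod j a (oneField M) = 0 :=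
  nprod_eq_zero (good_one a) (by simpa using hj)

theorem nprod_neg_one_one (a : FormalField M) : nprod (-1) a (oneField M) = a := by
  funext n e
  refine LinearMap.ext fun v => ?_
  rw [nprod_apply (good_one a)]
  simp only [Nat.cast_zero, zero_sub, sub_neg_eq_add, neg_add_cancel, pow_zero, Module.End.one_apply,
    taylor_zero_eq]
  rw [diag, finsum_eq_single _ n]
  · rw [Finset.sum_eq_single e]
    · simp [comp, oneField_apply]
    · intro k hk hke
      have : k ≤ e := by simpa [Nat.lt_succ_iff] using hk
      have : e - k ≠ 0 := by omega
      simp [comp, oneField_apply, this]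
    · simp
  · intro m hm
    refine Finset.sum_eq_zero fun k _ => ?_
    have : ¬ (n - 1 - m = -1) := fun h => hm (by linear_combination -h)
    simp [comp, oneField_apply, this]

end Products

/-! ### Boundedness -/

section Bounded

variable {M : Type*} [AddCommGroup M] [Module ℂ M]

/-- The exponent `n` lies in `α + j`, `α ∈ S`, `j ≤ N`, and `k ≤ K`. -/
def BddIn (S : Finset ℂ) (N : ℤ) (K : ℕ) (n : ℂ) (k : ℕ) : Prop :=
  k ≤ K ∧ ∃ α ∈ S, ∃ j : ℤ, j ≤ N ∧ n = α + j

theorem BddIn.mono {S S' : Finset ℂ} {N N' : ℤ} {K K' : ℕ} {n : ℂ} {k : ℕ} (h : BddIn S N K n k)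
    (hS : S ⊆ S') (hN : N ≤ N') (hK : K ≤ K') : BddIn S' N' K' n k := by
  obtain ⟨h1, α, hα, j, hj, h2⟩ := h
  exact ⟨h1.trans hK, α, hS hα, j, hj.trans hN, h2⟩

theorem BddIn.shift {S : Finset ℂ} {N : ℤ} {K : ℕ} {n : ℂ} {k : ℕ} (h : BddIn S N K (n + 1) k) :
    BddIn S N K n k := by
  obtain ⟨h1, α, hα, j, hj, h2⟩ := h
  refine ⟨h1, α, hα, j - 1, by omega, ?_⟩
  push_cast
  linear_combination h2

/-- Boundedness of a series in one variable. -/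
def Bdd1 (S : Finset ℂ) (f : Ser1 M) : Prop :=
  ∃ (N : ℤ) (K : ℕ), ∀ n k, f n k ≠ 0 → BddIn S N K n k

/-- Boundedness of a series in the variable `z`. -/
def BddZ (S : Finset ℂ) (f : Ser2 M) : Prop :=
  ∃ (N : ℤ) (K : ℕ), ∀ m k n l, f m k n l ≠ 0 → BddIn S N K m k

/-- Boundedness of a series in the variable `w`. -/
def BddW (S : Finset ℂ) (f : Ser2 M) : Prop :=
  ∃ (N : ℤ) (K : ℕ), ∀ m k n l, f m k n l ≠ 0 → BddIn S N K n l

theorem isLogField_iff {a : FormalField M} :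
    IsLogField a ↔ ∃ S : Finset ℂ, ∀ v : M, Bdd1 S (fun n k => a n k v) := Iff.rfl

theorem BddZ.zw {S : Finset ℂ} {f : Ser2 M} (h : BddZ S f) : BddZ S (zw f) := by
  obtain ⟨N, K, h⟩ := h
  refine ⟨N, K, fun m k n l h0 => ?_⟩
  by_contra hc
  have h1 : f (m + 1) k n l = 0 := by_contra fun h1 => hc (h _ _ _ _ h1).shift
  have h2 : f m k (n + 1) l = 0 := by_contra fun h2 => hc (h _ _ _ _ h2)
  exact h0 (by rw [zw_apply, h1, h2, sub_zero])

theorem BddW.zw {S : Finset ℂ} {f : Ser2 M} (h : BddW S f) : BddW S (zw f) := by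
  obtain ⟨N, K, h⟩ := h
  refine ⟨N, K, fun m k n l h0 => ?_⟩
  by_contra hc
  have h1 : f (m + 1) k n l = 0 := by_contra fun h1 => hc (h _ _ _ _ h1)
  have h2 : f m k (n + 1) l = 0 := by_contra fun h2 => hc (h _ _ _ _ h2).shift
  exact h0 (by rw [zw_apply, h1, h2, sub_zero])

theorem BddZ.zw_pow {S : Finset ℂ} {f : Ser2 M} (h : BddZ S f) (N : ℕ) :
    BddZ S ((SymplecticFermions.zw ^ N) f) := by
  induction N with
  | zero => simpa using h
  | succ N ih => rw [pow_succ', Module.End.mul_apply]; exact ih.zw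

theorem BddW.zw_pow {S : Finset ℂ} {f : Ser2 M} (h : BddW S f) (N : ℕ) :
    BddW S ((SymplecticFermions.zw ^ N) f) := by
  induction N with
  | zero => simpa using h
  | succ N ih => rw [pow_succ', Module.End.mul_apply]; exact ih.zw

theorem BddZ.dZ {S : Finset ℂ} {f : Ser2 M} (h : BddZ S f) : BddZ S (dZ f) := by
  obtain ⟨N, K, h⟩ := h
  refine ⟨N + 1, K, fun m k n l h0 => ?_⟩
  have hs : ∀ k', BddIn S N K (m - 1) k' → k ≤ k' → BddIn S (N + 1) K m k := by
    rintro k' ⟨h1, α, hα, j, hj, h2⟩ hk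
    refine ⟨hk.trans h1, α, hα, j + 1, by omega, ?_⟩
    push_cast
    linear_combination h2
  by_contra hc
  have h1 : f (m - 1) k n l = 0 := by_contra fun h1 => hc (hs _ (h _ _ _ _ h1) le_rfl)
  have h2 : f (m - 1) (k + 1) n l = 0 := by_contra fun h2 => hc (hs _ (h _ _ _ _ h2) (by omega))
  exact h0 (by rw [dZ_apply, h1, h2, smul_zero, smul_zero, add_zero])

theorem BddW.dZ {S : Finset ℂ} {f : Ser2 M} (h : BddW S f) : BddW S (dZ f) := by
  obtain ⟨N, K, h⟩ := h
  refine ⟨N, K, fun m k n l h0 => ?_⟩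
  by_contra hc
  have h1 : f (m - 1) k n l = 0 := by_contra fun h1 => hc (h _ _ _ _ h1)
  have h2 : f (m - 1) (k + 1) n l = 0 := by_contra fun h2 => hc (h _ _ _ _ h2)
  exact h0 (by rw [dZ_apply, h1, h2, smul_zero, smul_zero, add_zero])

theorem finite_bddIn (S : Finset ℂ) (N : ℤ) (C : ℝ) :
    {m : ℂ | (∃ α ∈ S, ∃ j : ℤ, j ≤ N ∧ m = α + j) ∧ C ≤ m.re}.Finite := by
  have : {m : ℂ | (∃ α ∈ S, ∃ j : ℤ, j ≤ N ∧ m = α + j) ∧ C ≤ m.re}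
      ⊆ ⋃ α ∈ S, (fun j : ℤ => α + (j : ℂ)) '' Set.Icc ⌊C - α.re⌋ N := by
    rintro m ⟨⟨α, hα, j, hj, rfl⟩, hC⟩
    simp only [Set.mem_iUnion]
    refine ⟨α, hα, j, ⟨?_, hj⟩, rfl⟩
    simp only [Complex.add_re, Complex.intCast_re] at hC
    have : (⌊C - α.re⌋ : ℝ) ≤ j := (Int.floor_le _).trans (by linarith)
    exact_mod_cast this
  exact (S.finite_toSet.biUnion fun α _ => (Set.finite_Icc _ _).image _).subset this

theorem BddIn.re_le {S : Finset ℂ} {N : ℤ} {K : ℕ} {n : ℂ} {k : ℕ} (h : BddIn S N K n k) :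
    n.re ≤ (∑ α ∈ S, |α.re|) + N := by
  obtain ⟨-, α, hα, j, hj, rfl⟩ := h
  have h1 : |α.re| ≤ ∑ α ∈ S, |α.re| :=
    Finset.single_le_sum (f := fun α : ℂ => |α.re|) (fun _ _ => abs_nonneg _) hα
  have h2 : (j : ℝ) ≤ N := by exact_mod_cast hj
  simp only [Complex.add_re, Complex.intCast_re]
  linarith [le_abs_self α.re]

/-- For a fixed total exponent an upper bound for the real part in `w` is a lower bound in `z`. In
finitely many cosets of `ℤ` this leaves finitely many exponents. -/
theorem DiagFinite.of_bdd {S T : Finset ℂ} {f : Ser2 M} (hZ : BddZ S f) (hW : BddW T f) :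
    DiagFinite f := fun n => by
  obtain ⟨N, K, h⟩ := hZ
  obtain ⟨N', K', h'⟩ := hW
  refine (finite_bddIn S N (n.re - ((∑ α ∈ T, |α.re|) + N'))).subset ?_
  rintro m ⟨k, l, h0⟩
  refine ⟨(h _ _ _ _ h0).2, ?_⟩
  have := (h' _ _ _ _ h0).re_le
  simp only [Complex.sub_re] at this
  linarith

open scoped Pointwise in
theorem Bdd1.taylor {S T : Finset ℂ} {f : Ser2 M} (hZ : BddZ S f) (hW : BddW T f) (d : ℤ) :
    Bdd1 (S + T) (taylor d f) := by
  rcases lt_or_ge d 0 with hd | hd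
  · refine ⟨0, 0, fun n k h => absurd ?_ h⟩
    rw [taylor_of_neg hd]; rfl
  lift d to ℕ using hd
  rw [taylor_natCast]
  have hZ' : BddZ S ((dZ ^ d) f) := by
    induction d with
    | zero => simpa using hZ
    | succ d ih => rw [pow_succ', Module.End.mul_apply]; exact ih.dZ
  have hW' : BddW T ((dZ ^ d) f) := by
    clear hZ'
    induction d with
    | zero => simpa using hW
    | succ d ih => rw [pow_succ', Module.End.mul_apply]; exact ih.dZ
  obtain ⟨N, K, h⟩ := hZ'
  obtain ⟨N', K', h'⟩ := hW'
  -- The extra `1` arises since `z^{-m-1} w^{-m'-1}` restricts to `z^{-n-1}` with `n = m + m' + 1`.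
  refine ⟨N + N' + 1, K + K', fun n e h0 => ?_⟩
  have h1 : diag ((dZ ^ d) f) n e ≠ 0 := fun h2 => h0 (by simp [h2])
  obtain ⟨m, hm⟩ : ∃ m : ℂ, ∑ k ∈ Finset.range (e + 1), (dZ ^ d) f m k (n - 1 - m) (e - k) ≠ 0 := by
    by_contra hc
    simp only [not_exists, not_not] at hc
    exact h1 (by simp only [diag, hc, finsum_zero])
  obtain ⟨k, hk, hk0⟩ := Finset.exists_ne_zero_of_sum_ne_zero hm
  obtain ⟨h2, α, hα, j, hj, h3⟩ := h _ _ _ _ hk0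
  obtain ⟨h4, β, hβ, j', hj', h5⟩ := h' _ _ _ _ hk0
  refine ⟨by omega, α + β, Finset.add_mem_add hα hβ, j + j' + 1, by omega, ?_⟩
  push_cast
  linear_combination h3 + h5

theorem IsLogField.bddW_comp {a b : FormalField M} {S : Finset ℂ}
    (hb : ∀ v : M, Bdd1 S (fun n k => b n k v)) (v : M) : BddW S (comp a b v) := by
  obtain ⟨N, K, h⟩ := hb v
  exact ⟨N, K, fun m k n l h0 => h _ _ fun h1 => h0 (by simp only [comp, h1, map_zero])⟩

theorem IsLogField.bddZ_compOp {a b : FormalField M} {S : Finset ℂ}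
    (ha : ∀ v : M, Bdd1 S (fun n k => a n k v)) (v : M) : BddZ S (compOp a b v) := by
  obtain ⟨N, K, h⟩ := ha v
  exact ⟨N, K, fun m k n l h0 => h _ _ fun h1 => h0 (by simp only [compOp, h1, map_zero])⟩

/-- In `a(z) b(w) v` the field `b` acts first, which bounds the exponents of `w`; in the other order
the exponents of `z` are bounded. Locality equates the two after multiplication with `(z - w)^N`, so
both bounds hold at once. -/
theorem Loc.good {N : ℕ} {a b b' a' : FormalField M} (h : Loc N a b b' a') (hb : IsLogField b)
    (ha' : IsLogField a') : Good N a b := fun v => by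
  obtain ⟨S, hS⟩ := ha'
  obtain ⟨T, hT⟩ := hb
  refine DiagFinite.of_bdd (S := S) (T := T) ?_ ((IsLogField.bddW_comp hT v).zw_pow N)
  rw [h v]
  exact (IsLogField.bddZ_compOp hS v).zw_pow N

theorem Loc.isLogField_nprod {N : ℕ} {a b b' a' : FormalField M} (h : Loc N a b b' a')
    (hb : IsLogField b) (ha' : IsLogField a') (j : ℤ) : IsLogField (nprod j a b) := by
  have hg := h.good hb ha'
  obtain ⟨S, hS⟩ := ha'
  obtain ⟨T, hT⟩ := hb
  rw [isLogField_iff]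
  open scoped Pointwise in
  refine ⟨S + T, fun v => ?_⟩
  rw [nprod_apply' hg]
  refine Bdd1.taylor ?_ ((IsLogField.bddW_comp hT v).zw_pow N) _
  rw [h v]
  exact (IsLogField.bddZ_compOp hS v).zw_pow N

theorem IsLogField.add {a b : FormalField M} (ha : IsLogField a) (hb : IsLogField b) :
    IsLogField (a + b) := by
  obtain ⟨S, hS⟩ := ha
  obtain ⟨T, hT⟩ := hb
  refine ⟨S ∪ T, fun v => ?_⟩
  obtain ⟨N, K, h⟩ := hS v
  obtain ⟨N', K', h'⟩ := hT v
  refine ⟨max N N', max K K', fun n k h0 => ?_⟩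
  by_contra hc
  have h1 : a n k v = 0 := by_contra fun h1 => hc (BddIn.mono (h n k h1)
    Finset.subset_union_left (le_max_left _ _) (le_max_left _ _))
  have h2 : b n k v = 0 := by_contra fun h1 => hc (BddIn.mono (h' n k h1)
    Finset.subset_union_right (le_max_right _ _) (le_max_right _ _))
  exact h0 (by simp [h1, h2])

theorem IsLogField.smul {a : FormalField M} (c : ℂ) (ha : IsLogField a) : IsLogField (c • a) := by
  obtain ⟨S, hS⟩ := ha
  refine ⟨S, fun v => ?_⟩
  obtain ⟨N, K, h⟩ := hS v
  exact ⟨N, K, fun n k h0 => h n k fun h1 => h0 (by simp [h1])⟩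

theorem isLogField_zero : IsLogField (0 : FormalField M) :=
  ⟨∅, fun _ => ⟨0, 0, fun _ _ h => absurd rfl h⟩⟩

theorem isLogField_one : IsLogField (oneField M) := by
  refine ⟨{-1}, fun v => ⟨0, 0, fun n k h => ?_⟩⟩
  rw [oneField_apply] at h
  split_ifs at h with h1
  · exact ⟨h1.2.le, -1, by simp, 0, le_rfl, by simp [h1.1]⟩
  · exact absurd rfl h

/-- For logarithmic fields the predicate `IsNProduct` has at most one solution, which allows
replacing it by the function `nprod`. -/
theorem IsNProduct.eq_nprod {p q : ℕ} {j : ℤ} {a b c : FormalField M} (h : IsNProduct p q j a b c)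
    (ha : IsLogField a) (hb : IsLogField b) : c = nprod j a b := by
  obtain ⟨N, h1, h2⟩ := isNProduct_iff.mp h
  funext n e
  refine LinearMap.ext fun v => ?_
  rw [h2, nprod_apply (h1.good hb ha)]

theorem isNProduct_nprod {p q N : ℕ} {a b : FormalField M}
    (h : Loc N a b ((-1 : ℂ) ^ (p * q) • b) a) (ha : IsLogField a) (hb : IsLogField b) (j : ℤ) :
    IsNProduct p q j a b (nprod j a b) :=
  isNProduct_iff.mpr ⟨N, h, fun n e v => nprod_apply (h.good hb ha) j n e v⟩

end Bounded
end SymplecticFermions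
end

set_option linter.unusedSectionVars false
noncomputable section
namespace SymplecticFermions

/-! ### Taylor coefficients of series with a pole along the diagonal -/

section Stable

variable {M : Type*} [AddCommGroup M] [Module ℂ M]
variable {V : Type*} [AddCommGroup V] [Module ℂ V]

/-- Some `(z - w)^P f` can be restricted to the diagonal. -/
def DiagPole (f : Ser2 M) : Prop := ∃ P : ℕ, DiagFinite ((zw ^ P) f)

open Classical in
/-- The Laurent coefficient of `(z - w)^d` in the expansion of `f` along the diagonal. -/
def laurent (d : ℤ) (f : Ser2 M) : Ser1 M :=
  if h : DiagPole f then taylor (d + h.choose) ((zw ^ h.choose) f) else 0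

theorem taylor_zw_pow_eq {P P' : ℕ} {f : Ser2 M} (h : DiagFinite ((zw ^ P) f))
    (h' : DiagFinite ((zw ^ P') f)) (d : ℤ) :
    taylor (d + P) ((zw ^ P) f) = taylor (d + P') ((zw ^ P') f) := by
  wlog hN : P ≤ P' generalizing P P'
  · exact (this h' h (by omega)).symm
  · obtain ⟨i, rfl⟩ := Nat.exists_eq_add_of_le' hN
    rw [zw_pow_add_apply, taylor_zw_pow _ h]
    congr 1
    push_cast
    ring

theorem laurent_eq {P : ℕ} {f : Ser2 M} (h : DiagFinite ((zw ^ P) f)) (d : ℤ) :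
    laurent d f = taylor (d + P) ((zw ^ P) f) := by
  have h' : DiagPole f := ⟨P, h⟩
  rw [laurent, dif_pos h']
  exact taylor_zw_pow_eq h'.choose_spec h d

theorem laurent_eq_taylor {f : Ser2 M} (h : DiagFinite f) (d : ℤ) : laurent d f = taylor d f := by
  have := laurent_eq (P := 0) (by simpa using h) d
  simpa using this

theorem DiagPole.of_le {P P' : ℕ} (hP : P ≤ P') {f : Ser2 M} (h : DiagFinite ((zw ^ P) f)) :
    DiagFinite ((zw ^ P') f) := by
  obtain ⟨i, rfl⟩ := Nat.exists_eq_add_of_le' hP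
  rw [zw_pow_add_apply]
  exact h.zw_pow i

theorem DiagPole.add {f g : Ser2 M} (hf : DiagPole f) (hg : DiagPole g) : DiagPole (f + g) := by
  obtain ⟨P, hP⟩ := hf
  obtain ⟨Q, hQ⟩ := hg
  refine ⟨max P Q, ?_⟩
  rw [map_add]
  exact (DiagPole.of_le (le_max_left _ _) hP).add (DiagPole.of_le (le_max_right _ _) hQ)

theorem DiagPole.neg {f : Ser2 M} (hf : DiagPole f) : DiagPole (-f) := by
  obtain ⟨P, hP⟩ := hf
  exact ⟨P, by rw [map_neg]; exact hP.neg⟩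

theorem DiagPole.sub {f g : Ser2 M} (hf : DiagPole f) (hg : DiagPole g) : DiagPole (f - g) := by
  rw [sub_eq_add_neg]; exact hf.add hg.neg

theorem DiagPole.zw {f : Ser2 M} (hf : DiagPole f) : DiagPole (zw f) := by
  obtain ⟨P, hP⟩ := hf
  refine ⟨P, ?_⟩
  rw [← Module.End.mul_apply, ← pow_succ, pow_succ', Module.End.mul_apply]
  exact hP.zw

theorem zw_pow_shiftW (P : ℕ) (f : Ser2 M) : (zw ^ P) (shiftW f) = shiftW ((zw ^ P) f) := by
  have h : Commute (zw : Module.End ℂ (Ser2 M)) shiftW :=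
    commute_shiftZ_shiftW.sub_left (Commute.refl _)
  exact congrArg (fun g : Module.End ℂ (Ser2 M) => g f) (h.pow_left P).eq

theorem DiagPole.shiftW {f : Ser2 M} (hf : DiagPole f) : DiagPole (shiftW f) := by
  obtain ⟨P, hP⟩ := hf
  exact ⟨P, by rw [zw_pow_shiftW]; exact hP.shiftW⟩

theorem laurent_sub (d : ℤ) {f g : Ser2 M} (hf : DiagPole f) (hg : DiagPole g) :
    laurent d (f - g) = laurent d f - laurent d g := by
  obtain ⟨P, hP⟩ := hf
  obtain ⟨Q, hQ⟩ := hg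
  have h1 := DiagPole.of_le (le_max_left P Q) hP
  have h2 := DiagPole.of_le (le_max_right P Q) hQ
  rw [laurent_eq h1, laurent_eq h2, laurent_eq (P := max P Q) (by rw [map_sub]; exact h1.sub h2),
    map_sub, taylor_sub _ h1 h2]

theorem laurent_zw (d : ℤ) {f : Ser2 M} (hf : DiagPole f) : laurent d (zw f) = laurent (d - 1) f := by
  obtain ⟨P, hP⟩ := hf
  have h : (SymplecticFermions.zw ^ P) (SymplecticFermions.zw f)
      = SymplecticFermions.zw ((SymplecticFermions.zw ^ P) f) := by
    rw [← Module.End.mul_apply, ← pow_succ, pow_succ', Module.End.mul_apply]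
  rw [laurent_eq hP, laurent_eq (P := P) (by rw [h]; exact hP.zw), h, taylor_zw _ hP]
  congr 1
  ring

theorem laurent_shiftW (d : ℤ) {f : Ser2 M} (hf : DiagPole f) :
    laurent d (shiftW f) = shift (laurent d f) := by
  obtain ⟨P, hP⟩ := hf
  rw [laurent_eq hP, laurent_eq (P := P) (by rw [zw_pow_shiftW]; exact hP.shiftW), zw_pow_shiftW,
    taylor_shiftW]

theorem DiagPole.map {f : Ser2 M} (hf : DiagPole f) (g : M →ₗ[ℂ] V) :
    DiagPole (fun m k n l => g (f m k n l)) := by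
  obtain ⟨P, hP⟩ := hf
  exact ⟨P, by rw [zw_pow_map]; exact hP.map g⟩

theorem laurent_map (d : ℤ) {f : Ser2 M} (hf : DiagPole f) (g : M →ₗ[ℂ] V) :
    laurent d (fun m k n l => g (f m k n l)) = fun n e => g (laurent d f n e) := by
  obtain ⟨P, hP⟩ := hf
  rw [laurent_eq hP, laurent_eq (P := P) (by rw [zw_pow_map]; exact hP.map g), zw_pow_map,
    taylor_map _ hP]

theorem Good.diagPole {N : ℕ} {a b : FormalField M} (h : Good N a b) (v : M) :
    DiagPole (comp a b v) := ⟨N, h v⟩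

/-- In this form the exponent `N` disappears: the `j`-th product is the coefficient of `(z -
w)^(-1-j)` along the diagonal. -/
theorem nprod_eq_laurent {N : ℕ} {a b : FormalField M} (h : Good N a b) (j : ℤ) (v : M) :
    (fun n e => nprod j a b n e v) = laurent (-1 - j) (comp a b v) := by
  rw [nprod_apply' h, laurent_eq (h v)]
  congr 1
  ring

end Stable

/-! ### Series in three variables -/

/-- Formal series in three variables `x`, `z`, `w` and their logarithms. -/
abbrev Ser3 (M : Type*) : Type _ := ℂ → ℕ → ℂ → ℕ → ℂ → ℕ → M

section Three

variable {M : Type*} [AddCommGroup M] [Module ℂ M]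

/-- Multiplication by `x`. -/
def shiftX : Module.End ℂ (Ser3 M) where
  toFun f := fun m k => f (m + 1) k
  map_add' _ _ := rfl
  map_smul' _ _ := rfl

/-- An operator in the variables `z`, `w`. -/
def onInner (T : Module.End ℂ (Ser2 M)) : Module.End ℂ (Ser3 M) where
  toFun f := fun m k => T (f m k)
  map_add' f g := by funext m k; exact map_add T _ _
  map_smul' c f := by funext m k; exact map_smul T _ _

variable (M) in
/-- Multiplication by `x - z`. -/
def xz : Module.End ℂ (Ser3 M) := shiftX - onInner shiftZ

variable (M) in
/-- Multiplication by `x - w`. -/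
def xw : Module.End ℂ (Ser3 M) := shiftX - onInner shiftW

variable (M) in
/-- Multiplication by `z - w`. -/
def zwIn : Module.End ℂ (Ser3 M) := onInner zw

theorem xz_apply (f : Ser3 M) (m : ℂ) (k : ℕ) (n : ℂ) (l : ℕ) (o : ℂ) (r : ℕ) :
    xz M f m k n l o r = f (m + 1) k n l o r - f m k (n + 1) l o r := rfl

theorem xw_apply (f : Ser3 M) (m : ℂ) (k : ℕ) (n : ℂ) (l : ℕ) (o : ℂ) (r : ℕ) :
    xw M f m k n l o r = f (m + 1) k n l o r - f m k n l (o + 1) r := rfl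

theorem zwIn_apply (f : Ser3 M) (m : ℂ) (k : ℕ) (n : ℂ) (l : ℕ) (o : ℂ) (r : ℕ) :
    zwIn M f m k n l o r = f m k (n + 1) l o r - f m k n l (o + 1) r := rfl

theorem xw_eq (f : Ser3 M) : xw M f = xz M f + zwIn M f := by
  funext m k n l o r
  simp only [xw_apply, xz_apply, Pi.add_apply, zwIn_apply]
  abel

theorem commute_xz_xw : Commute (xz M) (xw M) := by
  refine LinearMap.ext fun f => ?_
  funext m k n l o r
  simp only [Module.End.mul_apply, xw_apply, xz_apply]
  abel

theorem commute_xz_zw : Commute (xz M : Module.End ℂ (Ser3 M)) (zwIn M) := by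
  refine LinearMap.ext fun f => ?_
  funext m k n l o r
  simp only [Module.End.mul_apply, zwIn_apply, xz_apply]
  abel

theorem commute_xw_zw : Commute (xw M : Module.End ℂ (Ser3 M)) (zwIn M) := by
  refine LinearMap.ext fun f => ?_
  funext m k n l o r
  simp only [Module.End.mul_apply, zwIn_apply, xw_apply]
  abel

theorem xz_pow_apply (N : ℕ) (f : Ser3 M) (m : ℂ) (k : ℕ) (n : ℂ) (l : ℕ) (o : ℂ) (r : ℕ) :
    (xz M ^ N) f m k n l o r = (zw ^ N) (fun m k n l => f m k n l o r) m k n l := by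
  induction N generalizing m n with
  | zero => rfl
  | succ N ih => rw [pow_succ', Module.End.mul_apply, pow_succ', Module.End.mul_apply, xz_apply, ih, ih,
      zw_apply]

theorem xw_pow_apply (N : ℕ) (f : Ser3 M) (m : ℂ) (k : ℕ) (n : ℂ) (l : ℕ) (o : ℂ) (r : ℕ) :
    (xw M ^ N) f m k n l o r = (zw ^ N) (fun m k o r => f m k n l o r) m k o r := by
  induction N generalizing m o with
  | zero => rfl
  | succ N ih => rw [pow_succ', Module.End.mul_apply, pow_succ', Module.End.mul_apply, xw_apply, ih, ih,
      zw_apply]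

theorem zwIn_pow_apply (N : ℕ) (f : Ser3 M) (m : ℂ) (k : ℕ) :
    (zwIn M ^ N) f m k = (zw ^ N) (f m k) := by
  induction N with
  | zero => rfl
  | succ N ih => rw [pow_succ', Module.End.mul_apply, pow_succ', Module.End.mul_apply, ← ih]; rfl

/-- The coefficients of the expansion in `z` around `z = w`, as a series in `x`, `w`. -/
def laurentIn (d : ℤ) (f : Ser3 M) : Ser2 M := fun m k => laurent d (f m k)

theorem laurentIn_xw (d : ℤ) {f : Ser3 M} (hf : ∀ m k, DiagPole (f m k)) :
    laurentIn d (xw M f) = zw (laurentIn d f) := by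
  funext m k
  have : xw M f m k = f (m + 1) k - shiftW (f m k) := rfl
  rw [laurentIn, this, laurent_sub _ (hf _ _) (hf _ _).shiftW, laurent_shiftW _ (hf _ _)]
  rfl

/-- Write `x - z = (x - w) - (z - w)`. The first factor does not involve `z` and passes through the
expansion, the second one shifts the index. -/
theorem laurentIn_xz (d : ℤ) {f : Ser3 M} (hf : ∀ m k, DiagPole (f m k)) :
    laurentIn d (xz M f) = zw (laurentIn d f) - laurentIn (d - 1) f := by
  rw [← laurentIn_xw _ hf]
  funext m k
  have h1 : xz M f m k = xw M f m k - zw (f m k) := by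
    rw [eq_sub_iff_add_eq]; exact (congrFun (congrFun (xw_eq f) m) k).symm
  have h2 : DiagPole (xw M f m k) := (hf (m + 1) k).sub (hf m k).shiftW
  rw [laurentIn, h1, laurent_sub _ h2 (hf _ _).zw, laurent_zw _ (hf _ _)]
  rfl

theorem diagPole_xw {f : Ser3 M} (hf : ∀ m k, DiagPole (f m k)) (m : ℂ) (k : ℕ) :
    DiagPole (xw M f m k) := (hf (m + 1) k).sub (hf m k).shiftW

theorem diagPole_xz {f : Ser3 M} (hf : ∀ m k, DiagPole (f m k)) (m : ℂ) (k : ℕ) :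
    DiagPole (xz M f m k) := by
  have h1 : xz M f m k = xw M f m k - zw (f m k) := by
    rw [eq_sub_iff_add_eq]; exact (congrFun (congrFun (xw_eq f) m) k).symm
  rw [h1]
  exact (diagPole_xw hf m k).sub (hf m k).zw

theorem laurentIn_sub (d : ℤ) {f g : Ser3 M} (hf : ∀ m k, DiagPole (f m k))
    (hg : ∀ m k, DiagPole (g m k)) : laurentIn d (f - g) = laurentIn d f - laurentIn d g := by
  funext m k
  exact laurent_sub d (hf m k) (hg m k)

theorem laurentIn_zero (d : ℤ) : laurentIn d (0 : Ser3 M) = 0 := by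
  funext m k
  have : laurent d (0 : Ser2 M) = 0 := by
    rw [laurent_eq_taylor diagFinite_zero, taylor_map_zero]
  exact this

/-- This is the core of Dong's lemma. Let `c_e` be the coefficient of `(z - w)^e` in `f`, a series
in `x` and `w`. Then `(x - w) c_e` is the sum of the corresponding coefficient of `(x - z) f`, for
which `i` is smaller, and of `c_{e-1}`, for which `D` is smaller. The induction on `i + D` ends when
`D = 0`, where the coefficient lies below the lowest order `d`, or when `i = 0`, where the factor
`(x - w)^N` alone kills `f`. -/
theorem zw_pow_laurentIn_eq_zero (N i D : ℕ) {f : Ser3 M} (d : ℤ)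
    (hf : ∀ m k, DiagPole (f m k)) (hd : ∀ m k, ∀ e < d, laurent e (f m k) = 0)
    (h0 : (xz M ^ i) ((xw M ^ N) f) = 0) : (zw ^ (N + i + D)) (laurentIn (d + D - 1) f) = 0 := by
  induction hs : i + D generalizing i D f with
  | zero =>
    obtain ⟨rfl, rfl⟩ : i = 0 ∧ D = 0 := by omega
    have : laurentIn (d + ((0 : ℕ) : ℤ) - 1) f = 0 := by
      funext m k
      exact hd m k _ (by simp)
    rw [this, map_zero]
  | succ s ih =>
    rcases D with _ | D
    · have : laurentIn (d + ((0 : ℕ) : ℤ) - 1) f = 0 := by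
        funext m k
        exact hd m k _ (by simp)
      rw [this, map_zero]
    rcases i with _ | i
    · have h2 : ∀ (N : ℕ) (f : Ser3 M), (∀ m k, DiagPole (f m k)) →
          laurentIn (d + (D + 1 : ℕ) - 1) ((xw M ^ N) f)
            = (zw ^ N) (laurentIn (d + (D + 1 : ℕ) - 1) f) := by
        intro N
        induction N with
        | zero => intro f _; rfl
        | succ N ihN =>
          intro f hf
          rw [pow_succ, Module.End.mul_apply, ihN _ (diagPole_xw hf), laurentIn_xw _ hf, pow_succ,
            Module.End.mul_apply]
      have h3 : (xw M ^ N) f = 0 := by simpa using h0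
      rw [show N + 0 + (D + 1) = (D + 1) + N by ring, zw_pow_add_apply, ← h2 _ _ hf, h3, laurentIn_zero,
        map_zero]
    · have h1 : zw (laurentIn (d + (D + 1 : ℕ) - 1) f)
          = laurentIn (d + (D + 1 : ℕ) - 1) (xz M f) + laurentIn (d + D - 1) f := by
        rw [laurentIn_xz _ hf, show d + ((D + 1 : ℕ) : ℤ) - 1 - 1 = d + D - 1 by push_cast; ring]
        abel
      have h2 := ih i (D + 1) (f := xz M f) (diagPole_xz hf) ?_ ?_ (by omega)
      · have h3 := ih (i + 1) D hf hd h0 (by omega)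
        rw [show N + (i + 1) + (D + 1) = (N + i + (D + 1)) + 1 by ring, pow_succ, Module.End.mul_apply,
          h1, map_add, h2, zero_add, ← h3]
        congr 2
        ring
      · intro m k e he
        have : laurentIn e (xz M f) m k = 0 := by
          rw [laurentIn_xz _ hf]
          have h4 : laurentIn e f = 0 := by
            funext m k; exact hd m k e he
          have h5 : laurentIn (e - 1) f = 0 := by
            funext m k; exact hd m k _ (by omega)
          rw [h4, h5, map_zero, sub_zero]
          rfl
        exact this
      · rw [← h0, ← Module.End.mul_apply, ← Module.End.mul_apply, ← Module.End.mul_apply, pow_succ]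
        congr 1
        have := (commute_xz_xw (M := M)).pow_right N
        rw [mul_assoc, mul_assoc, this.eq]

/-- The series `a(x) b(z) c(w) v`. -/
def comp3 (a b c : FormalField M) (v : M) : Ser3 M :=
  fun m k n l o r => a m k (b n l (c o r v))

/-- The series `b(z) c(w) a(x) v`. -/
def comp3Op (b c a : FormalField M) (v : M) : Ser3 M :=
  fun m k n l o r => b n l (c o r (a m k v))

theorem laurent_eq_zero_of_lt {P : ℕ} {f : Ser2 M} (h : DiagFinite ((zw ^ P) f)) {d : ℤ}
    (hd : d < -P) : laurent d f = 0 := by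
  rw [laurent_eq h, taylor_of_neg (by omega)]

theorem Loc.xz_pow_comp3 {N : ℕ} {a b b' a' : FormalField M} (h : Loc N a b b' a')
    (c : FormalField M) (v : M) :
    (xz M ^ N) (comp3 a b c v) = (xz M ^ N) (fun m k n l o r => b' n l (a' m k (c o r v))) := by
  funext m k n l o r
  rw [xz_pow_apply, xz_pow_apply]
  exact congrFun (congrFun (congrFun (congrFun (h (c o r v)) m) k) n) l

theorem Loc.xw_pow_comp3 {N : ℕ} {a c c' a' : FormalField M} (h : Loc N a c c' a')
    (b : FormalField M) (v : M) :
    (xw M ^ N) (fun m k n l o r => b n l (a m k (c o r v))) = (xw M ^ N) (comp3Op b c' a' v) := by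
  funext m k n l o r
  rw [xw_pow_apply, xw_pow_apply]
  have h1 := zw_pow_map (b n l) N (comp a c v)
  have h2 := zw_pow_map (b n l) N (compOp a' c' v)
  have h3 : (zw ^ N) (fun m k o r => b n l (a m k (c o r v)))
      = (zw ^ N) (fun m k o r => b n l (c' o r (a' m k v))) := by
    refine h1.trans ?_
    rw [h v]
    exact h2.symm
  exact congrFun (congrFun (congrFun (congrFun h3 m) k) o) r

theorem laurentIn_comp3 {N : ℕ} {a b c : FormalField M} (h : Good N b c) (j : ℤ) (v : M) :
    laurentIn (-1 - j) (comp3 a b c v) = comp a (nprod j b c) v := by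
  funext m k
  have h1 := laurent_map (-1 - j) (h.diagPole v) (a m k)
  refine h1.trans ?_
  rw [← nprod_eq_laurent h]
  rfl

theorem laurentIn_comp3Op {N : ℕ} {a b c : FormalField M} (h : Good N b c) (j : ℤ) (v : M) :
    laurentIn (-1 - j) (comp3Op b c a v) = compOp a (nprod j b c) v := by
  funext m k
  exact (nprod_eq_laurent h j (a m k v)).symm

/-- Products of local fields are local. -/
theorem Loc.nprod {N : ℕ} {a b c b' c' a' a'' : FormalField M} (hab : Loc N a b b' a')
    (hac : Loc N a' c c' a'') (hbc : Good N b c) (hbc' : Good N b' c') (j : ℤ) :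
    ∃ N', Loc N' a (nprod j b c) (SymplecticFermions.nprod j b' c') a'' := by
  -- The coefficient of `(z - w)^(-1-j)` lies `N - j` places above the first one that is known to
  -- vanish, that of order `-N - 1`.
  refine ⟨N + N + (N - j).toNat, fun v => ?_⟩
  have h1 : ∀ m k, DiagPole (comp3 a b c v m k) := fun m k => (hbc.diagPole v).map (a m k)
  have h2 : ∀ m k, DiagPole (comp3Op b' c' a'' v m k) := fun m k => hbc'.diagPole (a'' m k v)
  rw [← sub_eq_zero, ← map_sub, ← laurentIn_comp3 hbc, ← laurentIn_comp3Op hbc', ← laurentIn_sub _ h1 h2]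
  rcases lt_or_ge (N : ℤ) j with hj | hj
  · have h3 : laurentIn (-1 - j) (comp3 a b c v - comp3Op b' c' a'' v) = 0 := by
      rw [laurentIn_sub _ h1 h2, laurentIn_comp3 hbc, laurentIn_comp3Op hbc',
        nprod_eq_zero hbc (by omega), nprod_eq_zero hbc' (by omega)]
      funext m k n l
      simp [comp, compOp]
    rw [h3, map_zero]
  have hD : ((N - j).toNat : ℤ) = N - j := Int.toNat_of_nonneg (by omega)
  have := zw_pow_laurentIn_eq_zero N N (N - j).toNat (f := comp3 a b c v - comp3Op b' c' a'' v) (-N)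
    (fun m k => (h1 m k).sub (h2 m k)) ?_ ?_
  · rw [← this]
    congr 2
    rw [hD]
    ring
  · intro m k e he
    have h3 : DiagFinite ((zw ^ N) (comp3 a b c v m k)) := by
      have := zw_pow_map (a m k) N (comp b c v)
      have h4 : (zw ^ N) (comp3 a b c v m k) = _ := this
      rw [h4]
      exact (hbc v).map (a m k)
    have h4 : DiagFinite ((zw ^ N) (comp3Op b' c' a'' v m k)) := hbc' _
    have := laurent_sub e (h1 m k) (h2 m k)
    rw [laurent_eq_zero_of_lt h3 he, laurent_eq_zero_of_lt h4 he, sub_zero] at this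
    exact this
  -- The factor `(x - z)^N` moves `a(x)` past `b(z)`, then `(x - w)^N` moves it past `c(w)`; so the
  -- difference of the two orders is annihilated by both together.
  · have hc : ∀ f : Ser3 M, (xz M ^ N) ((xw M ^ N) f) = (xw M ^ N) ((xz M ^ N) f) := fun f =>
      congrArg (fun g : Module.End ℂ (Ser3 M) => g f)
        (((commute_xz_xw (M := M)).pow_left N).pow_right N).eq
    rw [LinearMap.map_sub, LinearMap.map_sub, sub_eq_zero, hc, hab.xz_pow_comp3, ← hc, hac.xw_pow_comp3]

end Three
end SymplecticFermions
end

set_option linter.unusedSectionVars false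
noncomputable section
namespace SymplecticFermions

/-! ### Iterated expansions in three variables and their symmetry. -/

section Triple

variable {M : Type*} [AddCommGroup M] [Module ℂ M]

/-- Interchange of the variables `x` and `z`. -/
def swap3 (f : Ser3 M) : Ser3 M := fun m k n l o r => f n l m k o r

theorem swap3_xz (f : Ser3 M) : swap3 (xz M f) = - xz M (swap3 f) := by
  funext m k n l o r
  simp only [swap3, xz_apply, Pi.neg_apply, neg_sub]

theorem swap3_xw (f : Ser3 M) : swap3 (xw M f) = zwIn M (swap3 f) := rfl

theorem swap3_zwIn (f : Ser3 M) : swap3 (zwIn M f) = xw M (swap3 f) := rfl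

/-- The iterated expansion around `z = w` and then around `x = w` exists. -/
def Iter (f : Ser3 M) : Prop := (∀ m k, DiagPole (f m k)) ∧ ∀ e, DiagPole (laurentIn e f)

/-- The coefficient of `(x - w)^d (z - w)^e` in the iterated expansion. -/
def laurent2 (d e : ℤ) (f : Ser3 M) : Ser1 M := laurent d (laurentIn e f)

theorem laurentIn_zwIn (e : ℤ) {f : Ser3 M} (hf : ∀ m k, DiagPole (f m k)) :
    laurentIn e (zwIn M f) = laurentIn (e - 1) f := by
  funext m k
  exact laurent_zw e (hf m k)

theorem Iter.xw {f : Ser3 M} (hf : Iter f) : Iter (xw M f) :=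
  ⟨diagPole_xw hf.1, fun e => by rw [laurentIn_xw _ hf.1]; exact (hf.2 e).zw⟩

theorem Iter.zwIn {f : Ser3 M} (hf : Iter f) : Iter (zwIn M f) :=
  ⟨fun m k => (hf.1 m k).zw, fun e => by rw [laurentIn_zwIn _ hf.1]; exact hf.2 _⟩

theorem Iter.xz {f : Ser3 M} (hf : Iter f) : Iter (xz M f) :=
  ⟨diagPole_xz hf.1, fun e => by rw [laurentIn_xz _ hf.1]; exact (hf.2 e).zw.sub (hf.2 _)⟩

theorem Iter.neg {f : Ser3 M} (hf : Iter f) : Iter (-f) := by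
  have h : ∀ e, laurentIn e (-f) = - laurentIn e f := by
    intro e
    have := laurentIn_sub e (f := 0) (g := f) (fun m k => ⟨0, by simpa using diagFinite_zero⟩) hf.1
    rwa [laurentIn_zero, zero_sub, zero_sub] at this
  exact ⟨fun m k => (hf.1 m k).neg, fun e => by rw [h]; exact (hf.2 e).neg⟩

theorem laurent2_neg (d e : ℤ) {f : Ser3 M} (hf : Iter f) : laurent2 d e (-f) = -laurent2 d e f := by
  have h0 : DiagPole (0 : Ser2 M) := ⟨0, by simpa using diagFinite_zero⟩
  have h := laurentIn_sub e (f := 0) (g := f) (fun m k => h0) hf.1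
  rw [laurentIn_zero, zero_sub, zero_sub] at h
  have h1 := laurent_sub d h0 (hf.2 e)
  rw [zero_sub, laurent_eq_taylor diagFinite_zero, taylor_map_zero, zero_sub] at h1
  rw [laurent2, h, h1, laurent2]

theorem laurent2_xw (d e : ℤ) {f : Ser3 M} (hf : Iter f) :
    laurent2 d e (xw M f) = laurent2 (d - 1) e f := by
  rw [laurent2, laurentIn_xw _ hf.1, laurent_zw _ (hf.2 e), laurent2]

theorem laurent2_zwIn (d e : ℤ) {f : Ser3 M} (hf : Iter f) :
    laurent2 d e (zwIn M f) = laurent2 d (e - 1) f := by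
  rw [laurent2, laurentIn_zwIn _ hf.1, laurent2]

theorem laurent2_xz (d e : ℤ) {f : Ser3 M} (hf : Iter f) :
    laurent2 d e (xz M f) = laurent2 (d - 1) e f - laurent2 d (e - 1) f := by
  rw [laurent2, laurentIn_xz _ hf.1, laurent_sub _ (hf.2 e).zw (hf.2 _), laurent_zw _ (hf.2 e)]
  rfl

/-- The difference operator corresponding to multiplication by `x - z`. -/
def delta {E : Type*} [AddCommGroup E] (A : ℤ → ℤ → E) : ℤ → ℤ → E :=
  fun m n => A (m + 1) n - A m (n + 1)

/-- The modes of the iterated expansion, `z` first. -/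
def modesA (f : Ser3 M) (m n : ℤ) : Ser1 M := laurent2 (-1 - m) (-1 - n) f

/-- The modes of the iterated expansion, `x` first. -/
def modesB (f : Ser3 M) (m n : ℤ) : Ser1 M := laurent2 (-1 - n) (-1 - m) (swap3 f)

theorem modesA_xz {f : Ser3 M} (hf : Iter f) : modesA (xz M f) = delta (modesA f) := by
  funext m n
  rw [modesA, laurent2_xz _ _ hf, delta, modesA, modesA]
  congr 2 <;> ring

/-- Interchanging `x` and `z` changes the sign of `x - z`, but also the roles of the two indices;
the effects cancel, and both kinds of modes satisfy the same difference equation. -/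
theorem modesB_xz {f : Ser3 M} (hf : Iter (swap3 f)) : modesB (xz M f) = delta (modesB f) := by
  funext m n
  rw [modesB, swap3_xz, laurent2_neg _ _ hf.xz, laurent2_xz _ _ hf, delta, modesB, modesB, neg_sub]
  congr 2 <;> ring

theorem Iter.xz_pow {f : Ser3 M} (hf : Iter f) (N : ℕ) : Iter ((SymplecticFermions.xz M ^ N) f) := by
  induction N with
  | zero => exact hf
  | succ N ih => rw [pow_succ', Module.End.mul_apply]; exact ih.xz

theorem Iter.swap3_xz_pow {f : Ser3 M} (hf : Iter (swap3 f)) (N : ℕ) :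
    Iter (swap3 ((SymplecticFermions.xz M ^ N) f)) := by
  induction N with
  | zero => exact hf
  | succ N ih => rw [pow_succ', Module.End.mul_apply, swap3_xz]; exact ih.xz.neg

theorem modesA_xz_pow {f : Ser3 M} (hf : Iter f) (N : ℕ) :
    modesA ((xz M ^ N) f) = delta^[N] (modesA f) := by
  induction N with
  | zero => rfl
  | succ N ih =>
    rw [pow_succ', Module.End.mul_apply, modesA_xz (hf.xz_pow N), ih, Function.iterate_succ_apply']

theorem modesB_xz_pow {f : Ser3 M} (hf : Iter (swap3 f)) (N : ℕ) :
    modesB ((xz M ^ N) f) = delta^[N] (modesB f) := by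
  induction N with
  | zero => rfl
  | succ N ih =>
    rw [pow_succ', Module.End.mul_apply, modesB_xz (hf.swap3_xz_pow N), ih,
      Function.iterate_succ_apply']

/-- The purpose is to read off iterated coefficients from the regularized series, whose coefficients
are ordinary mixed Taylor coefficients. -/
theorem laurent2_shift (P Q : ℕ) (d e : ℤ) {f : Ser3 M} (hf : Iter f) :
    Iter ((xw M ^ P) ((zwIn M ^ Q) f)) ∧
    laurent2 (d + P) (e + Q) ((xw M ^ P) ((zwIn M ^ Q) f)) = laurent2 d e f := by
  induction P generalizing d with
  | zero =>
    induction Q generalizing e with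
    | zero => simpa using hf
    | succ Q ih =>
      have h1 := ih e
      simp only [pow_zero, Module.End.one_apply] at h1 ⊢
      rw [pow_succ', Module.End.mul_apply]
      refine ⟨h1.1.zwIn, ?_⟩
      rw [laurent2_zwIn _ _ h1.1, ← h1.2]
      congr 1
      push_cast
      ring
  | succ P ih =>
    have h1 := ih d
    rw [pow_succ', Module.End.mul_apply]
    refine ⟨h1.1.xw, ?_⟩
    rw [laurent2_xw _ _ h1.1, ← h1.2]
    congr 1
    push_cast
    ring

/-! ### Restriction to the full diagonal -/

/-- For every total exponent only finitely many pairs of powers of `x` and `z` occur. -/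
def TriFinite (F : Ser3 M) : Prop :=
  ∀ n : ℂ, {p : ℂ × ℂ | ∃ k l r, F p.1 k p.2 l (n - p.1 - p.2) r ≠ 0}.Finite

/-- The restriction to `z = w`. -/
def diagIn (F : Ser3 M) : Ser2 M := fun m k => diag (F m k)

/-- The Taylor coefficients along `z = w`. -/
def taylorIn (e : ℤ) (F : Ser3 M) : Ser2 M := fun m k => taylor e (F m k)

/-- The derivative `∂_x`. -/
def dX (F : Ser3 M) : Ser3 M :=
  fun m k => (-m) • F (m - 1) k + ((k : ℂ) + 1) • F (m - 1) (k + 1)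

/-- The derivative `∂_z`. -/
def dY (F : Ser3 M) : Ser3 M := fun m k => dZ (F m k)

theorem TriFinite.inner {F : Ser3 M} (hF : TriFinite F) (m : ℂ) (k : ℕ) : DiagFinite (F m k) :=
  fun n => by
    refine ((hF (n + m)).preimage (f := fun m' => (m, m')) (by intro x _ y _ h; simpa using h)).subset ?_
    rintro m' ⟨l, r, h⟩
    refine ⟨k, l, r, ?_⟩
    simpa only [add_sub_cancel_right] using h

theorem TriFinite.swap {F : Ser3 M} (hF : TriFinite F) : TriFinite (swap3 F) := fun n => by
  refine ((hF n).preimage (f := Prod.swap) Prod.swap_injective.injOn).subset ?_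
  rintro ⟨m, m'⟩ ⟨k, l, r, h⟩
  refine ⟨l, k, r, ?_⟩
  simp only [swap3, Prod.fst_swap, Prod.snd_swap] at h ⊢
  rwa [sub_right_comm]

theorem TriFinite.swapInner {F : Ser3 M} (hF : TriFinite F) :
    TriFinite (fun m k n l o r => F m k o r n l) := fun n => by
  refine ((hF n).preimage (f := fun p : ℂ × ℂ => (p.1, n - p.1 - p.2)) ?_).subset ?_
  · rintro ⟨x, y⟩ _ ⟨x', y'⟩ _ h
    simp only [Prod.mk.injEq] at h ⊢
    obtain ⟨rfl, h⟩ := h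
    exact ⟨rfl, by simpa using h⟩
  · rintro ⟨m, m'⟩ ⟨k, l, r, h⟩
    refine ⟨k, r, l, ?_⟩
    simpa using h

theorem TriFinite.add {F G : Ser3 M} (hF : TriFinite F) (hG : TriFinite G) : TriFinite (F + G) :=
  fun n => by
    refine ((hF n).union (hG n)).subset ?_
    rintro p ⟨k, l, r, h⟩
    by_contra hc
    simp only [Set.mem_union, Set.mem_ofPred_eq, not_or, not_exists, not_not] at hc
    exact h (by simp [hc.1 k l r, hc.2 k l r])

theorem TriFinite.dX {F : Ser3 M} (hF : TriFinite F) : TriFinite (dX F) := fun n => by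
  refine ((hF (n - 1)).preimage (f := fun p : ℂ × ℂ => (p.1 - 1, p.2)) ?_).subset ?_
  · rintro ⟨x, y⟩ _ ⟨x', y'⟩ _ h
    simpa using h
  · rintro ⟨m, m'⟩ ⟨k, l, r, h⟩
    by_contra hc
    simp only [Set.mem_preimage, Set.mem_ofPred_eq, not_exists, not_not,
      show n - 1 - (m - 1) = n - m by ring] at hc
    exact h (by simp [SymplecticFermions.dX, hc])

theorem TriFinite.dY {F : Ser3 M} (hF : TriFinite F) : TriFinite (dY F) := hF.swap.dX.swap

theorem TriFinite.diagIn {F : Ser3 M} (hF : TriFinite F) : DiagFinite (diagIn F) := fun n => by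
  refine ((hF (n - 1)).image Prod.fst).subset ?_
  rintro m ⟨k, e, h⟩
  by_contra hc
  have h1 : ∀ (m' : ℂ) (l r : ℕ), F m k m' l (n - 1 - m - m') r = 0 := by
    intro m' l r
    by_contra h2
    exact hc ⟨(m, m'), ⟨k, l, r, h2⟩, rfl⟩
  apply h
  rw [SymplecticFermions.diagIn, diag]
  have h2 : ∀ m' : ℂ, n - m - 1 - m' = n - 1 - m - m' := fun m' => by ring
  simp only [h2, h1, Finset.sum_const_zero, finsum_zero]

theorem TriFinite.dY_iterate {F : Ser3 M} (hF : TriFinite F) (d : ℕ) :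
    TriFinite (SymplecticFermions.dY^[d] F) := by
  induction d with
  | zero => exact hF
  | succ d ih => rw [Function.iterate_succ_apply']; exact ih.dY

theorem TriFinite.dX_iterate {F : Ser3 M} (hF : TriFinite F) (d : ℕ) :
    TriFinite (SymplecticFermions.dX^[d] F) := by
  induction d with
  | zero => exact hF
  | succ d ih => rw [Function.iterate_succ_apply']; exact ih.dX

theorem dY_iterate_apply (d : ℕ) (F : Ser3 M) (m : ℂ) (k : ℕ) :
    (dY^[d] F) m k = (dZ ^ d) (F m k) := by
  induction d with
  | zero => rfl
  | succ d ih => rw [Function.iterate_succ_apply', pow_succ', Module.End.mul_apply, ← ih]; rfl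

theorem taylorIn_natCast (e : ℕ) (F : Ser3 M) :
    taylorIn e F = ((e.factorial : ℂ))⁻¹ • diagIn (dY^[e] F) := by
  funext m k
  rw [taylorIn, taylor_natCast, ← dY_iterate_apply]
  rfl

theorem TriFinite.taylorIn {F : Ser3 M} (hF : TriFinite F) (e : ℤ) : DiagFinite (taylorIn e F) := by
  rcases lt_or_ge e 0 with he | he
  · have : SymplecticFermions.taylorIn e F = 0 := by
      funext m k; exact taylor_of_neg he _
    rw [this]; exact diagFinite_zero
  · lift e to ℕ using he
    rw [taylorIn_natCast]
    exact (hF.dY_iterate e).diagIn.smul _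

theorem diagIn_dX {F : Ser3 M} (hF : TriFinite F) : diagIn (dX F) = dZ (diagIn F) := by
  funext m k
  have h1 := diag_add ((hF.inner (m - 1) k).smul (-m)) ((hF.inner (m - 1) (k + 1)).smul ((k : ℂ) + 1))
  rw [diag_smul, diag_smul] at h1
  exact h1

theorem diagIn_dX_iterate {F : Ser3 M} (hF : TriFinite F) (d : ℕ) :
    diagIn (dX^[d] F) = (dZ ^ d) (diagIn F) := by
  induction d with
  | zero => rfl
  | succ d ih =>
    rw [Function.iterate_succ_apply', diagIn_dX (hF.dX_iterate d), ih, pow_succ', Module.End.mul_apply]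

theorem dX_dY (F : Ser3 M) : dX (dY F) = dY (dX F) := by
  funext m k
  exact ((map_add dZ _ _).trans (congrArg₂ (· + ·) (map_smul dZ _ _) (map_smul dZ _ _))).symm

/-- Restricting in two steps is a finite double sum, and its value does not depend on the order of
summation; the powers of the logarithms are distributed over a simplex that is symmetric as well. -/
theorem diag_diagIn_swap {G : Ser3 M} (hG : TriFinite G) :
    diag (diagIn G) = diag (diagIn (swap3 G)) := by
  classical
  have key : ∀ (G : Ser3 M), TriFinite G → ∀ (n : ℂ) (e : ℕ) (S : Finset ℂ),
      (∀ m m' k l r, G m k m' l (n - 2 - m - m') r ≠ 0 → m ∈ S ∧ m' ∈ S) →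
      diag (diagIn G) n e = ∑ m ∈ S, ∑ m' ∈ S, ∑ k ∈ Finset.range (e + 1),
        ∑ l ∈ Finset.range (e - k + 1), G m k m' l (n - 2 - m - m') (e - k - l) := by
    intro G hG n e S hS
    have e1 : ∀ m m' : ℂ, n - 1 - m - 1 - m' = n - 2 - m - m' := fun m m' => by ring
    simp only [diag, diagIn, e1]
    rw [finsum_eq_sum_of_support_subset (s := S)]
    · refine Finset.sum_congr rfl fun m _ => ?_
      rw [Finset.sum_comm]
      refine Finset.sum_congr rfl fun k _ => ?_
      rw [finsum_eq_sum_of_support_subset]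
      intro m' hm'
      by_contra hc
      refine hm' (Finset.sum_eq_zero fun l _ => ?_)
      by_contra h2
      exact hc (hS _ _ _ _ _ h2).2
    · intro m hm
      by_contra hc
      refine hm (Finset.sum_eq_zero fun k _ => ?_)
      have : ∀ m' l, G m k m' l (n - 2 - m - m') (e - k - l) = 0 := by
        intro m' l
        by_contra h2
        exact hc (hS _ _ _ _ _ h2).1
      simp [this]
  funext n e
  -- One finite set that contains all exponents of `x` and of `z` for this total degree, so that
  -- both iterated sums run over the same square.
  let S : Finset ℂ := (hG (n - 2)).toFinset.image Prod.fst ∪ (hG (n - 2)).toFinset.image Prod.snd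
  have hS : ∀ m m' k l r, G m k m' l (n - 2 - m - m') r ≠ 0 → m ∈ S ∧ m' ∈ S := by
    intro m m' k l r h
    have h1 : (m, m') ∈ (hG (n - 2)).toFinset := by
      rw [Set.Finite.mem_toFinset]; exact ⟨k, l, r, h⟩
    exact ⟨Finset.mem_union_left _ (Finset.mem_image_of_mem Prod.fst h1),
      Finset.mem_union_right _ (Finset.mem_image_of_mem Prod.snd h1)⟩
  rw [key G hG n e S hS, key _ hG.swap n e S, Finset.sum_comm]
  · refine Finset.sum_congr rfl fun m _ => Finset.sum_congr rfl fun m' _ => ?_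
    rw [Finset.sum_comm' (t' := Finset.range (e + 1)) (s' := fun l => Finset.range (e - l + 1))]
    · refine Finset.sum_congr rfl fun l _ => Finset.sum_congr rfl fun k _ => ?_
      simp only [swap3]
      rw [sub_right_comm (n - 2), Nat.sub_right_comm]
    · intro k l
      simp only [Finset.mem_range]
      omega
  · intro m m' k l r h
    simp only [swap3] at h
    rw [sub_right_comm] at h
    exact (hS _ _ _ _ _ h).symm

theorem swap3_dX_iterate (d : ℕ) (F : Ser3 M) : swap3 (dX^[d] F) = dY^[d] (swap3 F) := by
  induction d with
  | zero => rfl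
  | succ d ih => rw [Function.iterate_succ_apply', Function.iterate_succ_apply', ← ih]; rfl

theorem swap3_dY_iterate (d : ℕ) (F : Ser3 M) : swap3 (dY^[d] F) = dX^[d] (swap3 F) := by
  induction d with
  | zero => rfl
  | succ d ih => rw [Function.iterate_succ_apply', Function.iterate_succ_apply', ← ih]; rfl

theorem dX_dY_iterate (d e : ℕ) (F : Ser3 M) : dX^[d] (dY^[e] F) = dY^[e] (dX^[d] F) :=
  ((Function.Commute.iterate_left (f := dX) (g := dY) (fun F => dX_dY F) d).iterate_right e) F

theorem taylor_taylorIn_natCast {F : Ser3 M} (hF : TriFinite F) (d e : ℕ) :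
    taylor d (taylorIn e F)
      = ((d.factorial : ℂ)⁻¹ * (e.factorial : ℂ)⁻¹) • diag (diagIn (dX^[d] (dY^[e] F))) := by
  rw [taylorIn_natCast, taylor_smul, taylor_natCast, smul_smul, diagIn_dX_iterate (hF.dY_iterate e),
    mul_comm]

/-- Partial derivatives commute and the restriction to the full diagonal is symmetric; hence for a
regular series the order of the two expansions is immaterial. -/
theorem taylor_taylorIn_swap {F : Ser3 M} (hF : TriFinite F) (d e : ℤ) :
    taylor d (taylorIn e F) = taylor e (taylorIn d (swap3 F)) := by
  have h0 : ∀ (d e : ℤ) (F : Ser3 M), e < 0 → taylor d (taylorIn e F) = 0 := by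
    intro d e F he
    have : taylorIn e F = 0 := by
      funext m k; exact taylor_of_neg he _
    rw [this, taylor_map_zero]
  rcases lt_or_ge e 0 with he | he
  · rw [h0 d e F he, taylor_of_neg he]
  rcases lt_or_ge d 0 with hd | hd
  · rw [h0 e d _ hd, taylor_of_neg hd]
  lift d to ℕ using hd
  lift e to ℕ using he
  rw [taylor_taylorIn_natCast hF, taylor_taylorIn_natCast hF.swap,
    diag_diagIn_swap ((hF.dY_iterate e).dX_iterate d), swap3_dX_iterate, swap3_dY_iterate,
    dX_dY_iterate, mul_comm]

/-- The restriction to `x = z`, as a series in `z`, `w`. -/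
def diagXZ (F : Ser3 M) : Ser2 M := fun m k o r => diag (fun m k n l => F m k n l o r) m k

theorem diag_diagXZ {F : Ser3 M} (hF : TriFinite F) : diag (diagXZ F) = diag (diagIn F) := by
  have h1 : diagIn F = diagIn (fun m k n l o r => F m k o r n l) := by
    funext m k
    exact (diag_swap (F m k)).symm
  rw [h1, diag_diagIn_swap hF.swapInner, ← diag_swap]
  rfl

theorem TriFinite.diagFinite_outer {F : Ser3 M} (hF : TriFinite F) (o : ℂ) (r : ℕ) :
    DiagFinite (fun m k n l => F m k n l o r) := hF.swapInner.swap.inner o r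

theorem dZ_diagXZ {F : Ser3 M} (hF : TriFinite F) : dZ (diagXZ F) = diagXZ (dX F + dY F) := by
  funext m k o r
  have h := diag_dZ_add_dW (hF.diagFinite_outer o r)
  exact (congrFun (congrFun h m) k).symm

theorem taylorIn_dX {F : Ser3 M} (hF : TriFinite F) (e : ℤ) :
    taylorIn e (dX F) = dZ (taylorIn e F) := by
  funext m k
  have h1 := taylor_add e ((hF.inner (m - 1) k).smul (-m))
    ((hF.inner (m - 1) (k + 1)).smul ((k : ℂ) + 1))
  rw [taylor_smul, taylor_smul] at h1
  exact h1

theorem taylorIn_dY (F : Ser3 M) (e : ℤ) :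
    taylorIn e (dY F) = ((e : ℂ) + 1) • taylorIn (e + 1) F := by
  funext m k
  exact taylor_dZ e (F m k)

theorem taylorIn_add {F G : Ser3 M} (hF : TriFinite F) (hG : TriFinite G) (e : ℤ) :
    taylorIn e (F + G) = taylorIn e F + taylorIn e G := by
  funext m k
  exact taylor_add e (hF.inner m k) (hG.inner m k)

/-- Expanding `F(x, z, w)` around `w` in both variables and setting `x = z` collects the mixed
coefficients of total degree `s`. The proof is by induction: the derivative of `F(z, z, w)` in `z`
is the restriction of `(∂_x + ∂_z) F`. -/
theorem sum_taylor_taylorIn {F : Ser3 M} (hF : TriFinite F) (s : ℕ) :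
    ∑ d ∈ Finset.range (s + 1), taylor (d : ℤ) (taylorIn ((s : ℤ) - d) F) = taylor s (diagXZ F) := by
  induction s generalizing F with
  | zero =>
    have h1 : taylorIn 0 F = diagIn F := by
      funext m k; exact taylor_zero_eq _
    simp [taylor_zero_eq, diag_diagXZ hF, h1]
  | succ s ih =>
    have h1 : ((s : ℂ) + 1) ≠ 0 := by exact_mod_cast Nat.succ_ne_zero s
    have h2 := ih (hF.dX.add hF.dY)
    rw [← dZ_diagXZ hF, taylor_dZ] at h2
    have h3 : ∀ d ∈ Finset.range (s + 1), taylor (d : ℤ) (taylorIn ((s : ℤ) - d) (dX F + dY F))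
        = ((d : ℂ) + 1) • taylor ((d : ℤ) + 1) (taylorIn ((s : ℤ) - d) F)
          + ((s : ℂ) - d + 1) • taylor (d : ℤ) (taylorIn ((s : ℤ) - d + 1) F) := by
      intro d _
      rw [taylorIn_add hF.dX hF.dY, taylor_add _ (hF.dX.taylorIn _) (hF.dY.taylorIn _),
        taylorIn_dX hF, taylor_dZ, taylorIn_dY, taylor_smul]
      push_cast
      rfl
    rw [Finset.sum_congr rfl h3, Finset.sum_add_distrib] at h2
    have h4 := Finset.sum_range_succ'
      (fun d : ℕ => (d : ℂ) • taylor (d : ℤ) (taylorIn (((s + 1 : ℕ) : ℤ) - d) F)) (s + 1)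
    have h5 := Finset.sum_range_succ
      (fun d : ℕ => ((s : ℂ) + 1 - d) • taylor (d : ℤ) (taylorIn (((s + 1 : ℕ) : ℤ) - d) F)) (s + 1)
    simp only [Nat.cast_zero, zero_smul, add_zero, Nat.cast_succ, sub_self] at h4 h5
    have h6 : ∑ d ∈ Finset.range (s + 1 + 1),
        ((s : ℂ) + 1) • taylor (d : ℤ) (taylorIn (((s + 1 : ℕ) : ℤ) - d) F)
        = ((s : ℂ) + 1) • taylor ((s : ℤ) + 1) (diagXZ F) := by
      push_cast
      refine Eq.trans ?_ h2
      have h7 : ∀ d : ℕ, ((s : ℂ) + 1) • taylor (d : ℤ) (taylorIn ((s : ℤ) + 1 - d) F)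
          = (d : ℂ) • taylor (d : ℤ) (taylorIn ((s : ℤ) + 1 - d) F)
            + ((s : ℂ) + 1 - d) • taylor (d : ℤ) (taylorIn ((s : ℤ) + 1 - d) F) := by
        intro d
        rw [← add_smul]
        congr 1
        ring
      rw [Finset.sum_congr rfl fun d _ => h7 d, Finset.sum_add_distrib, h4, h5]
      congr 1
      · refine Finset.sum_congr rfl fun d _ => ?_
        congr 3
        ring
      · refine Finset.sum_congr rfl fun d _ => ?_
        congr 2
        · ring
        · congr 1
          ring
    rw [← Finset.smul_sum] at h6
    -- The derivative determines the Taylor coefficient of order `s + 1` up to the factor `s + 1`,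
    -- which is cancelled here.
    have h8 := smul_right_injective _ h1 h6
    push_cast at h8 ⊢
    exact h8

/-- The weight `d` is produced by a derivative in `x`, so the first moment of the mixed coefficients
reduces to the preceding sum for `∂_x F`. -/
theorem sum_smul_taylor_taylorIn {F : Ser3 M} (hF : TriFinite F) (s : ℕ) :
    ∑ d ∈ Finset.range (s + 2), (d : ℂ) • taylor (d : ℤ) (taylorIn ((s : ℤ) + 1 - d) F)
      = taylor s (diagXZ (dX F)) := by
  rw [← sum_taylor_taylorIn hF.dX, Finset.sum_range_succ']
  simp only [Nat.cast_zero, zero_smul, add_zero]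
  refine Finset.sum_congr rfl fun d _ => ?_
  rw [taylorIn_dX hF, taylor_dZ]
  push_cast
  congr 3
  ring

end Triple
end SymplecticFermions
end

set_option linter.unusedSectionVars false
noncomputable section
namespace SymplecticFermions

/-! ### Difference equations -/

section Discrete

variable {E : Type*} [AddCommGroup E]

theorem delta_iterate_map {E' : Type*} [AddCommGroup E'] (g : E →+ E') (N : ℕ) (A : ℤ → ℤ → E) :
    delta^[N] (fun m n => g (A m n)) = fun m n => g (delta^[N] A m n) := by
  induction N with
  | zero => rfl
  | succ N ih =>
    rw [Function.iterate_succ_apply', ih, Function.iterate_succ_apply']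
    funext m n
    simp [delta]

/-- Along an antidiagonal, `X m n` is `X (m+1) (n-1)` minus a value of `delta X`. So membership for
large `m` spreads downwards once `delta X` takes values in `Γ`, and `N` such steps suffice. -/
theorem mem_of_delta_iterate_mem (Γ : AddSubgroup E) (N : ℕ) (X : ℤ → ℤ → E) (M₀ : ℤ)
    (h1 : ∀ m n, delta^[N] X m n ∈ Γ) (h2 : ∀ m n, M₀ ≤ m → X m n ∈ Γ) (m n : ℤ) : X m n ∈ Γ := by
  induction N generalizing X m n with
  | zero => exact h1 m n
  | succ N ih =>
    have h3 : ∀ m n, delta X m n ∈ Γ := fun m n =>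
      ih (delta X) (fun m n => h1 m n)
        (fun m n hm => Γ.sub_mem (h2 _ _ (by omega)) (h2 _ _ hm)) m n
    have h4 : ∀ (i : ℕ) (m n : ℤ), M₀ ≤ m + i → X m n ∈ Γ := by
      intro i
      induction i with
      | zero => intro m n hm; exact h2 m n (by simpa using hm)
      | succ i ihi =>
        intro m n hm
        have h5 : X m n = X (m + 1) (n - 1) - delta X m (n - 1) := by
          simp [delta]
        rw [h5]
        exact Γ.sub_mem (ihi _ _ (by push_cast at hm; omega)) (h3 _ _)
    exact h4 (M₀ - m).toNat m n (by omega)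

/-- A discrete residue theorem: two solutions of one first order difference equation differ by a
constant, and as one vanishes at the left end and the other at the right end, this constant is the
total sum of `F`. -/
theorem sub_eq_sum_of_diff {a b F : ℤ → E} {L U : ℤ} (hLU : L ≤ U) (ha : ∀ m, a (m + 1) - a m = F m)
    (hb : ∀ m, b (m + 1) - b m = F m) (ha0 : a L = 0) (hb0 : b U = 0) (m : ℤ) :
    a m - b m = ∑ i ∈ Finset.Ico L U, F i := by
  have h1 : ∀ m, a m - b m = a U := by
    have h2 : ∀ m, a (m + 1) - b (m + 1) = a m - b m := by
      intro m
      have := (ha m).trans (hb m).symm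
      rw [sub_eq_sub_iff_sub_eq_sub] at this
      exact this
    have h3 : ∀ m, a m - b m = a 0 - b 0 := by
      intro m
      induction m using Int.induction_on with
      | zero => rfl
      | succ i ih => rw [h2, ih]
      | pred i ih =>
        rw [← ih, ← h2 (-(i : ℤ) - 1)]
        simp
    intro m
    rw [h3 m, ← h3 U, hb0, sub_zero]
  have h4 : ∀ k : ℕ, a (L + k) = ∑ i ∈ Finset.Ico L (L + k), F i := by
    intro k
    induction k with
    | zero => simp [ha0]
    | succ k ih =>
      have : Finset.Ico L (L + ((k + 1 : ℕ) : ℤ)) = insert (L + k) (Finset.Ico L (L + k)) := by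
        ext x; simp only [Finset.mem_Ico, Finset.mem_insert]; omega
      rw [this, Finset.sum_insert (by simp), ← ih, ← ha]
      push_cast
      rw [add_assoc, sub_add_cancel]
  rw [h1 m]
  have := h4 (U - L).toNat
  rwa [Int.toNat_of_nonneg (by omega), add_sub_cancel] at this

/-- The sequences `a (m+1) - a m` and `m (a (m+1) - a m) - a m` have first differences `F m` and `(m
+ 1) F m`. Applying the first order statement to both and eliminating the increments gives the
formula. -/
theorem sub_eq_of_second_diff [Module ℂ E] {a b F : ℤ → E} {L U : ℤ} (hLU : L ≤ U)
    (ha : ∀ m, a (m + 2) - (2 : ℂ) • a (m + 1) + a m = F m)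
    (hb : ∀ m, b (m + 2) - (2 : ℂ) • b (m + 1) + b m = F m)
    (ha0 : ∀ m ≤ L + 1, a m = 0) (hb0 : ∀ m ≥ U, b m = 0) (m : ℤ) :
    a m - b m = ((m : ℂ) - 1) • ∑ i ∈ Finset.Ico L U, F i
      - ∑ i ∈ Finset.Ico L U, (i : ℂ) • F i := by
  have h1 := sub_eq_sum_of_diff (a := fun m => a (m + 1) - a m) (b := fun m => b (m + 1) - b m) (F := F)
    hLU (fun m => by rw [← ha m, show m + 1 + 1 = m + 2 by ring]; module)
    (fun m => by rw [← hb m, show m + 1 + 1 = m + 2 by ring]; module)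
    (by simp [ha0 L (by omega), ha0 (L + 1) le_rfl]) (by simp [hb0 U le_rfl, hb0 (U + 1) (by omega)]) m
  have h2 := sub_eq_sum_of_diff (a := fun m => (m : ℂ) • (a (m + 1) - a m) - a m)
    (b := fun m => (m : ℂ) • (b (m + 1) - b m) - b m) (F := fun m => ((m : ℂ) + 1) • F m)
    hLU (fun m => by rw [← ha m, show m + 1 + 1 = m + 2 by ring]; push_cast; module)
    (fun m => by rw [← hb m, show m + 1 + 1 = m + 2 by ring]; push_cast; module)
    (by simp [ha0 L (by omega), ha0 (L + 1) le_rfl]) (by simp [hb0 U le_rfl, hb0 (U + 1) (by omega)]) m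
  simp only [add_smul, one_smul, Finset.sum_add_distrib] at h1 h2
  rw [← h1] at h2 ⊢
  have h3 : ∑ i ∈ Finset.Ico L U, (i : ℂ) • F i
      = ((m : ℂ) • (a (m + 1) - a m) - a m - ((m : ℂ) • (b (m + 1) - b m) - b m))
        - (a (m + 1) - a m - (b (m + 1) - b m)) := by
    rw [h2]; abel
  rw [h3]
  module

end Discrete

/-! ### Commutators of products -/

section Commutator

variable {M : Type*} [AddCommGroup M] [Module ℂ M]

/-- The support of a series in three variables satisfies `Q`. -/
def SuppIn (Q : ℂ → ℂ → ℂ → Prop) (f : Ser3 M) : Prop :=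
  ∀ m k n l o r, f m k n l o r ≠ 0 → Q m n o

theorem SuppIn.xz {Q : ℂ → ℂ → ℂ → Prop} {f : Ser3 M} (hf : SuppIn Q f)
    (h1 : ∀ m n o, Q (m + 1) n o → Q m n o) (h2 : ∀ m n o, Q m (n + 1) o → Q m n o) (N : ℕ) :
    SuppIn Q ((xz M ^ N) f) := by
  induction N with
  | zero => exact hf
  | succ N ih =>
    rw [pow_succ', Module.End.mul_apply]
    intro m k n l o r h0
    by_contra hc
    rw [xz_apply, by_contra fun h => hc (h1 _ _ _ (ih _ _ _ _ _ _ h)),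
      by_contra fun h => hc (h2 _ _ _ (ih _ _ _ _ _ _ h)), sub_zero] at h0
    exact h0 rfl

theorem SuppIn.xw {Q : ℂ → ℂ → ℂ → Prop} {f : Ser3 M} (hf : SuppIn Q f)
    (h1 : ∀ m n o, Q (m + 1) n o → Q m n o) (h2 : ∀ m n o, Q m n (o + 1) → Q m n o) (N : ℕ) :
    SuppIn Q ((xw M ^ N) f) := by
  induction N with
  | zero => exact hf
  | succ N ih =>
    rw [pow_succ', Module.End.mul_apply]
    intro m k n l o r h0
    by_contra hc
    rw [xw_apply, by_contra fun h => hc (h1 _ _ _ (ih _ _ _ _ _ _ h)),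
      by_contra fun h => hc (h2 _ _ _ (ih _ _ _ _ _ _ h)), sub_zero] at h0
    exact h0 rfl

theorem SuppIn.zwIn {Q : ℂ → ℂ → ℂ → Prop} {f : Ser3 M} (hf : SuppIn Q f)
    (h1 : ∀ m n o, Q m (n + 1) o → Q m n o) (h2 : ∀ m n o, Q m n (o + 1) → Q m n o) (N : ℕ) :
    SuppIn Q ((zwIn M ^ N) f) := by
  induction N with
  | zero => exact hf
  | succ N ih =>
    rw [pow_succ', Module.End.mul_apply]
    intro m k n l o r h0
    by_contra hc
    rw [zwIn_apply, by_contra fun h => hc (h1 _ _ _ (ih _ _ _ _ _ _ h)),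
      by_contra fun h => hc (h2 _ _ _ (ih _ _ _ _ _ _ h)), sub_zero] at h0
    exact h0 rfl

/-- Three upper bounds on real parts with a fixed sum confine all exponents. Only exponents matter
here, hence the entries `0` for the powers of the logarithms. -/
theorem triFinite_of_suppIn {S T U : Finset ℂ} {N₁ N₂ N₃ : ℤ} {f : Ser3 M}
    (h1 : SuppIn (fun m _ _ => BddIn S N₁ 0 m 0) f) (h2 : SuppIn (fun _ n _ => BddIn T N₂ 0 n 0) f)
    (h3 : SuppIn (fun _ _ o => BddIn U N₃ 0 o 0) f) : TriFinite f := fun n => by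
  let C₁ : ℝ := (∑ α ∈ S, |α.re|) + N₁
  let C₂ : ℝ := (∑ α ∈ T, |α.re|) + N₂
  let C₃ : ℝ := (∑ α ∈ U, |α.re|) + N₃
  refine ((finite_bddIn S N₁ (n.re - C₂ - C₃)).prod (finite_bddIn T N₂ (n.re - C₁ - C₃))).subset ?_
  rintro ⟨m, m'⟩ ⟨k, l, r, h⟩
  have b1 := h1 _ _ _ _ _ _ h
  have b2 := h2 _ _ _ _ _ _ h
  have b3 := h3 _ _ _ _ _ _ h
  have c1 : m.re ≤ C₁ := b1.re_le
  have c2 : m'.re ≤ C₂ := b2.re_le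
  have c3 : (n - m - m').re ≤ C₃ := b3.re_le
  simp only [Complex.sub_re] at c3
  exact ⟨⟨b1.2, by linarith⟩, ⟨b2.2, by linarith⟩⟩

theorem laurent2_eq_taylor {F : Ser3 M} (hF : TriFinite F) (d e : ℤ) :
    laurent2 d e F = taylor d (taylorIn e F) := by
  have : laurentIn e F = taylorIn e F := by
    funext m k; exact laurent_eq_taylor (hF.inner m k) e
  rw [laurent2, this, laurent_eq_taylor (hF.taylorIn e)]

theorem swap3_xw_pow (P : ℕ) (f : Ser3 M) : swap3 ((xw M ^ P) f) = (zwIn M ^ P) (swap3 f) := by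
  induction P with
  | zero => rfl
  | succ P ih => rw [pow_succ', Module.End.mul_apply, swap3_xw, ih, pow_succ', Module.End.mul_apply]

theorem swap3_zwIn_pow (P : ℕ) (f : Ser3 M) : swap3 ((zwIn M ^ P) f) = (xw M ^ P) (swap3 f) := by
  induction P with
  | zero => rfl
  | succ P ih => rw [pow_succ', Module.End.mul_apply, swap3_zwIn, ih, pow_succ', Module.End.mul_apply]

theorem iter_comp3 {N : ℕ} {a b c : FormalField M} (h : Good N b c)
    (hA : ∀ n, ∃ K, Good K a (nprod n b c)) (v : M) : Iter (comp3 a b c v) := by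
  refine ⟨fun m k => (h.diagPole v).map (a m k), fun e => ?_⟩
  have h1 := laurentIn_comp3 (a := a) h (-1 - e) v
  rw [sub_sub_cancel] at h1
  obtain ⟨K, hK⟩ := hA (-1 - e)
  rw [h1]
  exact hK.diagPole v

theorem laurent2_comp3 {N : ℕ} {a b c : FormalField M} (h : Good N b c)
    (hA : ∀ n, ∃ K, Good K a (nprod n b c)) (v : M) (m n : ℤ) :
    laurent2 (-1 - m) (-1 - n) (comp3 a b c v) = fun o e => nprod m a (nprod n b c) o e v := by
  obtain ⟨K, hK⟩ := hA n
  rw [laurent2, laurentIn_comp3 h, nprod_eq_laurent hK]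

/-- The hypotheses on three fields under which the commutator of the products with the first two is
computed. -/
structure LocTriple (N P : ℕ) (a b c b' c₁ c₂ : FormalField M) : Prop where
  ab : Loc N a b b' a
  ac : Loc P a c c₁ a
  bc : Loc P b c c₂ b
  log_a : IsLogField a
  log_b : IsLogField b
  log_c : IsLogField c
  good_a : ∀ n, ∃ K, Good K a (nprod n b c)
  good_b : ∀ m, ∃ K, Good K b' (nprod m a c)

/-- The regularized product `(x - z)^N (x - w)^P (z - w)^P a(x) b(z) c(w) v`. -/
def regular (N P : ℕ) (a b c : FormalField M) (v : M) : Ser3 M :=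
  (xw M ^ P) ((zwIn M ^ P) ((xz M ^ N) (comp3 a b c v)))

theorem pow_comm_xz_xw (N P : ℕ) (f : Ser3 M) :
    (xz M ^ N) ((xw M ^ P) f) = (xw M ^ P) ((xz M ^ N) f) :=
  congrArg (fun g : Module.End ℂ (Ser3 M) => g f) ((commute_xz_xw.pow_left N).pow_right P).eq

theorem pow_comm_xz_zwIn (N P : ℕ) (f : Ser3 M) :
    (xz M ^ N) ((zwIn M ^ P) f) = (zwIn M ^ P) ((xz M ^ N) f) :=
  congrArg (fun g : Module.End ℂ (Ser3 M) => g f) ((commute_xz_zw.pow_left N).pow_right P).eq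

theorem pow_comm_xw_zwIn (N P : ℕ) (f : Ser3 M) :
    (xw M ^ N) ((zwIn M ^ P) f) = (zwIn M ^ P) ((xw M ^ N) f) :=
  congrArg (fun g : Module.End ℂ (Ser3 M) => g f) ((commute_xw_zw.pow_left N).pow_right P).eq

variable {N P : ℕ} {a b c b' c₁ c₂ : FormalField M}

/-- The exponents of a variable are bounded if its field acts on `v` first. For `w` this is the case
already; the factors in `z - w` bring `b(z)` to the right, and those in `x - z` and `x - w` bring
`a(x)` there. -/
theorem LocTriple.triFinite (h : LocTriple N P a b c b' c₁ c₂) (v : M) :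
    TriFinite (regular N P a b c v) := by
  obtain ⟨S, hS⟩ := h.log_a
  obtain ⟨T, hT⟩ := h.log_b
  obtain ⟨U, hU⟩ := h.log_c
  obtain ⟨N₁, K₁, h1⟩ := hS v
  obtain ⟨N₂, K₂, h2⟩ := hT v
  obtain ⟨N₃, K₃, h3⟩ := hU v
  have hs : ∀ {S : Finset ℂ} {N : ℤ} {n : ℂ}, BddIn S N 0 (n + 1) 0 → BddIn S N 0 n 0 := fun h => h.shift
  have hall : ∀ {Q : ℂ → ℂ → ℂ → Prop} {f : Ser3 M}, SuppIn Q f → (∀ m n o, Q (m + 1) n o → Q m n o) →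
      (∀ m n o, Q m (n + 1) o → Q m n o) → (∀ m n o, Q m n (o + 1) → Q m n o) →
      SuppIn Q ((xw M ^ P) ((zwIn M ^ P) ((xz M ^ N) f))) := fun hf q1 q2 q3 =>
    ((hf.xz q1 q2 N).zwIn q2 q3 P).xw q1 q3 P
  refine triFinite_of_suppIn (S := S) (T := T) (U := U) (N₁ := N₁) (N₂ := N₂) (N₃ := N₃) ?_ ?_ ?_
  · have e1 : regular N P a b c v
        = (xw M ^ P) ((zwIn M ^ P) ((xz M ^ N) (comp3Op b' c₁ a v))) := by
      rw [regular, h.ab.xz_pow_comp3, pow_comm_xw_zwIn, ← pow_comm_xz_xw, h.ac.xw_pow_comp3,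
        pow_comm_xz_xw, ← pow_comm_xw_zwIn]
    rw [e1]
    refine hall ?_ (fun _ _ _ => hs) (fun _ _ _ h => h) (fun _ _ _ h => h)
    intro m k n l o r h0
    have h4 : a m k v ≠ 0 := fun h4 => h0 (by simp only [comp3Op, h4, map_zero])
    exact ⟨le_rfl, (h1 m k h4).2⟩
  · have e1 : regular N P a b c v
        = (xw M ^ P) ((zwIn M ^ P) ((xz M ^ N) fun m k n l o r => a m k (c₂ o r (b n l v)))) := by
      rw [regular, ← pow_comm_xz_zwIn, ← pow_comm_xz_zwIn]
      congr 2
      funext m k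
      rw [zwIn_pow_apply, zwIn_pow_apply]
      have e2 := zw_pow_map (a m k) P (comp b c v)
      have e3 := zw_pow_map (a m k) P (compOp b c₂ v)
      rw [← h.bc v] at e3
      exact e2.trans e3.symm
    rw [e1]
    refine hall ?_ (fun _ _ _ h => h) (fun _ _ _ => hs) (fun _ _ _ h => h)
    intro m k n l o r h0
    have h4 : b n l v ≠ 0 := fun h4 => h0 (by simp only [h4, map_zero])
    exact ⟨le_rfl, (h2 n l h4).2⟩
  · refine hall ?_ (fun _ _ _ h => h) (fun _ _ _ h => h) (fun _ _ _ => hs)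
    intro m k n l o r h0
    have h4 : c o r v ≠ 0 := fun h4 => h0 (by simp only [comp3, h4, map_zero])
    exact ⟨le_rfl, (h3 o r h4).2⟩

/-- Multiplication by `(x - z)^N` is the iterated difference operator on modes, and the remaining
factors of `regular` only shift the indices. -/
theorem LocTriple.delta_left (h : LocTriple N P a b c b' c₁ c₂) (v : M) (m n : ℤ) :
    delta^[N] (fun m n => (fun o e => nprod m a (nprod n b c) o e v : Ser1 M)) m n
      = taylor (-1 - m + P) (taylorIn (-1 - n + P) (regular N P a b c v)) := by
  have hbc := h.bc.good h.log_c h.log_b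
  have hI := iter_comp3 hbc h.good_a v
  have h1 : (fun m n => (fun o e => nprod m a (nprod n b c) o e v : Ser1 M))
      = modesA (comp3 a b c v) := by
    funext m n; exact (laurent2_comp3 hbc h.good_a v m n).symm
  rw [h1, ← modesA_xz_pow hI, modesA, ← (laurent2_shift P P _ _ (hI.xz_pow N)).2]
  exact laurent2_eq_taylor (h.triFinite v) _ _

/-- After multiplication by `(x - z)^N` the product may be reordered, which gives the same
regularized series; its mixed Taylor coefficients do not depend on the order of expansion. -/
theorem LocTriple.delta_right (h : LocTriple N P a b c b' c₁ c₂) (v : M) (m n : ℤ) :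
    delta^[N] (fun m n => (fun o e => nprod n b' (nprod m a c) o e v : Ser1 M)) m n
      = taylor (-1 - m + P) (taylorIn (-1 - n + P) (regular N P a b c v)) := by
  have hac := h.ac.good h.log_c h.log_a
  have hI := iter_comp3 hac h.good_b v
  let f : Ser3 M := fun m k n l o r => b' n l (a m k (c o r v))
  have hf : swap3 f = comp3 b' a c v := rfl
  rw [← hf] at hI
  have h1 : (fun m n => (fun o e => nprod n b' (nprod m a c) o e v : Ser1 M)) = modesB f := by
    funext m n
    rw [modesB, hf]
    exact (laurent2_comp3 hac h.good_b v n m).symm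
  rw [h1, ← modesB_xz_pow hI, modesB, ← (laurent2_shift P P _ _ (hI.swap3_xz_pow N)).2,
    taylor_taylorIn_swap (h.triFinite v), ← laurent2_eq_taylor (h.triFinite v).swap]
  congr 1
  rw [regular, h.ab.xz_pow_comp3, swap3_xw_pow, swap3_zwIn_pow, pow_comm_xw_zwIn]

/-- Weak commutativity of products. -/
theorem LocTriple.delta_eq (h : LocTriple N P a b c b' c₁ c₂) :
    delta^[N] (fun m n => nprod m a (nprod n b c)) = delta^[N] (fun m n => nprod n b' (nprod m a c)) := by
  funext m n o e
  refine LinearMap.ext fun v => ?_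
  let g : FormalField M →+ Ser1 M :=
    { toFun := fun x o e => x o e v, map_zero' := rfl, map_add' := fun _ _ => rfl }
  have h1 := (h.delta_left v m n).trans (h.delta_right v m n).symm
  have h2 := delta_iterate_map g N (fun m n => nprod m a (nprod n b c))
  have h3 := delta_iterate_map g N (fun m n => nprod n b' (nprod m a c))
  have h4 := (congrFun (congrFun h2 m) n).symm.trans (h1.trans (congrFun (congrFun h3 m) n))
  exact congrFun (congrFun h4 o) e

/-! ### The commutator for a constant operator product -/

theorem comp_oneField_left (c : FormalField M) (v : M) :
    comp (oneField M) c v = fun m k n l => comp c (oneField M) v n l m k := by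
  funext m k n l
  simp only [comp, oneField_apply]
  split_ifs <;> simp

theorem diagFinite_one_comp (c : FormalField M) (v : M) : DiagFinite (comp (oneField M) c v) :=
  fun n => by
    refine (Set.finite_singleton (-1)).subset ?_
    rintro m ⟨k, l, h⟩
    rw [comp, oneField_apply] at h
    split_ifs at h with h1
    · exact h1.1
    · exact absurd rfl h

theorem comp_deriv1_left (a b : FormalField M) (v : M) : comp (deriv1 a) b v = dZ (comp a b v) := by
  funext m k n l
  simp [comp, dZ_apply, deriv1_apply]

/-- The series is constant in `z`, so only its value on the diagonal remains. -/
theorem taylor_one_comp (c : FormalField M) (v : M) (d : ℤ) :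
    taylor d (comp (oneField M) c v) = if d = 0 then fun n e => c n e v else 0 := by
  rcases lt_or_ge d 0 with hd | hd
  · rw [taylor_of_neg hd, if_neg (by omega)]
  lift d to ℕ using hd
  rcases d with _ | d
  · have h1 := nprod_apply' (good_one c) (-1) v
    rw [nprod_neg_one_one] at h1
    simp only [Nat.cast_zero, zero_sub, sub_neg_eq_add, neg_add_cancel, pow_zero, Module.End.one_apply,
      taylor_zero_eq] at h1
    simp only [Nat.cast_zero, if_true, taylor_zero_eq]
    rw [comp_oneField_left, diag_swap, h1]
  · have h0 : comp (0 : FormalField M) c v = 0 := rfl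
    rw [taylor_natCast, pow_succ, Module.End.mul_apply, ← comp_deriv1_left, deriv1_oneField, h0, map_zero,
      diag_zero, smul_zero, if_neg (by omega)]

theorem diagXZ_xw {f : Ser3 M} (hf : ∀ o r, DiagFinite (fun m k n l => f m k n l o r)) :
    diagXZ (xw M f) = zw (diagXZ f) := by
  funext m k o r
  have h := diag_sub (hf o r).shiftZ (hf (o + 1) r)
  rw [diag_shiftZ] at h
  exact congrFun (congrFun h m) k

theorem diagXZ_zwIn {f : Ser3 M} (hf : ∀ o r, DiagFinite (fun m k n l => f m k n l o r)) :
    diagXZ (zwIn M f) = zw (diagXZ f) := by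
  funext m k o r
  have h := diag_sub (hf o r).shiftW (hf (o + 1) r)
  rw [diag_shiftW] at h
  exact congrFun (congrFun h m) k

theorem outer_xw {f : Ser3 M} (hf : ∀ o r, DiagFinite (fun m k n l => f m k n l o r)) (o : ℂ) (r : ℕ) :
    DiagFinite (fun m k n l => xw M f m k n l o r) := (hf o r).shiftZ.sub (hf (o + 1) r)

theorem outer_zwIn {f : Ser3 M} (hf : ∀ o r, DiagFinite (fun m k n l => f m k n l o r)) (o : ℂ) (r : ℕ) :
    DiagFinite (fun m k n l => zwIn M f m k n l o r) := (hf o r).shiftW.sub (hf (o + 1) r)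

theorem diagXZ_pow {f : Ser3 M} (hf : ∀ o r, DiagFinite (fun m k n l => f m k n l o r)) (P Q : ℕ) :
    (∀ o r, DiagFinite (fun m k n l => (xw M ^ P) ((zwIn M ^ Q) f) m k n l o r)) ∧
    diagXZ ((xw M ^ P) ((zwIn M ^ Q) f)) = (zw ^ (P + Q)) (diagXZ f) := by
  induction P with
  | zero =>
    induction Q with
    | zero => exact ⟨hf, rfl⟩
    | succ Q ih =>
      simp only [pow_zero, Module.End.one_apply, zero_add] at ih ⊢
      rw [pow_succ', Module.End.mul_apply]
      exact ⟨outer_zwIn ih.1, by rw [diagXZ_zwIn ih.1, ih.2, pow_succ', Module.End.mul_apply]⟩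
  | succ P ih =>
    rw [pow_succ', Module.End.mul_apply]
    refine ⟨outer_xw ih.1, ?_⟩
    rw [diagXZ_xw ih.1, ih.2, show P + 1 + Q = P + Q + 1 by ring, pow_succ', Module.End.mul_apply]

theorem dX_apply (f : Ser3 M) (m : ℂ) (k : ℕ) (n : ℂ) (l : ℕ) (o : ℂ) (r : ℕ) :
    dX f m k n l o r = (-m) • f (m - 1) k n l o r + ((k : ℂ) + 1) • f (m - 1) (k + 1) n l o r := rfl

theorem dX_xw (f : Ser3 M) : dX (xw M f) = xw M (dX f) + f := by
  funext m k n l o r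
  simp only [dX_apply, xw_apply, Pi.add_apply, sub_add_cancel, add_sub_cancel_right, neg_add,
    add_smul, smul_sub, neg_smul, one_smul]
  abel

theorem dX_zwIn_pow (P : ℕ) (f : Ser3 M) : dX ((zwIn M ^ P) f) = (zwIn M ^ P) (dX f) := by
  funext m k
  simp only [dX, zwIn_pow_apply, map_add, map_smul]

theorem dX_xw_pow (P : ℕ) (f : Ser3 M) :
    dX ((xw M ^ (P + 1)) f) = (xw M ^ (P + 1)) (dX f) + ((P : ℂ) + 1) • (xw M ^ P) f := by
  induction P with
  | zero => simp [dX_xw]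
  | succ P ih =>
    rw [pow_succ' _ (P + 1), Module.End.mul_apply, dX_xw, ih, LinearMap.map_add, LinearMap.map_smul,
      ← Module.End.mul_apply (xw M) (xw M ^ P), ← pow_succ', Module.End.mul_apply]
    push_cast
    simp only [add_smul, one_smul, add_assoc]

theorem diagXZ_add {f g : Ser3 M} (hf : ∀ o r, DiagFinite (fun m k n l => f m k n l o r))
    (hg : ∀ o r, DiagFinite (fun m k n l => g m k n l o r)) :
    diagXZ (f + g) = diagXZ f + diagXZ g := by
  funext m k o r
  exact congrFun (congrFun (diag_add (hf o r) (hg o r)) m) k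

theorem diagXZ_smul (c : ℂ) (f : Ser3 M) : diagXZ (c • f) = c • diagXZ f := by
  funext m k o r
  exact congrFun (congrFun (diag_smul c (fun m k n l => f m k n l o r)) m) k

theorem sum_Ico_reflect {E : Type*} [AddCommGroup E] (P : ℤ) (s : ℕ) (f : ℤ → E) :
    ∑ m ∈ Finset.Ico (P - 1 - s) P, f (P - 1 - m) = ∑ d ∈ Finset.range (s + 1), f d := by
  refine Finset.sum_bij' (fun m _ => (P - 1 - m).toNat) (fun d _ => P - 1 - (d : ℤ)) ?_ ?_ ?_ ?_ ?_
  · intro m hm; simp only [Finset.mem_Ico, Finset.mem_range] at hm ⊢; omega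
  · intro m hm; simp only [Finset.mem_Ico, Finset.mem_range] at hm ⊢; omega
  · intro m hm; simp only [Finset.mem_Ico] at hm; omega
  · intro m hm; omega
  · intro m hm
    simp only [Finset.mem_Ico] at hm
    rw [Int.toNat_of_nonneg (by omega)]

/-- The commutator of the products with two fields whose operator product is `κ (z - w)⁻²`. -/
theorem LocTriple.commutator {κ : ℂ} (h : LocTriple 2 (P + 1) a b c b' c₁ c₂)
    (h1 : nprod 1 a b = κ • oneField M) (h0 : nprod 0 a b = 0) (m n : ℤ) :
    nprod m a (nprod n b c) - nprod n b' (nprod m a c)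
      = (if m + n = 0 then κ * m else 0 : ℂ) • c := by
  have hab := h.ab.good h.log_b h.log_a
  have hac := h.ac.good h.log_c h.log_a
  have hbc := h.bc.good h.log_c h.log_b
  funext o e
  refine LinearMap.ext fun v => ?_
  obtain ⟨L, hL⟩ : ∃ L, L = m + n := ⟨_, rfl⟩
  let F := regular 2 (P + 1) a b c v
  have hF : TriFinite F := h.triFinite v
  let A : ℤ → ℤ → Ser1 M := fun m n o e => nprod m a (nprod n b c) o e v
  let B : ℤ → ℤ → Ser1 M := fun m n o e => nprod n b' (nprod m a c) o e v
  let G : ℤ → ℤ → Ser1 M := fun d e => taylor d (taylorIn e F)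
  -- On the antidiagonal `m + n = L` the modes of both iterated products have the second difference
  -- `Φ`. It is supported in `L - P - 2 ≤ i ≤ P`, where both Taylor indices are nonnegative.
  let Φ : ℤ → Ser1 M := fun i => G (P - i) (P - (L - 2 - i))
  have hdel : ∀ (X : ℤ → ℤ → Ser1 M) (i : ℤ), delta^[2] X i (L - 2 - i)
      = X (i + 2) (L - (i + 2)) - (2 : ℂ) • X (i + 1) (L - (i + 1)) + X i (L - i) := by
    intro X i
    simp only [Function.iterate_succ, Function.iterate_zero, Function.comp, id, delta]
    rw [show i + 1 + 1 = i + 2 by ring, show L - 2 - i = L - (i + 2) by ring,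
      show L - (i + 2) + 1 = L - (i + 1) by ring, show L - (i + 1) + 1 = L - i by ring]
    module
  have hA : ∀ i, A (i + 2) (L - (i + 2)) - (2 : ℂ) • A (i + 1) (L - (i + 1)) + A i (L - i) = Φ i := by
    intro i
    have := h.delta_left v i (L - 2 - i)
    rw [hdel] at this
    refine this.trans ?_
    rw [show -1 - i + ((P + 1 : ℕ) : ℤ) = P - i by push_cast; ring,
      show -1 - (L - 2 - i) + ((P + 1 : ℕ) : ℤ) = P - (L - 2 - i) by push_cast; ring]
  have hB : ∀ i, B (i + 2) (L - (i + 2)) - (2 : ℂ) • B (i + 1) (L - (i + 1)) + B i (L - i) = Φ i := by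
    intro i
    have := h.delta_right v i (L - 2 - i)
    rw [hdel] at this
    refine this.trans ?_
    rw [show -1 - i + ((P + 1 : ℕ) : ℤ) = P - i by push_cast; ring,
      show -1 - (L - 2 - i) + ((P + 1 : ℕ) : ℤ) = P - (L - 2 - i) by push_cast; ring]
  have hz : ∀ (j : ℤ) (x : FormalField M), nprod j x 0 = 0 := by
    intro j x
    have hg : Good 0 x 0 := fun v => by
      have : comp x 0 v = 0 := by funext m k n l; simp [comp]
      rw [this]; simpa using diagFinite_zero
    have := nprod_smul_right hg 0 j
    simpa using this
  -- For such `i` the inner product `b_(L-i) c` is zero by locality; for `B` the inner product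
  -- `a_(i) c` vanishes at the other end.
  have hA0 : ∀ i ≤ L - P - 2 + 1, A i (L - i) = 0 := by
    intro i hi
    simp only [A]
    rw [nprod_eq_zero hbc (by push_cast; omega), hz]
    rfl
  have hB0 : ∀ i ≥ (P : ℤ) + 1, B i (L - i) = 0 := by
    intro i hi
    simp only [B]
    rw [nprod_eq_zero hac (by push_cast; omega), hz]
    rfl
  -- the moments of the regularized product
  have hG0 : ∀ o r, DiagFinite (fun m k n l => (xz M ^ 2) (comp3 a b c v) m k n l o r) := by
    intro o r
    have := hab (c o r v)
    refine this.of_imp fun m k n l hne => ⟨k, l, ?_⟩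
    rw [xz_pow_apply] at hne
    exact hne
  -- The restriction of `(x - z)^2 a(x) b(z)` to `x = z` is the field `a_(1) b = κ`.
  have e0 : diagXZ ((xz M ^ 2) (comp3 a b c v)) = κ • comp (oneField M) c v := by
    funext m k o r
    have e1 := nprod_apply' hab 1 (c o r v)
    rw [h1] at e1
    have e2 : diag (fun m k n l => (xz M ^ 2) (comp3 a b c v) m k n l o r) m k
        = diag ((zw ^ 2) (comp a b (c o r v))) m k := by
      congr 1
    refine e2.trans ?_
    have e3 := congrFun (congrFun e1 m) k
    norm_num [taylor_zero_eq] at e3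
    rw [← e3]
    rfl
  have hG1 : ∀ o r, DiagFinite (fun m k n l => dX ((xz M ^ 2) (comp3 a b c v)) m k n l o r) := by
    intro o r
    exact (hG0 o r).dZ
  -- The first derivative on `x = z` is `a_(0) b`, which is zero.
  have e1 : diagXZ (dX ((xz M ^ 2) (comp3 a b c v))) = 0 := by
    funext m k o r
    have e1 := nprod_apply' hab 0 (c o r v)
    rw [h0] at e1
    have e2 : diag (fun m k n l => dX ((xz M ^ 2) (comp3 a b c v)) m k n l o r) m k
        = diag (dZ ((zw ^ 2) (comp a b (c o r v)))) m k := by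
      congr 1
    refine e2.trans ?_
    have e3 := congrFun (congrFun e1 m) k
    have e4 := taylor_natCast 1 ((zw ^ 2) (comp a b (c o r v)))
    norm_num at e3 e4
    rw [e4] at e3
    exact e3.symm
  have m0 : diagXZ F = κ • (zw ^ (2 * P + 2)) (comp (oneField M) c v) := by
    have := (diagXZ_pow hG0 (P + 1) (P + 1)).2
    rw [e0, map_smul] at this
    rw [← show P + 1 + (P + 1) = 2 * P + 2 by ring]
    exact this
  -- The derivative of the regular product of `a` and `b` contributes nothing, so `∂_x` acts only on
  -- `(x - w)^(P+1)`.
  have m1 : diagXZ (dX F) = (((P : ℂ) + 1) * κ) • (zw ^ (2 * P + 1)) (comp (oneField M) c v) := by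
    have f1 : dX F = (xw M ^ (P + 1)) ((zwIn M ^ (P + 1)) (dX ((xz M ^ 2) (comp3 a b c v))))
        + ((P : ℂ) + 1) • (xw M ^ P) ((zwIn M ^ (P + 1)) ((xz M ^ 2) (comp3 a b c v))) := by
      simp only [F, regular]
      rw [dX_xw_pow, dX_zwIn_pow]
    have f2 := diagXZ_pow hG0 P (P + 1)
    have f3 := diagXZ_pow hG1 (P + 1) (P + 1)
    have f4 : ∀ o r, DiagFinite (fun m k n l => (((P : ℂ) + 1) •
        (xw M ^ P) ((zwIn M ^ (P + 1)) ((xz M ^ 2) (comp3 a b c v)))) m k n l o r) :=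
      fun o r => (f2.1 o r).smul _
    rw [f1, diagXZ_add f3.1 f4, f3.2, e1, map_zero, zero_add, diagXZ_smul,
      f2.2, e0, map_smul, smul_smul, show P + (P + 1) = 2 * P + 1 by ring]
  have hone := diagFinite_one_comp c v
  -- Since `c(w)` does not depend on `z`, a multiple of `(z - w)^k c(w)` has the single Taylor
  -- coefficient of order `k`.
  have hm0 : ∀ s : ℕ, taylor s (diagXZ F)
      = if s = 2 * P + 2 then κ • (fun n e => c n e v : Ser1 M) else 0 := by
    intro s
    rw [m0, taylor_smul, taylor_zw_pow _ hone, taylor_one_comp]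
    by_cases hs : s = 2 * P + 2
    · rw [if_pos hs, if_pos (by push_cast; omega)]
    · rw [if_neg hs, if_neg (by push_cast; omega), smul_zero]
  have hm1 : ∀ s : ℕ, taylor s (diagXZ (dX F))
      = if s + 1 = 2 * P + 2 then (((P : ℂ) + 1) * κ) • (fun n e => c n e v : Ser1 M) else 0 := by
    intro s
    rw [m1, taylor_smul, taylor_zw_pow _ hone, taylor_one_comp]
    by_cases hs : s + 1 = 2 * P + 2
    · rw [if_pos hs, if_pos (by push_cast; omega)]
    · rw [if_neg hs, if_neg (by push_cast; omega), smul_zero]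
  have main : A m n - B m n = (if m + n = 0 then κ * m else 0 : ℂ) • (fun n e => c n e v : Ser1 M) := by
    rcases lt_or_ge (2 * (P : ℤ) + 2) L with hbig | hsmall
    · -- all coefficients of this total degree vanish
      rw [if_neg (by omega), zero_smul]
      have hΦ : ∀ i, Φ i = 0 := by
        intro i
        simp only [Φ, G]
        rcases lt_or_ge ((P : ℤ) - i) 0 with hd | hd
        · rw [taylor_of_neg hd]
        · have : taylorIn ((P : ℤ) - (L - 2 - i)) F = 0 := by
            funext m k; exact taylor_of_neg (by omega) _
          rw [this, taylor_map_zero]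
      have := sub_eq_of_second_diff (a := fun i => A i (L - i)) (b := fun i => B i (L - i)) (F := Φ)
        (L := L - P - 2) (U := max (P + 1) (L - P - 2)) (by omega) hA hB hA0
        (fun i hi => hB0 i (by omega)) m
      simp only [hΦ, smul_zero, Finset.sum_const_zero, sub_zero] at this
      rwa [show L - m = n by omega] at this
    -- Here `s` is the total degree of the Taylor coefficients on this antidiagonal; the critical
    -- value `2P + 2` occurs exactly for `L = 0`, that is for `m + n = 0`.
    · obtain ⟨s, hs⟩ := Int.eq_ofNat_of_zero_le (show 0 ≤ 2 * (P : ℤ) + 2 - L by omega)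
      have := sub_eq_of_second_diff (a := fun i => A i (L - i)) (b := fun i => B i (L - i)) (F := Φ)
        (L := L - P - 2) (U := P + 1) (by omega) hA hB hA0 hB0 m
      rw [show L - m = n by omega] at this
      rw [this]
      have hIco : Finset.Ico (L - P - 2) ((P : ℤ) + 1) = Finset.Ico ((P : ℤ) + 1 - 1 - s) ((P : ℤ) + 1) := by
        congr 1; omega
      have s0 : ∑ i ∈ Finset.Ico (L - P - 2) ((P : ℤ) + 1), Φ i = taylor s (diagXZ F) := by
        rw [← sum_taylor_taylorIn hF, hIco,
          ← sum_Ico_reflect ((P : ℤ) + 1) s (fun d => taylor d (taylorIn ((s : ℤ) - d) F))]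
        refine Finset.sum_congr rfl fun i _ => ?_
        simp only [Φ, G]
        rw [show (P : ℤ) + 1 - 1 - i = P - i by ring,
          show (s : ℤ) - (P - i) = P - (L - 2 - i) by omega]
      have s1 : ∑ i ∈ Finset.Ico (L - P - 2) ((P : ℤ) + 1), (i : ℂ) • Φ i
          = (P : ℂ) • taylor s (diagXZ F)
            - ∑ d ∈ Finset.range (s + 1), (d : ℂ) • taylor (d : ℤ) (taylorIn ((s : ℤ) - d) F) := by
        rw [← s0, Finset.smul_sum]
        have h2 := sum_Ico_reflect ((P : ℤ) + 1) s
          (fun d => (d : ℂ) • taylor d (taylorIn ((s : ℤ) - d) F))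
        simp only [Int.cast_natCast] at h2
        rw [← h2, ← hIco, ← Finset.sum_sub_distrib]
        refine Finset.sum_congr rfl fun i _ => ?_
        have h3 : Φ i = taylor ((P : ℤ) + 1 - 1 - i) (taylorIn ((s : ℤ) - ((P : ℤ) + 1 - 1 - i)) F) := by
          simp only [Φ, G]
          rw [show (P : ℤ) + 1 - 1 - i = P - i by ring,
            show (s : ℤ) - (P - i) = P - (L - 2 - i) by omega]
        rw [← h3, ← sub_smul]
        congr 1
        push_cast
        ring
      rw [s1, s0]
      rcases s with _ | s
      · have h3 := hm0 0
        rw [if_neg (by omega)] at h3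
        rw [h3, if_neg (by omega)]
        simp
      · have h3 := hm0 (s + 1)
        have h4 := sum_smul_taylor_taylorIn hF s
        rw [hm1] at h4
        have h5 : ∑ d ∈ Finset.range (s + 1 + 1),
            (d : ℂ) • taylor (d : ℤ) (taylorIn (((s + 1 : ℕ) : ℤ) - d) F)
            = if s + 1 = 2 * P + 2 then (((P : ℂ) + 1) * κ) • (fun n e => c n e v : Ser1 M) else 0 := by
          rw [← h4]
          push_cast
          rfl
        rw [h3, h5]
        -- In the critical degree the moments combine to `(m - 1)κ - (Pκ - (P + 1)κ) = mκ`.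
        by_cases hc : s + 1 = 2 * P + 2
        · rw [if_pos hc, if_pos hc, if_pos (by omega)]
          module
        · rw [if_neg hc, if_neg hc, if_neg (by omega)]
          simp
  exact congrFun (congrFun main o) e

end Commutator
end SymplecticFermions
end

set_option linter.unusedSectionVars false
noncomputable section
namespace SymplecticFermions

/-! ### Conjugation of fields -/

section Intertwine

variable {M : Type*} [AddCommGroup M] [Module ℂ M]

/-- The operator `g` intertwines the fields `a` and `a'`. -/
def Intertwines (g : Module.End ℂ M) (a a' : FormalField M) : Prop :=
  ∀ n k v, a' n k (g v) = g (a n k v)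

theorem Intertwines.comp {g : Module.End ℂ M} {a a' b b' : FormalField M} (ha : Intertwines g a a')
    (hb : Intertwines g b b') (v : M) :
    comp a' b' (g v) = fun m k n l => g (comp a b v m k n l) := by
  funext m k n l
  simp only [SymplecticFermions.comp, hb _ _ _, ha _ _ _]

theorem Intertwines.good {g : Module.End ℂ M} (hg : Function.Surjective g) {a a' b b' : FormalField M}
    (ha : Intertwines g a a') (hb : Intertwines g b b') {N : ℕ} (h : Good N a b) : Good N a' b' := by
  intro v
  obtain ⟨v, rfl⟩ := hg v
  rw [ha.comp hb, zw_pow_map]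
  exact (h v).map g

/-- The coefficients of a product on a vector are finite linear expressions in compositions of
modes, which `g` carries along; surjectivity is used to verify on every vector that the target
product exists. -/
theorem Intertwines.nprod {g : Module.End ℂ M} (hg : Function.Surjective g)
    {a a' b b' : FormalField M}
    (ha : Intertwines g a a') (hb : Intertwines g b b') {N : ℕ} (h : Good N a b) (j : ℤ) :
    Intertwines g (nprod j a b) (nprod j a' b') := by
  intro n e v
  rw [nprod_apply h, nprod_apply (ha.good hg hb h), ha.comp hb, zw_pow_map, taylor_map _ (h v)]

theorem Intertwines.eq_of_surjective {g : Module.End ℂ M} (hg : Function.Surjective g)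
    {a a' a'' : FormalField M} (h : Intertwines g a a') (h' : Intertwines g a a'') : a' = a'' := by
  funext n k
  refine LinearMap.ext fun v => ?_
  obtain ⟨v, rfl⟩ := hg v
  rw [h, h']

theorem intertwines_one (g : Module.End ℂ M) : Intertwines g (oneField M) (oneField M) :=
  fun n k v => by
    simp only [oneField_apply]
    split_ifs <;> simp

/-- Conjugation of a field with an involution. -/
def conj (π : Module.End ℂ M) : Module.End ℂ (FormalField M) where
  toFun b := fun n k => π * b n k * π
  map_add' b c := by funext n k; simp [mul_add, add_mul]
  map_smul' c b := by funext n k; simp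

theorem conj_apply (π : Module.End ℂ M) (b : FormalField M) (n : ℂ) (k : ℕ) (v : M) :
    conj π b n k v = π (b n k (π v)) := rfl

variable {π : Module.End ℂ M}

theorem involutive_of_sq (hπ : π * π = 1) (v : M) : π (π v) = v :=
  congrArg (fun f : Module.End ℂ M => f v) hπ

theorem surjective_of_sq (hπ : π * π = 1) : Function.Surjective π :=
  fun v => ⟨π v, involutive_of_sq hπ v⟩

theorem intertwines_conj (hπ : π * π = 1) (b : FormalField M) : Intertwines π b (conj π b) :=
  fun n k v => by rw [conj_apply, involutive_of_sq hπ]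

theorem conj_conj (hπ : π * π = 1) (b : FormalField M) : conj π (conj π b) = b := by
  funext n k
  refine LinearMap.ext fun v => ?_
  simp only [conj_apply, involutive_of_sq hπ]

theorem conj_nprod (hπ : π * π = 1) {N : ℕ} {a b : FormalField M} (h : Good N a b) (j : ℤ) :
    conj π (nprod j a b) = nprod j (conj π a) (conj π b) :=
  (intertwines_conj hπ _).eq_of_surjective (surjective_of_sq hπ)
    ((intertwines_conj hπ a).nprod (surjective_of_sq hπ) (intertwines_conj hπ b) h j)

theorem Good.conj (hπ : π * π = 1) {N : ℕ} {a b : FormalField M} (h : Good N a b) :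
    Good N (conj π a) (conj π b) :=
  (intertwines_conj hπ a).good (surjective_of_sq hπ) (intertwines_conj hπ b) h

theorem conj_oneField (hπ : π * π = 1) : conj π (oneField M) = oneField M :=
  (intertwines_conj hπ _).eq_of_surjective (surjective_of_sq hπ) (intertwines_one π)

theorem IsLogField.conj {b : FormalField M} (hb : IsLogField b) : IsLogField (conj π b) := by
  obtain ⟨S, hS⟩ := hb
  refine ⟨S, fun v => ?_⟩
  obtain ⟨N, K, h⟩ := hS (π v)
  exact ⟨N, K, fun n k h0 => h n k fun h1 => h0 (by rw [conj_apply, h1, map_zero])⟩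

theorem hasParity_iff (hπ : π * π = 1) {p : ℕ} {a : FormalField M} :
    HasParity π p a ↔ SymplecticFermions.conj π a = (-1 : ℂ) ^ p • a := by
  constructor
  · intro h
    funext n k
    change π * a n k * π = _
    rw [h, smul_mul_assoc, mul_assoc, hπ, mul_one]
    rfl
  · intro h n k
    have h1 : π * a n k * π = (-1 : ℂ) ^ p • a n k := congrFun (congrFun h n) k
    rw [← smul_mul_assoc, ← h1, mul_assoc, hπ, mul_one]

theorem Loc.conj (hπ : π * π = 1) {N : ℕ} {a b b' a' : FormalField M} (h : Loc N a b b' a') :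
    Loc N (conj π a) (conj π b) (conj π b') (conj π a') := by
  intro v
  obtain ⟨v, rfl⟩ := surjective_of_sq hπ v
  rw [(intertwines_conj hπ a).comp (intertwines_conj hπ b), zw_pow_map, h v, ← zw_pow_map]
  congr 1
  funext m k n l
  simp only [compOp, conj_apply, involutive_of_sq hπ]

theorem Loc.add_right {N N' : ℕ} {a b c b' c' a' : FormalField M} (h : Loc N a b b' a')
    (h' : Loc N' a c c' a') : Loc (max N N') a (b + c) (b' + c') a' := fun v => by
  rw [comp_add_right, map_add, h.mono (le_max_left N N') v, h'.mono (le_max_right N N') v, ← map_add]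
  rfl

theorem Loc.smul_right {N : ℕ} {a b b' a' : FormalField M} (c : ℂ) (h : Loc N a b b' a') :
    Loc N a (c • b) (c • b') a' := fun v => by
  rw [comp_smul_right, map_smul, h v, ← map_smul]
  rfl

theorem zw_pow_swap (N : ℕ) (f : Ser2 M) :
    (zw ^ N) (fun m k n l => f n l m k) = fun m k n l => (-1 : ℂ) ^ N • (zw ^ N) f n l m k := by
  induction N with
  | zero => simp
  | succ N ih =>
    funext m k n l
    rw [pow_succ', Module.End.mul_apply, Module.End.mul_apply, ih, zw_apply, zw_apply, pow_succ']
    module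

/-- Locality read in the opposite direction. -/
theorem Loc.flip {N : ℕ} {a b b' a' : FormalField M} (h : Loc N a b b' a') : Loc N b' a' a b := by
  intro v
  have h1 : comp b' a' v = fun m k n l => compOp a' b' v n l m k := rfl
  have h2 : compOp b a v = fun m k n l => comp a b v n l m k := rfl
  rw [h1, h2, zw_pow_swap, zw_pow_swap N (comp a b v), h v]

theorem Loc.add_left {N N' : ℕ} {a a₁ b b' a' a₁' : FormalField M} (h : Loc N a b b' a')
    (h' : Loc N' a₁ b b' a₁') : Loc (max N N') (a + a₁) b b' (a' + a₁') :=
  (h.flip.add_right h'.flip).flip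

theorem Loc.smul_left {N : ℕ} {a b b' a' : FormalField M} (c : ℂ) (h : Loc N a b b' a') :
    Loc N (c • a) b b' (c • a') := (h.flip.smul_right c).flip

theorem loc_one (a : FormalField M) : Loc 0 a (oneField M) (oneField M) a := by
  intro v
  simp only [pow_zero, Module.End.one_apply]
  funext m k n l
  simp only [comp, compOp, oneField_apply]
  split_ifs <;> simp

end Intertwine

/-! ### The Fock space -/

/-- The generators `ψ_k` and `ψ̄_k` of the untwisted mode algebra. -/
def gen (i : Fin 2) (k : ℤ) : ModeAlgebra 0 0 := if i = 0 then psi 0 0 k else psibar 0 0 k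

/-- The pairing between `ψ` and `ψ̄`. -/
def pairing (i j : Fin 2) : ℂ := if i = j then 0 else if i = 0 then 1 else -1

/-- The vacuum vector. -/
def vac : Fock := Submodule.Quotient.mk (p := vacuumIdeal) 1

theorem gen_anticomm (i j : Fin 2) (k l : ℤ) :
    gen i k * gen j l + gen j l * gen i k
      = algebraMap ℂ _ (if k + l = 0 then pairing i j * k else 0) := by
  have hc : ∀ k l : ℤ, ((0 : ℂ) + k = -(-0 + l)) ↔ k + l = 0 := by
    intro k l
    rw [zero_add, neg_zero, zero_add, eq_neg_iff_add_eq_zero]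
    exact_mod_cast Iff.rfl
  fin_cases i <;> fin_cases j <;> simp only [gen, pairing, Fin.zero_eta, Fin.mk_one, Fin.isValue,
    ↓reduceIte, one_ne_zero, zero_ne_one, zero_mul, ite_self, map_zero]
  · rw [psi_psi]; simp
  · rw [psi_psibar]
    congr 1
    simp only [hc, one_mul]
    rw [zero_add]
  · rw [add_comm, psi_psibar]
    congr 1
    simp only [hc]
    rw [zero_add, add_comm l k]
    split_ifs with h
    · have : (l : ℂ) = -k := by
        rw [eq_neg_iff_add_eq_zero, add_comm]; exact_mod_cast h
      rw [this]; ring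
    · rfl
  · exact psibar_psibar 0 0 k l

theorem gen_vac (i : Fin 2) {k : ℤ} (hk : 0 ≤ k) : gen i k • vac = 0 := by
  have h : gen i k ∈ vacuumIdeal := by
    refine Ideal.subset_span ⟨k, hk, ?_⟩
    fin_cases i <;> simp [gen]
  have h1 : gen i k • vac = Submodule.Quotient.mk (p := vacuumIdeal) (gen i k • 1) := rfl
  rw [h1, smul_eq_mul, mul_one]
  exact (Submodule.Quotient.mk_eq_zero _).mpr h

theorem mkMode_surjective (r t : ℂ) : Function.Surjective (mkMode r t) :=
  RingQuot.mkAlgHom_surjective ℂ _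

theorem smul_mem_of_gen (S : Submodule ℂ Fock) (hS : ∀ i k, ∀ u ∈ S, gen i k • u ∈ S)
    (a : ModeAlgebra 0 0) : ∀ u ∈ S, a • u ∈ S := by
  obtain ⟨a, rfl⟩ := mkMode_surjective 0 0 a
  induction a using FreeAlgebra.induction with
  | grade0 c =>
    intro u hu
    rw [AlgHom.commutes, algebraMap_smul]
    exact S.smul_mem c hu
  | grade1 x =>
    intro u hu
    cases x with
    | psi k => exact hS 0 k u hu
    | psibar k => exact hS 1 k u hu
  | mul a b ha hb =>
    intro u hu
    rw [map_mul, mul_smul]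
    exact ha _ (hb _ hu)
  | add a b ha hb =>
    intro u hu
    rw [map_add, add_smul]
    exact S.add_mem (ha _ hu) (hb _ hu)

theorem exists_smul_vac (u : Fock) : ∃ a : ModeAlgebra 0 0, u = a • vac := by
  obtain ⟨a, ha⟩ := Submodule.Quotient.mk_surjective (p := vacuumIdeal) u
  refine ⟨a, ?_⟩
  have h1 : a • vac = Submodule.Quotient.mk (p := vacuumIdeal) (a • 1) := rfl
  rw [h1, smul_eq_mul, mul_one]
  exact ha.symm

/-- All states arise from the vacuum by generators. Statements about generated fields are proved by
this induction on states, which avoids any induction on words in products of fields. -/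
theorem Fock.induction {p : Fock → Prop} (h_vac : p vac) (h_add : ∀ u w, p u → p w → p (u + w))
    (h_smul : ∀ (c : ℂ) u, p u → p (c • u)) (h_gen : ∀ i k u, p u → p (gen i k • u)) (u : Fock) :
    p u := by
  let S : Submodule ℂ Fock :=
    { carrier := {u | p u}
      zero_mem' := by simpa using h_smul 0 vac h_vac
      add_mem' := fun {u w} hu hw => h_add u w hu hw
      smul_mem' := fun c u hu => h_smul c u hu }
  obtain ⟨a, rfl⟩ := exists_smul_vac u
  exact smul_mem_of_gen S (fun i k u hu => h_gen i k u hu) a vac h_vac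

theorem fockAut_vac (g : Matrix.SpecialLinearGroup (Fin 2) ℂ) : fockAut g vac = vac := by
  have h : fockAut g vac = Submodule.Quotient.mk (p := vacuumIdeal) (modeAut g 1) := rfl
  rw [h, map_one]
  rfl

theorem fockAut_smul (g : Matrix.SpecialLinearGroup (Fin 2) ℂ) (a : ModeAlgebra 0 0) (u : Fock) :
    fockAut g (a • u) = modeAut g a • fockAut g u := by
  obtain ⟨b, rfl⟩ := Submodule.Quotient.mk_surjective (p := vacuumIdeal) u
  have h : fockAut g (a • Submodule.Quotient.mk (p := vacuumIdeal) b)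
    = Submodule.Quotient.mk (p := vacuumIdeal) (modeAut g (a * b)) := rfl
  refine h.trans ?_
  rw [map_mul]
  rfl

theorem modeAut_gen (g : Matrix.SpecialLinearGroup (Fin 2) ℂ) (i : Fin 2) (k : ℤ) :
    modeAut g (gen i k) = ∑ j, g j i • gen j k := by
  fin_cases i <;> simp [gen, modeAut_psi, modeAut_psibar]

theorem fockAut_gen_smul (g : Matrix.SpecialLinearGroup (Fin 2) ℂ) (i : Fin 2) (k : ℤ) (u : Fock) :
    fockAut g (gen i k • u) = ∑ j, g j i • gen j k • fockAut g u := by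
  rw [fockAut_smul, modeAut_gen, Finset.sum_smul]
  simp only [smul_assoc]

theorem gen_smul_smul (i : Fin 2) (k : ℤ) (c : ℂ) (u : Fock) :
    gen i k • c • u = c • gen i k • u := by
  have := (fockAction (gen i k)).map_smul c u
  exact this

theorem fockAut_mul (g h : Matrix.SpecialLinearGroup (Fin 2) ℂ) : fockAut (g * h) = fockAut g * fockAut h := by
  refine LinearMap.ext fun u => ?_
  rw [Module.End.mul_apply]
  induction u using Fock.induction with
  | h_vac => simp only [fockAut_vac]
  | h_add u w hu hw => simp only [map_add, hu, hw]
  | h_smul c u hu => simp only [map_smul, hu]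
  | h_gen i k u hu =>
    simp only [fockAut_gen_smul, hu, Fin.sum_univ_two, map_add, map_smul,
      Matrix.SpecialLinearGroup.coe_mul, Matrix.mul_apply, smul_add, add_smul, smul_smul]
    generalize gen 0 k • fockAut g (fockAut h u) = x
    generalize gen 1 k • fockAut g (fockAut h u) = y
    module

theorem fockAut_one : fockAut 1 = 1 := by
  refine LinearMap.ext fun u => ?_
  rw [Module.End.one_apply]
  induction u using Fock.induction with
  | h_vac => simp only [fockAut_vac]
  | h_add u w hu hw => simp only [map_add, hu, hw]
  | h_smul c u hu => simp only [map_smul, hu]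
  | h_gen i k u hu =>
    rw [fockAut_gen_smul, hu, Fin.sum_univ_two]
    fin_cases i <;> simp [Matrix.SpecialLinearGroup.coe_one]

theorem fockParity_sq : fockParity * fockParity = 1 := by
  rw [fockParity, ← fockAut_mul, neg_mul_neg, one_mul, fockAut_one]

theorem fockParity_vac : fockParity vac = vac := fockAut_vac _

theorem fockParity_gen (i : Fin 2) (k : ℤ) (u : Fock) :
    fockParity (gen i k • u) = -(gen i k • fockParity u) := by
  rw [fockParity, fockAut_gen_smul, Fin.sum_univ_two]
  fin_cases i <;> simp [Matrix.SpecialLinearGroup.coe_neg]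

end SymplecticFermions
end

set_option linter.unusedSectionVars false
noncomputable section
namespace SymplecticFermions

/-! ### The space of fields generated by a pair of free fields -/

section FreePair

variable {M : Type*} [AddCommGroup M] [Module ℂ M]

/-- A pair of odd logarithmic fields on `M` with the operator products of symplectic fermions. -/
structure FreePair (π : Module.End ℂ M) (X : Fin 2 → FormalField M) : Prop where
  sq : π * π = 1
  isLog : ∀ i, IsLogField (X i)
  odd : ∀ i, conj π (X i) = -X i
  loc : ∀ i j, Loc 2 (X i) (X j) (-X j) (X i)
  prod_one : ∀ i j, nprod 1 (X i) (X j) = pairing i j • oneField M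
  prod_zero : ∀ i j, nprod 0 (X i) (X j) = 0

/-- The logarithmic fields that are local with respect to the fields `X i`. -/
def localFields (π : Module.End ℂ M) (X : Fin 2 → FormalField M) : Submodule ℂ (FormalField M) where
  carrier := {b | IsLogField b ∧ ∀ i, ∃ N, Loc N (X i) b (conj π b) (X i)}
  zero_mem' := ⟨isLogField_zero, fun i => ⟨0, fun v => by
    rw [map_zero]
    congr 1
    funext m k n l
    simp [comp, compOp]⟩⟩
  add_mem' := by
    rintro b c ⟨hb, hb'⟩ ⟨hc, hc'⟩
    refine ⟨hb.add hc, fun i => ?_⟩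
    obtain ⟨N, h⟩ := hb' i
    obtain ⟨N', h'⟩ := hc' i
    rw [map_add]
    exact ⟨_, h.add_right h'⟩
  smul_mem' := by
    rintro c b ⟨hb, hb'⟩
    refine ⟨hb.smul c, fun i => ?_⟩
    obtain ⟨N, h⟩ := hb' i
    rw [map_smul]
    exact ⟨_, h.smul_right c⟩

variable {π : Module.End ℂ M} {X : Fin 2 → FormalField M}

theorem FreePair.one_mem (h : FreePair π X) : oneField M ∈ localFields π X :=
  ⟨isLogField_one, fun i => ⟨0, by rw [conj_oneField h.sq]; exact loc_one _⟩⟩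

theorem FreePair.good (h : FreePair π X) {b : FormalField M} (hb : b ∈ localFields π X) (i : Fin 2) :
    ∃ N, Good N (X i) b := by
  obtain ⟨N, hN⟩ := hb.2 i
  exact ⟨N, hN.good hb.1 (h.isLog i)⟩

/-- This is Dong's lemma with signs: moving a generator past `x_(j) b` changes the sign of the odd
field `x` and conjugates `b`, which is conjugation of the product. -/
theorem FreePair.nprod_mem (h : FreePair π X) {b : FormalField M} (hb : b ∈ localFields π X)
    (i : Fin 2) (j : ℤ) : nprod j (X i) b ∈ localFields π X := by
  obtain ⟨N, hN⟩ := hb.2 i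
  have hg := hN.good hb.1 (h.isLog i)
  refine ⟨hN.isLogField_nprod hb.1 (h.isLog i) j, fun i' => ?_⟩
  obtain ⟨N', hN'⟩ := hb.2 i'
  have hg' := hg.conj h.sq
  rw [h.odd] at hg'
  rw [conj_nprod h.sq hg, h.odd]
  let K := max 2 (max N N')
  exact ((h.loc i' i).mono (le_max_left 2 _ : 2 ≤ K)).nprod
    (hN'.mono ((le_max_right N N').trans (le_max_right _ _) : N' ≤ K))
    (hg.mono ((le_max_left N N').trans (le_max_right _ _) : N ≤ K))
    (hg'.mono ((le_max_left N N').trans (le_max_right _ _) : N ≤ K)) j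

/-- The product with a generator as an operator on local fields. -/
def FreePair.op (h : FreePair π X) (i : Fin 2) (j : ℤ) : Module.End ℂ (localFields π X) where
  toFun b := ⟨nprod j (X i) b, h.nprod_mem b.2 i j⟩
  map_add' b c := by
    obtain ⟨N, hN⟩ := h.good b.2 i
    obtain ⟨N', hN'⟩ := h.good c.2 i
    exact Subtype.ext (nprod_add_right hN hN' j)
  map_smul' c b := by
    obtain ⟨N, hN⟩ := h.good b.2 i
    exact Subtype.ext (nprod_smul_right hN c j)

theorem nprod_neg_left {N : ℕ} {a b : FormalField M} (h : Good N a b) (j : ℤ) :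
    nprod j (-a) b = -nprod j a b := by
  have := nprod_smul_left h (-1) j
  simpa using this

/-- In `LocTriple.commutator` the second field is replaced by its negative when it is moved to the
left, since generators are odd; the commutator formula thus becomes an anticommutator. On a third,
arbitrary local field both generators induce the same conjugation. -/
theorem FreePair.op_anticomm (h : FreePair π X) (i i' : Fin 2) (m n : ℤ) :
    h.op i m * h.op i' n + h.op i' n * h.op i m
      = algebraMap ℂ _ (if m + n = 0 then pairing i i' * m else 0) := by
  refine LinearMap.ext fun b => Subtype.ext ?_
  obtain ⟨N, hN⟩ := b.2.2 i
  obtain ⟨N', hN'⟩ := b.2.2 i'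
  obtain ⟨K, hK⟩ := h.good (h.nprod_mem b.2 i m) i'
  let P := max N N'
  have hT : LocTriple 2 (P + 1) (X i) (X i') b.1 (-X i') (conj π b.1) (conj π b.1) :=
    { ab := h.loc i i'
      ac := hN.mono ((le_max_left N N').trans (Nat.le_succ _))
      bc := hN'.mono ((le_max_right N N').trans (Nat.le_succ _))
      log_a := h.isLog i
      log_b := h.isLog i'
      log_c := b.2.1
      good_a := fun n => h.good (h.nprod_mem b.2 i' n) i
      good_b := fun m => by
        obtain ⟨K, hK⟩ := h.good (h.nprod_mem b.2 i m) i'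
        exact ⟨K, by simpa using hK.smul_left (-1)⟩ }
  have := hT.commutator (h.prod_one i i') (h.prod_zero i i') m n
  rw [nprod_neg_left hK, sub_neg_eq_add] at this
  exact this

/-- The untwisted mode algebra acts on local fields by the products with the generators. -/
def FreePair.action (h : FreePair π X) : ModeAlgebra 0 0 →ₐ[ℂ] Module.End ℂ (localFields π X) :=
  RingQuot.liftAlgHom ℂ (s := ModeRel 0 0)
    ⟨FreeAlgebra.lift ℂ fun x => match x with
      | Gen.psi k => h.op 0 k
      | Gen.psibar k => h.op 1 k, by
      have hc : ∀ k l : ℤ, ((0 : ℂ) + k = -(-0 + l)) ↔ k + l = 0 := by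
        intro k l
        rw [zero_add, neg_zero, zero_add, eq_neg_iff_add_eq_zero]
        exact_mod_cast Iff.rfl
      intro x y hxy
      cases hxy with
      | psi_psi k l =>
        simp only [map_add, map_mul, FreeAlgebra.lift_ι_apply, AlgHom.commutes]
        rw [h.op_anticomm]
        simp [pairing]
      | psi_psibar k l =>
        simp only [map_add, map_mul, FreeAlgebra.lift_ι_apply, AlgHom.commutes]
        rw [h.op_anticomm]
        simp only [hc]
        simp [pairing]
      | psibar_psibar k l =>
        simp only [map_add, map_mul, FreeAlgebra.lift_ι_apply, map_zero]
        rw [h.op_anticomm]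
        simp [pairing]⟩

theorem FreePair.action_gen (h : FreePair π X) (i : Fin 2) (k : ℤ) : h.action (gen i k) = h.op i k := by
  have key : ∀ x : FreeAlgebra ℂ Gen, h.action (mkMode 0 0 x) = FreeAlgebra.lift ℂ (fun x => match x with
      | Gen.psi k => h.op 0 k
      | Gen.psibar k => h.op 1 k) x := fun x => RingQuot.liftAlgHom_mkAlgHom_apply ℂ _ _ x
  fin_cases i
  · exact (key _).trans (FreeAlgebra.lift_ι_apply _ _)
  · exact (key _).trans (FreeAlgebra.lift_ι_apply _ _)

/-- The identity field as a local field. -/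
def FreePair.one (h : FreePair π X) : localFields π X := ⟨oneField M, h.one_mem⟩

/-- The identity field has no nonnegative products, as a vacuum should. Therefore the action on it
factors through the Fock space. -/
theorem FreePair.action_vacuumIdeal (h : FreePair π X) {a : ModeAlgebra 0 0} (ha : a ∈ vacuumIdeal) :
    h.action a h.one = 0 := by
  induction ha using Submodule.span_induction with
  | mem x hx =>
    obtain ⟨k, hk, hx⟩ := hx
    have key : ∀ i, h.action (gen i k) h.one = 0 := fun i => by
      rw [h.action_gen]
      exact Subtype.ext (nprod_one_nonneg _ hk)
    rcases hx with rfl | rfl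
    · exact key 0
    · exact key 1
  | zero => simp
  | add x y _ _ hx hy => rw [map_add, LinearMap.add_apply, hx, hy, add_zero]
  | smul b x _ hx => rw [smul_eq_mul, map_mul, Module.End.mul_apply, hx, map_zero]

/-- The state-field correspondence for the fields generated by a free pair. -/
def FreePair.fields (h : FreePair π X) : Fock →ₗ[ℂ] FormalField M :=
  (localFields π X).subtype ∘ₗ Submodule.liftQ (vacuumIdeal.restrictScalars ℂ)
    ((LinearMap.applyₗ h.one) ∘ₗ h.action.toLinearMap) (fun _ ha => h.action_vacuumIdeal ha)

theorem FreePair.fields_mem (h : FreePair π X) (u : Fock) : h.fields u ∈ localFields π X :=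
  Subtype.coe_prop _

theorem FreePair.fields_smul_vac (h : FreePair π X) (a : ModeAlgebra 0 0) :
    h.fields (a • vac) = (h.action a h.one).1 := by
  have h1 : a • vac = Submodule.Quotient.mk (p := vacuumIdeal) (a • 1) := rfl
  rw [h1, smul_eq_mul, mul_one]
  rfl

theorem FreePair.fields_vac (h : FreePair π X) : h.fields vac = oneField M := by
  have := h.fields_smul_vac 1
  rw [one_smul, map_one] at this
  exact this

theorem FreePair.fields_gen (h : FreePair π X) (i : Fin 2) (k : ℤ) (u : Fock) :
    h.fields (gen i k • u) = nprod k (X i) (h.fields u) := by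
  obtain ⟨a, rfl⟩ := exists_smul_vac u
  rw [smul_smul, h.fields_smul_vac, h.fields_smul_vac, map_mul, Module.End.mul_apply, h.action_gen]
  rfl

theorem FreePair.fields_gen_vac (h : FreePair π X) (i : Fin 2) : h.fields (gen i (-1) • vac) = X i := by
  rw [h.fields_gen, h.fields_vac, nprod_neg_one_one]

theorem FreePair.isLogField_fields (h : FreePair π X) (u : Fock) : IsLogField (h.fields u) :=
  (h.fields_mem u).1

theorem FreePair.fields_parity (h : FreePair π X) (u : Fock) :
    h.fields (fockParity u) = conj π (h.fields u) := by
  induction u using Fock.induction with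
  | h_vac => rw [fockParity_vac, h.fields_vac, conj_oneField h.sq]
  | h_add u w hu hw => simp only [map_add, hu, hw]
  | h_smul c u hu => simp only [map_smul, hu]
  | h_gen i k u hu =>
    obtain ⟨N, hN⟩ := h.good (h.fields_mem u) i
    obtain ⟨N', hN'⟩ := h.good (h.fields_mem (fockParity u)) i
    rw [fockParity_gen, map_neg, h.fields_gen, h.fields_gen, conj_nprod h.sq hN, h.odd, ← hu,
      nprod_neg_left hN']

/-- The component of parity `p`. -/
def parityPart (p : ℕ) : Module.End ℂ Fock := (1 / 2 : ℂ) • (1 + (-1 : ℂ) ^ p • fockParity)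

theorem parityPart_apply (p : ℕ) (u : Fock) :
    parityPart p u = (1 / 2 : ℂ) • (u + (-1 : ℂ) ^ p • fockParity u) := rfl

theorem parityPart_gen (p : ℕ) (i : Fin 2) (k : ℤ) (u : Fock) :
    parityPart p (gen i k • u) = gen i k • parityPart (p + 1) u := by
  rw [parityPart_apply, parityPart_apply, fockParity_gen, gen_smul_smul, smul_add (gen i k),
    gen_smul_smul, pow_succ]
  generalize gen i k • u = x
  generalize gen i k • fockParity u = y
  module

theorem parityPart_of_eq {p : ℕ} {u : Fock} (hu : fockParity u = (-1 : ℂ) ^ p • u) :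
    parityPart p u = u := by
  rw [parityPart_apply, hu, smul_smul, ← mul_pow, neg_one_mul, neg_neg, one_pow, one_smul, ← two_smul ℂ,
    smul_smul]
  norm_num

theorem fockParity_parityPart (p : ℕ) (u : Fock) :
    fockParity (parityPart p u) = (-1 : ℂ) ^ p • parityPart p u := by
  rw [parityPart_apply, map_smul, map_add, map_smul, involutive_of_sq fockParity_sq,
    smul_comm ((-1 : ℂ) ^ p), smul_add ((-1 : ℂ) ^ p), smul_smul ((-1 : ℂ) ^ p), ← mul_pow, neg_one_mul, neg_neg, one_pow, one_smul, add_comm]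

theorem parityPart_add (u : Fock) : parityPart 0 u + parityPart 1 u = u := by
  simp only [parityPart_apply]
  module

theorem conj_mem_localFields (h : FreePair π X) {b : FormalField M} (hb : b ∈ localFields π X) :
    conj π b ∈ localFields π X := by
  refine ⟨hb.1.conj, fun i => ?_⟩
  obtain ⟨N, hN⟩ := hb.2 i
  refine ⟨N, ?_⟩
  have h1 := hN.conj h.sq
  rw [h.odd] at h1
  have h2 := (h1.flip.smul_right (-1)).flip.smul_left 1
  simpa using h2

theorem conj_pow_mem_localFields (h : FreePair π X) {b : FormalField M} (hb : b ∈ localFields π X)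
    (p : ℕ) : (conj π ^ p) b ∈ localFields π X := by
  induction p with
  | zero => simpa using hb
  | succ p ih => rw [pow_succ', Module.End.mul_apply]; exact conj_mem_localFields h ih

/-- The fields generated by a free pair are local with respect to all local fields. -/
theorem FreePair.loc_fields_parityPart (h : FreePair π X) (u : Fock) (p : ℕ) {b : FormalField M}
    (hb : b ∈ localFields π X) :
    ∃ N, Loc N (h.fields (parityPart p u)) b ((conj π ^ p) b) (h.fields (parityPart p u)) := by
  have hsq : ∀ (p : ℕ) (b : FormalField M), (conj π ^ (p + 2)) b = (conj π ^ p) b := by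
    intro p b
    rw [pow_add, Module.End.mul_apply, pow_two, Module.End.mul_apply, conj_conj h.sq]
  induction u using Fock.induction generalizing p with
  -- The vacuum is even: its part of even parity is the identity field and its odd part is zero.
  | h_vac =>
    rw [parityPart_apply, fockParity_vac]
    obtain ⟨q, rfl | rfl⟩ := Nat.even_or_odd' p
    · refine ⟨0, ?_⟩
      have h1 : (conj π ^ (2 * q)) b = b := by
        rw [pow_mul, pow_two, show conj π * conj π = 1 from LinearMap.ext (conj_conj h.sq), one_pow]
        rfl
      rw [h1, pow_mul, neg_one_sq, one_pow, one_smul, ← two_smul ℂ, smul_smul]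
      norm_num
      rw [h.fields_vac]
      exact (loc_one b).flip
    · refine ⟨0, fun v => ?_⟩
      rw [pow_succ, pow_mul, neg_one_sq, one_pow, one_mul, neg_one_smul, add_neg_cancel, smul_zero,
        map_zero]
      congr 1
      funext m k n l
      simp [comp, compOp]
  | h_add u w hu hw =>
    obtain ⟨N, hN⟩ := hu p
    obtain ⟨N', hN'⟩ := hw p
    rw [map_add, map_add]
    exact ⟨_, hN.add_left hN'⟩
  | h_smul c u hu =>
    obtain ⟨N, hN⟩ := hu p
    rw [map_smul, map_smul]
    exact ⟨_, hN.smul_left c⟩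
  | h_gen i k u hu =>
    obtain ⟨N, hN⟩ := hu (p + 1)
    rw [parityPart_gen, h.fields_gen]
    -- The field `b` is conjugated `p + 1` times by the smaller state and once more by the
    -- generator, and conjugating twice has no effect.
    obtain ⟨N', hN'⟩ := (conj_pow_mem_localFields h hb (p + 1)).2 i
    rw [← Module.End.mul_apply, ← pow_succ', hsq] at hN'
    obtain ⟨N'', hN''⟩ := h.good (h.fields_mem (parityPart (p + 1) u)) i
    let K := max N (max N' N'')
    have hg := hN''.mono ((le_max_right N' N'').trans (le_max_right _ _) : N'' ≤ K)
    -- Dong's lemma moves a field past a product. As here a product is moved past a field, locality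
    -- is read in the opposite direction before and after its use.
    obtain ⟨L, hL⟩ := (hN'.flip.mono ((le_max_left N' N'').trans (le_max_right _ _) : N' ≤ K)).nprod
      (hN.flip.mono (le_max_left _ _ : N ≤ K)) hg hg k
    exact ⟨L, hL.flip⟩

theorem FreePair.loc_fields (h : FreePair π X) {p : ℕ} {u : Fock}
    (hu : fockParity u = (-1 : ℂ) ^ p • u) {b : FormalField M} (hb : b ∈ localFields π X) :
    ∃ N, Loc N (h.fields u) b ((conj π ^ p) b) (h.fields u) := by
  have := h.loc_fields_parityPart u p hb
  rwa [parityPart_of_eq hu] at this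

theorem FreePair.good_fields (h : FreePair π X) (u : Fock) {b : FormalField M}
    (hb : b ∈ localFields π X) : ∃ N, Good N (h.fields u) b := by
  have key : ∀ p, ∃ N, Good N (h.fields (parityPart p u)) b := fun p => by
    obtain ⟨N, hN⟩ := h.loc_fields_parityPart u p hb
    exact ⟨N, hN.good hb.1 (h.isLogField_fields _)⟩
  obtain ⟨N, hN⟩ := key 0
  obtain ⟨N', hN'⟩ := key 1
  refine ⟨max N N', ?_⟩
  rw [← parityPart_add u, map_add]
  exact (hN.mono (le_max_left _ _)).add_left (hN'.mono (le_max_right _ _))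

end FreePair

end SymplecticFermions
end

set_option linter.unusedSectionVars false
noncomputable section
namespace SymplecticFermions

/-! ### Closure of the generated fields under products -/

section Closure

variable {M : Type*} [AddCommGroup M] [Module ℂ M] {π : Module.End ℂ M} {X : Fin 2 → FormalField M}
variable {M' : Type*} [AddCommGroup M'] [Module ℂ M'] {π' : Module.End ℂ M'}
  {X' : Fin 2 → FormalField M'}

theorem nprod_zero_right (j : ℤ) (a : FormalField M) : nprod j a 0 = 0 := by
  have hg : Good 0 a 0 := fun v => by
    have : comp a 0 v = 0 := by funext m k n l; simp [comp]
    rw [this]; simpa using diagFinite_zero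
  simpa using nprod_smul_right hg 0 j

theorem delta_iterate_swap {E : Type*} [AddCommGroup E] (N : ℕ) (A : ℤ → ℤ → E) (m n : ℤ) :
    delta^[N] (fun m n => A n m) m n = (-1 : ℤ) ^ N • delta^[N] A n m := by
  induction N generalizing m n with
  | zero => simp
  | succ N ih =>
    rw [Function.iterate_succ_apply', Function.iterate_succ_apply']
    simp only [delta]
    rw [ih, ih, pow_succ]
    module

theorem delta_iterate_mem {E : Type*} [AddCommGroup E] (Γ : AddSubgroup E) (N : ℕ) (A : ℤ → ℤ → E)
    (h : ∀ m n, A m n ∈ Γ) (m n : ℤ) : delta^[N] A m n ∈ Γ := by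
  induction N generalizing m n with
  | zero => exact h m n
  | succ N ih =>
    rw [Function.iterate_succ_apply']
    exact Γ.sub_mem (ih _ _) (ih _ _)

/-- The derivative of a generated field is generated, and given by a universal expression. -/
theorem FreePair.exists_deriv (h : FreePair π X) (h' : FreePair π' X') (u : Fock) :
    ∃ x, deriv1 (h.fields u) = h.fields x ∧ deriv1 (h'.fields u) = h'.fields x := by
  induction u using Fock.induction with
  | h_vac => exact ⟨0, by simp [h.fields_vac, deriv1_oneField], by simp [h'.fields_vac, deriv1_oneField]⟩
  | h_add u w hu hw =>
    obtain ⟨x, hx, hx'⟩ := hu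
    obtain ⟨y, hy, hy'⟩ := hw
    exact ⟨x + y, by simp [hx, hy], by simp [hx', hy']⟩
  | h_smul c u hu =>
    obtain ⟨x, hx, hx'⟩ := hu
    exact ⟨c • x, by simp [hx], by simp [hx']⟩
  | h_gen i k u hu =>
    obtain ⟨x, hx, hx'⟩ := hu
    obtain ⟨N, hN⟩ := h.good (h.fields_mem u) i
    obtain ⟨N', hN'⟩ := h'.good (h'.fields_mem u) i
    refine ⟨(-(k : ℂ)) • gen i (k - 1) • u + gen i k • x, ?_, ?_⟩
    · rw [h.fields_gen, deriv1_nprod hN, map_add, map_smul, h.fields_gen, h.fields_gen, hx]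
    · rw [h'.fields_gen, deriv1_nprod hN', map_add, map_smul, h'.fields_gen, h'.fields_gen, hx']

/-- The derivative of the identity field is zero, so the derivation rule lowers the index. Together
with `nprod_neg_one_one` this gives all products with the identity on the right as iterated
derivatives. -/
theorem nprod_sub_one_one (a : FormalField M) {j : ℤ} (hj : j ≠ 0) :
    nprod (j - 1) a (oneField M) = (-(j : ℂ))⁻¹ • deriv1 (nprod j a (oneField M)) := by
  have := deriv1_nprod (good_one a) j
  rw [deriv1_oneField, nprod_zero_right, add_zero] at this
  rw [this, smul_smul, inv_mul_cancel₀ (by simpa using hj), one_smul]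

theorem FreePair.exists_nprod_one (h : FreePair π X) (h' : FreePair π' X') (u : Fock) (n : ℤ) :
    ∃ x, nprod n (h.fields u) (oneField M) = h.fields x ∧
      nprod n (h'.fields u) (oneField M') = h'.fields x := by
  rcases le_or_gt 0 n with hn | hn
  · exact ⟨0, by simp [nprod_one_nonneg _ hn], by simp [nprod_one_nonneg _ hn]⟩
  obtain ⟨k, rfl⟩ : ∃ k : ℕ, n = -1 - k := ⟨(-1 - n).toNat, by omega⟩
  induction k with
  | zero => exact ⟨u, by simp [nprod_neg_one_one], by simp [nprod_neg_one_one]⟩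
  | succ k ih =>
    obtain ⟨x, hx, hx'⟩ := ih (by omega)
    obtain ⟨y, hy, hy'⟩ := h.exists_deriv h' x
    have hk : (-1 - (k : ℤ)) ≠ 0 := by omega
    refine ⟨(-(((-1 - (k : ℤ) : ℤ)) : ℂ))⁻¹ • y, ?_, ?_⟩
    · rw [show (-1 - ((k + 1 : ℕ) : ℤ)) = (-1 - (k : ℤ)) - 1 by push_cast; ring,
        nprod_sub_one_one _ hk, hx, hy, map_smul]
    · rw [show (-1 - ((k + 1 : ℕ) : ℤ)) = (-1 - (k : ℤ)) - 1 by push_cast; ring,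
        nprod_sub_one_one _ hk, hx', hy', map_smul]

theorem FreePair.gen_mem (h : FreePair π X) (i : Fin 2) : X i ∈ localFields π X := by
  rw [← h.fields_gen_vac i]; exact h.fields_mem _

theorem FreePair.conj_pow_gen (h : FreePair π X) (p : ℕ) (i : Fin 2) :
    (conj π ^ p) (X i) = (-1 : ℂ) ^ p • X i := by
  induction p with
  | zero => simp
  | succ p ih => rw [pow_succ', Module.End.mul_apply, ih, map_smul, h.odd, pow_succ]; module

/-- The assumption that products of `u` and `w` are generated serves only to ensure that the
generator can be multiplied with them. In the induction for closure it is available from the smaller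
state. -/
theorem FreePair.locTriple (h : FreePair π X) {p : ℕ} {u w : Fock}
    (hu : fockParity u = (-1 : ℂ) ^ p • u) (i : Fin 2)
    (hw : ∀ m, ∃ x, nprod m (h.fields u) (h.fields w) = h.fields x) :
    ∃ K, ∀ N, K ≤ N → LocTriple N N (h.fields u) (X i) (h.fields w) ((-1 : ℂ) ^ p • X i)
      ((conj π ^ p) (h.fields w)) (conj π (h.fields w)) := by
  obtain ⟨N₁, h₁⟩ := h.loc_fields hu (h.gen_mem i)
  obtain ⟨N₂, h₂⟩ := h.loc_fields hu (h.fields_mem w)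
  obtain ⟨N₃, h₃⟩ := (h.fields_mem w).2 i
  rw [h.conj_pow_gen] at h₁
  refine ⟨max N₁ (max N₂ N₃), fun N hN => ?_⟩
  simp only [max_le_iff] at hN
  exact
    { ab := h₁.mono hN.1
      ac := h₂.mono hN.2.1
      bc := h₃.mono hN.2.2
      log_a := h.isLogField_fields u
      log_b := h.isLog i
      log_c := h.isLogField_fields w
      good_a := fun n => by
        rw [← h.fields_gen]
        exact h.good_fields u (h.fields_mem _)
      good_b := fun m => by
        obtain ⟨x, hx⟩ := hw m
        rw [hx]
        obtain ⟨K, hK⟩ := h.good (h.fields_mem x) i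
        exact ⟨K, hK.smul_left _⟩ }

/-- Induction on `w`. For `w = x_(k) w'`, weak commutativity (`LocTriple.delta_eq`) says that the
iterated differences of `u_(m)(x_(n) w')` agree with those of `± x_(n)(u_(m) w')`, which are
generated by the induction hypothesis. Since `x_(n) w'` vanishes for large `n`, the difference
equation can be solved downwards within the generated fields. Working with pairs of fields on `M`
and `M'` gives one state for both, which is what later makes `Y` compatible with products. -/
theorem FreePair.exists_nprod_of_parity (h : FreePair π X) (h' : FreePair π' X') {p : ℕ} {u : Fock}
    (hu : fockParity u = (-1 : ℂ) ^ p • u) (w : Fock) (n : ℤ) :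
    ∃ x, nprod n (h.fields u) (h.fields w) = h.fields x ∧
      nprod n (h'.fields u) (h'.fields w) = h'.fields x := by
  induction w using Fock.induction generalizing n with
  | h_vac => rw [h.fields_vac, h'.fields_vac]; exact h.exists_nprod_one h' u n
  | h_add w y hw hy =>
    obtain ⟨x₁, hx₁, hx₁'⟩ := hw n
    obtain ⟨x₂, hx₂, hx₂'⟩ := hy n
    obtain ⟨N₁, h₁⟩ := h.good_fields u (h.fields_mem w)
    obtain ⟨N₂, h₂⟩ := h.good_fields u (h.fields_mem y)
    obtain ⟨N₃, h₃⟩ := h'.good_fields u (h'.fields_mem w)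
    obtain ⟨N₄, h₄⟩ := h'.good_fields u (h'.fields_mem y)
    refine ⟨x₁ + x₂, ?_, ?_⟩
    · rw [map_add, map_add, nprod_add_right h₁ h₂, hx₁, hx₂]
    · rw [map_add, map_add, nprod_add_right h₃ h₄, hx₁', hx₂']
  | h_smul c w hw =>
    obtain ⟨x₁, hx₁, hx₁'⟩ := hw n
    obtain ⟨N₁, h₁⟩ := h.good_fields u (h.fields_mem w)
    obtain ⟨N₂, h₂⟩ := h'.good_fields u (h'.fields_mem w)
    refine ⟨c • x₁, ?_, ?_⟩
    · rw [map_smul, map_smul, nprod_smul_right h₁, hx₁]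
    · rw [map_smul, map_smul, nprod_smul_right h₂, hx₁']
  | h_gen i k w hw =>
    obtain ⟨K, hK⟩ := h.locTriple hu i (fun m => (hw m).imp fun _ hx => hx.1)
    obtain ⟨K', hK'⟩ := h'.locTriple hu i (fun m => (hw m).imp fun _ hx => hx.2)
    let N := max K K'
    have T := hK N (le_max_left _ _)
    have T' := hK' N (le_max_right _ _)
    -- The pairs of fields which belong to a common state.
    let Γ : AddSubgroup (FormalField M × FormalField M') :=
      (LinearMap.range (h.fields.prod h'.fields)).toAddSubgroup
    let A : ℤ → ℤ → FormalField M × FormalField M' := fun m n =>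
      (nprod m (h.fields u) (nprod n (X i) (h.fields w)),
        nprod m (h'.fields u) (nprod n (X' i) (h'.fields w)))
    let B : ℤ → ℤ → FormalField M × FormalField M' := fun m n =>
      (nprod n ((-1 : ℂ) ^ p • X i) (nprod m (h.fields u) (h.fields w)),
        nprod n ((-1 : ℂ) ^ p • X' i) (nprod m (h'.fields u) (h'.fields w)))
    have hB : ∀ m n, B m n ∈ Γ := by
      intro m n
      obtain ⟨x, hx, hx'⟩ := hw m
      obtain ⟨L, hL⟩ := h.good (h.fields_mem x) i
      obtain ⟨L', hL'⟩ := h'.good (h'.fields_mem x) i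
      refine ⟨(-1 : ℂ) ^ p • gen i n • x, Prod.ext ?_ ?_⟩
      · simp only [B, hx]
        rw [nprod_smul_left hL]
        change h.fields _ = _
        rw [ map_smul, h.fields_gen]
      · simp only [B, hx']
        rw [nprod_smul_left hL']
        change h'.fields _ = _
        rw [ map_smul, h'.fields_gen]
    have hAB : delta^[N] A = delta^[N] B := by
      have e1 := T.delta_eq
      have e2 := T'.delta_eq
      have f1 : ∀ C : ℤ → ℤ → FormalField M × FormalField M',
          delta^[N] (fun m n => (C m n).1) = fun m n => (delta^[N] C m n).1 := fun C =>
        delta_iterate_map (AddMonoidHom.fst _ _) N C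
      have f2 : ∀ C : ℤ → ℤ → FormalField M × FormalField M',
          delta^[N] (fun m n => (C m n).2) = fun m n => (delta^[N] C m n).2 := fun C =>
        delta_iterate_map (AddMonoidHom.snd _ _) N C
      funext m n
      refine Prod.ext ?_ ?_
      · exact (congrFun (congrFun (f1 A) m) n).symm.trans ((congrFun (congrFun e1 m) n).trans
          (congrFun (congrFun (f1 B) m) n))
      · exact (congrFun (congrFun (f2 A) m) n).symm.trans ((congrFun (congrFun e2 m) n).trans
          (congrFun (congrFun (f2 B) m) n))
    have hA : A n k ∈ Γ := by
      -- The indices are interchanged because the vanishing for large values holds in the inner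
      -- index, and the descent runs in the first one.
      refine mem_of_delta_iterate_mem Γ N (fun m n => A n m) N (fun m n => ?_) (fun m n hm => ?_) k n
      · rw [delta_iterate_swap, hAB]
        exact Γ.zsmul_mem (delta_iterate_mem Γ N B hB _ _) _
      · have e1 : A n m = 0 := by
          simp only [A]
          rw [nprod_eq_zero (T.bc.good T.log_c T.log_b) hm, nprod_eq_zero (T'.bc.good T'.log_c T'.log_b) hm,
            nprod_zero_right, nprod_zero_right]
          rfl
        rw [e1]
        exact Γ.zero_mem
    obtain ⟨x, hx⟩ := hA
    refine ⟨x, ?_, ?_⟩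
    · rw [h.fields_gen]; exact (congrArg Prod.fst hx).symm
    · rw [h'.fields_gen]; exact (congrArg Prod.snd hx).symm

/-- The products of generated fields are generated, and given by universal expressions. -/
theorem FreePair.exists_nprod (h : FreePair π X) (h' : FreePair π' X') (u w : Fock) (n : ℤ) :
    ∃ x, nprod n (h.fields u) (h.fields w) = h.fields x ∧
      nprod n (h'.fields u) (h'.fields w) = h'.fields x := by
  obtain ⟨x₁, hx₁, hx₁'⟩ := h.exists_nprod_of_parity h' (fockParity_parityPart 0 u) w n
  obtain ⟨x₂, hx₂, hx₂'⟩ := h.exists_nprod_of_parity h' (fockParity_parityPart 1 u) w n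
  obtain ⟨N₁, h₁⟩ := h.good_fields (parityPart 0 u) (h.fields_mem w)
  obtain ⟨N₂, h₂⟩ := h.good_fields (parityPart 1 u) (h.fields_mem w)
  obtain ⟨N₃, h₃⟩ := h'.good_fields (parityPart 0 u) (h'.fields_mem w)
  obtain ⟨N₄, h₄⟩ := h'.good_fields (parityPart 1 u) (h'.fields_mem w)
  refine ⟨x₁ + x₂, ?_, ?_⟩
  · rw [map_add, ← hx₁, ← hx₂, ← nprod_add_left h₁ h₂, ← map_add, parityPart_add]
  · rw [map_add, ← hx₁', ← hx₂', ← nprod_add_left h₃ h₄, ← map_add, parityPart_add]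

end Closure

/-! ### States of fields on the Fock space -/

section State

/-- The fields `ψ(z)` and `ψ̄(z)` on the Fock space. -/
def fockFields (i : Fin 2) : FormalField Fock := ofIntModes fun k => fockAction (gen i k)

theorem fockFields_zero : fockFields 0 = psiField := by
  simp [fockFields, psiField, gen]

theorem fockFields_one : fockFields 1 = psibarField := by
  simp [fockFields, psibarField, gen]

theorem fockFields_int (i : Fin 2) (j : ℤ) (u : Fock) : fockFields i j 0 u = gen i j • u := by
  have : ofIntModes (fun k => fockAction (gen i k)) j 0 = fockAction (gen i j) := by
    unfold ofIntModes
    rw [if_pos]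
    · simp
    · simp
  rw [fockFields, this]
  rfl

theorem fockFields_ne_zero {i : Fin 2} {n : ℂ} {k : ℕ} {u : Fock} (h : fockFields i n k u ≠ 0) :
    k = 0 ∧ ∃ j : ℤ, n = j := by
  rw [fockFields, ofIntModes] at h
  split_ifs at h with h1
  · exact ⟨h1.2, _, h1.1⟩
  · exact absurd rfl h

variable {M : Type*} [AddCommGroup M] [Module ℂ M]

/-- A power series in `z`. -/
def IsPow1 (f : Ser1 M) : Prop := ∀ n k, f n k ≠ 0 → k = 0 ∧ ∃ i : ℕ, n = -1 - i

/-- A power series in `z` and `w`. -/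
def IsPow2 (f : Ser2 M) : Prop :=
  ∀ m k n l, f m k n l ≠ 0 → k = 0 ∧ l = 0 ∧ (∃ i : ℕ, m = -1 - i) ∧ ∃ j : ℕ, n = -1 - j

theorem IsPow2.dZ {f : Ser2 M} (hf : IsPow2 f) : IsPow2 (dZ f) := by
  intro m k n l h
  rw [dZ_apply] at h
  have h0 : f (m - 1) (k + 1) n l = 0 := by
    by_contra h1
    exact Nat.succ_ne_zero k (hf _ _ _ _ h1).1
  rw [h0, smul_zero, add_zero] at h
  have h1 : f (m - 1) k n l ≠ 0 := fun h1 => h (by rw [h1, smul_zero])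
  obtain ⟨hk, hl, ⟨i, hi⟩, hj⟩ := hf _ _ _ _ h1
  refine ⟨hk, hl, ?_, hj⟩
  have hm : m = -(i : ℂ) := by linear_combination hi
  rcases Nat.eq_zero_or_pos i with rfl | hi0
  · exact absurd (by rw [hm]; simp) h
  · exact ⟨i - 1, by rw [hm]; push_cast [Nat.cast_sub hi0]; ring⟩

theorem IsPow2.dZ_pow {f : Ser2 M} (hf : IsPow2 f) (d : ℕ) : IsPow2 ((SymplecticFermions.dZ ^ d) f) := by
  induction d with
  | zero => simpa using hf
  | succ d ih => rw [pow_succ', Module.End.mul_apply]; exact ih.dZ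

theorem IsPow2.diag {f : Ser2 M} (hf : IsPow2 f) : IsPow1 (diag f) := by
  intro n e h
  obtain ⟨m, hm⟩ : ∃ m : ℂ, ∑ k ∈ Finset.range (e + 1), f m k (n - 1 - m) (e - k) ≠ 0 := by
    by_contra hc
    simp only [not_exists, not_not] at hc
    exact h (by simp only [SymplecticFermions.diag, hc, finsum_zero])
  obtain ⟨k, hk, hk0⟩ := Finset.exists_ne_zero_of_sum_ne_zero hm
  obtain ⟨h1, h2, ⟨i, hi⟩, j, hj⟩ := hf _ _ _ _ hk0
  simp only [Finset.mem_range] at hk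
  exact ⟨by omega, i + j, by push_cast; linear_combination hi + hj⟩

theorem IsPow2.diag_neg_one {f : Ser2 M} (hf : IsPow2 f) :
    SymplecticFermions.diag f (-1) 0 = f (-1) 0 (-1) 0 := by
  rw [SymplecticFermions.diag, finsum_eq_single _ (-1)]
  · norm_num
  · intro m hm
    rw [Finset.sum_range_one]
    by_contra h
    obtain ⟨-, -, ⟨i, hi⟩, j, hj⟩ := hf _ _ _ _ h
    have h0 : ((i + j : ℕ) : ℂ) = 0 := by push_cast; linear_combination hi + hj
    have h1 : i = 0 := by
      have : i + j = 0 := by exact_mod_cast h0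
      omega
    exact hm (by rw [hi, h1]; simp)

theorem IsPow2.dZ_pow_neg_one {f : Ser2 M} (hf : IsPow2 f) (d i : ℕ) :
    (SymplecticFermions.dZ ^ d) f (-1 - i) 0 (-1) 0
      = ((i + d).descFactorial d : ℂ) • f (-1 - i - d) 0 (-1) 0 := by
  induction d generalizing i with
  | zero => simp
  | succ d ih =>
    rw [pow_succ', Module.End.mul_apply, dZ_apply]
    have h0 : (SymplecticFermions.dZ ^ d) f (-1 - i - 1) (0 + 1) (-1) 0 = 0 := by
      by_contra h1
      exact Nat.succ_ne_zero 0 ((hf.dZ_pow d) _ _ _ _ h1).1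
    rw [h0, smul_zero, add_zero, show (-1 - (i : ℂ) - 1) = -1 - ((i + 1 : ℕ) : ℂ) by push_cast; ring,
      ih, smul_smul, show i + (d + 1) = i + 1 + d by ring, Nat.descFactorial_succ,
      show i + 1 + d - d = i + 1 by omega]
    push_cast
    rw [show (-1 - ((i : ℂ) + 1) - d) = -1 - i - (d + 1) by ring]
    congr 1
    ring

theorem IsPow2.taylor {f : Ser2 M} (hf : IsPow2 f) (d : ℤ) : IsPow1 (taylor d f) := by
  rcases lt_or_ge d 0 with hd | hd
  · rw [taylor_of_neg hd]
    intro n k h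
    exact absurd rfl h
  lift d to ℕ using hd
  rw [taylor_natCast]
  intro n k h
  exact (hf.dZ_pow d).diag n k fun h0 => h (by simp [h0])

theorem IsPow2.taylor_neg_one {f : Ser2 M} (hf : IsPow2 f) (d : ℕ) :
    SymplecticFermions.taylor d f (-1) 0 = f (-1 - d) 0 (-1) 0 := by
  rw [taylor_natCast, Pi.smul_apply, Pi.smul_apply, (hf.dZ_pow d).diag_neg_one]
  have := hf.dZ_pow_neg_one d 0
  simp only [Nat.cast_zero, sub_zero, zero_add, Nat.descFactorial_self] at this
  rw [this, smul_smul, inv_mul_cancel₀ (by exact_mod_cast d.factorial_ne_zero), one_smul]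

/-- The state of a field on the Fock space. -/
def state : FormalField Fock →ₗ[ℂ] Fock where
  toFun a := a (-1) 0 vac
  map_add' _ _ := rfl
  map_smul' _ _ := rfl

/-- On the vacuum, `a(z) b(w)` has only nonnegative powers of `w`, and the opposite order has only
nonnegative powers of `z`; locality combines both properties. -/
theorem isPow2_zw_pow_comp {a b b' : FormalField Fock} {N : ℕ}
    (ha0 : ∀ n k u, a n k u ≠ 0 → k = 0)
    (ha : IsPow1 fun n k => a n k vac) (hb : IsPow1 fun n k => b n k vac)
    (h : Loc N a b b' a) : IsPow2 ((zw ^ N) (comp a b vac)) := by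
  intro m k n l h0
  have h1 := h0
  rw [h vac] at h1
  rw [zw_pow_apply] at h0 h1
  obtain ⟨i, hi, h0⟩ := Finset.exists_ne_zero_of_sum_ne_zero h0
  obtain ⟨i', hi', h1⟩ := Finset.exists_ne_zero_of_sum_ne_zero h1
  replace h0 := right_ne_zero_of_smul h0
  replace h1 := right_ne_zero_of_smul h1
  simp only [comp, compOp] at h0 h1
  have h2 := ha0 _ _ _ h0
  obtain ⟨h3, j, hj⟩ := hb _ _ (fun h4 => h0 (by rw [h4, map_zero]) : b (n + i) l vac ≠ 0)
  obtain ⟨-, j', hj'⟩ := ha _ _ (fun h4 => h1 (by rw [h4, map_zero]) : a (m + N - i') k vac ≠ 0)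
  simp only [Finset.mem_range] at hi'
  refine ⟨h2, h3, ⟨j' + (N - i'), ?_⟩, j + i, ?_⟩
  · push_cast [Nat.cast_sub (Nat.lt_succ_iff.mp hi')]
    linear_combination hj'
  · push_cast
    linear_combination hj

/-- The regularized product on the vacuum is a power series, so the value of its Taylor coefficient
at `z = 0` may be computed by setting `w = 0` first. This yields `a_j` applied to the state of `b`.
The restriction `j < N` is needed because the Taylor index has to be nonnegative. -/
theorem state_nprod {a b b' : FormalField Fock} {N : ℕ}
    (ha0 : ∀ n k u, a n k u ≠ 0 → k = 0)
    (ha : IsPow1 fun n k => a n k vac) (hb : IsPow1 fun n k => b n k vac)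
    (h : Loc N a b b' a) (hla : IsLogField a) (hlb : IsLogField b) (j : ℤ) :
    (IsPow1 fun n k => nprod j a b n k vac) ∧ (j < N → state (nprod j a b) = a j 0 (state b)) := by
  have hp := isPow2_zw_pow_comp ha0 ha hb h
  have hg := h.good hlb hla
  rw [nprod_apply' hg]
  refine ⟨hp.taylor _, fun hj => ?_⟩
  obtain ⟨d, hd⟩ : ∃ d : ℕ, (d : ℤ) = N - 1 - j := ⟨((N : ℤ) - 1 - j).toNat, by omega⟩
  change nprod j a b (-1) 0 vac = a j 0 (b (-1) 0 vac)
  -- Only the summand without a factor `w` in `(z - w)^N` contributes at `w = 0`.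
  rw [nprod_apply hg, ← hd, hp.taylor_neg_one, zw_pow_apply, Finset.sum_eq_single 0]
  · have : (-1 - (d : ℂ) + N - (0 : ℕ)) = j := by
      have : (d : ℂ) = N - 1 - j := by exact_mod_cast hd
      rw [this]; push_cast; ring
    rw [this]
    simp [comp]
  · intro i hi hi0
    have : b (-1 + i) 0 vac = 0 := by
      by_contra h0
      obtain ⟨-, j', hj'⟩ := hb _ _ h0
      have : ((i + j' : ℕ) : ℂ) = 0 := by push_cast; linear_combination hj'
      have : i + j' = 0 := by exact_mod_cast this
      omega
    simp only [comp, this, map_zero, smul_zero]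
  · simp

variable (hF : FreePair fockParity fockFields)

/-- Evaluating at the vacuum inverts the map from states to fields. Each generator `gen i k` acts on
states as the product `x_(k)` acts on fields, by `state_nprod`. -/
theorem FreePair.state_fields (u : Fock) :
    (IsPow1 fun n k => hF.fields u n k vac) ∧ state (hF.fields u) = u := by
  have hX : ∀ i, IsPow1 fun n k => fockFields i n k vac := by
    intro i n k h
    beta_reduce at h
    obtain ⟨rfl, j, rfl⟩ := fockFields_ne_zero h
    refine ⟨rfl, ?_⟩
    rw [fockFields_int] at h
    have : j < 0 := by
      by_contra hj
      exact h (gen_vac i (by omega))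
    refine ⟨(-1 - j).toNat, ?_⟩
    have : ((-1 - j).toNat : ℤ) = -1 - j := Int.toNat_of_nonneg (by omega)
    have : ((-1 - j).toNat : ℂ) = -1 - j := by exact_mod_cast this
    rw [this]; ring
  induction u using Fock.induction with
  | h_vac =>
    rw [hF.fields_vac]
    refine ⟨fun n k h => ?_, ?_⟩
    · beta_reduce at h
      rw [oneField_apply] at h
      split_ifs at h with h1
      · exact ⟨h1.2, 0, by simp [h1.1]⟩
      · exact absurd rfl h
    · change oneField Fock (-1) 0 vac = vac
      rw [oneField_apply, if_pos ⟨rfl, rfl⟩]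
  | h_add u w hu hw =>
    refine ⟨fun n k h => ?_, by rw [map_add, map_add, hu.2, hw.2]⟩
    by_contra hc
    have h1 : hF.fields u n k vac = 0 := by_contra fun h1 => hc (hu.1 n k h1)
    have h2 : hF.fields w n k vac = 0 := by_contra fun h1 => hc (hw.1 n k h1)
    exact h (by simp [h1, h2])
  | h_smul c u hu =>
    refine ⟨fun n k h => ?_, by rw [map_smul, map_smul, hu.2]⟩
    exact hu.1 n k fun h1 => h (by simp [h1])
  | h_gen i k u hu =>
    obtain ⟨N, hN⟩ := (hF.fields_mem u).2 i
    rw [hF.fields_gen]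
    -- The order of locality is enlarged beyond `k`, so that the formula for the state applies to
    -- every mode.
    have key := state_nprod (fun n k u h => (fockFields_ne_zero h).1) (hX i) hu.1
      (hN.mono (le_max_left N (k + 1).toNat)) (hF.isLog i) (hF.isLogField_fields u) k
    refine ⟨key.1, ?_⟩
    rw [key.2 (by push_cast; omega), hu.2, fockFields_int]

end State

end SymplecticFermions
end

set_option linter.unusedSectionVars false
noncomputable section
namespace SymplecticFermions

/-! ### Monodromy -/

section Monodromy

variable {M : Type*} [AddCommGroup M] [Module ℂ M] {V : Type*} [AddCommGroup V] [Module ℂ V]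

/-- The coefficient of `(log z)^k` in `(log z + 2πi)^l`. -/
def logCoeff (k l : ℕ) : ℂ := (l.choose k : ℂ) * (2 * Real.pi * Complex.I) ^ (l - k)

/-- The factor `e^{-2πi n}` of the monodromy of `z^{-n-1}`. -/
def expFactor (n : ℂ) : ℂ := Complex.exp (-(2 * Real.pi * Complex.I) * n)

theorem expFactor_add (m n : ℂ) : expFactor (m + n) = expFactor m * expFactor n := by
  rw [expFactor, expFactor, expFactor, ← Complex.exp_add, mul_add]

theorem expFactor_int (j : ℤ) : expFactor j = 1 := by
  rw [expFactor, show -(2 * Real.pi * Complex.I) * (j : ℂ) = ((-j : ℤ) : ℂ) * (2 * Real.pi * Complex.I)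
    by push_cast; ring]
  exact Complex.exp_int_mul_two_pi_mul_I _

theorem expFactor_add_int (n : ℂ) (j : ℤ) : expFactor (n + j) = expFactor n := by
  rw [expFactor_add, expFactor_int, mul_one]

theorem expFactor_add_one (n : ℂ) : expFactor (n + 1) = expFactor n := by
  simpa using expFactor_add_int n 1

theorem expFactor_sub_one (n : ℂ) : expFactor (n - 1) = expFactor n := by
  simpa [sub_eq_add_neg] using expFactor_add_int n (-1)

theorem logCoeff_of_lt {k l : ℕ} (h : l < k) : logCoeff k l = 0 := by
  simp [logCoeff, Nat.choose_eq_zero_of_lt h]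

theorem logCoeff_succ (k l : ℕ) :
    ((l : ℂ) + 1) * logCoeff k l = ((k : ℂ) + 1) * logCoeff (k + 1) (l + 1) := by
  have h : ((l : ℂ) + 1) * (l.choose k : ℂ) = ((l + 1).choose (k + 1) : ℂ) * ((k : ℂ) + 1) := by
    exact_mod_cast Nat.add_one_mul_choose_eq l k
  rw [logCoeff, logCoeff, Nat.add_sub_add_right]
  linear_combination (2 * Real.pi * Complex.I) ^ (l - k) * h

/-- The Vandermonde identity; it expresses that the substitution `log z ↦ log z + 2πi` respects
products of powers. -/
theorem sum_logCoeff (e k' l' : ℕ) :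
    ∑ k ∈ Finset.range (e + 1), logCoeff k k' * logCoeff (e - k) l' = logCoeff e (k' + l') := by
  have h : ((k' + l').choose e : ℂ)
      = ∑ k ∈ Finset.range (e + 1), (k'.choose k : ℂ) * (l'.choose (e - k) : ℂ) := by
    rw [Nat.add_choose_eq, Finset.Nat.sum_antidiagonal_eq_sum_range_succ_mk]
    push_cast
    rfl
  rw [logCoeff, h, Finset.sum_mul]
  refine Finset.sum_congr rfl fun k hk => ?_
  rw [logCoeff, logCoeff]
  simp only [Finset.mem_range] at hk
  rcases lt_or_ge k' k with h1 | h1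
  · simp [Nat.choose_eq_zero_of_lt h1]
  rcases lt_or_ge l' (e - k) with h2 | h2
  · simp [Nat.choose_eq_zero_of_lt h2]
  rw [show k' + l' - e = (k' - k) + (l' - (e - k)) by omega, pow_add]
  ring

/-- The substitution `log z ↦ log z + 2πi` in a polynomial in `log z`. -/
def logShift (x : ℕ → M) (k : ℕ) : M := ∑ᶠ l, logCoeff k l • x l

theorem logShift_eq {x : ℕ → M} {K : ℕ} (h : ∀ l, K ≤ l → x l = 0) (k : ℕ) :
    logShift x k = ∑ l ∈ Finset.range K, logCoeff k l • x l := by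
  refine finsum_eq_sum_of_support_subset _ fun l hl => ?_
  by_contra hc
  simp only [Finset.coe_range, Set.mem_Iio, not_lt] at hc
  exact hl (by simp [h l hc])

theorem logShift_ne_zero {x : ℕ → M} {k : ℕ} (h : logShift x k ≠ 0) : ∃ l, x l ≠ 0 := by
  by_contra hc
  simp only [not_exists, not_not] at hc
  exact h (by simp [logShift, hc])

theorem logShift_add {x y : ℕ → M} {K : ℕ} (hx : ∀ l, K ≤ l → x l = 0) (hy : ∀ l, K ≤ l → y l = 0)
    (k : ℕ) : logShift (fun l => x l + y l) k = logShift x k + logShift y k := by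
  rw [logShift_eq hx, logShift_eq hy, logShift_eq (K := K) (fun l hl => by rw [hx l hl, hy l hl, add_zero]),
    ← Finset.sum_add_distrib]
  simp only [smul_add]

theorem logShift_smul (c : ℂ) (x : ℕ → M) (k : ℕ) :
    logShift (fun l => c • x l) k = c • logShift x k := by
  simp only [logShift, smul_comm _ c]
  exact (smul_finsum c _).symm

theorem logShift_map (g : M →ₗ[ℂ] V) {x : ℕ → M} {K : ℕ} (hx : ∀ l, K ≤ l → x l = 0) (k : ℕ) :
    logShift (fun l => g (x l)) k = g (logShift x k) := by
  rw [logShift_eq hx, logShift_eq (K := K) (fun l hl => by rw [hx l hl, map_zero])]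
  simp

theorem logShift_sum {ι : Type*} (s : Finset ι) {x : ι → ℕ → M} {K : ℕ}
    (hx : ∀ i ∈ s, ∀ l, K ≤ l → x i l = 0) (k : ℕ) :
    logShift (fun l => ∑ i ∈ s, x i l) k = ∑ i ∈ s, logShift (x i) k := by
  rw [logShift_eq (K := K) (fun l hl => Finset.sum_eq_zero fun i hi => hx i hi l hl),
    Finset.sum_congr rfl fun i hi => logShift_eq (hx i hi) k, Finset.sum_comm]
  simp only [Finset.smul_sum]

theorem logShift_deriv {x : ℕ → M} {K : ℕ} (hx : ∀ l, K ≤ l → x l = 0) (k : ℕ) :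
    logShift (fun l => ((l : ℂ) + 1) • x (l + 1)) k = ((k : ℂ) + 1) • logShift x (k + 1) := by
  rw [logShift_eq (K := K + 1) (fun l hl => hx l (by omega)) (k + 1),
    logShift_eq (K := K) (fun l hl => by rw [hx (l + 1) (by omega), smul_zero]), Finset.sum_range_succ',
    logCoeff_of_lt (Nat.succ_pos k), zero_smul, add_zero, Finset.smul_sum]
  refine Finset.sum_congr rfl fun l _ => ?_
  rw [smul_smul, smul_smul, mul_comm, logCoeff_succ]

/-- Setting `log w = log z` and then substituting agrees with substituting in both logarithms first.
All sums are finite because of the bound `K`. -/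
theorem logShift_conv {y : ℕ → ℕ → M} {K : ℕ} (hy : ∀ k l, K ≤ k ∨ K ≤ l → y k l = 0) (e : ℕ) :
    ∑ k ∈ Finset.range (e + 1), logShift (fun k' => logShift (y k') (e - k)) k
      = logShift (fun E => ∑ k ∈ Finset.range (E + 1), y k (E - k)) e := by
  have h1 : ∀ k l, logShift (fun k' => logShift (y k') l) k
      = ∑ k' ∈ Finset.range K, ∑ l' ∈ Finset.range K, (logCoeff k k' * logCoeff l l') • y k' l' := by
    intro k l
    rw [logShift_eq (K := K)]
    · refine Finset.sum_congr rfl fun k' _ => ?_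
      rw [logShift_eq fun l' hl' => hy k' l' (Or.inr hl'), Finset.smul_sum]
      simp only [smul_smul]
    · intro k' hk'
      rw [logShift_eq (K := 0) fun l' _ => hy k' l' (Or.inl hk')]
      simp
  simp only [h1]
  rw [Finset.sum_comm]
  have h2 : ∀ k' ∈ Finset.range K, ∑ k ∈ Finset.range (e + 1), ∑ l' ∈ Finset.range K,
      (logCoeff k k' * logCoeff (e - k) l') • y k' l'
        = ∑ l' ∈ Finset.range K, logCoeff e (k' + l') • y k' l' := by
    intro k' _
    rw [Finset.sum_comm]
    refine Finset.sum_congr rfl fun l' _ => ?_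
    rw [← Finset.sum_smul, sum_logCoeff]
  rw [Finset.sum_congr rfl h2, logShift_eq (K := 2 * K)]
  · simp only [Finset.smul_sum]
    rw [← Finset.sum_product' (f := fun k' l' => logCoeff e (k' + l') • y k' l'), Finset.sum_sigma']
    refine Finset.sum_of_injOn (fun p : ℕ × ℕ => (⟨p.1 + p.2, p.1⟩ : (_ : ℕ) × ℕ)) ?_ ?_ ?_ ?_
    · rintro ⟨a, b⟩ _ ⟨c, d⟩ _ h
      simp only [Sigma.mk.injEq, heq_eq_eq] at h
      exact Prod.ext h.2 (by omega)
    · rintro ⟨a, b⟩ h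
      simp only [Finset.coe_product, Finset.coe_range, Set.mem_prod, Set.mem_Iio] at h
      simp only [Finset.coe_sigma, Finset.coe_range, Set.mem_sigma_iff, Set.mem_Iio]
      omega
    · rintro ⟨E, k⟩ h1 h2
      simp only [Finset.mem_sigma, Finset.mem_range] at h1
      rw [hy, smul_zero]
      by_contra hc
      simp only [not_or, not_le] at hc
      refine h2 ⟨⟨k, E - k⟩, ?_, ?_⟩
      · simp only [Finset.coe_product, Finset.coe_range, Set.mem_prod, Set.mem_Iio]
        exact hc
      · simp only [Sigma.mk.injEq, heq_eq_eq, and_true]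
        omega
    · rintro ⟨a, b⟩ _
      simp
  · intro E hE
    refine Finset.sum_eq_zero fun k hk => hy _ _ ?_
    simp only [Finset.mem_range] at hk
    omega

/-! ### Monodromy of series in two variables. -/

/-- For fixed powers of `z` and `w` the series is a polynomial in the logarithms. -/
def LogFinite (f : Ser2 M) : Prop := ∀ m n, ∃ K, ∀ k l, K ≤ k ∨ K ≤ l → f m k n l = 0

/-- The monodromy in both variables. -/
def mono2 (f : Ser2 M) : Ser2 M := fun m k n l =>
  (expFactor m * expFactor n) • logShift (fun k' => logShift (f m k' n) l) k

theorem LogFinite.zw {f : Ser2 M} (hf : LogFinite f) : LogFinite (zw f) := by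
  intro m n
  obtain ⟨K, hK⟩ := hf (m + 1) n
  obtain ⟨K', hK'⟩ := hf m (n + 1)
  refine ⟨max K K', fun k l h => ?_⟩
  rw [zw_apply, hK k l (by omega), hK' k l (by omega), sub_zero]

theorem LogFinite.dZ {f : Ser2 M} (hf : LogFinite f) : LogFinite (dZ f) := by
  intro m n
  obtain ⟨K, hK⟩ := hf (m - 1) n
  refine ⟨K, fun k l h => ?_⟩
  rw [dZ_apply, hK k l h, hK (k + 1) l (by omega), smul_zero, smul_zero, add_zero]

theorem mono2_ne_zero {f : Ser2 M} {m : ℂ} {k : ℕ} {n : ℂ} {l : ℕ} (h : mono2 f m k n l ≠ 0) :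
    ∃ k' l', f m k' n l' ≠ 0 := by
  obtain ⟨k', h⟩ := logShift_ne_zero (right_ne_zero_of_smul h)
  obtain ⟨l', h⟩ := logShift_ne_zero h
  exact ⟨k', l', h⟩

theorem DiagFinite.mono2 {f : Ser2 M} (hf : DiagFinite f) : DiagFinite (mono2 f) :=
  hf.of_imp fun _ _ _ _ h => mono2_ne_zero h

theorem logShift_logShift_add {y y' : ℕ → ℕ → M} {K K' : ℕ} (hy : ∀ k l, K ≤ k ∨ K ≤ l → y k l = 0)
    (hy' : ∀ k l, K' ≤ k ∨ K' ≤ l → y' k l = 0) (k l : ℕ) :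
    logShift (fun k' => logShift (fun l' => y k' l' + y' k' l') l) k
      = logShift (fun k' => logShift (y k') l) k + logShift (fun k' => logShift (y' k') l) k := by
  have hz : ∀ l, logShift (fun _ => (0 : M)) l = 0 := fun l => by simp [logShift]
  have h0 : ∀ {y : ℕ → ℕ → M} {K k : ℕ}, (∀ l, y k l = 0) → logShift (y k) l = 0 := by
    intro y K k h
    rw [show y k = fun _ => 0 from funext h, hz]
  rw [← logShift_add (K := max K K') (fun k' hk' => h0 (K := K) fun l => hy k' l (Or.inl (by omega)))
    (fun k' hk' => h0 (K := K) fun l => hy' k' l (Or.inl (by omega)))]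
  congr 1
  funext k'
  exact logShift_add (K := max K K') (fun l' hl' => hy k' l' (Or.inr (by omega)))
    (fun l' hl' => hy' k' l' (Or.inr (by omega))) l

theorem logShift_logShift_smul (c : ℂ) (y : ℕ → ℕ → M) (k l : ℕ) :
    logShift (fun k' => logShift (fun l' => c • y k' l') l) k
      = c • logShift (fun k' => logShift (y k') l) k := by
  simp only [logShift_smul]

theorem mono2_zw {f : Ser2 M} (hf : LogFinite f) : mono2 (zw f) = zw (mono2 f) := by
  funext m k n l
  obtain ⟨K, hK⟩ := hf (m + 1) n
  obtain ⟨K', hK'⟩ := hf m (n + 1)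
  have h1 : (fun k' => logShift (zw f m k' n) l)
      = fun k' => logShift (fun l' => f (m + 1) k' n l' + (-1 : ℂ) • f m k' (n + 1) l') l := by
    funext k'
    congr 1
    funext l'
    rw [zw_apply, neg_one_smul, sub_eq_add_neg]
  rw [zw_apply]
  simp only [mono2]
  rw [h1, logShift_logShift_add hK (K' := K') (fun k l h => by rw [hK' k l h, smul_zero]),
    logShift_logShift_smul, expFactor_add_one, expFactor_add_one, smul_add, neg_one_smul, smul_neg,
    sub_eq_add_neg]

theorem mono2_dZ {f : Ser2 M} (hf : LogFinite f) : mono2 (dZ f) = dZ (mono2 f) := by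
  funext m k n l
  obtain ⟨K, hK⟩ := hf (m - 1) n
  have h1 : (fun k' => logShift (dZ f m k' n) l) = fun k' => logShift (fun l' =>
      (-m) • f (m - 1) k' n l' + ((k' : ℂ) + 1) • f (m - 1) (k' + 1) n l') l := rfl
  rw [dZ_apply]
  simp only [mono2]
  rw [h1, logShift_logShift_add (K := K) (K' := K) (fun k l h => by rw [hK k l h, smul_zero])
    (fun k l h => by rw [hK (k + 1) l (by omega), smul_zero]),
    logShift_logShift_smul, expFactor_sub_one, smul_add, smul_comm _ (-m)]
  congr 1
  simp only [logShift_smul]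
  rw [logShift_deriv (x := fun k' => logShift (f (m - 1) k' n) l) (K := K), smul_comm]
  intro k' hk'
  rw [logShift_eq (K := 0) fun l' _ => hK k' l' (Or.inl hk')]
  simp

theorem LogFinite.zw_pow {f : Ser2 M} (hf : LogFinite f) (N : ℕ) :
    LogFinite ((SymplecticFermions.zw ^ N) f) ∧
      mono2 ((SymplecticFermions.zw ^ N) f) = (SymplecticFermions.zw ^ N) (mono2 f) := by
  induction N with
  | zero => simpa using hf
  | succ N ih =>
    rw [pow_succ', Module.End.mul_apply, Module.End.mul_apply]
    exact ⟨ih.1.zw, by rw [mono2_zw ih.1, ih.2]⟩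

theorem LogFinite.dZ_pow {f : Ser2 M} (hf : LogFinite f) (N : ℕ) :
    LogFinite ((SymplecticFermions.dZ ^ N) f) ∧
      mono2 ((SymplecticFermions.dZ ^ N) f) = (SymplecticFermions.dZ ^ N) (mono2 f) := by
  induction N with
  | zero => simpa using hf
  | succ N ih =>
    rw [pow_succ', Module.End.mul_apply, Module.End.mul_apply]
    exact ⟨ih.1.dZ, by rw [mono2_dZ ih.1, ih.2]⟩

/-- The monodromy in one variable. -/
def mono1 (f : Ser1 M) : Ser1 M := fun n k => expFactor n • logShift (f n) k

/-- The exponential factors multiply to that of the total exponent, the extra shift by one being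
invisible, and the substitution in the logarithms is multiplicative. -/
theorem diag_mono2 {f : Ser2 M} (hf : LogFinite f) (hd : DiagFinite f) :
    diag (mono2 f) = mono1 (diag f) := by
  funext n e
  let s := (hd (n - 1)).toFinset
  have hs : ∀ m, m ∉ s → ∀ k l, f m k (n - 1 - m) l = 0 := by
    intro m hm k l
    by_contra h
    exact hm ((hd (n - 1)).mem_toFinset.mpr ⟨k, l, h⟩)
  choose K hK using fun m => hf m (n - 1 - m)
  have h1 : diag f n = fun E => ∑ m ∈ s, ∑ k ∈ Finset.range (E + 1), f m k (n - 1 - m) (E - k) := by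
    funext E
    refine finsum_eq_sum_of_support_subset _ fun m hm => ?_
    by_contra hc
    exact hm (Finset.sum_eq_zero fun k _ => hs m hc _ _)
  -- If each logarithm occurs with powers below `K m`, then every product of total degree at least
  -- `2 K m` contains one of too high degree.
  have h2 : ∀ m ∈ s, ∀ E, 2 * s.sup K ≤ E →
      ∑ k ∈ Finset.range (E + 1), f m k (n - 1 - m) (E - k) = 0 := by
    intro m hm E hE
    have : K m ≤ s.sup K := Finset.le_sup hm
    refine Finset.sum_eq_zero fun k hk => hK m _ _ ?_
    simp only [Finset.mem_range] at hk
    omega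
  rw [mono1, h1, logShift_sum s h2, Finset.smul_sum, diag,
    finsum_eq_sum_of_support_subset (s := s) _ fun m hm => ?_]
  · refine Finset.sum_congr rfl fun m _ => ?_
    simp only [mono2]
    rw [← Finset.smul_sum, logShift_conv (y := fun k l => f m k (n - 1 - m) l) (hK m), ← expFactor_add,
      show m + (n - 1 - m) = n - 1 by ring, expFactor_sub_one]
  · by_contra hc
    refine hm (Finset.sum_eq_zero fun k _ => ?_)
    by_contra h
    obtain ⟨k', l', h⟩ := mono2_ne_zero h
    exact h (hs m hc _ _)

theorem taylor_mono2 {f : Ser2 M} (hf : LogFinite f) (hd : DiagFinite f) (d : ℤ) :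
    taylor d (mono2 f) = mono1 (taylor d f) := by
  unfold taylor
  split_ifs
  · rw [← (hf.dZ_pow _).2, diag_mono2 (hf.dZ_pow _).1 (hd.dZ_pow _)]
    funext n k
    simp only [mono1]
    rw [show logShift ((((d.toNat).factorial : ℂ)⁻¹ • diag ((dZ ^ d.toNat) f)) n) k
      = logShift (fun l => ((d.toNat).factorial : ℂ)⁻¹ • diag ((dZ ^ d.toNat) f) n l) k from rfl,
      logShift_smul, smul_comm]
    rfl
  · funext n k
    simp [mono1, logShift]

/-- The field `a'` is obtained from `a` by the monodromy around `z = 0`. -/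
def IsMonodromy (a a' : FormalField M) : Prop :=
  ∀ n k v, a' n k v = expFactor n • logShift (fun l => a n l v) k

/-- On every vector, every power of `z` comes with a polynomial in `log z`. -/
def LogPolynomial (a : FormalField M) : Prop := ∀ n v, ∃ K, ∀ k, K ≤ k → a n k v = 0

theorem IsLogField.logPolynomial {a : FormalField M} (ha : IsLogField a) : LogPolynomial a := by
  obtain ⟨S, hS⟩ := ha
  intro n v
  obtain ⟨N, K, h⟩ := hS v
  refine ⟨K + 1, fun k hk => ?_⟩
  by_contra h0
  have := (h n k h0).1
  omega

theorem logFinite_comp {a b : FormalField M} (ha : LogPolynomial a) (hb : LogPolynomial b) (v : M) :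
    LogFinite (comp a b v) := by
  intro m n
  obtain ⟨K, hK⟩ := hb n v
  choose L hL using fun l => ha m (b n l v)
  refine ⟨max K ((Finset.range K).sup L), fun k l h => ?_⟩
  simp only [comp]
  rcases le_or_gt K l with h1 | h1
  · rw [hK l h1, map_zero]
  · have : L l ≤ (Finset.range K).sup L := Finset.le_sup (Finset.mem_range.mpr h1)
    exact hL l k (by omega)

theorem IsMonodromy.comp {a a' b b' : FormalField M} (ha : IsMonodromy a a') (hb : IsMonodromy b b')
    (hlb : LogPolynomial b) (v : M) :
    comp a' b' v = mono2 (comp a b v) := by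
  funext m k n l
  simp only [SymplecticFermions.comp, mono2]
  obtain ⟨K, hK⟩ := hlb n v
  rw [ha, hb, mul_smul]
  congr 1
  refine Eq.trans ?_ (logShift_smul (expFactor n) _ k)
  congr 1
  funext k'
  rw [map_smul, ← logShift_map (a m k') hK]
  rfl

/-- Moving both variables once around zero preserves `z - w`, commutes with `∂_z` and with the
restriction to the diagonal. So monodromy is compatible with every product. -/
theorem IsMonodromy.nprod {a a' b b' : FormalField M} (ha : IsMonodromy a a') (hb : IsMonodromy b b')
    (hla : LogPolynomial a) (hlb : LogPolynomial b) {N : ℕ} (h : Good N a b) (j : ℤ) :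
    IsMonodromy (nprod j a b) (nprod j a' b') := by
  have hf := fun v => (logFinite_comp hla hlb v).zw_pow N
  have h' : Good N a' b' := fun v => by
    rw [ha.comp hb hlb, ← (hf v).2]
    exact (h v).mono2
  intro n e v
  rw [nprod_apply h', ha.comp hb hlb, ← (hf v).2, taylor_mono2 (hf v).1 (h v), ← nprod_apply' h]
  rfl

theorem IsMonodromy.add {a a' b b' : FormalField M} (ha : IsMonodromy a a') (hb : IsMonodromy b b')
    (hla : LogPolynomial a) (hlb : LogPolynomial b) : IsMonodromy (a + b) (a' + b') := by
  intro n k v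
  obtain ⟨K, hK⟩ := hla n v
  obtain ⟨L, hL⟩ := hlb n v
  simp only [Pi.add_apply, LinearMap.add_apply]
  rw [ha, hb, ← smul_add, ← logShift_add (K := max K L) (fun l hl => hK l (by omega))
    (fun l hl => hL l (by omega))]

theorem IsMonodromy.smul {a a' : FormalField M} (c : ℂ) (ha : IsMonodromy a a') :
    IsMonodromy (c • a) (c • a') := by
  intro n k v
  simp only [Pi.smul_apply, LinearMap.smul_apply]
  rw [ha, logShift_smul, smul_comm]

theorem isMonodromy_one : IsMonodromy (oneField M) (oneField M) := by
  intro n k v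
  have h : ∀ l, 1 ≤ l → oneField M n l v = 0 := fun l hl => by
    rw [oneField_apply, if_neg (by omega)]
  rw [logShift_eq h, Finset.sum_range_one]
  simp only [oneField_apply]
  by_cases hn : n = -1
  · have h1 : expFactor (-1) = 1 := by simpa using expFactor_int (-1)
    rw [hn, h1]
    rcases Nat.eq_zero_or_pos k with rfl | hk
    · simp [logCoeff]
    · rw [logCoeff_of_lt hk, if_neg (by omega)]
      simp
  · simp [hn]

/-- Both sides are compatible with products by generators, so the claim spreads from the two
generating fields to all states. -/
theorem FreePair.isMonodromy_fields {π : Module.End ℂ M} {X : Fin 2 → FormalField M}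
    (h : FreePair π X) {g : Matrix.SpecialLinearGroup (Fin 2) ℂ}
    (hX : ∀ i, IsMonodromy (X i) (∑ j, g j i • X j)) (u : Fock) :
    IsMonodromy (h.fields u) (h.fields (fockAut g u)) := by
  induction u using Fock.induction with
  | h_vac => rw [fockAut_vac, h.fields_vac]; exact isMonodromy_one
  | h_add u w hu hw =>
    rw [map_add, map_add, map_add]
    exact hu.add hw (h.isLogField_fields u).logPolynomial (h.isLogField_fields w).logPolynomial
  | h_smul c u hu =>
    rw [map_smul, map_smul, map_smul]
    exact hu.smul c
  | h_gen i k u hu =>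
    obtain ⟨N, hN⟩ := h.good (h.fields_mem u) i
    have key := (hX i).nprod hu (h.isLog i).logPolynomial (h.isLogField_fields u).logPolynomial hN k
    rw [fockAut_gen_smul, h.fields_gen]
    obtain ⟨N₀, h₀⟩ := h.good (h.fields_mem (fockAut g u)) 0
    obtain ⟨N₁, h₁⟩ := h.good (h.fields_mem (fockAut g u)) 1
    rw [Fin.sum_univ_two] at key ⊢
    rw [nprod_add_left (h₀.smul_left _) (h₁.smul_left _), nprod_smul_left h₀, nprod_smul_left h₁] at key
    rw [map_add, LinearMap.map_smul, LinearMap.map_smul, h.fields_gen, h.fields_gen]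
    exact key

end Monodromy

/-! ### The twisted module defined by a free pair -/

section Construction

variable {M : Type*} [AddCommGroup M] [Module ℂ M] {π : Module.End ℂ M} {X : Fin 2 → FormalField M}

theorem FreePair.isClosedFieldSpace_range (hF : FreePair fockParity fockFields) :
    IsClosedFieldSpace (LinearMap.range hF.fields) where
  one_mem := ⟨vac, hF.fields_vac⟩
  psi_mem := ⟨_, (hF.fields_gen_vac 0).trans fockFields_zero⟩
  psibar_mem := ⟨_, (hF.fields_gen_vac 1).trans fockFields_one⟩
  nProduct_mem := by
    rintro p q j _ _ c ⟨u, rfl⟩ ⟨w, rfl⟩ - - h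
    obtain ⟨x, hx, -⟩ := hF.exists_nprod hF u w j
    exact ⟨x, by rw [h.eq_nprod (hF.isLogField_fields u) (hF.isLogField_fields w), hx]⟩

/-- The fields of states form a closed space, hence contain the vertex superalgebra by minimality;
on fields of states, `state` is inverted by construction. No separate uniqueness theorem for fields
is required. -/
theorem FreePair.fields_state (hF : FreePair fockParity fockFields) (a : SF) :
    hF.fields (state a.1) = a.1 := by
  obtain ⟨u, hu⟩ := Submodule.mem_sInf.mp a.2 _ hF.isClosedFieldSpace_range
  rw [← hu, (hF.state_fields u).2]

/-- The map `a ↦ Y(a, z)` defined by a free pair. -/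
def FreePair.vertexMap (h : FreePair π X) : SF →ₗ[ℂ] FormalField M :=
  h.fields ∘ₗ state ∘ₗ SF.subtype

theorem FreePair.vertexMap_apply (h : FreePair π X) (a : SF) : h.vertexMap a = h.fields (state a.1) := rfl

theorem conj_pow_of_eq {q : ℕ} {b : FormalField M} (hb : conj π b = (-1 : ℂ) ^ q • b) (p : ℕ) :
    (conj π ^ p) b = (-1 : ℂ) ^ (p * q) • b := by
  induction p with
  | zero => simp
  | succ p ih =>
    rw [pow_succ', Module.End.mul_apply, ih, map_smul, hb, smul_smul, ← pow_add, Nat.succ_mul]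

theorem FreePair.parity_state (hF : FreePair fockParity fockFields) {p : ℕ} {a : SF}
    (ha : HasParity fockParity p a.1) : fockParity (state a.1) = (-1 : ℂ) ^ p • state a.1 := by
  rw [hasParity_iff fockParity_sq, ← hF.fields_state, ← hF.fields_parity, ← map_smul] at ha
  have := congrArg state ha
  rwa [(hF.state_fields _).2, (hF.state_fields _).2] at this

theorem FreePair.conj_vertexMap (hF : FreePair fockParity fockFields) (h : FreePair π X) {p : ℕ} {a : SF}
    (ha : HasParity fockParity p a.1) : conj π (h.vertexMap a) = (-1 : ℂ) ^ p • h.vertexMap a := by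
  rw [h.vertexMap_apply, ← h.fields_parity, hF.parity_state ha, map_smul]

theorem FreePair.loc_vertexMap (hF : FreePair fockParity fockFields) (h : FreePair π X) {p q : ℕ} {a b : SF}
    (ha : HasParity fockParity p a.1) (hb : HasParity fockParity q b.1) :
    ∃ N, Loc N (h.vertexMap a) (h.vertexMap b) ((-1 : ℂ) ^ (p * q) • h.vertexMap b) (h.vertexMap a) := by
  obtain ⟨N, hN⟩ := h.loc_fields (hF.parity_state ha) (h.fields_mem (state b.1))
  have := conj_pow_of_eq (hF.conj_vertexMap h hb) p
  rw [h.vertexMap_apply] at this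
  rw [this] at hN
  exact ⟨N, hN⟩

theorem FreePair.isTwistedModule (hF : FreePair fockParity fockFields) (h : FreePair π X)
    {g : Matrix.SpecialLinearGroup (Fin 2) ℂ} (hX : ∀ i, IsMonodromy (X i) (∑ j, g j i • X j)) :
    IsTwistedModule g π h.vertexMap where
  isLogField a := h.isLogField_fields _
  parity p a ha := (hasParity_iff h.sq).mpr (hF.conj_vertexMap h ha)
  vacuum := by
    have := (hF.state_fields vac).2
    rw [hF.fields_vac] at this
    rw [h.vertexMap_apply, ← h.fields_vac]
    exact congrArg _ this
  isLocal p q a b ha hb := by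
    obtain ⟨N, hN⟩ := hF.loc_vertexMap h ha hb
    exact ⟨N, isLocal_iff.mpr hN⟩
  nProduct p q j a b c ha hb hc := by
    have hla : IsLogField a.1 := by rw [← hF.fields_state]; exact hF.isLogField_fields _
    have hlb : IsLogField b.1 := by rw [← hF.fields_state]; exact hF.isLogField_fields _
    -- The same state `x` describes the product on the Fock space and on `M`; on the Fock space it
    -- must be the state of `c`.
    obtain ⟨x, hx, hx'⟩ := hF.exists_nprod h (state a.1) (state b.1) j
    have e : h.vertexMap c = nprod j (h.vertexMap a) (h.vertexMap b) := by
      rw [h.vertexMap_apply, h.vertexMap_apply, h.vertexMap_apply, hx', hc.eq_nprod hla hlb]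
      rw [hF.fields_state, hF.fields_state] at hx
      rw [hx, (hF.state_fields x).2]
    obtain ⟨N, hN⟩ := hF.loc_vertexMap h ha hb
    rw [e]
    exact isNProduct_nprod hN (h.isLogField_fields _) (h.isLogField_fields _) j
  monodromy a a' haa' n k v := by
    -- The coefficient of `z^0` in the conjugation identity, applied to the vacuum, which `g` fixes.
    have e : state a'.1 = fockAut g (state a.1) := by
      have := congrArg (fun f : Module.End ℂ Fock => f vac) (haa' (-1) 0)
      simp only [Module.End.mul_apply, fockAut_vac] at this
      exact this
    rw [h.vertexMap_apply, e]
    exact h.isMonodromy_fields hX (state a.1) n k v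

end Construction

end SymplecticFermions
end

set_option linter.unusedSectionVars false
noncomputable section
namespace SymplecticFermions

/-! ### Operator products with poles of order at most two -/

section Ope

variable {M : Type*} [AddCommGroup M] [Module ℂ M]

/-- The anticommuting fields `a`, `b` are local of order two, with singular part
`s₁(w) (z - w)⁻² + s₀(w) (z - w)⁻¹`. -/
structure HasOpe (a b s₁ s₀ : FormalField M) : Prop where
  loc : Loc 2 a b (-b) a
  good : Good 2 a b
  prod_one : nprod 1 a b = s₁
  prod_zero : nprod 0 a b = s₀

variable {a a' b b' s₁ s₀ s₁' s₀' : FormalField M}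

theorem HasOpe.congr (h : HasOpe a b s₁ s₀) (h₁ : s₁ = s₁') (h₀ : s₀ = s₀') : HasOpe a b s₁' s₀' :=
  h₁ ▸ h₀ ▸ h

theorem HasOpe.add_left (h : HasOpe a b s₁ s₀) (h' : HasOpe a' b s₁' s₀') :
    HasOpe (a + a') b (s₁ + s₁') (s₀ + s₀') where
  loc := h.loc.add_left h'.loc
  good := h.good.add_left h'.good
  prod_one := by rw [nprod_add_left h.good h'.good, h.prod_one, h'.prod_one]
  prod_zero := by rw [nprod_add_left h.good h'.good, h.prod_zero, h'.prod_zero]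

theorem HasOpe.add_right (h : HasOpe a b s₁ s₀) (h' : HasOpe a b' s₁' s₀') :
    HasOpe a (b + b') (s₁ + s₁') (s₀ + s₀') where
  loc := by rw [neg_add]; exact h.loc.add_right h'.loc
  good := h.good.add_right h'.good
  prod_one := by rw [nprod_add_right h.good h'.good, h.prod_one, h'.prod_one]
  prod_zero := by rw [nprod_add_right h.good h'.good, h.prod_zero, h'.prod_zero]

theorem HasOpe.smul_left (c : ℂ) (h : HasOpe a b s₁ s₀) : HasOpe (c • a) b (c • s₁) (c • s₀) where
  loc := h.loc.smul_left c
  good := h.good.smul_left c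
  prod_one := by rw [nprod_smul_left h.good, h.prod_one]
  prod_zero := by rw [nprod_smul_left h.good, h.prod_zero]

theorem HasOpe.smul_right (c : ℂ) (h : HasOpe a b s₁ s₀) : HasOpe a (c • b) (c • s₁) (c • s₀) where
  loc := by rw [← smul_neg]; exact h.loc.smul_right c
  good := h.good.smul_right c
  prod_one := by rw [nprod_smul_right h.good, h.prod_one]
  prod_zero := by rw [nprod_smul_right h.good, h.prod_zero]

/-- Multiplication with `log w`. -/
def logW (f : Ser2 M) : Ser2 M := fun m k n l => if l = 0 then 0 else f m k n (l - 1)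

/-- Multiplication with `log z`. -/
def logZ (f : Ser2 M) : Ser2 M := fun m k n l => if k = 0 then 0 else f m (k - 1) n l

/-- Multiplication with `z⁻¹`. -/
def invMul (f : Ser1 M) : Ser1 M := fun n k => f (n - 1) k

/-- Multiplication with `z⁻¹` of a series in two variables. -/
def invZ (f : Ser2 M) : Ser2 M := fun m k n l => f (m - 1) k n l

theorem zw_logW (f : Ser2 M) : zw (logW f) = logW (zw f) := by
  funext m k n l
  simp only [zw_apply, logW]
  split_ifs <;> simp

theorem zw_logZ (f : Ser2 M) : zw (logZ f) = logZ (zw f) := by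
  funext m k n l
  simp only [zw_apply, logZ]
  split_ifs <;> simp

theorem dZ_logW (f : Ser2 M) : dZ (logW f) = logW (dZ f) := by
  funext m k n l
  simp only [dZ_apply, logW]
  split_ifs <;> simp

theorem dZ_logZ (f : Ser2 M) : dZ (logZ f) = logZ (dZ f) + invZ f := by
  funext m k n l
  simp only [dZ_apply, logZ, Pi.add_apply, invZ]
  cases k with
  | zero => simp
  | succ k =>
    simp only [Nat.succ_ne_zero, if_false, Nat.add_sub_cancel]
    push_cast
    module

theorem zw_pow_logW (N : ℕ) (f : Ser2 M) : (zw ^ N) (logW f) = logW ((zw ^ N) f) := by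
  induction N with
  | zero => rfl
  | succ N ih => rw [pow_succ', Module.End.mul_apply, ih, zw_logW, Module.End.mul_apply]

theorem zw_pow_logZ (N : ℕ) (f : Ser2 M) : (zw ^ N) (logZ f) = logZ ((zw ^ N) f) := by
  induction N with
  | zero => rfl
  | succ N ih => rw [pow_succ', Module.End.mul_apply, ih, zw_logZ, Module.End.mul_apply]

theorem DiagFinite.logW {f : Ser2 M} (hf : DiagFinite f) : DiagFinite (logW f) :=
  hf.of_imp fun m k n l h => by
    unfold SymplecticFermions.logW at h
    split_ifs at h
    · exact absurd rfl h
    · exact ⟨_, _, h⟩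

theorem DiagFinite.logZ {f : Ser2 M} (hf : DiagFinite f) : DiagFinite (logZ f) :=
  hf.of_imp fun m k n l h => by
    unfold SymplecticFermions.logZ at h
    split_ifs at h
    · exact absurd rfl h
    · exact ⟨_, _, h⟩

theorem diag_logW (f : Ser2 M) : diag (logW f) = logMul (diag f) := by
  funext n e
  simp only [diag, logMul_apply, logW]
  cases e with
  | zero => simp
  | succ e =>
    rw [if_neg (Nat.succ_ne_zero e)]
    refine finsum_congr fun m => ?_
    rw [Finset.sum_range_succ, Nat.sub_self, if_pos rfl, add_zero, Nat.add_sub_cancel]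
    refine Finset.sum_congr rfl fun k hk => ?_
    simp only [Finset.mem_range] at hk
    rw [if_neg (by omega), show e + 1 - k - 1 = e - k by omega]

theorem diag_logZ (f : Ser2 M) : diag (logZ f) = logMul (diag f) := by
  rw [← diag_swap f, ← diag_logW, ← diag_swap (logZ f)]
  rfl

theorem diag_invZ (f : Ser2 M) : diag (invZ f) = invMul (diag f) := by
  funext n e
  simp only [diag, invMul, invZ]
  rw [← finsum_comp_equiv (Equiv.addRight (1 : ℂ))]
  refine finsum_congr fun m => Finset.sum_congr rfl fun k _ => ?_
  rw [Equiv.coe_addRight, add_sub_cancel_right, show n - 1 - (m + 1) = n - 1 - 1 - m by ring]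

theorem DiagFinite.invZ {f : Ser2 M} (hf : DiagFinite f) : DiagFinite (invZ f) := fun n => by
  refine ((hf (n - 1)).preimage (f := fun m => m - 1) (sub_left_injective).injOn).subset ?_
  rintro m ⟨k, l, h⟩
  refine ⟨k, l, ?_⟩
  rw [show n - 1 - (m - 1) = n - m by ring]
  exact h

theorem logMul_field_apply (a : FormalField M) (n : ℂ) (k : ℕ) (v : M) :
    logMul a n k v = if k = 0 then 0 else a n (k - 1) v := by
  rw [logMul_apply]
  split_ifs <;> rfl

theorem comp_logMul_right (a b : FormalField M) (v : M) : comp a (logMul b) v = logW (comp a b v) := by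
  funext m k n l
  simp only [comp, logW, logMul_field_apply]
  split_ifs <;> simp

theorem comp_logMul_left (a b : FormalField M) (v : M) : comp (logMul a) b v = logZ (comp a b v) := by
  funext m k n l
  simp only [comp, logZ, logMul_field_apply]

theorem Loc.logMul_right {N : ℕ} {b' a' : FormalField M} (h : Loc N a b b' a') :
    Loc N a (logMul b) (logMul b') a' := fun v => by
  have e : compOp a' (logMul b') v = logW (compOp a' b' v) := by
    funext m k n l
    simp only [compOp, logW, logMul_field_apply]
  rw [comp_logMul_right, e, zw_pow_logW, zw_pow_logW, h v]

theorem Loc.logMul_left {N : ℕ} {b' a' : FormalField M} (h : Loc N a b b' a') :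
    Loc N (logMul a) b b' (logMul a') := h.flip.logMul_right.flip

theorem nprod_one_eq (h : Good 2 a b) (v : M) :
    (fun n e => nprod 1 a b n e v) = diag ((zw ^ 2) (comp a b v)) := by
  rw [nprod_apply' h, ← taylor_zero_eq]
  rfl

theorem nprod_zero_eq (h : Good 2 a b) (v : M) :
    (fun n e => nprod 0 a b n e v) = diag (dZ ((zw ^ 2) (comp a b v))) := by
  have := taylor_natCast 1 ((zw ^ 2) (comp a b v))
  rw [nprod_apply' h]
  norm_num at this ⊢
  exact this

theorem FormalField.ext_apply (h : ∀ v, (fun n e => a n e v) = fun n e => b n e v) : a = b := by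
  funext n e
  refine LinearMap.ext fun v => ?_
  exact congrFun (congrFun (h v) n) e

/-- The factor `log w` is constant for `∂_z` and commutes with `z - w`. -/
theorem HasOpe.log_right (h : HasOpe a b s₁ s₀) : HasOpe a (logMul b) (logMul s₁) (logMul s₀) := by
  have hg : Good 2 a (logMul b) := fun v => by
    rw [comp_logMul_right, zw_pow_logW]; exact (h.good v).logW
  have e : ∀ (s : FormalField M) (v : M),
      (fun n e => logMul s n e v) = logMul (fun n e => s n e v : Ser1 M) := fun s v => by
    funext n e
    rw [logMul_field_apply, logMul_apply]
  refine ⟨by rw [← map_neg]; exact h.loc.logMul_right, hg, FormalField.ext_apply fun v => ?_,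
    FormalField.ext_apply fun v => ?_⟩
  · rw [nprod_one_eq hg, comp_logMul_right, zw_pow_logW, diag_logW, ← nprod_one_eq h.good, e, h.prod_one]
  · rw [nprod_zero_eq hg, comp_logMul_right, zw_pow_logW, dZ_logW, diag_logW, ← nprod_zero_eq h.good, e,
      h.prod_zero]

/-- Expand `log z = log w + (z - w) w⁻¹ + ...`: the second term lowers the double pole to a simple
pole with coefficient `w⁻¹ s₁(w)`. This asymmetry between left and right is the origin of the
relation for `{ψ_m, ψ_n}`. -/
theorem HasOpe.log_left (h : HasOpe a b s₁ s₀) :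
    HasOpe (logMul a) b (logMul s₁) (logMul s₀ + invMul s₁) := by
  have hg : Good 2 (logMul a) b := fun v => by
    rw [comp_logMul_left, zw_pow_logZ]; exact (h.good v).logZ
  have e : ∀ (s : FormalField M) (v : M),
      (fun n e => logMul s n e v) = logMul (fun n e => s n e v : Ser1 M) := fun s v => by
    funext n e
    rw [logMul_field_apply, logMul_apply]
  refine ⟨h.loc.logMul_left, hg, FormalField.ext_apply fun v => ?_, FormalField.ext_apply fun v => ?_⟩
  · rw [nprod_one_eq hg, comp_logMul_left, zw_pow_logZ, diag_logZ, ← nprod_one_eq h.good, e, h.prod_one]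
  · rw [nprod_zero_eq hg, comp_logMul_left, zw_pow_logZ, dZ_logZ,
      diag_add (h.good v).dZ.logZ (h.good v).invZ, diag_logZ, diag_invZ, ← nprod_zero_eq h.good,
      ← nprod_one_eq h.good, h.prod_one, h.prod_zero, ← e]
    rfl

end Ope

/-! ### Monomials -/

section Monomials

variable {M : Type*} [AddCommGroup M] [Module ℂ M]

open Classical in
/-- The series `z^{-p-1} v`. -/
def monomial1 (p : ℂ) (v : M) : Ser1 M := fun n k => if n = p ∧ k = 0 then v else 0

open Classical in
/-- The series `z^{-p-1} w^{-q-1} v`. -/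
def monomial2 (p q : ℂ) (v : M) : Ser2 M := fun m k n l =>
  if m = p ∧ k = 0 ∧ n = q ∧ l = 0 then v else 0

theorem diagFinite_monomial2 (p q : ℂ) (v : M) : DiagFinite (monomial2 p q v) := fun n => by
  refine (Set.finite_singleton p).subset ?_
  rintro m ⟨k, l, h⟩
  by_contra hc
  rw [Set.mem_singleton_iff] at hc
  exact h (by simp [monomial2, hc])

theorem diag_monomial2 (p q : ℂ) (v : M) :
    diag (monomial2 p q v) = monomial1 (p + q + 1) v := by
  funext n e
  rw [diag, finsum_eq_single _ p, Finset.sum_eq_single 0]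
  · simp only [monomial2, monomial1, Nat.sub_zero, true_and]
    congr 1
    rw [show n - 1 - p = q ↔ n = p + q + 1 from
      ⟨fun h => by linear_combination h, fun h => by linear_combination h⟩]
  · intro k _ hk
    simp [monomial2, hk]
  · simp
  · intro m hm
    simp [monomial2, hm]

theorem dZ_monomial2 (p q : ℂ) (v : M) :
    dZ (monomial2 p q v) = (-(p + 1)) • monomial2 (p + 1) q v := by
  funext m k n l
  rw [dZ_apply]
  simp only [monomial2, Pi.smul_apply, Nat.succ_ne_zero, false_and, and_false, if_false, smul_zero,
    add_zero]
  simp only [sub_eq_iff_eq_add]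
  split_ifs with h
  · rw [h.1]
  · simp

theorem monomial1_neg_one (v : M) : monomial1 (-1) v = fun n k => oneField M n k v := by
  funext n k
  rw [oneField_apply, monomial1]

theorem monomial1_zero (v : M) : monomial1 0 v = fun n k => invMul (oneField M) n k v := by
  funext n k
  rw [invMul, oneField_apply, monomial1]
  simp only [sub_eq_iff_eq_add, neg_add_cancel]

end Monomials

/-! ### Fields with a single coset of exponents -/

section ModeField

variable {M : Type*} [AddCommGroup M] [Module ℂ M]

/-- The exponents of `a` lie in `α + ℤ` and there are no logarithms. -/
def SuppCoset (α : ℂ) (a : FormalField M) : Prop := ∀ n k, a n k ≠ 0 → k = 0 ∧ ∃ j : ℤ, n = α + j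

open Classical in
/-- The anticommutator `{a_m, b_n} = δ_{m,-n} (κ m + κ')`, for `m ∈ α + ℤ`. -/
def CanonAnticomm (α κ κ' : ℂ) (a b : FormalField M) : Prop :=
  ∀ m k n l v, a m k (b n l v) + b n l (a m k v)
    = if k = 0 ∧ l = 0 ∧ m + n = 0 ∧ ∃ j : ℤ, m = α + j then (κ * m + κ') • v else 0

open Classical in
/-- The normally ordered product `a(z) b(w) v`, with respect to `α`. -/
def normalOrder (α : ℂ) (a b : FormalField M) (v : M) : Ser2 M := fun m k n l =>
  if ∃ j : ℤ, j < 0 ∧ m = α + j then a m k (b n l v) else -(b n l (a m k v))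

variable {a b : FormalField M} {α κ κ' : ℂ}

/-- Where `a_m` stands on the left, `m` is bounded above by the ordering and below through `b`;
where it acts first on `v`, it is bounded below by the ordering and above through `a`. -/
theorem diagFinite_normalOrder (hs : SuppCoset α a) (ha : IsLogField a) (hb : IsLogField b) (v : M) :
    DiagFinite (normalOrder α a b v) := by
  intro n
  obtain ⟨S, hS⟩ := ha
  obtain ⟨T, hT⟩ := hb
  obtain ⟨N, K, h⟩ := hS v
  obtain ⟨N', K', h'⟩ := hT v
  refine (finite_bddIn {α} 0 (n.re - ((∑ β ∈ T, |β.re|) + N'))).union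
    (finite_bddIn S N α.re) |>.subset ?_
  rintro m ⟨k, l, h0⟩
  unfold normalOrder at h0
  split_ifs at h0 with h1
  · obtain ⟨j, hj, hm⟩ := h1
    refine Or.inl ⟨⟨α, by simp, j, hj.le, hm⟩, ?_⟩
    have h2 : b (n - m) l v ≠ 0 := fun h2 => h0 (by rw [h2, map_zero])
    have := BddIn.re_le (h' _ _ h2)
    simp only [Complex.sub_re] at this
    linarith
  · have h2 : a m k v ≠ 0 := fun h2 => h0 (by rw [h2, map_zero, neg_zero])
    refine Or.inr ⟨(h _ _ h2).2, ?_⟩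
    obtain ⟨-, j, hj⟩ := hs m k fun h3 => h2 (by rw [h3]; rfl)
    have h3 : 0 ≤ j := by
      by_contra h3
      exact h1 ⟨j, by omega, hj⟩
    rw [hj]
    simp only [Complex.add_re, Complex.intCast_re, le_add_iff_nonneg_right]
    exact_mod_cast h3

/-- The contraction has coefficients `κm + κ'` for `m = α + j`, `j ≥ 0`. Multiplication by `(z -
w)^2` takes second differences of this linear sequence truncated at `j = 0`; they vanish except at
`j = -1` and `j = -2`, which accounts for the two monomials. -/
theorem CanonAnticomm.zw_sq (h : CanonAnticomm α κ κ' a b) (v : M) :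
    (zw ^ 2) (comp a b v) = (zw ^ 2) (normalOrder α a b v)
      + ((κ * (1 - α) - κ') • monomial2 (α - 1) (-1 - α) v
        + (κ * α + κ') • monomial2 (α - 2) (-α) v) := by
  classical
  rw [← sub_eq_iff_eq_add', ← map_sub]
  -- The contraction, that is the difference between the product and the normally ordered product.
  let A₀ : Ser2 M := fun m k n l =>
    if k = 0 ∧ l = 0 ∧ m + n = 0 ∧ ∃ j : ℤ, 0 ≤ j ∧ m = α + j then (κ * m + κ') • v else 0
  have hA : comp a b v - normalOrder α a b v = A₀ := by
    funext m k n l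
    simp only [Pi.sub_apply, comp, normalOrder, A₀]
    split_ifs with h1 h2 h2
    · obtain ⟨-, -, -, j, hj, rfl⟩ := h2
      obtain ⟨j', hj', h1⟩ := h1
      rw [add_right_inj] at h1
      have : j = j' := by exact_mod_cast h1
      omega
    · rw [sub_self]
    · rw [sub_neg_eq_add, h, if_pos]
      exact ⟨h2.1, h2.2.1, h2.2.2.1, h2.2.2.2.imp fun _ h => h.2⟩
    · rw [sub_neg_eq_add, h, if_neg]
      rintro ⟨h3, h4, h5, j, hj⟩
      refine h2 ⟨h3, h4, h5, j, ?_, hj⟩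
      by_contra h6
      exact h1 ⟨j, by omega, hj⟩
  rw [hA]
  have hz : ∀ m k n l, (zw ^ 2) A₀ m k n l
      = A₀ (m + 2) k n l - (2 : ℂ) • A₀ (m + 1) k (n + 1) l + A₀ m k (n + 2) l := by
    intro m k n l
    rw [pow_two, Module.End.mul_apply, zw_apply, zw_apply, zw_apply,
      show m + 1 + 1 = m + 2 by ring, show n + 1 + 1 = n + 2 by ring]
    module
  have hA1 : ∀ (j : ℤ) (n : ℂ), α + j + n = 0 →
      A₀ (α + j) 0 n 0 = if 0 ≤ j then (κ * (α + j) + κ') • v else 0 := by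
    intro j n hn
    simp only [A₀, hn, true_and]
    congr 1
    refine propext ⟨?_, fun h => ⟨j, h, rfl⟩⟩
    rintro ⟨j', hj', h⟩
    rw [add_right_inj] at h
    have : j = j' := by exact_mod_cast h
    omega
  have hA2 : ∀ m k n l, ¬ (k = 0 ∧ l = 0 ∧ m + n = 0 ∧ ∃ j : ℤ, m = α + j) → A₀ m k n l = 0 := by
    intro m k n l hc
    simp only [A₀]
    rw [if_neg]
    rintro ⟨h1, h2, h3, j, -, h4⟩
    exact hc ⟨h1, h2, h3, j, h4⟩
  funext m k n l
  rw [hz]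
  by_cases hc : k = 0 ∧ l = 0 ∧ m + n + 2 = 0 ∧ ∃ j : ℤ, m = α + j
  · obtain ⟨rfl, rfl, hmn, j, rfl⟩ := hc
    have hn : n = -2 - α - j := by linear_combination hmn
    have e1 : A₀ (α + j + 2) 0 n 0 = if 0 ≤ j + 2 then (κ * (α + (j + 2 : ℤ)) + κ') • v else 0 := by
      rw [← hA1 (j + 2) n (by push_cast; linear_combination hmn)]
      push_cast
      rw [add_assoc]
    have e2 : A₀ (α + j + 1) 0 (n + 1) 0 = if 0 ≤ j + 1 then (κ * (α + (j + 1 : ℤ)) + κ') • v else 0 := by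
      rw [← hA1 (j + 1) (n + 1) (by push_cast; linear_combination hmn)]
      push_cast
      rw [add_assoc]
    rw [e1, e2, hA1 j (n + 2) (by linear_combination hmn)]
    simp only [Pi.add_apply, Pi.smul_apply, monomial2, true_and, and_true]
    have c1 : (α + j = α - 1 ∧ n = -1 - α) ↔ j = -1 := by
      constructor
      · rintro ⟨h1, -⟩
        have : (j : ℂ) = (-1 : ℤ) := by push_cast; linear_combination h1
        exact_mod_cast this
      · rintro rfl
        push_cast at hn ⊢
        exact ⟨by ring, by linear_combination hn⟩
    have c2 : (α + j = α - 2 ∧ n = -α) ↔ j = -2 := by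
      constructor
      · rintro ⟨h1, -⟩
        have : (j : ℂ) = (-2 : ℤ) := by push_cast; linear_combination h1
        exact_mod_cast this
      · rintro rfl
        push_cast at hn ⊢
        exact ⟨by ring, by linear_combination hn⟩
    simp only [c1, c2]
    rcases lt_or_ge j (-2) with hj | hj
    · rw [if_neg (by omega), if_neg (by omega), if_neg (by omega), if_neg (by omega), if_neg (by omega)]
      simp
    rcases hj.eq_or_lt with rfl | hj
    · norm_num
    rcases (show -1 ≤ j by omega).eq_or_lt with rfl | hj'
    · norm_num
      module
    · rw [if_pos (by omega), if_pos (by omega), if_pos (by omega), if_neg (by omega), if_neg (by omega)]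
      push_cast
      module
  · have h1 : monomial2 (α - 1) (-1 - α) v m k n l = 0 := by
      simp only [monomial2]
      rw [if_neg]
      rintro ⟨rfl, rfl, rfl, rfl⟩
      exact hc ⟨rfl, rfl, by ring, -1, by push_cast; ring⟩
    have h2 : monomial2 (α - 2) (-α) v m k n l = 0 := by
      simp only [monomial2]
      rw [if_neg]
      rintro ⟨rfl, rfl, rfl, rfl⟩
      exact hc ⟨rfl, rfl, by ring, -2, by push_cast; ring⟩
    rw [hA2 _ _ _ _ fun h => hc ⟨h.1, h.2.1, by linear_combination h.2.2.1, ?_⟩,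
      hA2 _ _ _ _ fun h => hc ⟨h.1, h.2.1, by linear_combination h.2.2.1, ?_⟩,
      hA2 _ _ _ _ fun h => hc ⟨h.1, h.2.1, by linear_combination h.2.2.1, h.2.2.2⟩]
    · simp only [Pi.add_apply, Pi.smul_apply, h1, h2]
      simp
    · obtain ⟨j, hj⟩ := h.2.2.2
      exact ⟨j - 1, by push_cast; linear_combination hj⟩
    · obtain ⟨j, hj⟩ := h.2.2.2
      exact ⟨j - 2, by push_cast; linear_combination hj⟩

/-- Without truncation the anticommutator is linear in `m`, and second differences of a linear
sequence vanish. -/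
theorem CanonAnticomm.loc (h : CanonAnticomm α κ κ' a b) : Loc 2 a b (-b) a := by
  classical
  intro v
  rw [← sub_eq_zero, ← map_sub]
  funext m k n l
  let A₀ : Ser2 M := fun m k n l =>
    if k = 0 ∧ l = 0 ∧ m + n = 0 ∧ ∃ j : ℤ, m = α + j then (κ * m + κ') • v else 0
  have hA : comp a b v - compOp a (-b) v = A₀ := by
    funext m k n l
    simp only [Pi.sub_apply, comp, compOp, A₀, Pi.neg_apply, LinearMap.neg_apply, sub_neg_eq_add]
    exact h m k n l v
  rw [hA, pow_two, Module.End.mul_apply, zw_apply, zw_apply, zw_apply]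
  have hj : ∀ m : ℂ, (∃ j : ℤ, m + 1 = α + j) ↔ ∃ j : ℤ, m = α + j := fun m =>
    ⟨fun ⟨j, hj⟩ => ⟨j - 1, by push_cast; linear_combination hj⟩,
      fun ⟨j, hj⟩ => ⟨j + 1, by push_cast; linear_combination hj⟩⟩
  simp only [A₀, hj]
  rw [show m + 1 + 1 + n = m + n + 2 by ring, show m + 1 + (n + 1) = m + n + 2 by ring,
    show m + (n + 1 + 1) = m + n + 2 by ring]
  split_ifs
  · simp only [Pi.zero_apply]
    module
  · simp

/-- The term `(z - w)^2` times the normally ordered product vanishes on the diagonal to second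
order, so both singular coefficients come from the two monomials. The dependence on `α` cancels. -/
theorem CanonAnticomm.hasOpe (h : CanonAnticomm α κ κ' a b) (hs : SuppCoset α a) (ha : IsLogField a)
    (hb : IsLogField b) : HasOpe a b (κ • oneField M) (κ' • invMul (oneField M)) := by
  have hg := h.loc.good hb ha
  have h1 := fun v => (diagFinite_normalOrder hs ha hb v)
  have hm1 := fun v : M => ((diagFinite_monomial2 (α - 1) (-1 - α) v).smul (κ * (1 - α) - κ'))
  have hm2 := fun v : M => ((diagFinite_monomial2 (α - 2) (-α) v).smul (κ * α + κ'))
  refine ⟨h.loc, hg, FormalField.ext_apply fun v => ?_, FormalField.ext_apply fun v => ?_⟩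
  · rw [nprod_one_eq hg, h.zw_sq, diag_add ((h1 v).zw_pow 2) ((hm1 v).add (hm2 v)),
      diag_add (hm1 v) (hm2 v), diag_smul, diag_smul, diag_monomial2, diag_monomial2, pow_two,
      Module.End.mul_apply, diag_zw (h1 v).zw, show α - 1 + (-1 - α) + 1 = -1 by ring,
      show α - 2 + -α + 1 = -1 by ring, zero_add, ← add_smul,
      show κ * (1 - α) - κ' + (κ * α + κ') = κ by ring, monomial1_neg_one]
    rfl
  · rw [nprod_zero_eq hg, h.zw_sq, map_add, map_add, map_smul, map_smul, dZ_monomial2, dZ_monomial2,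
      smul_smul, smul_smul, diag_add ((h1 v).zw_pow 2).dZ
        (((diagFinite_monomial2 _ _ v).smul _).add ((diagFinite_monomial2 _ _ v).smul _)),
      diag_add ((diagFinite_monomial2 _ _ v).smul _) ((diagFinite_monomial2 _ _ v).smul _),
      diag_smul, diag_smul, diag_monomial2, diag_monomial2, pow_two,
      Module.End.mul_apply, dZ_zw, diag_add (h1 v).zw.dZ.zw (h1 v).zw, diag_zw (h1 v).zw.dZ,
      diag_zw (h1 v), show α - 1 + 1 + (-1 - α) + 1 = 0 by ring,
      show α - 2 + 1 + -α + 1 = 0 by ring, add_zero, zero_add, ← add_smul, monomial1_zero,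
      show (κ * (1 - α) - κ') * -(α - 1 + 1) + (κ * α + κ') * -(α - 2 + 1) = κ' by ring]
    rfl

end ModeField

end SymplecticFermions
end

set_option linter.unusedSectionVars false
noncomputable section
namespace SymplecticFermions

/-! ### Pairs of mode fields -/

section ModePair

variable {M : Type*} [AddCommGroup M] [Module ℂ M]

/-- Two log-free fields with exponents in `r + ℤ` and `-r + ℤ` whose modes satisfy the relations of
the twisted mode algebra. -/
structure ModePair (r τ : ℂ) (a b : FormalField M) : Prop where
  isLog_fst : IsLogField a
  isLog_snd : IsLogField b
  supp_fst : SuppCoset r a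
  supp_snd : SuppCoset (-r) b
  fst_fst : CanonAnticomm r 0 (2 * τ) a a
  fst_snd : CanonAnticomm r 1 0 a b
  snd_snd : CanonAnticomm (-r) 0 0 b b

variable {r τ : ℂ} {a b : FormalField M}

theorem CanonAnticomm.symm {α κ : ℂ} (h : CanonAnticomm α κ 0 a b) : CanonAnticomm (-α) (-κ) 0 b a := by
  intro m k n l v
  rw [add_comm, h n l m k v]
  have e : (l = 0 ∧ k = 0 ∧ n + m = 0 ∧ ∃ j : ℤ, n = α + j)
      ↔ (k = 0 ∧ l = 0 ∧ m + n = 0 ∧ ∃ j : ℤ, m = -α + j) := by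
    constructor
    · rintro ⟨h1, h2, h3, j, h4⟩
      exact ⟨h2, h1, by rw [add_comm, h3], -j, by push_cast; linear_combination h3 - h4⟩
    · rintro ⟨h1, h2, h3, j, h4⟩
      exact ⟨h2, h1, by rw [add_comm, h3], -j, by push_cast; linear_combination h3 - h4⟩
  by_cases h1 : k = 0 ∧ l = 0 ∧ m + n = 0 ∧ ∃ j : ℤ, m = -α + j
  · rw [if_pos h1, if_pos (e.mpr h1)]
    rw [show n = -m by linear_combination h1.2.2.1]
    congr 1
    ring
  · rw [if_neg h1, if_neg (mt e.mp h1)]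

theorem ModePair.ope_fst_fst (h : ModePair r τ a b) : HasOpe a a 0 ((2 * τ) • invMul (oneField M)) :=
  (h.fst_fst.hasOpe h.supp_fst h.isLog_fst h.isLog_fst).congr (zero_smul _ _) rfl

theorem ModePair.ope_fst_snd (h : ModePair r τ a b) : HasOpe a b (oneField M) 0 :=
  (h.fst_snd.hasOpe h.supp_fst h.isLog_fst h.isLog_snd).congr (one_smul _ _) (zero_smul _ _)

theorem ModePair.ope_snd_fst (h : ModePair r τ a b) : HasOpe b a (-oneField M) 0 :=
  (h.fst_snd.symm.hasOpe h.supp_snd h.isLog_snd h.isLog_fst).congr (neg_one_smul _ _) (zero_smul _ _)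

theorem ModePair.ope_snd_snd (h : ModePair r τ a b) : HasOpe b b 0 0 :=
  (h.snd_snd.hasOpe h.supp_snd h.isLog_snd h.isLog_snd).congr (zero_smul _ _) (zero_smul _ _)

/-- The twisted fields `ψ(z)`, `ψ̄(z)` built from mode fields. -/
def pairFields (c τ : ℂ) (a b : FormalField M) (i : Fin 2) : FormalField M :=
  if i = 0 then a + ((-c) • b + (2 * τ) • logMul b) else b

theorem invMul_neg (s : FormalField M) : invMul (-s) = -invMul s := rfl

theorem HasOpe.pairFields_right (c τ : ℂ) {x s₁ : FormalField M} (hxb : HasOpe x b s₁ 0)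
    {s₁' s₀' : FormalField M} (hxa : HasOpe x a s₁' s₀') :
    HasOpe x (pairFields c τ a b 0) (s₁' + ((-c) • s₁ + (2 * τ) • logMul s₁)) s₀' :=
  (hxa.add_right ((hxb.smul_right (-c)).add_right (hxb.log_right.smul_right (2 * τ)))).congr rfl (by simp)

theorem ModePair.ope_zero_one (h : ModePair r τ a b) (c : ℂ) :
    HasOpe (pairFields c τ a b 0) b (oneField M) 0 :=
  (h.ope_fst_snd.add_left ((h.ope_snd_snd.smul_left (-c)).add_left
    (h.ope_snd_snd.log_left.smul_left (2 * τ)))).congr (by simp)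
    (by
      have : invMul (0 : FormalField M) = 0 := rfl
      simp [this])

theorem ModePair.ope_one_zero (h : ModePair r τ a b) (c : ℂ) :
    HasOpe b (pairFields c τ a b 0) (-oneField M) 0 :=
  (HasOpe.pairFields_right c τ h.ope_snd_snd h.ope_snd_fst).congr (by simp) rfl

/-- Everything cancels: the constant and logarithmic double poles of `a` with `-c b + 2τ log(z) b`
are opposite to those in the reversed order, and the simple pole `2τ z⁻¹` of `a` with itself is
removed by the derivative of the logarithm on the left. -/
theorem ModePair.ope_zero_zero (h : ModePair r τ a b) (c : ℂ) :
    HasOpe (pairFields c τ a b 0) (pairFields c τ a b 0) 0 0 :=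
  ((HasOpe.pairFields_right c τ h.ope_fst_snd h.ope_fst_fst).add_left
    (((h.ope_one_zero c).smul_left (-c)).add_left
      ((h.ope_one_zero c).log_left.smul_left (2 * τ)))).congr
    (by rw [map_neg, smul_neg, smul_neg]; abel)
    (by rw [map_zero, invMul_neg, zero_add, smul_zero, smul_neg, zero_add, add_neg_cancel])

theorem conj_logMul (π : Module.End ℂ M) (b : FormalField M) : conj π (logMul b) = logMul (conj π b) := by
  funext n k
  refine LinearMap.ext fun v => ?_
  rw [conj_apply, logMul_field_apply, logMul_field_apply, conj_apply]
  split_ifs <;> simp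

theorem IsLogField.logMul (hb : IsLogField b) : IsLogField (logMul b) := by
  obtain ⟨S, hS⟩ := hb
  refine ⟨S, fun v => ?_⟩
  obtain ⟨N, K, h⟩ := hS v
  refine ⟨N, K + 1, fun n k h0 => ?_⟩
  rw [logMul_field_apply] at h0
  split_ifs at h0 with hk
  · exact absurd rfl h0
  · obtain ⟨h1, h2⟩ := h n (k - 1) h0
    exact ⟨by omega, h2⟩

theorem ModePair.freePair (h : ModePair r τ a b) (c : ℂ) {π : Module.End ℂ M} (hπ : π * π = 1)
    (ha : conj π a = -a) (hb : conj π b = -b) : FreePair π (pairFields c τ a b) := by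
  have key : ∀ i j, HasOpe (pairFields c τ a b i) (pairFields c τ a b j) (pairing i j • oneField M) 0 := by
    intro i j
    fin_cases i <;> fin_cases j
    · exact (h.ope_zero_zero c).congr (by simp [pairing]) rfl
    · exact (h.ope_zero_one c).congr (by simp [pairing]) rfl
    · exact (h.ope_one_zero c).congr (by simp [pairing]) rfl
    · exact h.ope_snd_snd.congr (by simp [pairing]) rfl
  refine ⟨hπ, fun i => ?_, fun i => ?_, fun i j => (key i j).loc, fun i j => (key i j).prod_one,
    fun i j => (key i j).prod_zero⟩
  · fin_cases i
    · exact h.isLog_fst.add ((h.isLog_snd.smul _).add (h.isLog_snd.logMul.smul _))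
    · exact h.isLog_snd
  · fin_cases i
    · simp only [pairFields, Fin.zero_eta, if_true, map_add, map_smul, conj_logMul, ha, hb, map_neg]
      module
    · exact hb

theorem SuppCoset.isMonodromy {α : ℂ} (h : SuppCoset α a) : IsMonodromy a (expFactor α • a) := by
  intro n k v
  by_cases hn : ∃ j : ℤ, n = α + j
  · have h1 : ∀ l, 1 ≤ l → a n l v = 0 := fun l hl => by
      by_contra h0
      have := (h n l fun h1 => h0 (by rw [h1]; rfl)).1
      omega
    obtain ⟨j, rfl⟩ := hn
    rw [logShift_eq h1, Finset.sum_range_one, expFactor_add_int]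
    rcases Nat.eq_zero_or_pos k with rfl | hk
    · simp [logCoeff]
    · rw [logCoeff_of_lt hk]
      simp [h1 k hk]
  · have h1 : ∀ l, a n l = 0 := fun l => by
      by_contra h0
      exact hn (h n l h0).2
    simp [h1, logShift]

theorem SuppCoset.isMonodromy_logMul {α : ℂ} (h : SuppCoset α b) :
    IsMonodromy (logMul b) (expFactor α • (logMul b + (2 * Real.pi * Complex.I : ℂ) • b)) := by
  intro n k v
  by_cases hn : ∃ j : ℤ, n = α + j
  · have h1 : ∀ l, 1 ≤ l → b n l v = 0 := fun l hl => by
      by_contra h0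
      have := (h n l fun h1 => h0 (by rw [h1]; rfl)).1
      omega
    have h2 : ∀ l, 2 ≤ l → logMul b n l v = 0 := fun l hl => by
      rw [logMul_field_apply, if_neg (by omega), h1 _ (by omega)]
    obtain ⟨j, rfl⟩ := hn
    rw [logShift_eq h2, Finset.sum_range_succ, Finset.sum_range_one, expFactor_add_int]
    simp only [Pi.smul_apply, Pi.add_apply, LinearMap.smul_apply, LinearMap.add_apply, logMul_field_apply]
    congr 1
    rcases k with _ | _ | k
    · simp [logCoeff]
    · simp [logCoeff, h1 1 le_rfl]
    · simp [logCoeff_of_lt, h1 (k + 1) (by omega), h1 (k + 1 + 1) (by omega)]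
  · have h1 : ∀ l, b n l = 0 := fun l => by
      by_contra h0
      exact hn (h n l h0).2
    have h2 : ∀ l v, logMul b n l v = 0 := fun l v => by
      rw [logMul_field_apply, h1]
      simp
    simp [h1, h2, logShift]

/-- The matrix entries of the twist, in terms of parameters `c`, `τ` of the twisted field `ψ(z)`. -/
structure TwistData (r t : ℂ) (g : Matrix.SpecialLinearGroup (Fin 2) ℂ) (c τ : ℂ) : Prop where
  g00 : g 0 0 = expFactor r
  g01 : g 0 1 = 0
  g11 : g 1 1 = expFactor (-r)
  g10 : g 1 0 = c * (expFactor r - expFactor (-r)) + 2 * τ * (2 * Real.pi * Complex.I) * expFactor (-r)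
  cases : (τ = 0 ∧ ∀ n : ℤ, 2 * r ≠ n) ∨ (c = 0 ∧ τ = t ∧ ∃ n : ℤ, 2 * r = n)

theorem expFactor_neg_of_two_mul {r : ℂ} {n : ℤ} (h : 2 * r = n) : expFactor (-r) = expFactor r := by
  rw [show -r = r + ((-n : ℤ) : ℂ) by push_cast; linear_combination -h, expFactor_add_int]

/-- Only `ψ` requires an argument. For `τ = 0` the entry `g 1 0` is made so that `a = ψ + cψ̄` is
multiplied by `q`; for `2r ∈ ℤ` both eigenvalues agree, and the off-diagonal entry comes from the
increment `2πi` of the logarithm. -/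
theorem TwistData.isMonodromy {t c : ℂ} {g : Matrix.SpecialLinearGroup (Fin 2) ℂ}
    (hg : TwistData r t g c τ) (ha : SuppCoset r a) (hb : SuppCoset (-r) b) (hla : IsLogField a)
    (hlb : IsLogField b) (i : Fin 2) :
    IsMonodromy (pairFields c τ a b i) (∑ j, g j i • pairFields c τ a b j) := by
  have h1 := ha.isMonodromy.add ((hb.isMonodromy.smul (-c)).add (hb.isMonodromy_logMul.smul (2 * τ))
    (hlb.smul _).logPolynomial (hlb.logMul.smul _).logPolynomial) hla.logPolynomial
    ((hlb.smul _).add (hlb.logMul.smul _)).logPolynomial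
  have h2 := hb.isMonodromy
  rw [Fin.sum_univ_two]
  fin_cases i
  · simp only [pairFields, Fin.zero_eta, Fin.isValue, if_true, one_ne_zero, if_false]
    rw [hg.g00, hg.g10]
    convert h1 using 1
    rcases hg.cases with ⟨h, -⟩ | ⟨h, -, n, hn⟩
    · subst h
      module
    · subst h
      rw [expFactor_neg_of_two_mul hn]
      module
  · simp only [pairFields, Fin.mk_one, Fin.isValue, if_true, one_ne_zero, if_false]
    rw [hg.g01, hg.g11, zero_smul, zero_add]
    exact h2

end ModePair

/-! ### The twist -/

section Twist

theorem exp_sMat (r : ℂ) : NormedSpace.exp (-(2 * Real.pi * Complex.I) • sMat r)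
    = !![expFactor r, 0; 0, expFactor (-r)] := by
  have h : -(2 * Real.pi * Complex.I) • sMat r
      = Matrix.diagonal ![-(2 * Real.pi * Complex.I) * r, -(2 * Real.pi * Complex.I) * -r] := by
    ext i j
    fin_cases i <;> fin_cases j <;> simp [sMat]
  rw [h, Matrix.exp_diagonal]
  ext i j
  fin_cases i <;> fin_cases j <;>
    simp [expFactor, Pi.exp_def, ← Complex.exp_eq_exp_ℂ]

theorem exp_of_sq_eq_zero (A : Matrix (Fin 2) (Fin 2) ℂ) (hA : A ^ 2 = 0) : NormedSpace.exp A = 1 + A := by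
  rw [NormedSpace.exp_eq_tsum ℂ]
  beta_reduce
  rw [tsum_eq_sum (s := Finset.range 2)]
  · simp [Finset.sum_range_succ]
  · intro n hn
    simp only [Finset.mem_range, not_lt] at hn
    obtain ⟨m, rfl⟩ := Nat.exists_eq_add_of_le hn
    rw [pow_add, hA, zero_mul, smul_zero]

theorem exp_xMat (t : ℂ) : NormedSpace.exp (-(2 * Real.pi * Complex.I) • xMat t)
    = !![1, 0; 2 * t * (2 * Real.pi * Complex.I), 1] := by
  rw [exp_of_sq_eq_zero]
  · ext i j
    fin_cases i <;> fin_cases j <;> simp [xMat]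
    ring
  · ext i j
    fin_cases i <;> fin_cases j <;> simp [xMat, pow_two, Matrix.mul_apply]

theorem expFactor_eq_neg {r : ℂ} (h : expFactor r = expFactor (-r)) : ∃ n : ℤ, 2 * r = n := by
  rw [expFactor, expFactor, Complex.exp_eq_exp_iff_exists_int] at h
  obtain ⟨n, hn⟩ := h
  refine ⟨-n, ?_⟩
  have hpi : (2 * Real.pi * Complex.I : ℂ) ≠ 0 := Complex.two_pi_I_ne_zero
  apply mul_left_cancel₀ hpi
  push_cast
  linear_combination -hn

/-- If `2r ∉ ℤ`, the eigenvalues are distinct and division by their difference gives `c`, whatever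
`g 1 0` is; therefore only the diagonal of the second form of `g` has to be known. If `2r ∈ ℤ`, only
the first form is allowed and the exponential of the nilpotent part is read off. -/
theorem IsTwist.exists_data {r t : ℂ} {g : Matrix.SpecialLinearGroup (Fin 2) ℂ} (hg : IsTwist r t g) :
    ∃ c τ, TwistData r t g c τ := by
  have key : (∀ n : ℤ, 2 * r ≠ n) → g 0 0 = expFactor r → g 0 1 = 0 → g 1 1 = expFactor (-r) →
      ∃ c τ, TwistData r t g c τ := by
    intro hr h00 h01 h11
    have hq : expFactor r - expFactor (-r) ≠ 0 := fun h =>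
      (expFactor_eq_neg (sub_eq_zero.mp h)).elim fun n hn => hr n hn
    exact ⟨g 1 0 / (expFactor r - expFactor (-r)), 0, h00, h01, h11, by field_simp; simp, Or.inl ⟨rfl, hr⟩⟩
  rcases hg with hg | ⟨hr, hg⟩
  · rw [exp_sMat, exp_xMat] at hg
    have h00 : g 0 0 = expFactor r := by
      rw [hg]; simp [Matrix.mul_apply]
    have h01 : g 0 1 = 0 := by
      rw [hg]; simp [Matrix.mul_apply]
    have h11 : g 1 1 = expFactor (-r) := by
      rw [hg]; simp [Matrix.mul_apply]
    have h10 : g 1 0 = expFactor (-r) * (2 * t * (2 * Real.pi * Complex.I)) := by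
      rw [hg]; simp [Matrix.mul_apply]
    by_cases hr : ∃ n : ℤ, 2 * r = n
    · exact ⟨0, t, h00, h01, h11, by rw [h10]; ring, Or.inr ⟨rfl, rfl, hr⟩⟩
    · exact key (fun n hn => hr ⟨n, hn⟩) h00 h01 h11
  · have hr0 : r ≠ 0 := fun h => hr 0 (by simp [h])
    -- For `r ≠ 0` conjugation with this unipotent matrix takes `s` to `s + x`, so the exponential
    -- of the sum is again lower triangular with the same diagonal.
    let P : Matrix (Fin 2) (Fin 2) ℂ := !![1, 0; -t / r, 1]
    let Q : Matrix (Fin 2) (Fin 2) ℂ := !![1, 0; t / r, 1]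
    have hPQ : P * Q = 1 := by
      ext i j
      fin_cases i <;> fin_cases j <;> simp [P, Q, Matrix.mul_apply]
      ring
    have hQP : Q * P = 1 := mul_eq_one_comm.mp hPQ
    have hP : P⁻¹ = Q := Matrix.inv_eq_right_inv hPQ
    have hu : IsUnit P := ⟨⟨P, Q, hPQ, hQP⟩, rfl⟩
    have e : -(2 * Real.pi * Complex.I) • (sMat r + xMat t)
        = P * (-(2 * Real.pi * Complex.I) • sMat r) * P⁻¹ := by
      rw [hP]
      ext i j
      fin_cases i <;> fin_cases j <;> simp [P, Q, Matrix.mul_apply, sMat, xMat]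
      field_simp
      ring
    rw [e, Matrix.exp_conj _ _ hu, exp_sMat, hP] at hg
    refine key hr ?_ ?_ ?_
    · rw [hg]; simp [P, Q, Matrix.mul_apply]
    · rw [hg]; simp [P, Q, Matrix.mul_apply]
    · rw [hg]; simp [P, Q, Matrix.mul_apply]

end Twist

end SymplecticFermions
end

set_option linter.unusedSectionVars false
noncomputable section
namespace SymplecticFermions

/-! ### The twisted module of a restricted representation -/

section Representation

variable {M : Type*} [AddCommGroup M] [Module ℂ M]

open Classical in
/-- The field `∑_{j ∈ ℤ} u_j z^{-α-j-1}`. -/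
def modeField (α : ℂ) (u : ℤ → Module.End ℂ M) : FormalField M := fun n k =>
  if h : ∃ j : ℤ, n = α + j then (if k = 0 then u h.choose else 0) else 0

theorem modeField_add (α : ℂ) (u : ℤ → Module.End ℂ M) (j : ℤ) : modeField α u (α + j) 0 = u j := by
  have h : ∃ i : ℤ, α + (j : ℂ) = α + i := ⟨j, rfl⟩
  rw [modeField, dif_pos h, if_pos rfl]
  have h1 := h.choose_spec
  rw [add_right_inj] at h1
  have h2 : j = h.choose := by exact_mod_cast h1
  rw [← h2]

theorem suppCoset_modeField (α : ℂ) (u : ℤ → Module.End ℂ M) : SuppCoset α (modeField α u) := by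
  intro n k h
  unfold modeField at h
  split_ifs at h with h1 h2
  · exact ⟨h2, h1⟩
  · exact absurd rfl h
  · exact absurd rfl h

theorem SuppCoset.eq_modeField {α : ℂ} {a : FormalField M} (h : SuppCoset α a) {u : ℤ → Module.End ℂ M}
    (hu : ∀ j : ℤ, a (α + j) 0 = u j) : a = modeField α u := by
  funext n k
  by_cases hn : k = 0 ∧ ∃ j : ℤ, n = α + j
  · obtain ⟨rfl, j, rfl⟩ := hn
    rw [hu, modeField_add]
  · rw [not_not.mp (mt (h n k) hn), not_not.mp (mt (suppCoset_modeField α u n k) hn)]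

theorem isLogField_modeField (α : ℂ) {u : ℤ → Module.End ℂ M}
    (h : ∀ v, ∃ N : ℤ, ∀ k, N ≤ k → u k v = 0) : IsLogField (modeField α u) := by
  refine ⟨{α}, fun v => ?_⟩
  obtain ⟨N, hN⟩ := h v
  refine ⟨N, 0, fun n k h0 => ?_⟩
  obtain ⟨rfl, j, rfl⟩ := suppCoset_modeField α u n k fun h1 => h0 (by rw [h1]; rfl)
  refine ⟨le_rfl, α, by simp, j, ?_, rfl⟩
  by_contra hj
  rw [modeField_add] at h0
  exact h0 (hN j (by omega))

theorem conj_modeField {π : Module.End ℂ M} (hπ : π * π = 1) (α : ℂ) {u : ℤ → Module.End ℂ M}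
    (h : ∀ k, π * u k = -(u k * π)) : conj π (modeField α u) = -modeField α u := by
  funext n k
  change π * modeField α u n k * π = -modeField α u n k
  unfold modeField
  split_ifs with h1 h2
  · rw [h, neg_mul, mul_assoc, hπ, mul_one]
  · simp
  · simp

open Classical in
-- The second hypothesis treats indices `m` for which no mode of the other field has index `-m`:
-- there the anticommutator is zero and the prescribed constant must be so too.
theorem canonAnticomm_modeField {α β κ κ' : ℂ} {u w : ℤ → Module.End ℂ M}
    (h : ∀ i j v, u i (w j v) + w j (u i v) = if α + i + (β + j) = 0 then (κ * (α + i) + κ') • v else 0)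
    (h0 : ∀ i : ℤ, (∀ j : ℤ, -(α + i) ≠ β + j) → κ * (α + i) + κ' = 0) :
    CanonAnticomm α κ κ' (modeField α u) (modeField β w) := by
  intro m k n l v
  by_cases hm : k = 0 ∧ ∃ j : ℤ, m = α + j
  · obtain ⟨rfl, i, rfl⟩ := hm
    by_cases hn : l = 0 ∧ ∃ j : ℤ, n = β + j
    · obtain ⟨rfl, j, rfl⟩ := hn
      rw [modeField_add, modeField_add, h]
      simp
    · rw [not_not.mp (mt (suppCoset_modeField β w n l) hn)]
      simp only [LinearMap.zero_apply, map_zero, add_zero]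
      split_ifs with hc
      · rw [h0 i fun j hj => hn ⟨hc.2.1, j, by rw [← hj]; linear_combination hc.2.2.1⟩, zero_smul]
      · rfl
  · rw [not_not.mp (mt (suppCoset_modeField α u m k) hm), if_neg]
    · simp
    · rintro ⟨h1, -, -, h2⟩
      exact hm ⟨h1, h2⟩

theorem ModePair.of_rep {r t τ : ℂ} (hτ : (τ = 0 ∧ ∀ n : ℤ, 2 * r ≠ n) ∨ (τ = t ∧ ∃ n : ℤ, 2 * r = n))
    {ρ : ModeAlgebra r t →ₐ[ℂ] Module.End ℂ M} (hρ : IsRestricted r t ρ) :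
    ModePair r τ (modeField r fun k => ρ (psi r t k)) (modeField (-r) fun k => ρ (psibar r t k)) := by
  have key : ∀ (x y : ModeAlgebra r t) (c : ℂ), x * y + y * x = algebraMap ℂ _ c →
      ∀ v, ρ x (ρ y v) + ρ y (ρ x v) = c • v := by
    intro x y c h v
    have := congrArg (fun z => ρ z v) h
    simp only [map_add, map_mul, AlgHom.commutes] at this
    exact this
  refine ⟨isLogField_modeField _ fun v => ?_, isLogField_modeField _ fun v => ?_,
    suppCoset_modeField _ _, suppCoset_modeField _ _, canonAnticomm_modeField (fun i j v => ?_) fun i hi => ?_,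
    canonAnticomm_modeField (fun i j v => ?_) fun i hi => ?_, canonAnticomm_modeField (fun i j v => ?_) fun i hi => ?_⟩
  · exact (hρ v).imp fun N h k hk => (h k hk).1
  · exact (hρ v).imp fun N h k hk => (h k hk).2
  · rw [key _ _ _ (psi_psi r t i j) v]
    simp only [eq_neg_iff_add_eq_zero]
    split_ifs with h
    -- If `2r ∉ ℤ`, two indices in `r + ℤ` never add up to zero, so replacing `t` by `τ = 0` loses
    -- nothing.
    · rcases hτ with ⟨-, h1⟩ | ⟨rfl, -⟩
      · exact absurd (by push_cast; linear_combination h) (h1 (-i - j))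
      · simp
    · simp
  · rcases hτ with ⟨rfl, -⟩ | ⟨-, n, hn⟩
    · simp
    · exact absurd (by push_cast; linear_combination -hn) (hi (-n - i))
  · rw [key _ _ _ (psi_psibar r t i j) v]
    simp only [eq_neg_iff_add_eq_zero]
    split_ifs with h
    · simp
    · simp
  · exact absurd (by push_cast; ring) (hi (-i))
  · rw [key _ _ 0 (by rw [psibar_psibar, map_zero]) v]
    simp
  · simp

theorem fock_restricted (i : Fin 2) (u : Fock) : ∃ N : ℤ, ∀ k, N ≤ k → gen i k • u = 0 := by
  induction u using Fock.induction with
  | h_vac => exact ⟨0, fun k hk => gen_vac i hk⟩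
  | h_add u w hu hw =>
    obtain ⟨N, hN⟩ := hu
    obtain ⟨N', hN'⟩ := hw
    exact ⟨max N N', fun k hk => by rw [smul_add, hN k (by omega), hN' k (by omega), add_zero]⟩
  | h_smul c u hu =>
    obtain ⟨N, hN⟩ := hu
    exact ⟨N, fun k hk => by rw [gen_smul_smul, hN k hk, smul_zero]⟩
  | h_gen j l u hu =>
    obtain ⟨N, hN⟩ := hu
    refine ⟨max N (1 - l), fun k hk => ?_⟩
    have := gen_anticomm i j k l
    rw [if_neg (by omega), map_zero] at this
    rw [smul_smul, eq_neg_of_add_eq_zero_left this, neg_smul, mul_smul, hN k (by omega), smul_zero,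
      neg_zero]

theorem isRestricted_fockAction : IsRestricted 0 0 fockAction := by
  intro u
  obtain ⟨N, hN⟩ := fock_restricted 0 u
  obtain ⟨N', hN'⟩ := fock_restricted 1 u
  exact ⟨max N N', fun k hk => ⟨hN k (by omega), hN' k (by omega)⟩⟩

theorem fockFields_eq_modeField (i : Fin 2) :
    fockFields i = modeField 0 fun k => fockAction (gen i k) := by
  refine SuppCoset.eq_modeField (fun n k h => ?_) fun j => LinearMap.ext fun u => ?_
  · obtain ⟨u, hu⟩ : ∃ u, fockFields i n k u ≠ 0 := by
      by_contra hc
      simp only [not_exists, not_not] at hc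
      exact h (LinearMap.ext hc)
    obtain ⟨h1, j, h2⟩ := fockFields_ne_zero hu
    exact ⟨h1, j, by rw [h2, zero_add]⟩
  · rw [zero_add, fockFields_int]
    rfl

/-- The untwisted case is the special case `r = t = 0` of the construction, with `c = τ = 0`. -/
theorem freePair_fockFields : FreePair fockParity fockFields := by
  have h := ModePair.of_rep (τ := 0) (Or.inr ⟨rfl, 0, by simp⟩) isRestricted_fockAction
  have hodd : ∀ i k, fockParity * fockAction (gen i k) = -(fockAction (gen i k) * fockParity) :=
    fun i k => LinearMap.ext fun u => fockParity_gen i k u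
  rw [neg_zero] at h
  have h' := h.freePair 0 fockParity_sq (conj_modeField fockParity_sq _ (hodd 0))
    (conj_modeField fockParity_sq _ (hodd 1))
  convert h' using 1
  funext i
  fin_cases i
  · change fockFields 0 = _
    rw [fockFields_eq_modeField]
    simp [pairFields, gen]
  · change fockFields 1 = _
    rw [fockFields_eq_modeField]
    simp [pairFields, gen]

/-- The generators as elements of the vertex superalgebra. -/
def sfGen (i : Fin 2) : SF := if i = 0 then SF.psi else SF.psibar

theorem sfGen_val (i : Fin 2) : (sfGen i).1 = fockFields i := by
  fin_cases i
  · exact fockFields_zero.symm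
  · exact fockFields_one.symm

theorem FreePair.vertexMap_sfGen {π : Module.End ℂ M} {X : Fin 2 → FormalField M} (h : FreePair π X)
    (i : Fin 2) : h.vertexMap (sfGen i) = X i := by
  rw [h.vertexMap_apply, sfGen_val, ← freePair_fockFields.fields_gen_vac,
    (freePair_fockFields.state_fields _).2, h.fields_gen_vac]

theorem TwistData.cases' {r t c τ : ℂ} {g : Matrix.SpecialLinearGroup (Fin 2) ℂ}
    (hg : TwistData r t g c τ) : (τ = 0 ∧ ∀ n : ℤ, 2 * r ≠ n) ∨ (τ = t ∧ ∃ n : ℤ, 2 * r = n) :=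
  hg.cases.imp_right fun h => h.2

/-- The logarithmic term does not contribute to the coefficient of `(log z)^0`, and `c b` has no
exponent in `r + ℤ` unless `2r ∈ ℤ`, in which case `c = 0`. So the twisted modes of `ψ` are exactly
the modes of `a`. -/
theorem TwistData.pairFields_apply {r t c τ : ℂ} {g : Matrix.SpecialLinearGroup (Fin 2) ℂ}
    (hg : TwistData r t g c τ) {a b : FormalField M} (hb : SuppCoset (-r) b) (k : ℤ) :
    pairFields c τ a b 0 (r + k) 0 = a (r + k) 0 := by
  have h1 : (-c) • b (r + k) 0 = 0 := by
    rcases hg.cases with ⟨-, h⟩ | ⟨h, -⟩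
    · have : b (r + k) 0 = 0 := by
        by_contra hne
        obtain ⟨-, j, hj⟩ := hb _ _ hne
        exact h (j - k) (by push_cast; linear_combination hj)
      rw [this, smul_zero]
    · rw [h, neg_zero, zero_smul]
  have h2 : logMul b (r + k) 0 = 0 := by rw [logMul_apply, if_pos rfl]
  change a (r + k) 0 + ((-c) • b (r + k) 0 + (2 * τ) • logMul b (r + k) 0) = _
  rw [h1, h2]
  simp

/-- Every restricted representation comes from a twisted module. -/
theorem TwistData.exists_module {r t c τ : ℂ} {g : Matrix.SpecialLinearGroup (Fin 2) ℂ}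
    (hg : TwistData r t g c τ) {π : Module.End ℂ M} (hπ : π * π = 1)
    {ρ : ModeAlgebra r t →ₐ[ℂ] Module.End ℂ M} (hρ : IsRestricted r t ρ) (hs : IsSuperRep r t π ρ) :
    ∃ Y : SF →ₗ[ℂ] FormalField M, IsTwistedModule g π Y ∧ IsModeAction r t Y ρ := by
  have h := ModePair.of_rep hg.cases' hρ
  have hX := h.freePair c hπ (conj_modeField hπ r fun k => (hs k).1)
    (conj_modeField hπ (-r) fun k => (hs k).2)
  refine ⟨hX.vertexMap, freePair_fockFields.isTwistedModule hX
    (hg.isMonodromy h.supp_fst h.supp_snd h.isLog_fst h.isLog_snd), fun k => ⟨?_, ?_⟩⟩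
  · rw [psiMode, show SF.psi = sfGen 0 from rfl, hX.vertexMap_sfGen, hg.pairFields_apply h.supp_snd,
      modeField_add]
  · rw [psibarMode, show SF.psibar = sfGen 1 from rfl, hX.vertexMap_sfGen]
    exact (modeField_add (-r) (fun k => ρ (psibar r t k)) k).symm

/-- A twisted module is determined by the fields of the generators. -/
theorem IsTwistedModule.ext {g : Matrix.SpecialLinearGroup (Fin 2) ℂ} {π : Module.End ℂ M}
    {Y Y' : SF →ₗ[ℂ] FormalField M} (h : IsTwistedModule g π Y) (h' : IsTwistedModule g π Y')
    (hgen : ∀ i, Y (sfGen i) = Y' (sfGen i)) : Y = Y' := by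
  -- The elements on which the two maps agree form a closed space of fields, since products in `M`
  -- are unique; by minimality it is everything.
  let W : Submodule ℂ (FormalField Fock) := (LinearMap.eqLocus Y Y').map SF.subtype
  have hmem : ∀ a : SF, Y a = Y' a → a.1 ∈ W := fun a ha => ⟨a, ha, rfl⟩
  have hW : IsClosedFieldSpace W :=
    { one_mem := hmem SF.one (by rw [h.vacuum, h'.vacuum])
      psi_mem := hmem SF.psi (hgen 0)
      psibar_mem := hmem SF.psibar (hgen 1)
      nProduct_mem := by
        rintro p q j _ _ c ⟨a, ha, rfl⟩ ⟨b, hb, rfl⟩ hpa hpb hc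
        have hcS : c ∈ SF := Submodule.mem_sInf.mpr fun V hV =>
          hV.nProduct_mem p q j a.1 b.1 c (Submodule.mem_sInf.mp a.2 V hV)
            (Submodule.mem_sInf.mp b.2 V hV) hpa hpb hc
        refine hmem ⟨c, hcS⟩ ?_
        rw [(h.nProduct p q j a b ⟨c, hcS⟩ hpa hpb hc).eq_nprod (h.isLogField a) (h.isLogField b),
          (h'.nProduct p q j a b ⟨c, hcS⟩ hpa hpb hc).eq_nprod (h'.isLogField a) (h'.isLogField b)]
        rw [show Y a = Y' a from ha, show Y b = Y' b from hb] }
  refine LinearMap.ext fun a => ?_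
  obtain ⟨a', ha', he⟩ := Submodule.mem_sInf.mp a.2 W hW
  rw [← show a' = a from Subtype.ext he]
  exact ha'

end Representation

end SymplecticFermions
end

set_option linter.unusedSectionVars false
noncomputable section
namespace SymplecticFermions

/-! ### The mode relations in a twisted module -/

section Converse

variable {M : Type*} [AddCommGroup M] [Module ℂ M]

theorem logShift_top {x : ℕ → M} {K : ℕ} (hx : ∀ l, K + 1 ≤ l → x l = 0) : logShift x K = x K := by
  rw [logShift_eq hx, Finset.sum_range_succ, Finset.sum_eq_zero, zero_add]
  · simp [logCoeff]
  · intro l hl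
    rw [logCoeff_of_lt (by simpa using hl), zero_smul]

theorem logShift_second {x : ℕ → M} {K : ℕ} (hx : ∀ l, K + 2 ≤ l → x l = 0) :
    logShift x K = x K + (((K : ℂ) + 1) * (2 * Real.pi * Complex.I)) • x (K + 1) := by
  rw [logShift_eq hx, Finset.sum_range_succ, Finset.sum_range_succ, Finset.sum_eq_zero, zero_add]
  · simp [logCoeff]
  · intro l hl
    rw [logCoeff_of_lt (by simpa using hl), zero_smul]

theorem expFactor_ne_zero (n : ℂ) : expFactor n ≠ 0 := Complex.exp_ne_zero _

theorem exists_int_of_expFactor_eq {m n : ℂ} (h : expFactor m = expFactor n) : ∃ j : ℤ, n = m + j := by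
  rw [expFactor, expFactor, Complex.exp_eq_exp_iff_exists_int] at h
  obtain ⟨j, hj⟩ := h
  refine ⟨j, ?_⟩
  apply mul_left_cancel₀ Complex.two_pi_I_ne_zero
  linear_combination hj

/-- A field with diagonalizable monodromy is free of logarithms. -/
theorem suppCoset_of_isMonodromy {α : ℂ} {a : FormalField M} (ha : LogPolynomial a)
    (h : IsMonodromy a (expFactor α • a)) : SuppCoset α a := by
  classical
  intro n k hne
  obtain ⟨v, hv⟩ : ∃ v, a n k v ≠ 0 := by
    by_contra hc
    simp only [not_exists, not_not] at hc
    exact hne (LinearMap.ext hc)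
  have hE : ∃ K, ∀ l, K ≤ l → a n l v = 0 := ha n v
  -- Below, the highest power of `log z` is compared with the one before it: the highest fixes the
  -- coset of the exponent.
  obtain ⟨K, hK, hmin⟩ : ∃ K, (∀ l, K ≤ l → a n l v = 0) ∧ ∀ K' < K, ¬ ∀ l, K' ≤ l → a n l v = 0 :=
    ⟨Nat.find hE, Nat.find_spec hE, fun K' hK' => Nat.find_min hE hK'⟩
  have hk : k < K := by
    by_contra hk
    exact hv (hK k (by omega))
  obtain ⟨K, rfl⟩ : ∃ K', K = K' + 1 := ⟨K - 1, by omega⟩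
  have htop : a n K v ≠ 0 := by
    intro h0
    refine hmin K (by omega) fun l hl => ?_
    rcases hl.eq_or_lt with rfl | hl
    · exact h0
    · exact hK l hl
  have h1 := h n K v
  rw [logShift_top (x := fun l => a n l v) hK] at h1
  have h2 : expFactor α = expFactor n := by
    by_contra hc
    have : (expFactor α - expFactor n) • a n K v = 0 := by
      rw [sub_smul, sub_eq_zero]
      exact h1
    rcases smul_eq_zero.mp this with h3 | h3
    · exact hc (sub_eq_zero.mp h3)
    · exact htop h3
  refine ⟨?_, exists_int_of_expFactor_eq h2⟩
  -- If a positive power of `log z` occurred, the monodromy would add a nonzero multiple of the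
  -- highest coefficient to the preceding one.
  rcases K with _ | K
  · omega
  · have h3 := h n K v
    rw [logShift_second (x := fun l => a n l v) hK, ← h2] at h3
    have h4 : expFactor α • a n K v
        = expFactor α • (a n K v + (((K : ℂ) + 1) * (2 * Real.pi * Complex.I)) • a n (K + 1) v) := h3
    rw [smul_right_inj (expFactor_ne_zero α), left_eq_add] at h4
    rcases smul_eq_zero.mp h4 with h5 | h5
    · rcases mul_eq_zero.mp h5 with h6 | h6
      · exact absurd h6 (Nat.cast_add_one_ne_zero K)
      · exact absurd h6 Complex.two_pi_I_ne_zero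
    · exact absurd h5 htop

theorem diag_eq_sum_Ico {F : Ser2 M} {m p : ℂ} {L U : ℤ}
    (hF : ∀ m', F m' 0 (p - 1 - m') 0 ≠ 0 → ∃ i : ℤ, (L ≤ i ∧ i < U) ∧ m' = m + i) :
    diag F p 0 = ∑ i ∈ Finset.Ico L U, F (m + i) 0 (p - 1 - (m + i)) 0 := by
  classical
  have hinj : Function.Injective fun i : ℤ => m + (i : ℂ) := fun i j h => by
    simpa using h
  rw [diag, ← Finset.sum_image (s := Finset.Ico L U) (g := fun i : ℤ => m + (i : ℂ))
    (f := fun m' => F m' 0 (p - 1 - m') 0) fun i _ j _ h => hinj h]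
  simp only [zero_add, Finset.sum_range_one, Nat.sub_zero]
  refine finsum_eq_sum_of_support_subset _ fun m' hm' => ?_
  obtain ⟨i, hi, rfl⟩ := hF m' hm'
  exact Finset.mem_coe.mpr (Finset.mem_image.mpr ⟨i, Finset.mem_Ico.mpr hi, rfl⟩)

/-! ### Anticommutators from the singular part of the operator product. -/

/-- The bounds on exponents for the two orders of a product. -/
structure TwoSided (f f' : Ser2 M) (m : ℂ) (C C' : ℝ) : Prop where
  bound_w : ∀ m' k n l, f m' k n l ≠ 0 → n.re ≤ C
  bound_z : ∀ m' k n l, f' m' k n l ≠ 0 → m'.re ≤ C'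
  coset : ∀ m' n, f m' 0 n 0 ≠ 0 → ∃ i : ℤ, m' = m + i
  log_free : ∀ m' k n l, k ≠ 0 → f m' k n l = 0

theorem TwoSided.zw {f f' : Ser2 M} {m : ℂ} {C C' : ℝ} (h : TwoSided f f' m C C') :
    TwoSided (zw f) (zw f') m C C' where
  bound_w m' k n l h0 := by
    rw [zw_apply] at h0
    by_contra hc
    refine h0 ?_
    rw [not_not.mp (mt (h.bound_w (m' + 1) k n l) hc), not_not.mp (mt (h.bound_w m' k (n + 1) l) ?_), sub_zero]
    rw [Complex.add_re, Complex.one_re]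
    linarith
  bound_z m' k n l h0 := by
    rw [zw_apply] at h0
    by_contra hc
    refine h0 ?_
    rw [not_not.mp (mt (h.bound_z (m' + 1) k n l) ?_), not_not.mp (mt (h.bound_z m' k (n + 1) l) hc), sub_zero]
    rw [Complex.add_re, Complex.one_re]
    linarith
  coset m' n h0 := by
    rw [zw_apply] at h0
    by_contra hc
    refine h0 ?_
    rw [not_not.mp (mt (h.coset m' (n + 1)) hc), not_not.mp (mt (h.coset (m' + 1) n) ?_), sub_zero]
    rintro ⟨i, hi⟩
    exact hc ⟨i - 1, by push_cast; linear_combination hi⟩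
  log_free m' k n l hk := by
    rw [zw_apply, h.log_free _ _ _ _ hk, h.log_free _ _ _ _ hk, sub_zero]

theorem TwoSided.zw_pow {f f' : Ser2 M} {m : ℂ} {C C' : ℝ} (h : TwoSided f f' m C C') (N : ℕ) :
    TwoSided ((SymplecticFermions.zw ^ N) f) ((SymplecticFermions.zw ^ N) f') m C C' := by
  induction N with
  | zero => simpa using h
  | succ N ih => rw [pow_succ', Module.End.mul_apply, Module.End.mul_apply]; exact ih.zw

theorem TwoSided.exists_bounds {f f' : Ser2 M} {m : ℂ} {C C' : ℝ} (h : TwoSided f f' m C C') (n : ℂ) :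
    ∃ L U : ℤ, L ≤ U ∧ (∀ i : ℤ, i ≤ L + 1 → ∀ m', f m' 0 (n - i) 0 = 0) ∧
      (∀ i : ℤ, U ≤ i → ∀ n', f' (m + i) 0 n' 0 = 0) ∧
      (∀ i : ℤ, (n - i - 2).re ≤ C → L ≤ i) ∧ (∀ i : ℤ, (m + i).re ≤ C' → i < U) := by
  -- The margin `4` covers the shift by two in the third bound and the additional vanishing at `L +
  -- 1`.
  obtain ⟨L, hL⟩ := exists_int_lt (n.re - C - 4)
  obtain ⟨U, hU⟩ := exists_int_gt (max (L : ℝ) (C' - m.re))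
  rw [max_lt_iff] at hU
  refine ⟨L, U, by exact_mod_cast hU.1.le, fun i hi m' => ?_, fun i hi n' => ?_,
    fun i hi => ?_, fun i hi => ?_⟩
  · refine not_not.mp (mt (h.bound_w _ _ _ _) ?_)
    have : (i : ℝ) ≤ L + 1 := by exact_mod_cast hi
    simp only [Complex.sub_re, Complex.intCast_re]
    linarith
  · refine not_not.mp (mt (h.bound_z _ _ _ _) ?_)
    have : (U : ℝ) ≤ i := by exact_mod_cast hi
    simp only [Complex.add_re, Complex.intCast_re]
    linarith [hU.2]
  · simp only [Complex.sub_re, Complex.intCast_re, Complex.re_ofNat] at hi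
    have : (L : ℝ) < i := by linarith
    exact_mod_cast this.le
  · simp only [Complex.add_re, Complex.intCast_re] at hi
    have : (i : ℝ) < U := by linarith [hU.2]
    exact_mod_cast this

/-- For a fixed total exponent `f` vanishes far to the left and `f'` far to the right, while
multiplication by `z - w` takes the same first differences of both. By `sub_eq_sum_of_diff` they
differ by the sum of these differences, which is the value on the diagonal. -/
theorem TwoSided.sub_eq_diag {f f' : Ser2 M} {m : ℂ} {C C' : ℝ} (h : TwoSided f f' m C C')
    (he : SymplecticFermions.zw f = SymplecticFermions.zw f') (n : ℂ) :
    f m 0 n 0 - f' m 0 n 0 = diag (SymplecticFermions.zw f) (m + n) 0 := by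
  obtain ⟨L, U, hLU, h1, h2, h3, h4⟩ := h.exists_bounds n
  have key := sub_eq_sum_of_diff (a := fun i : ℤ => f (m + i) 0 (n - i) 0)
    (b := fun i : ℤ => f' (m + i) 0 (n - i) 0)
    (F := fun i : ℤ => SymplecticFermions.zw f (m + i) 0 (m + n - 1 - (m + i)) 0) hLU
    (fun i => by
      rw [zw_apply, show m + n - 1 - (m + i) = n - ((i + 1 : ℤ) : ℂ) by push_cast; ring]
      push_cast
      rw [← add_assoc, show n - ((i : ℂ) + 1) + 1 = n - i by ring])
    (fun i => by
      rw [he, zw_apply, show m + n - 1 - (m + i) = n - ((i + 1 : ℤ) : ℂ) by push_cast; ring]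
      push_cast
      rw [← add_assoc, show n - ((i : ℂ) + 1) + 1 = n - i by ring])
    (h1 L (by omega) _) (h2 U le_rfl _) 0
  simp only [Int.cast_zero, add_zero, sub_zero] at key
  rw [key, diag_eq_sum_Ico (m := m)]
  intro m' h0
  obtain ⟨i, rfl⟩ := h.zw.coset _ _ h0
  refine ⟨i, ⟨h3 i ?_, h4 i ?_⟩, rfl⟩
  · have := h.zw.bound_w _ _ _ _ h0
    rw [show m + n - 1 - (m + i) = n - i - 1 by ring] at this
    simp only [Complex.sub_re, Complex.one_re, Complex.re_ofNat] at this ⊢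
    linarith
  · rw [he] at h0
    exact h.zw.bound_z _ _ _ _ h0

/-- The same with second differences: the sum and the first moment of `(z - w)^2 f` on a line of
constant total exponent are the values of this series and of its `z`-derivative on the diagonal. -/
theorem TwoSided.sub_eq_diag_sq {f f' : Ser2 M} {m : ℂ} {C C' : ℝ} (h : TwoSided f f' m C C')
    (he : (SymplecticFermions.zw ^ 2) f = (SymplecticFermions.zw ^ 2) f') (n : ℂ) :
    f m 0 n 0 - f' m 0 n 0 = m • diag ((SymplecticFermions.zw ^ 2) f) (m + n - 1) 0
      + diag (SymplecticFermions.dZ ((SymplecticFermions.zw ^ 2) f)) (m + n) 0 := by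
  obtain ⟨L, U, hLU, h1, h2, h3, h4⟩ := h.exists_bounds n
  have hz : ∀ (f : Ser2 M) (i : ℤ), f (m + (i + 2 : ℤ)) 0 (n - (i + 2 : ℤ)) 0
      - (2 : ℂ) • f (m + (i + 1 : ℤ)) 0 (n - (i + 1 : ℤ)) 0 + f (m + i) 0 (n - i) 0
      = (SymplecticFermions.zw ^ 2) f (m + i) 0 (m + n - 1 - 1 - (m + i)) 0 := by
    intro f i
    rw [pow_two, Module.End.mul_apply, zw_apply, zw_apply, zw_apply]
    push_cast
    rw [show m + (i : ℂ) + 1 + 1 = m + (i + 2) by ring, show m + (i : ℂ) + 1 = m + (i + 1) by ring,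
      show m + n - 1 - 1 - (m + i) + 1 + 1 = n - i by ring,
      show m + n - 1 - 1 - (m + i) + 1 = n - ((i : ℂ) + 1) by ring,
      show m + n - 1 - 1 - (m + i) = n - ((i : ℂ) + 2) by ring]
    module
  have key := sub_eq_of_second_diff (a := fun i : ℤ => f (m + i) 0 (n - i) 0)
    (b := fun i : ℤ => f' (m + i) 0 (n - i) 0)
    (F := fun i : ℤ => (SymplecticFermions.zw ^ 2) f (m + i) 0 (m + n - 1 - 1 - (m + i)) 0) hLU
    (hz f) (fun i => by rw [he]; exact hz f' i) (fun i hi => h1 i hi _) (fun i hi => h2 i hi _) 0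
  simp only [Int.cast_zero, add_zero, sub_zero] at key
  have hF : ∀ m', (SymplecticFermions.zw ^ 2) f m' 0 (m + n - 1 - 1 - m') 0 ≠ 0 →
      ∃ i : ℤ, (L ≤ i ∧ i < U) ∧ m' = m + i := by
    intro m' h0
    obtain ⟨i, rfl⟩ := (h.zw_pow 2).coset _ _ h0
    refine ⟨i, ⟨h3 i ?_, h4 i ?_⟩, rfl⟩
    · have := (h.zw_pow 2).bound_w _ _ _ _ h0
      rwa [show m + n - 1 - 1 - (m + i) = n - i - 2 by ring] at this
    · rw [he] at h0
      exact (h.zw_pow 2).bound_z _ _ _ _ h0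
  have e1 := diag_eq_sum_Ico hF
  have e2 : diag (SymplecticFermions.dZ ((SymplecticFermions.zw ^ 2) f)) (m + n) 0
      = ∑ i ∈ Finset.Ico L U, (-(m + 1 + i)) •
        (SymplecticFermions.zw ^ 2) f (m + i) 0 (m + n - 1 - 1 - (m + i)) 0 := by
    have hd : ∀ m', SymplecticFermions.dZ ((SymplecticFermions.zw ^ 2) f) m' 0 (m + n - 1 - m') 0
        = (-m') • (SymplecticFermions.zw ^ 2) f (m' - 1) 0 (m + n - 1 - 1 - (m' - 1)) 0 := by
      intro m'
      rw [dZ_apply, (h.zw_pow 2).log_free _ _ _ _ (Nat.succ_ne_zero 0), smul_zero, add_zero,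
        show m + n - 1 - 1 - (m' - 1) = m + n - 1 - m' by ring]
    rw [diag_eq_sum_Ico (m := m + 1) (L := L) (U := U)]
    · refine Finset.sum_congr rfl fun i _ => ?_
      rw [hd, show m + 1 + (i : ℂ) - 1 = m + i by ring]
    · intro m' h0
      rw [hd] at h0
      obtain ⟨i, hi, h5⟩ := hF _ (right_ne_zero_of_smul h0)
      exact ⟨i, hi, by linear_combination h5⟩
  rw [key, e1, e2, Finset.smul_sum, Finset.smul_sum, ← Finset.sum_sub_distrib, ← Finset.sum_add_distrib]
  refine Finset.sum_congr rfl fun i _ => ?_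
  module

theorem IsLogField.re_bound {a : FormalField M} (ha : IsLogField a) (v : M) :
    ∃ C : ℝ, ∀ n k, a n k v ≠ 0 → n.re ≤ C := by
  obtain ⟨S, hS⟩ := ha
  obtain ⟨N, K, h⟩ := hS v
  exact ⟨_, fun n k h0 => BddIn.re_le (h n k h0)⟩

theorem twoSided_comp {a b b' : FormalField M} {α : ℂ} (hs : SuppCoset α a) (ha : IsLogField a)
    (hb : IsLogField b) (v : M) :
    ∃ C C', ∀ i : ℤ, TwoSided (comp a b v) (compOp a b' v) (α + i) C C' := by
  obtain ⟨C', hC'⟩ := ha.re_bound v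
  obtain ⟨C, hC⟩ := hb.re_bound v
  refine ⟨C, C', fun i => ⟨fun m' k n l h => hC n l fun h0 => h ?_, fun m' k n l h => hC' m' k fun h0 => h ?_,
    fun m' n h => ?_, fun m' k n l hk => ?_⟩⟩
  · simp only [comp, h0, map_zero]
  · simp only [compOp, h0, map_zero]
  · obtain ⟨-, j, hj⟩ := hs m' 0 fun h0 => h (by simp [comp, h0])
    exact ⟨j - i, by rw [hj]; push_cast; ring⟩
  · have : a m' k = 0 := by
      by_contra h0
      exact hk (hs _ _ h0).1
    simp [comp, this]

/-- For log-free fields with a single coset of exponents a vanishing product lowers the order of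
locality. -/
theorem loc_pred {a b : FormalField M} {α β : ℂ} (hsa : SuppCoset α a) (hsb : SuppCoset β b)
    (ha : IsLogField a) (hb : IsLogField b) {N : ℕ} (h : Loc (N + 1) a b (-b) a) (h0 : nprod N a b = 0) :
    Loc N a b (-b) a := by
  intro v
  have hz : ∀ (f : Ser2 M), (∀ m k n l, f m k n l ≠ 0 → k = 0 ∧ l = 0 ∧ ∃ j : ℤ, m = α + j) →
      ∀ N : ℕ, ∀ m k n l, ¬ (k = 0 ∧ l = 0 ∧ ∃ j : ℤ, m = α + j) → (zw ^ N) f m k n l = 0 := by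
    intro f hf N m k n l hc
    rw [zw_pow_apply]
    refine Finset.sum_eq_zero fun i _ => ?_
    rw [not_not.mp (mt (hf (m + N - i) k (n + i) l) ?_), smul_zero]
    rintro ⟨h1, h2, j, hj⟩
    exact hc ⟨h1, h2, j - N + i, by push_cast; linear_combination hj⟩
  have hf : ∀ m k n l, comp a b v m k n l ≠ 0 → k = 0 ∧ l = 0 ∧ ∃ j : ℤ, m = α + j := by
    intro m k n l h1
    obtain ⟨h2, h3⟩ := hsa m k fun h2 => h1 (by simp [comp, h2])
    exact ⟨h2, (hsb n l fun h2 => h1 (by simp [comp, h2])).1, h3⟩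
  have hf' : ∀ m k n l, compOp a (-b) v m k n l ≠ 0 → k = 0 ∧ l = 0 ∧ ∃ j : ℤ, m = α + j := by
    intro m k n l h1
    obtain ⟨h2, h3⟩ := hsa m k fun h2 => h1 (by simp [compOp, h2])
    exact ⟨h2, (hsb n l fun h2 => h1 (by simp [compOp, h2])).1, h3⟩
  funext m k n l
  by_cases hc : k = 0 ∧ l = 0 ∧ ∃ j : ℤ, m = α + j
  · obtain ⟨rfl, rfl, j, rfl⟩ := hc
    obtain ⟨C, C', hT⟩ := twoSided_comp (b' := -b) hsa ha hb v
    have he := h v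
    rw [pow_succ', Module.End.mul_apply, Module.End.mul_apply] at he
    have := ((hT j).zw_pow N).sub_eq_diag he n
    rw [← sub_eq_zero, this, ← Module.End.mul_apply, ← pow_succ']
    have h2 := nprod_apply (h.good hb ha) N (α + j + n) 0 v
    rw [h0, show ((N + 1 : ℕ) : ℤ) - 1 - N = 0 by push_cast; ring, taylor_zero_eq] at h2
    rw [← h2]
    rfl
  · rw [hz _ hf N m k n l hc, hz _ hf' N m k n l hc]

/-- The axioms of a twisted module provide locality of some unknown order. The vanishing products
lower it step by step to the order of the actual pole. -/
theorem loc_reduce {a b : FormalField M} {α β : ℂ} (hsa : SuppCoset α a) (hsb : SuppCoset β b)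
    (ha : IsLogField a) (hb : IsLogField b) {N : ℕ} (h : Loc N a b (-b) a) (K : ℕ)
    (h0 : ∀ j : ℕ, K ≤ j → nprod j a b = 0) : Loc K a b (-b) a := by
  rcases le_total N K with hN | hN
  · exact h.mono hN
  obtain ⟨i, rfl⟩ := Nat.exists_eq_add_of_le hN
  induction i with
  | zero => exact h
  | succ i ih => exact ih (loc_pred hsa hsb ha hb h (h0 _ (by omega))) (by omega)

/-- This is the converse of `CanonAnticomm.hasOpe`: once locality is reduced to order two, the
anticommutator is the discrete residue given by the first and zeroth products. -/
theorem canonAnticomm_of_nprod {a b : FormalField M} {α β κ κ' : ℂ} (hsa : SuppCoset α a)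
    (hsb : SuppCoset β b) (ha : IsLogField a) (hb : IsLogField b) {N : ℕ} (h : Loc N a b (-b) a)
    (h1 : nprod 1 a b = κ • oneField M) (h0 : nprod 0 a b = κ' • invMul (oneField M))
    (hj : ∀ j : ℕ, 2 ≤ j → nprod j a b = 0) : CanonAnticomm α κ κ' a b := by
  have hl := loc_reduce hsa hsb ha hb h 2 hj
  have hg := hl.good hb ha
  intro m k n l v
  by_cases hk : k = 0 ∧ ∃ j : ℤ, m = α + j
  · obtain ⟨rfl, j, rfl⟩ := hk
    by_cases hl0 : l = 0
    · subst hl0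
      obtain ⟨C, C', hT⟩ := twoSided_comp (b' := -b) hsa ha hb v
      have key := (hT j).sub_eq_diag_sq (hl v) n
      have e1 := congrFun (congrFun (nprod_one_eq hg v) (α + j + n - 1)) 0
      have e2 := congrFun (congrFun (nprod_zero_eq hg v) (α + j + n)) 0
      rw [h1] at e1
      rw [h0] at e2
      rw [← e1, ← e2] at key
      simp only [comp, compOp, Pi.neg_apply, LinearMap.neg_apply, sub_neg_eq_add] at key
      rw [key]
      simp only [Pi.smul_apply, LinearMap.smul_apply, invMul, oneField_apply]
      by_cases hmn : α + j + n = 0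
      · rw [if_pos ⟨by rw [hmn]; ring, trivial⟩, if_pos ⟨rfl, rfl, hmn, j, rfl⟩]
        module
      · have : α + j + n - 1 ≠ -1 := fun h => hmn (by linear_combination h)
        rw [if_neg fun h => this h.1, if_neg fun h => hmn h.2.2.1]
        simp
    · have : b n l = 0 := by
        by_contra hc
        exact hl0 (hsb _ _ hc).1
      rw [if_neg fun h => hl0 h.2.1, this]
      simp
  · have : a m k = 0 := by
      by_contra hc
      exact hk (hsa _ _ hc)
    rw [if_neg fun h => hk ⟨h.1, h.2.2.2⟩, this]
    simp

end Converse

end SymplecticFermions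
end

set_option linter.unusedSectionVars false
noncomputable section
namespace SymplecticFermions

/-! ### The structure of twisted modules -/

section Structure

variable {M : Type*} [AddCommGroup M] [Module ℂ M]

theorem isImage_sfGen (g : Matrix.SpecialLinearGroup (Fin 2) ℂ) (i : Fin 2) :
    IsImage g (sfGen i) (g 0 i • sfGen 0 + g 1 i • sfGen 1) := by
  intro n k
  refine LinearMap.ext fun u => ?_
  have e : (g 0 i • sfGen 0 + g 1 i • sfGen 1 : SF).1 = g 0 i • fockFields 0 + g 1 i • fockFields 1 := by
    rw [← sfGen_val, ← sfGen_val]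
    rfl
  rw [e, sfGen_val]
  simp only [Module.End.mul_apply, Pi.add_apply, Pi.smul_apply, LinearMap.add_apply, LinearMap.smul_apply]
  by_cases h : k = 0 ∧ ∃ j : ℤ, n = j
  · obtain ⟨rfl, j, rfl⟩ := h
    rw [fockFields_int, fockFields_int, fockFields_int, fockAut_gen_smul, Fin.sum_univ_two]
  · have h0 : ∀ i u, fockFields i n k u = 0 := fun i u => not_not.mp (mt fockFields_ne_zero h)
    simp [h0]

theorem hasParity_sfGen (i : Fin 2) : HasParity fockParity 1 (sfGen i).1 := by
  rw [hasParity_iff fockParity_sq, sfGen_val, freePair_fockFields.odd, pow_one, neg_one_smul]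

theorem FreePair.nprod_natCast {π : Module.End ℂ M} {X : Fin 2 → FormalField M} (h : FreePair π X)
    (i j : Fin 2) (m : ℕ) : nprod m (X i) (X j) = if m = 1 then pairing i j • oneField M else 0 := by
  rcases m with _ | _ | m
  · exact h.prod_zero i j
  · exact h.prod_one i j
  · rw [if_neg (by omega)]
    exact nprod_eq_zero ((h.loc i j).good (h.isLog j) (h.isLog i)) (by push_cast; omega)

variable {π : Module.End ℂ M} {g : Matrix.SpecialLinearGroup (Fin 2) ℂ} {Y : SF →ₗ[ℂ] FormalField M}

/-- The operator products are transported from the Fock space, where locality of order two is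
explicit, by compatibility of `Y` with products. All nonnegative indices are covered because the
order of the poles on `M` is not known beforehand. -/
theorem IsTwistedModule.isNProduct_sfGen (h : IsTwistedModule g π Y) (i j : Fin 2) (m : ℕ) :
    IsNProduct 1 1 m (Y (sfGen i)) (Y (sfGen j)) (if m = 1 then pairing i j • oneField M else 0) := by
  let c : SF := if m = 1 then pairing i j • SF.one else 0
  have hc : c.1 = nprod m (fockFields i) (fockFields j) := by
    rw [freePair_fockFields.nprod_natCast]
    simp only [c]
    split_ifs <;> rfl
  have hYc : Y c = if m = 1 then pairing i j • oneField M else 0 := by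
    simp only [c]
    split_ifs
    · rw [map_smul, h.vacuum]
    · rw [map_zero]
  rw [← hYc]
  refine h.nProduct 1 1 m _ _ c (hasParity_sfGen i) (hasParity_sfGen j) ?_
  rw [hc, sfGen_val, sfGen_val]
  refine isNProduct_nprod (N := 2) ?_ (freePair_fockFields.isLog i) (freePair_fockFields.isLog j) m
  rw [mul_one, pow_one, neg_one_smul]
  exact freePair_fockFields.loc i j

theorem IsTwistedModule.nprod_sfGen (h : IsTwistedModule g π Y) (i j : Fin 2) (m : ℕ) :
    nprod m (Y (sfGen i)) (Y (sfGen j)) = if m = 1 then pairing i j • oneField M else 0 :=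
  ((h.isNProduct_sfGen i j m).eq_nprod (h.isLogField _) (h.isLogField _)).symm

theorem IsTwistedModule.loc_sfGen (h : IsTwistedModule g π Y) (i j : Fin 2) :
    ∃ N, Loc N (Y (sfGen i)) (Y (sfGen j)) (-Y (sfGen j)) (Y (sfGen i)) := by
  obtain ⟨N, hN⟩ := h.isLocal 1 1 _ _ (hasParity_sfGen i) (hasParity_sfGen j)
  rw [isLocal_iff, mul_one, pow_one, neg_one_smul] at hN
  exact ⟨N, hN⟩

theorem IsTwistedModule.isMonodromy_sfGen (h : IsTwistedModule g π Y) (i : Fin 2) :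
    IsMonodromy (Y (sfGen i)) (g 0 i • Y (sfGen 0) + g 1 i • Y (sfGen 1)) := by
  have := h.monodromy _ _ (isImage_sfGen g i)
  rw [map_add, map_smul, map_smul] at this
  exact this

theorem HasOpe.nprod_natCast {a b s₁ s₀ : FormalField M} (h : HasOpe a b s₁ s₀) (m : ℕ) :
    nprod m a b = if m = 1 then s₁ else if m = 0 then s₀ else 0 := by
  rcases m with _ | _ | m
  · exact h.prod_zero
  · exact h.prod_one
  · rw [if_neg (by omega), if_neg (by omega)]
    exact nprod_eq_zero h.good (by push_cast; omega)

/-- The fields of the generators in a twisted module are given by a pair of mode fields. -/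
theorem IsTwistedModule.exists_modePair {r t c τ : ℂ} (hπ : π * π = 1) (hg : TwistData r t g c τ)
    (h : IsTwistedModule g π Y) : ∃ a, ModePair r τ a (Y (sfGen 1)) ∧
      Y (sfGen 0) = pairFields c τ a (Y (sfGen 1)) 0 ∧ conj π a = -a ∧
      conj π (Y (sfGen 1)) = -Y (sfGen 1) := by
  set P := Y (sfGen 0) with hP
  set B := Y (sfGen 1) with hB
  have hlP : IsLogField P := h.isLogField _
  have hlB : IsLogField B := h.isLogField _
  have hodd : ∀ i, conj π (Y (sfGen i)) = -Y (sfGen i) := fun i => by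
    have := (hasParity_iff hπ).mp (h.parity 1 _ (hasParity_sfGen i))
    rwa [pow_one, neg_one_smul] at this
  have hsB : SuppCoset (-r) B := by
    refine suppCoset_of_isMonodromy hlB.logPolynomial ?_
    have := h.isMonodromy_sfGen 1
    rwa [hg.g01, hg.g11, zero_smul, zero_add] at this
  -- This choice inverts `pairFields`: `ψ + R` should be the logarithm-free field `a`, with
  -- monodromy the scalar `q`.
  set R := c • B + (-(2 * τ)) • logMul B with hR
  set A := P + R with hA
  have hlR : IsLogField R := (hlB.smul _).add (hlB.logMul.smul _)
  have hlA : IsLogField A := hlP.add hlR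
  have hsA : SuppCoset r A := by
    refine suppCoset_of_isMonodromy hlA.logPolynomial ?_
    have h1 := (h.isMonodromy_sfGen 0).add ((hsB.isMonodromy.smul c).add
      (hsB.isMonodromy_logMul.smul (-(2 * τ))) (hlB.smul _).logPolynomial
      (hlB.logMul.smul _).logPolynomial) hlP.logPolynomial hlR.logPolynomial
    convert h1 using 1
    rw [hg.g00, hg.g10, hA, hR, ← hP, ← hB]
    rcases hg.cases with ⟨h2, -⟩ | ⟨h2, -, n, hn⟩
    · rw [h2]
      module
    · rw [h2, expFactor_neg_of_two_mul hn]
      module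
  obtain ⟨N₁, hPP⟩ := h.loc_sfGen 0 0
  obtain ⟨N₂, hPB⟩ := h.loc_sfGen 0 1
  obtain ⟨N₃, hBB⟩ := h.loc_sfGen 1 1
  -- The field `B` comes first: the operator products of its logarithmic multiples are needed to
  -- handle `A` with `B`, and these in turn for `A` with itself.
  have hcBB : CanonAnticomm (-r) 0 0 B B := by
    refine canonAnticomm_of_nprod hsB hsB hlB hlB hBB ?_ ?_ fun j hj => ?_
    · have := h.nprod_sfGen 1 1 1
      simpa [pairing] using this
    · have := h.nprod_sfGen 1 1 0
      simpa using this
    · have := h.nprod_sfGen 1 1 j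
      rwa [if_neg (by omega)] at this
  have oBB : HasOpe B B 0 0 :=
    (hcBB.hasOpe hsB hlB hlB).congr (zero_smul _ _) (zero_smul _ _)
  have hinv : invMul (0 : FormalField M) = 0 := rfl
  have oRB : HasOpe R B 0 0 :=
    ((oBB.smul_left c).add_left (oBB.log_left.smul_left _)).congr (by simp) (by simp [hinv])
  have hcAB : CanonAnticomm r 1 0 A B := by
    have hn : ∀ m : ℕ, nprod m A B = if m = 1 then oneField M else 0 := fun m => by
      rw [hA, nprod_add_left (hPB.good hlB hlP) oRB.good, h.nprod_sfGen 0 1 m, oRB.nprod_natCast]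
      simp [pairing]
    refine canonAnticomm_of_nprod hsA hsB hlA hlB (hPB.add_left oRB.loc) ?_ ?_ fun j hj => ?_
    · simpa using hn 1
    · simpa using hn 0
    · rw [hn, if_neg (by omega)]
  have oAB : HasOpe A B (oneField M) 0 :=
    (hcAB.hasOpe hsA hlA hlB).congr (one_smul _ _) (zero_smul _ _)
  have oBA : HasOpe B A (-oneField M) 0 :=
    (hcAB.symm.hasOpe hsB hlB hlA).congr (neg_one_smul _ _) (zero_smul _ _)
  have oRR : HasOpe R R 0 0 :=
    ((oRB.smul_right c).add_right (oRB.log_right.smul_right _)).congr (by simp) (by simp)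
  have hPA : P = A + (-1 : ℂ) • R := by rw [hA]; module
  have oAR := (oAB.smul_right c).add_right (oAB.log_right.smul_right (-(2 * τ)))
  rw [← hR] at oAR
  have oRA := (oBA.smul_left c).add_left (oBA.log_left.smul_left (-(2 * τ)))
  rw [← hR] at oRA
  have oPR := oAR.add_left (oRR.smul_left (-1))
  have oRP := oRA.add_right (oRR.smul_right (-1))
  rw [← hPA] at oPR oRP
  -- Expand `A = P + R` on both sides. In the first product the mixed terms cancel; in the zeroth
  -- one the logarithm on the left leaves `2τ z⁻¹`.
  have hn : ∀ m : ℕ, nprod m A A = if m = 0 then (2 * τ) • invMul (oneField M) else 0 := fun m => by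
    have e : nprod m A A = nprod m P P + nprod m P R + (nprod m R P + nprod m R R) := by
      have gPP : Good (max N₁ 2) P P := (hPP.mono (le_max_left _ _)).good hlP hlP
      rw [hA, nprod_add_left (gPP.add_right (oPR.good.mono (le_max_right _ _)))
        (oRP.good.add_right oRR.good), nprod_add_right gPP oPR.good, nprod_add_right oRP.good oRR.good]
    rw [e, h.nprod_sfGen 0 0 m, oPR.nprod_natCast, oRP.nprod_natCast, oRR.nprod_natCast]
    by_cases h1 : m = 1
    · subst h1
      simp only [if_true, one_ne_zero, if_false, smul_zero, add_zero, smul_neg, map_neg]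
      simp only [pairing, neg_smul]
      simp
      abel
    · by_cases h2 : m = 0
      · subst h2
        simp [invMul_neg]
      · simp [h1, h2]
  have hlAA : ∃ N, Loc N A A (-A) A := by
    have := (hPP.add_right oPR.loc).add_left (oRP.loc.add_right oRR.loc)
    rw [← neg_add] at this
    exact ⟨_, this⟩
  obtain ⟨N, hlAA⟩ := hlAA
  have hcAA : CanonAnticomm r 0 (2 * τ) A A := by
    refine canonAnticomm_of_nprod hsA hsA hlA hlA hlAA ?_ ?_ fun j hj => ?_
    · simpa using hn 1
    · simpa using hn 0
    · rw [hn, if_neg (by omega)]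
  refine ⟨A, ⟨hlA, hlB, hsA, hsB, hcAA, hcAB, hcBB⟩, ?_, ?_, hodd 1⟩
  · rw [pairFields, if_pos rfl, hA, hR]
    module
  · rw [hA, hR, map_add, map_add, map_smul, map_smul, conj_logMul, hodd 0, hodd 1, map_neg]
    module

end Structure

/-! ### Twisted modules and representations of the mode algebra. -/

section Correspondence

variable {M : Type*} [AddCommGroup M] [Module ℂ M]

theorem CanonAnticomm.mul_add_mul {α κ κ' : ℂ} {a b : FormalField M} (h : CanonAnticomm α κ κ' a b)
    (j : ℤ) (n : ℂ) : a (α + j) 0 * b n 0 + b n 0 * a (α + j) 0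
      = algebraMap ℂ (Module.End ℂ M)
        (open Classical in if α + j = -n then κ * (α + j) + κ' else 0) := by
  refine LinearMap.ext fun v => ?_
  have := h (α + j) 0 n 0 v
  rw [LinearMap.add_apply, Module.End.mul_apply, Module.End.mul_apply, this,
    Module.algebraMap_end_apply]
  by_cases hn : α + j = -n
  · rw [if_pos hn, if_pos ⟨rfl, rfl, by rw [hn]; ring, j, rfl⟩]
  · rw [if_neg hn, if_neg fun h => hn (by linear_combination h.2.2.1), zero_smul]

theorem ModePair.exists_rep {r t τ : ℂ}
    (hτ : (τ = 0 ∧ ∀ n : ℤ, 2 * r ≠ n) ∨ (τ = t ∧ ∃ n : ℤ, 2 * r = n)) {a b : FormalField M}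
    (h : ModePair r τ a b) : ∃ ρ : ModeAlgebra r t →ₐ[ℂ] Module.End ℂ M, IsRestricted r t ρ ∧
      ∀ k : ℤ, ρ (psi r t k) = a (r + k) 0 ∧ ρ (psibar r t k) = b (-r + k) 0 := by
  let f : Gen → Module.End ℂ M := fun x => match x with
    | Gen.psi k => a (r + k) 0
    | Gen.psibar k => b (-r + k) 0
  have hf : ∀ ⦃x y⦄, ModeRel r t x y → FreeAlgebra.lift ℂ f x = FreeAlgebra.lift ℂ f y := by
    intro x y hxy
    cases hxy with
    | psi_psi k l =>
      simp only [map_add, map_mul, FreeAlgebra.lift_ι_apply, AlgHom.commutes, f]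
      rw [h.fst_fst.mul_add_mul]
      congr 1
      by_cases hkl : r + k = -(r + l)
      · rw [if_pos hkl, if_pos hkl]
        rcases hτ with ⟨-, h2⟩ | ⟨h2, -⟩
        · exact absurd (by push_cast; linear_combination hkl) (h2 (-k - l))
        · rw [h2]; ring
      · rw [if_neg hkl, if_neg hkl]
    | psi_psibar k l =>
      simp only [map_add, map_mul, FreeAlgebra.lift_ι_apply, AlgHom.commutes, f]
      rw [h.fst_snd.mul_add_mul, one_mul, add_zero]
    | psibar_psibar k l =>
      simp only [map_add, map_mul, FreeAlgebra.lift_ι_apply, map_zero, f]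
      rw [h.snd_snd.mul_add_mul]
      simp
  let ρ : ModeAlgebra r t →ₐ[ℂ] Module.End ℂ M :=
    RingQuot.liftAlgHom ℂ (s := ModeRel r t) ⟨FreeAlgebra.lift ℂ f, hf⟩
  have hρ : ∀ x, ρ (mkMode r t (FreeAlgebra.ι ℂ x)) = f x := fun x => by
    rw [← FreeAlgebra.lift_ι_apply (R := ℂ) f x]
    exact RingQuot.liftAlgHom_mkAlgHom_apply ℂ _ hf _
  refine ⟨ρ, fun v => ?_, fun k => ⟨hρ _, hρ _⟩⟩
  obtain ⟨C, hC⟩ := h.isLog_fst.re_bound v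
  obtain ⟨C', hC'⟩ := h.isLog_snd.re_bound v
  refine ⟨max (⌊C - r.re⌋ + 1) (⌊C' + r.re⌋ + 1), fun k hk => ⟨?_, ?_⟩⟩
  · rw [psi, hρ]
    by_contra h0
    have h1 := hC _ _ h0
    have h2 := Int.floor_lt.mp (lt_of_lt_of_le (Int.lt_succ_self _) ((le_max_left _ _).trans hk))
    simp at h1
    linarith
  · rw [psibar, hρ]
    by_contra h0
    have h1 := hC' _ _ h0
    have h2 := Int.floor_lt.mp (lt_of_lt_of_le (Int.lt_succ_self _) ((le_max_right _ _).trans hk))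
    simp at h1
    linarith

theorem mul_eq_neg_mul_of_conj {π : Module.End ℂ M} (hπ : π * π = 1) {a : FormalField M}
    (h : conj π a = -a) (n : ℂ) (k : ℕ) : π * a n k = -(a n k * π) := by
  have := (hasParity_iff (p := 1) hπ).mpr (by rw [h, pow_one, neg_one_smul]) n k
  rwa [pow_one, neg_one_smul] at this

variable {π : Module.End ℂ M} {g : Matrix.SpecialLinearGroup (Fin 2) ℂ} {Y : SF →ₗ[ℂ] FormalField M}
  {r t c τ : ℂ}

theorem IsTwistedModule.exists_rep (hπ : π * π = 1) (hg : TwistData r t g c τ)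
    (h : IsTwistedModule g π Y) : ∃ ρ : ModeAlgebra r t →ₐ[ℂ] Module.End ℂ M,
      IsModeAction r t Y ρ ∧ IsRestricted r t ρ ∧ IsSuperRep r t π ρ := by
  obtain ⟨a, hab, hY, ha, hb⟩ := h.exists_modePair hπ hg
  obtain ⟨ρ, hr, hρ⟩ := hab.exists_rep hg.cases'
  refine ⟨ρ, fun k => ⟨?_, (hρ k).2⟩, hr, fun k => ?_⟩
  · rw [(hρ k).1, psiMode, show SF.psi = sfGen 0 from rfl, hY, hg.pairFields_apply hab.supp_snd]
  · rw [(hρ k).1, (hρ k).2]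
    exact ⟨mul_eq_neg_mul_of_conj hπ ha _ _, mul_eq_neg_mul_of_conj hπ hb _ _⟩

/-- The fields `a` and `b` are logarithm-free with one coset of exponents, so they are recovered
from the twisted modes; `c` and `τ` depend only on `g`, so `ψ` and `ψ̄` are recovered as well, and
these determine `Y`. -/
theorem IsTwistedModule.eq_of_isModeAction (hπ : π * π = 1) (hg : TwistData r t g c τ)
    (h : IsTwistedModule g π Y) {Y' : SF →ₗ[ℂ] FormalField M} (h' : IsTwistedModule g π Y')
    {ρ : ModeAlgebra r t →ₐ[ℂ] Module.End ℂ M} (hρ : IsModeAction r t Y ρ)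
    (hρ' : IsModeAction r t Y' ρ) : Y = Y' := by
  obtain ⟨a, hab, hY, -, -⟩ := h.exists_modePair hπ hg
  obtain ⟨a', hab', hY', -, -⟩ := h'.exists_modePair hπ hg
  have h1 : Y (sfGen 1) = Y' (sfGen 1) :=
    (hab.supp_snd.eq_modeField fun k => ((hρ k).2.symm.trans (hρ' k).2)).trans
      (hab'.supp_snd.eq_modeField fun _ => rfl).symm
  have h2 : a = a' := by
    refine (hab.supp_fst.eq_modeField fun k => ?_).trans (hab'.supp_fst.eq_modeField fun _ => rfl).symm
    rw [← hg.pairFields_apply (a := a) hab.supp_snd, ← hg.pairFields_apply (a := a') hab'.supp_snd, ← hY, ← hY']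
    exact (hρ k).1.symm.trans (hρ' k).1
  refine h.ext h' fun i => ?_
  fin_cases i
  · change Y (sfGen 0) = Y' (sfGen 0)
    rw [hY, hY', h1, h2]
  · exact h1

end Correspondence

end SymplecticFermions
end

set_option linter.unusedSectionVars false
noncomputable section
namespace SymplecticFermions

/-! ### Faithfulness of the restricted representations -/

section Faithful

/-- The generator of the mode algebra for a symbol. -/
def modeGen (r t : ℂ) (x : Gen) : ModeAlgebra r t := mkMode r t (FreeAlgebra.ι ℂ x)

open Classical in
/-- The anticommutators of the generators of the mode algebra. -/
def genForm (r t : ℂ) : Gen → Gen → ℂ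
  | Gen.psi k, Gen.psi l => if r + k = -(r + l) then 2 * t else 0
  | Gen.psi k, Gen.psibar l => if r + k = -(-r + l) then r + k else 0
  | Gen.psibar l, Gen.psi k => if r + k = -(-r + l) then r + k else 0
  | Gen.psibar _, Gen.psibar _ => 0

/-- The integer labelling a symbol. -/
def Gen.index : Gen → ℤ
  | Gen.psi k => k
  | Gen.psibar k => k

variable {r t : ℂ}

theorem genForm_comm (x y : Gen) : genForm r t x y = genForm r t y x := by
  cases x with
  | psi k =>
    cases y with
    | psi l =>
      simp only [genForm]
      by_cases h : r + (k : ℂ) = -(r + l)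
      · rw [if_pos h, if_pos (by rw [h, neg_neg])]
      · rw [if_neg h, if_neg fun h' => h (by rw [h', neg_neg])]
    | psibar l => rfl
  | psibar k =>
    cases y with
    | psi l => rfl
    | psibar l => rfl

theorem modeGen_anticomm (x y : Gen) : modeGen r t x * modeGen r t y + modeGen r t y * modeGen r t x
    = algebraMap ℂ _ (genForm r t x y) := by
  cases x with
  | psi k =>
    cases y with
    | psi l => exact psi_psi r t k l
    | psibar l => exact psi_psibar r t k l
  | psibar k =>
    cases y with
    | psi l =>
      rw [add_comm]
      exact psi_psibar r t l k
    | psibar l =>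
      rw [show genForm r t (Gen.psibar k) (Gen.psibar l) = 0 from rfl, map_zero]
      exact psibar_psibar r t k l

/-- Operators with the anticommutators of the generators define a representation. -/
theorem exists_rep_of_anticomm {M : Type*} [AddCommGroup M] [Module ℂ M] (T : Gen → Module.End ℂ M)
    (hT : ∀ x y, T x * T y + T y * T x = algebraMap ℂ _ (genForm r t x y)) :
    ∃ ρ : ModeAlgebra r t →ₐ[ℂ] Module.End ℂ M, ∀ x, ρ (modeGen r t x) = T x := by
  have hf : ∀ ⦃x y⦄, ModeRel r t x y → FreeAlgebra.lift ℂ T x = FreeAlgebra.lift ℂ T y := by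
    intro x y hxy
    cases hxy with
    | psi_psi k l =>
      simp only [map_add, map_mul, FreeAlgebra.lift_ι_apply, AlgHom.commutes]
      exact hT _ _
    | psi_psibar k l =>
      simp only [map_add, map_mul, FreeAlgebra.lift_ι_apply, AlgHom.commutes]
      exact hT _ _
    | psibar_psibar k l =>
      simp only [map_add, map_mul, FreeAlgebra.lift_ι_apply, map_zero]
      rw [hT, show genForm r t (Gen.psibar k) (Gen.psibar l) = 0 from rfl, map_zero]
  refine ⟨RingQuot.liftAlgHom ℂ (s := ModeRel r t) ⟨FreeAlgebra.lift ℂ T, hf⟩, fun x => ?_⟩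
  rw [← FreeAlgebra.lift_ι_apply (R := ℂ) T x]
  exact RingQuot.liftAlgHom_mkAlgHom_apply ℂ _ hf _

theorem eventually_genForm_eq_zero (y : Gen) :
    ∃ K : ℤ, ∀ x : Gen, K ≤ x.index → genForm r t x y = 0 := by
  -- A symbol pairing with `y` has index `-y.index`, or `-y.index - 2r` if both are of type `psi`;
  -- in the latter case `2r` is an integer and equals the floor used here.
  refine ⟨|y.index| + |⌊2 * r.re⌋| + 2, fun x hx => ?_⟩
  have h1 := neg_abs_le y.index
  have h2 := neg_abs_le ⌊2 * r.re⌋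
  have h3 := abs_nonneg ⌊2 * r.re⌋
  have h4 := abs_nonneg y.index
  cases x with
  | psi k =>
    cases y with
    | psi l =>
      refine if_neg fun h => ?_
      have h' : 2 * r.re = ((-k - l : ℤ) : ℝ) := by
        have := congrArg Complex.re h
        simp at this
        push_cast
        linarith
      rw [h', Int.floor_intCast] at h2 hx
      simp only [Gen.index] at *
      have := neg_abs_le (-k - l)
      have := le_abs_self (-k - l)
      have := neg_le_abs (-k - l)
      omega
    | psibar l =>
      refine if_neg fun h => ?_
      have : ((k + l : ℤ) : ℂ) = 0 := by push_cast; linear_combination h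
      have : k + l = 0 := by exact_mod_cast this
      simp only [Gen.index] at *
      omega
  | psibar k =>
    cases y with
    | psi l =>
      refine if_neg fun h => ?_
      have : ((k + l : ℤ) : ℂ) = 0 := by push_cast; linear_combination h
      have : k + l = 0 := by exact_mod_cast this
      simp only [Gen.index] at *
      omega
    | psibar l => rfl

/-- Mode indices of large positive real part never sum to zero, so all sufficiently high generators
anticommute. -/
theorem exists_isotropic (r t : ℂ) :
    ∃ K : ℤ, ∀ x y : Gen, K ≤ x.index → K ≤ y.index → genForm r t x y = 0 := by
  refine ⟨max 1 (⌊-r.re⌋ + 1), fun x y hx hy => ?_⟩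
  cases x with
  | psi k =>
    cases y with
    | psi l =>
      refine if_neg fun h => ?_
      have := congrArg Complex.re h
      simp at this
      have h1 := Int.floor_lt.mp (lt_of_lt_of_le (Int.lt_succ_self _) ((le_max_right _ _).trans hx))
      have h2 := Int.floor_lt.mp (lt_of_lt_of_le (Int.lt_succ_self _) ((le_max_right _ _).trans hy))
      simp only [Gen.index] at *
      linarith
    | psibar l =>
      refine if_neg fun h => ?_
      have : ((k + l : ℤ) : ℂ) = 0 := by push_cast; linear_combination h
      have : k + l = 0 := by exact_mod_cast this
      simp only [Gen.index] at *
      omega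
  | psibar k =>
    cases y with
    | psi l =>
      refine if_neg fun h => ?_
      have : ((k + l : ℤ) : ℂ) = 0 := by push_cast; linear_combination h
      have : k + l = 0 := by exact_mod_cast this
      simp only [Gen.index] at *
      omega
    | psibar l => rfl

/-! ### A faithful action on an exterior algebra. -/

/-- The space spanned by the symbols of index less than `K`. -/
abbrev LowSpace (K : ℤ) : Type := {x : Gen // x.index < K} →₀ ℂ

/-- The Fock space on which the generators of index at least `K` act by contractions. -/
abbrev LowFock (K : ℤ) : Type := CliffordAlgebra (0 : QuadraticForm ℂ (LowSpace K))

/-- The image of a generator in the span of the symbols of low index. -/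
def lowVec (K : ℤ) (x : Gen) : LowSpace K := if h : x.index < K then Finsupp.single ⟨x, h⟩ 1 else 0

/-- The functional by which a generator is contracted. -/
def lowDual (r t : ℂ) (K : ℤ) (x : Gen) : Module.Dual ℂ (LowSpace K) :=
  Finsupp.linearCombination ℂ fun y => (if x.index < K then 1 / 2 else 1) * genForm r t x y

/-- The action of a generator on `LowFock K`. -/
def lowOp (r t : ℂ) (K : ℤ) (x : Gen) : Module.End ℂ (LowFock K) :=
  LinearMap.mulLeft ℂ (CliffordAlgebra.ι _ (lowVec K x)) + CliffordAlgebra.contractLeft (lowDual r t K x)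

theorem lowOp_apply (K : ℤ) (x : Gen) (v : LowFock K) : lowOp r t K x v
    = CliffordAlgebra.ι _ (lowVec K x) * v + CliffordAlgebra.contractLeft (lowDual r t K x) v := rfl

theorem lowDual_single (K : ℤ) (x : Gen) (y : {y : Gen // y.index < K}) (c : ℂ) :
    lowDual r t K x (Finsupp.single y c) = c * ((if x.index < K then 1 / 2 else 1) * genForm r t x y) := by
  rw [lowDual, Finsupp.linearCombination_single, smul_eq_mul]

/-- Two low generators are contracted in both orders, which explains the factor `1/2`; a low and a
high generator are contracted only once; for two high generators the form vanishes by the choice of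
`K`. -/
theorem lowDual_lowVec {K : ℤ} (hK : ∀ x y : Gen, K ≤ x.index → K ≤ y.index → genForm r t x y = 0)
    (x y : Gen) : lowDual r t K x (lowVec K y) + lowDual r t K y (lowVec K x) = genForm r t x y := by
  unfold lowVec
  split_ifs with h1 h2 h2
  · rw [lowDual_single, lowDual_single, if_pos h1, if_pos h2, genForm_comm y x]
    ring
  · rw [lowDual_single, if_neg h2, map_zero]
    ring
  · rw [lowDual_single, if_neg h1, map_zero, genForm_comm y x]
    ring
  · rw [map_zero, map_zero, hK _ _ (not_lt.mp h2) (not_lt.mp h1), add_zero]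

/-- Left multiplications anticommute, contractions anticommute, and a contraction with a
multiplication produces the value of the functional. The symmetrized pairing is the required form.
-/
theorem lowOp_anticomm {K : ℤ} (hK : ∀ x y : Gen, K ≤ x.index → K ≤ y.index → genForm r t x y = 0)
    (x y : Gen) : lowOp r t K x * lowOp r t K y + lowOp r t K y * lowOp r t K x
      = algebraMap ℂ _ (genForm r t x y) := by
  refine LinearMap.ext fun v => ?_
  have h := CliffordAlgebra.ι_mul_ι_add_swap (Q := (0 : QuadraticForm ℂ (LowSpace K)))
    (lowVec K x) (lowVec K y)
  have h0 : QuadraticMap.polar (0 : QuadraticForm ℂ (LowSpace K)) (lowVec K x) (lowVec K y) = 0 := by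
    simp [QuadraticMap.polar]
  rw [h0, map_zero] at h
  rw [LinearMap.add_apply, Module.End.mul_apply, Module.End.mul_apply, Module.algebraMap_end_apply,
    ← lowDual_lowVec hK x y]
  simp only [lowOp_apply, map_add, CliffordAlgebra.contractLeft_ι_mul, ← mul_assoc]
  rw [eq_neg_of_add_eq_zero_left h, CliffordAlgebra.contractLeft_comm (lowDual r t K x)]
  rw [add_smul, neg_mul]
  abel

theorem involute_contractLeft {V : Type*} [AddCommGroup V] [Module ℂ V] {Q : QuadraticForm ℂ V}
    (d : Module.Dual ℂ V) (v : CliffordAlgebra Q) :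
    CliffordAlgebra.involute (CliffordAlgebra.contractLeft d v)
      = -CliffordAlgebra.contractLeft d (CliffordAlgebra.involute v) := by
  induction v using CliffordAlgebra.left_induction with
  | algebraMap c => simp
  | add x y hx hy => simp only [map_add, hx, hy, neg_add]
  | ι_mul x m hx =>
    rw [CliffordAlgebra.contractLeft_ι_mul, map_sub, map_smul, map_mul, map_mul, hx,
      CliffordAlgebra.involute_ι, neg_mul, neg_mul, map_neg, CliffordAlgebra.contractLeft_ι_mul]
    simp

theorem involute_lowOp (K : ℤ) (x : Gen) :
    CliffordAlgebra.involute.toLinearMap * lowOp r t K x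
      = -(lowOp r t K x * CliffordAlgebra.involute.toLinearMap) := by
  refine LinearMap.ext fun v => ?_
  simp only [Module.End.mul_apply, LinearMap.neg_apply, lowOp_apply, AlgHom.toLinearMap_apply, map_add,
    map_mul, CliffordAlgebra.involute_ι, involute_contractLeft]
  rw [neg_mul, neg_add]

theorem lowDual_eventually_zero (K : ℤ) (u : LowSpace K) :
    ∃ N : ℤ, ∀ x : Gen, N ≤ x.index → lowDual r t K x u = 0 := by
  induction u using Finsupp.induction_linear with
  | zero => exact ⟨0, fun x _ => map_zero _⟩
  | add u v hu hv =>
    obtain ⟨N, hN⟩ := hu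
    obtain ⟨N', hN'⟩ := hv
    exact ⟨max N N', fun x hx => by
      rw [map_add, hN x ((le_max_left _ _).trans hx), hN' x ((le_max_right _ _).trans hx), add_zero]⟩
  | single y c =>
    obtain ⟨N, hN⟩ := eventually_genForm_eq_zero (r := r) (t := t) y
    exact ⟨N, fun x hx => by rw [lowDual_single, hN x hx, mul_zero, mul_zero]⟩

theorem contractLeft_lowDual_eventually_zero (K : ℤ) (v : LowFock K) :
    ∃ N : ℤ, ∀ x : Gen, N ≤ x.index → CliffordAlgebra.contractLeft (lowDual r t K x) v = 0 := by
  induction v using CliffordAlgebra.left_induction with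
  | algebraMap c => exact ⟨0, fun x _ => CliffordAlgebra.contractLeft_algebraMap _ _ _⟩
  | add u v hu hv =>
    obtain ⟨N, hN⟩ := hu
    obtain ⟨N', hN'⟩ := hv
    exact ⟨max N N', fun x hx => by
      rw [map_add, hN x ((le_max_left _ _).trans hx), hN' x ((le_max_right _ _).trans hx), add_zero]⟩
  | ι_mul v u hv =>
    obtain ⟨N, hN⟩ := hv
    obtain ⟨N', hN'⟩ := lowDual_eventually_zero (r := r) (t := t) K u
    exact ⟨max N N', fun x hx => by
      rw [CliffordAlgebra.contractLeft_ι_mul, hN x ((le_max_left _ _).trans hx),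
        hN' x ((le_max_right _ _).trans hx), zero_smul, mul_zero, sub_zero]⟩

theorem lowOp_eventually_zero (K : ℤ) (v : LowFock K) :
    ∃ N : ℤ, ∀ x : Gen, N ≤ x.index → lowOp r t K x v = 0 := by
  obtain ⟨N, hN⟩ := contractLeft_lowDual_eventually_zero (r := r) (t := t) K v
  refine ⟨max N K, fun x hx => ?_⟩
  rw [lowOp_apply, hN x ((le_max_left _ _).trans hx), lowVec,
    dif_neg (not_lt.mpr ((le_max_right _ _).trans hx)), map_zero, zero_mul, add_zero]

/-- Half of the anticommutator form, on the span of the symbols of low index. -/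
def lowForm (r t : ℂ) (K : ℤ) : LinearMap.BilinForm ℂ (LowSpace K) :=
  Finsupp.linearCombination ℂ fun x : {x : Gen // x.index < K} => lowDual r t K x

theorem lowForm_single (K : ℤ) (x : {x : Gen // x.index < K}) (c : ℂ) :
    lowForm r t K (Finsupp.single x c) = c • lowDual r t K x := by
  rw [lowForm, Finsupp.linearCombination_single]

/-- The inclusion of the span of the symbols of low index into the mode algebra. -/
def lowIncl (r t : ℂ) (K : ℤ) : LowSpace K →ₗ[ℂ] ModeAlgebra r t :=
  Finsupp.linearCombination ℂ fun x => modeGen r t x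

theorem lowIncl_anticomm (K : ℤ) (u v : LowSpace K) :
    lowIncl r t K u * lowIncl r t K v + lowIncl r t K v * lowIncl r t K u
      = algebraMap ℂ _ (2 * lowForm r t K u v) := by
  induction u using Finsupp.induction_linear with
  | zero => simp
  | add u u' hu hu' =>
    rw [map_add, map_add, LinearMap.add_apply, mul_add 2, map_add, ← hu, ← hu']
    noncomm_ring
  | single x c =>
    induction v using Finsupp.induction_linear with
    | zero => simp
    | add v v' hv hv' =>
      rw [map_add, map_add, mul_add 2, map_add, ← hv, ← hv']
      noncomm_ring
    | single y d =>
      rw [lowForm_single, LinearMap.smul_apply, lowDual_single, if_pos x.2, lowIncl,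
        Finsupp.linearCombination_single, Finsupp.linearCombination_single, smul_mul_smul_comm,
        smul_mul_smul_comm, mul_comm d c, ← smul_add, modeGen_anticomm, Algebra.smul_def, ← map_mul,
        smul_eq_mul]
      congr 1
      ring

theorem lowIncl_mul_self (K : ℤ) (u : LowSpace K) : lowIncl r t K u * lowIncl r t K u
    = algebraMap ℂ _ ((lowForm r t K).toQuadraticMap u) := by
  have h := lowIncl_anticomm (r := r) (t := t) K u u
  rw [← two_smul ℂ, map_mul, ← Algebra.smul_def] at h
  exact smul_right_injective _ (two_ne_zero : (2 : ℂ) ≠ 0) h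

/-- The Clifford algebra on the symbols of low index maps to the mode algebra. -/
def lowHom (r t : ℂ) (K : ℤ) : CliffordAlgebra (lowForm r t K).toQuadraticMap →ₐ[ℂ] ModeAlgebra r t :=
  CliffordAlgebra.lift _ ⟨lowIncl r t K, lowIncl_mul_self K⟩

theorem lowHom_ι (K : ℤ) (u : LowSpace K) : lowHom r t K (CliffordAlgebra.ι _ u) = lowIncl r t K u :=
  CliffordAlgebra.lift_ι_apply _ _ _

theorem lowForm_proof (r t : ℂ) (K : ℤ) : (-lowForm r t K).toQuadraticMap
    = (0 : QuadraticForm ℂ (LowSpace K)) - (lowForm r t K).toQuadraticMap := by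
  ext u
  simp

theorem rep_lowIncl {K : ℤ} {ρ : ModeAlgebra r t →ₐ[ℂ] Module.End ℂ (LowFock K)}
    (hρ : ∀ x, ρ (modeGen r t x) = lowOp r t K x) (u : LowSpace K) (v : LowFock K) :
    ρ (lowIncl r t K u) v
      = CliffordAlgebra.ι _ u * v + CliffordAlgebra.contractLeft (lowForm r t K u) v := by
  induction u using Finsupp.induction_linear with
  | zero => simp
  | add u u' hu hu' =>
    simp only [map_add, LinearMap.add_apply, hu, hu', add_mul]
    abel
  | single x c =>
    rw [lowIncl, Finsupp.linearCombination_single, map_smul, hρ, LinearMap.smul_apply, lowOp_apply,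
      lowForm_single, lowVec, dif_pos x.2, map_smul, LinearMap.smul_apply, smul_add, ← smul_mul_assoc,
      ← map_smul, Finsupp.smul_single, smul_eq_mul, mul_one]

/-- Multiplying by a vector and adding its contraction is the recursion that defines `changeForm`.
So the orbit map of `1` is the linear isomorphism between the Clifford algebras of the
anticommutator form and of the zero form. -/
theorem rep_lowHom {K : ℤ} {ρ : ModeAlgebra r t →ₐ[ℂ] Module.End ℂ (LowFock K)}
    (hρ : ∀ x, ρ (modeGen r t x) = lowOp r t K x) (c : CliffordAlgebra (lowForm r t K).toQuadraticMap) :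
    ρ (lowHom r t K c) 1 = CliffordAlgebra.changeForm (lowForm_proof r t K) c := by
  induction c using CliffordAlgebra.left_induction with
  | algebraMap c =>
    rw [AlgHom.commutes, AlgHom.commutes, CliffordAlgebra.changeForm_algebraMap,
      Module.algebraMap_end_apply, Algebra.algebraMap_eq_smul_one]
  | add x y hx hy => simp only [map_add, LinearMap.add_apply, hx, hy]
  | ι_mul x u hx =>
    rw [map_mul, map_mul, Module.End.mul_apply, hx, lowHom_ι, rep_lowIncl hρ,
      CliffordAlgebra.changeForm_ι_mul, LinearMap.neg_apply, map_neg, LinearMap.neg_apply, sub_neg_eq_add]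

theorem exists_mem_adjoin (a : ModeAlgebra r t) :
    ∃ K : ℤ, a ∈ Algebra.adjoin ℂ (modeGen r t '' {x | x.index < K}) := by
  have mono : ∀ {K K' : ℤ}, K ≤ K' → Algebra.adjoin ℂ (modeGen r t '' {x | x.index < K})
      ≤ Algebra.adjoin ℂ (modeGen r t '' {x | x.index < K'}) := fun h =>
    Algebra.adjoin_mono (Set.image_mono fun x hx => lt_of_lt_of_le hx h)
  obtain ⟨a, rfl⟩ := mkMode_surjective r t a
  induction a using FreeAlgebra.induction with
  | grade0 c => exact ⟨0, by rw [AlgHom.commutes]; exact Subalgebra.algebraMap_mem _ _⟩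
  | grade1 x => exact ⟨x.index + 1, Algebra.subset_adjoin ⟨x, by simp, rfl⟩⟩
  | mul a b ha hb =>
    obtain ⟨K, hK⟩ := ha
    obtain ⟨K', hK'⟩ := hb
    exact ⟨max K K', by
      rw [map_mul]
      exact Subalgebra.mul_mem _ (mono (le_max_left _ _) hK) (mono (le_max_right _ _) hK')⟩
  | add a b ha hb =>
    obtain ⟨K, hK⟩ := ha
    obtain ⟨K', hK'⟩ := hb
    exact ⟨max K K', by
      rw [map_add]
      exact Subalgebra.add_mem _ (mono (le_max_left _ _) hK) (mono (le_max_right _ _) hK')⟩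

/-- An element of the mode algebra that acts by zero in all restricted representations is zero. -/
theorem eq_zero_of_restricted {a : ModeAlgebra r t}
    (ha : ∀ (M : Type) [AddCommGroup M] [Module ℂ M] (π : Module.End ℂ M), π * π = 1 →
      ∀ ρ : ModeAlgebra r t →ₐ[ℂ] Module.End ℂ M, IsRestricted r t ρ → IsSuperRep r t π ρ → ρ a = 0) :
    a = 0 := by
  obtain ⟨K₀, hK₀⟩ := exists_isotropic r t
  obtain ⟨K₁, hK₁⟩ := exists_mem_adjoin a
  -- One bound for two purposes: generators from `K` on anticommute, and `a` is an expression in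
  -- generators below `K`.
  let K := max K₀ K₁
  have hK : ∀ x y : Gen, K ≤ x.index → K ≤ y.index → genForm r t x y = 0 := fun x y hx hy =>
    hK₀ x y ((le_max_left _ _).trans hx) ((le_max_left _ _).trans hy)
  have hmem : a ∈ (lowHom r t K).range := by
    refine Algebra.adjoin_le ?_ hK₁
    rintro _ ⟨x, hx, rfl⟩
    refine ⟨CliffordAlgebra.ι _ (Finsupp.single ⟨x, lt_of_lt_of_le hx (le_max_right _ _)⟩ 1), ?_⟩
    change lowHom r t K _ = _
    rw [lowHom_ι, lowIncl, Finsupp.linearCombination_single, one_smul]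
  obtain ⟨c, rfl⟩ := hmem
  obtain ⟨ρ, hρ⟩ := exists_rep_of_anticomm (lowOp r t K) (lowOp_anticomm hK)
  have h0 : ρ (lowHom r t K c) = 0 := by
    refine ha (LowFock K) CliffordAlgebra.involute.toLinearMap ?_ ρ ?_ ?_
    · exact LinearMap.ext fun v => CliffordAlgebra.involute_involute v
    · intro v
      obtain ⟨N, hN⟩ := lowOp_eventually_zero (r := r) (t := t) K v
      exact ⟨N, fun k hk => ⟨(congrArg (· v) (hρ (Gen.psi k))).trans (hN (Gen.psi k) hk),
        (congrArg (· v) (hρ (Gen.psibar k))).trans (hN (Gen.psibar k) hk)⟩⟩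
    · intro k
      have h1 := hρ (Gen.psi k)
      have h2 := hρ (Gen.psibar k)
      rw [modeGen] at h1 h2
      rw [psi, psibar, h1, h2]
      exact ⟨involute_lowOp K _, involute_lowOp K _⟩
  have h1 := rep_lowHom hρ c
  rw [h0, LinearMap.zero_apply] at h1
  -- The change of form is invertible, so the Clifford element is zero; injectivity of `lowHom` is
  -- not needed.
  have h2 : c = 0 :=
    (CliffordAlgebra.changeFormEquiv (lowForm_proof r t K)).injective (h1.symm.trans (map_zero _).symm)
  exact (congrArg _ h2).trans (map_zero _)

end Faithful

end SymplecticFermions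
end

set_option linter.unusedSectionVars false
noncomputable section
namespace SymplecticFermions

/-! ### Virasoro operators from modes -/

section Virasoro

variable {M : Type*} [AddCommGroup M] [Module ℂ M]

/-- Modes `A k` and `B k`, standing for `ψ_{s+k}` and `ψ̄_{-s+k}`, which satisfy the relations
`{ψ_m, ψ_n} = 2τ δ_{m,-n}`, `{ψ_m, ψ̄_n} = m δ_{m,-n}`, `{ψ̄_m, ψ̄_n} = 0`. If `τ ≠ 0`, then `e = 2s`. -/
structure ModeSystem (s τ : ℂ) (e : ℤ) (A B : ℤ → Module.End ℂ M) : Prop where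
  ann_fst : ∀ v, ∃ K : ℤ, ∀ k, K ≤ k → A k v = 0
  ann_snd : ∀ v, ∃ K : ℤ, ∀ k, K ≤ k → B k v = 0
  fst_fst : ∀ k l v, A k (A l v) + A l (A k v) = if e + k + l = 0 then (2 * τ) • v else 0
  fst_snd : ∀ k l v, A k (B l v) + B l (A k v) = if k + l = 0 then (s + k) • v else 0
  snd_snd : ∀ k l v, B k (B l v) + B l (B k v) = 0

/-- The summands of the normally ordered expression for `L_n v`. -/
def virTerm (A B : ℤ → Module.End ℂ M) (n k : ℤ) (v : M) : M :=
  if 0 ≤ k then B (n - k) (A k v) else -(A k (B (n - k) v))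

/-- The operators `L n` are given by the normally ordered expressions in the modes. -/
def IsVirasoroOp (s : ℂ) (A B : ℤ → Module.End ℂ M) (L : ℤ → Module.End ℂ M) : Prop :=
  ∀ n v, L n v = ∑ᶠ k, virTerm A B n k v + (if n = 0 then s * (s - 1) / 2 else 0) • v

theorem finite_support_int {f : ℤ → M} {K K' : ℤ} (h : ∀ k, K ≤ k → f k = 0) (h' : ∀ k, k ≤ K' → f k = 0) :
    (Function.support f).Finite :=
  (Set.finite_Icc K' K).subset fun k hk =>
    ⟨le_of_not_ge fun h1 => hk (h' k h1), le_of_not_ge fun h1 => hk (h k h1)⟩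

variable {s τ : ℂ} {e : ℤ} {A B : ℤ → Module.End ℂ M}

namespace ModeSystem

theorem finite_ordered (h : ModeSystem s τ e A B) (m n c : ℤ) (v : M) : (Function.support fun k =>
    if c ≤ k then B (n - k) (A (m + k) v) else -(A (m + k) (B (n - k) v))).Finite := by
  obtain ⟨K, hK⟩ := h.ann_fst v
  obtain ⟨K', hK'⟩ := h.ann_snd v
  refine finite_support_int (K := max c (K - m)) (K' := min (c - 1) (n - K')) (fun k hk => ?_) fun k hk => ?_
  · rw [if_pos (by omega), hK _ (by omega), map_zero]
  · rw [if_neg (by omega), hK' _ (by omega), map_zero, neg_zero]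

theorem finite_virTerm (h : ModeSystem s τ e A B) (n : ℤ) (v : M) :
    (Function.support fun k => virTerm A B n k v).Finite := by
  have := h.finite_ordered 0 n 0 v
  simp only [zero_add] at this
  exact this

theorem snd_neg (h : ModeSystem s τ e A B) (k l : ℤ) (v : M) : B k (B l v) = -(B l (B k v)) :=
  eq_neg_of_add_eq_zero_left (h.snd_snd k l v)

theorem finite_snd_snd (h : ModeSystem s τ e A B) (m n : ℤ) (v : M) :
    (Function.support fun k => B (n - k) (B (m + k) v)).Finite := by
  obtain ⟨K, hK⟩ := h.ann_snd v
  refine finite_support_int (K := K - m) (K' := n - K) (fun k hk => ?_) fun k hk => ?_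
  · rw [hK _ (by omega), map_zero]
  · rw [h.snd_neg, hK _ (by omega), map_zero, neg_zero]

/-- The reflection `k ↦ n - m - k` interchanges the two anticommuting factors, so the sum equals its
negative. -/
theorem finsum_snd_snd (h : ModeSystem s τ e A B) (m n : ℤ) (v : M) :
    ∑ᶠ k, B (n - k) (B (m + k) v) = 0 := by
  have h1 : ∑ᶠ k, B (n - k) (B (m + k) v) = -∑ᶠ k, B (n - k) (B (m + k) v) := by
    rw [← finsum_neg_distrib, ← finsum_comp_equiv (Equiv.subLeft (n - m))]
    refine finsum_congr fun k => ?_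
    simp only [Equiv.subLeft_apply]
    rw [h.snd_neg, show m + (n - m - k) = n - k by ring, show n - (n - m - k) = m + k by ring]
  have h2 : (2 : ℂ) • ∑ᶠ k, B (n - k) (B (m + k) v) = 0 := by
    rw [two_smul]
    nth_rewrite 1 [h1]
    exact neg_add_cancel _
  exact (smul_eq_zero.mp h2).resolve_left two_ne_zero

variable {L : ℤ → Module.End ℂ M}

theorem map_comm_eq_finsum (h : ModeSystem s τ e A B) (hL : IsVirasoroOp s A B L) (X : Module.End ℂ M)
    (n : ℤ) (v : M) :
    L n (X v) - X (L n v) = ∑ᶠ k, (virTerm A B n k (X v) - X (virTerm A B n k v)) := by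
  have hX : (Function.support fun k => X (virTerm A B n k v)).Finite :=
    (h.finite_virTerm n v).subset fun k hk h0 => hk (by simp only [h0, map_zero])
  rw [hL, hL, map_add, LinearMap.map_smul, finsum_sub_distrib (h.finite_virTerm n (X v)) hX,
    map_finsum X (h.finite_virTerm n v)]
  abel

theorem finsum_ite_single (k₀ : ℤ) (x : M) : (∑ᶠ k : ℤ, if k = k₀ then x else 0) = x := by
  rw [finsum_eq_single _ k₀ fun k hk => if_neg hk, if_pos rfl]

theorem finite_ite_single (k₀ : ℤ) (x : M) :
    Function.HasFiniteSupport fun k : ℤ => if k = k₀ then x else 0 :=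
  (Set.finite_singleton k₀).subset fun _ hk => by_contra fun h0 => hk (if_neg h0)

/-- Commuting `ψ̄_p` through a bilinear term leaves `ψ̄` times the anticommutator with the
`ψ`-factor, which is nonzero at most for `k = -p`. The ordering and the additive constant are
irrelevant. -/
theorem comm_snd (h : ModeSystem s τ e A B) (hL : IsVirasoroOp s A B L) (m p : ℤ) (v : M) :
    L m (B p v) = B p (L m v) + (s - p) • B (m + p) v := by
  rw [← sub_eq_iff_eq_add', h.map_comm_eq_finsum hL, ← finsum_ite_single (-p) ((s - p) • B (m + p) v)]
  refine finsum_congr fun k => ?_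
  have e1 : virTerm A B m k (B p v) - B p (virTerm A B m k v) = B (m - k) (A k (B p v) + B p (A k v)) := by
    unfold virTerm
    split_ifs with hk
    · rw [h.snd_neg p, map_add, sub_neg_eq_add]
    · have h2 := h.fst_snd k p (B (m - k) v)
      have h3 := congrArg (B (m - k)) (h.fst_snd k p v)
      rw [map_neg, sub_neg_eq_add, h.snd_neg (m - k) p, map_neg, neg_neg, h2, h3]
      split_ifs
      · rw [LinearMap.map_smul]
      · rw [map_zero]
  rw [e1, h.fst_snd]
  by_cases hp : k = -p
  · subst hp
    rw [if_pos (by ring), if_pos rfl, LinearMap.map_smul]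
    push_cast
    rw [sub_neg_eq_add, ← sub_eq_add_neg]
  · rw [if_neg (by omega), if_neg hp, map_zero]

/-- Now both factors can contribute: the anticommutator with `ψ̄` at `k = m + p`, and that with `ψ`,
of size `2τ`, at `k = -e - p`. -/
theorem comm_fst (h : ModeSystem s τ e A B) (hL : IsVirasoroOp s A B L) (m p : ℤ) (v : M) :
    L m (A p v) = A p (L m v) + (-(s + p) • A (m + p) v + (2 * τ) • B (e + m + p) v) := by
  rw [← sub_eq_iff_eq_add', h.map_comm_eq_finsum hL, ← finsum_ite_single (m + p) (-(s + p) • A (m + p) v),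
    ← finsum_ite_single (-e - p) ((2 * τ) • B (e + m + p) v),
    ← finsum_add_distrib (finite_ite_single _ _) (finite_ite_single _ _)]
  refine finsum_congr fun k => ?_
  have e1 : virTerm A B m k (A p v) - A p (virTerm A B m k v)
      = -(A p (B (m - k) (A k v)) + B (m - k) (A p (A k v))) + B (m - k) (A k (A p v) + A p (A k v)) := by
    unfold virTerm
    split_ifs with hk
    · rw [map_add]
      abel
    · have h1 := h.fst_snd p (m - k) v
      have h2 := h.fst_fst k p (B (m - k) v)
      have h3 := congrArg (B (m - k)) (h.fst_fst k p v)
      have h4 := h.fst_snd p (m - k) (A k v)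
      have h5 : A k (A p (B (m - k) v)) + A k (B (m - k) (A p v))
          = if p + (m - k) = 0 then (s + p) • A k v else 0 := by
        rw [← map_add, h1]
        split_ifs
        · rw [LinearMap.map_smul]
        · rw [map_zero]
      rw [h4, h3, ← h5, map_neg, sub_neg_eq_add]
      have h6 : B (m - k) (if e + k + p = 0 then (2 * τ) • v else 0)
          = if e + k + p = 0 then (2 * τ) • B (m - k) v else 0 := by
        split_ifs
        · rw [LinearMap.map_smul]
        · rw [map_zero]
      rw [h6, ← h2]
      abel
  rw [e1, h.fst_fst, h.fst_snd]
  congr 1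
  · by_cases hp : k = m + p
    · subst hp
      rw [if_pos (by ring), if_pos rfl, neg_smul]
    · rw [if_neg (by omega), if_neg hp, neg_zero]
  · by_cases hp : k = -e - p
    · subst hp
      rw [if_pos (by ring), if_pos rfl, LinearMap.map_smul, show m - (-e - p) = e + m + p by ring]
    · rw [if_neg (by omega), if_neg hp, map_zero]

theorem comm_virTerm (h : ModeSystem s τ e A B) (hL : IsVirasoroOp s A B L) (m n k : ℤ) (v : M) :
    virTerm A B n k (L m v) - L m (virTerm A B n k v)
      = -((s - n + k) • virTerm A B (m + n) k v
        + (-(s + k)) • (if 0 ≤ k then B (n - k) (A (m + k) v) else -(A (m + k) (B (n - k) v)))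
        + (2 * τ) • B (n - k) (B (e + m + k) v)) := by
  unfold virTerm
  split_ifs with hk
  · rw [h.comm_snd hL, h.comm_fst hL, map_add, map_add, LinearMap.map_smul, LinearMap.map_smul,
      show m + (n - k) = m + n - k by ring]
    push_cast
    module
  · rw [map_neg, h.comm_fst hL, h.comm_snd hL, map_add, LinearMap.map_smul,
      show m + (n - k) = m + n - k by ring, h.snd_neg (e + m + k)]
    push_cast
    module

/-- For `m + n ≠ 0` the two factors anticommute, so the place where the order changes is irrelevant.
-/
theorem virTerm_reorder (h : ModeSystem s τ e A B) (m n k : ℤ) (hmn : m + n ≠ 0) (v : M) :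
    (if m ≤ k then B (m + n - k) (A k v) else -(A k (B (m + n - k) v))) = virTerm A B (m + n) k v := by
  have h1 := h.fst_snd k (m + n - k) v
  rw [if_neg (by omega)] at h1
  rw [← eq_neg_iff_add_eq_zero] at h1
  unfold virTerm
  rw [h1, neg_neg, ite_self, ite_self]

/-- In degree zero, moving the place of reordering from `0` to `m` costs the anticommutator `s + k`
for each `k` in between. These constants produce the central term. -/
theorem virTerm_reorder_zero (h : ModeSystem s τ e A B) (m : ℕ) (k : ℤ) (v : M) :
    (if (m : ℤ) ≤ k then B (-k) (A k v) else -(A k (B (-k) v)))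
      = virTerm A B 0 k v - if k ∈ Finset.Ico (0 : ℤ) m then (s + k) • v else 0 := by
  have h1 := h.fst_snd k (-k) v
  rw [if_pos (by ring), ← eq_sub_iff_add_eq] at h1
  unfold virTerm
  rw [zero_sub, h1]
  simp only [Finset.mem_Ico]
  split_ifs <;> first | omega | abel

/-- The quadratic part in `s` is what the constant in `L_0` absorbs, and the cubic remainder in `m`
is the central term for `c = -2`. -/
theorem sum_central (s : ℂ) (m : ℕ) : ∑ k ∈ Finset.range m, (s + k - m) * (s + k)
    = 2 * m * (s * (s - 1) / 2) - ((m : ℂ) ^ 3 - m) / 6 := by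
  have h : ∀ (c : ℂ) (m : ℕ), ∑ k ∈ Finset.range m, (s + k - c) * (s + k)
      = m * (s * (s - c)) + (2 * s - c) * (m * (m - 1) / 2) + m * (m - 1) * (2 * m - 1) / 6 := by
    intro c m
    induction m with
    | zero => simp
    | succ m ih =>
      rw [Finset.sum_range_succ, ih]
      push_cast
      ring
  rw [h]
  ring

theorem finsum_mul_ico (f : ℤ → ℂ) (m : ℕ) (v : M) :
    ∑ᶠ k : ℤ, f k • (if k ∈ Finset.Ico (0 : ℤ) m then (s + k) • v else 0)
      = (∑ k ∈ Finset.range m, f k * (s + k)) • v := by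
  rw [finsum_eq_sum_of_support_subset (s := Finset.Ico (0 : ℤ) m), Finset.sum_smul]
  · refine (Finset.sum_bij (fun (k : ℕ) _ => (k : ℤ)) ?_ ?_ ?_ ?_).symm
    · intro k hk
      simp only [Finset.mem_range, Finset.mem_Ico] at *
      omega
    · intro k _ l _ hkl
      exact_mod_cast hkl
    · intro k hk
      simp only [Finset.mem_Ico] at hk
      exact ⟨k.toNat, by simp only [Finset.mem_range]; omega, by omega⟩
    · intro k hk
      rw [if_pos (by simp only [Finset.mem_range, Finset.mem_Ico] at *; omega), smul_smul]
      norm_cast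
  · intro k hk
    by_contra h0
    exact hk (by simp only [if_neg (fun h => h0 (Finset.mem_coe.mpr h)), smul_zero])

theorem finite_smul {f : ℤ → M} (hf : (Function.support f).Finite) (c : ℤ → ℂ) :
    (Function.support fun k => c k • f k).Finite :=
  hf.subset fun k hk h0 => hk (by simp only [h0, smul_zero])

/-- Commuting `L_m` through each bilinear term gives three sums. The one with two factors `ψ̄`,
weighted with `τ`, vanishes by antisymmetry, and the reindexing `k ↦ k - m` makes the other two
comparable, with the reordering at `m` instead of `0`. -/
theorem comm_eq_finsum (h : ModeSystem s τ e A B) (hL : IsVirasoroOp s A B L) (m n : ℤ) (v : M) :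
    L m (L n v) - L n (L m v) = ∑ᶠ k : ℤ, ((s - n + k) • virTerm A B (m + n) k v
      + (-(s + k - m)) • (if m ≤ k then B (m + n - k) (A k v) else -(A k (B (m + n - k) v)))) := by
  have h1 := h.map_comm_eq_finsum hL (L m) n v
  rw [← neg_sub, h1, ← finsum_neg_distrib]
  have f1 := finite_smul (h.finite_virTerm (m + n) v) fun k => s - n + k
  have f2 := finite_smul (h.finite_ordered m n 0 v) fun k => -(s + k)
  have f3 := finite_smul (h.finite_snd_snd (e + m) n v) fun _ => 2 * τ
  have f4 := finite_smul (h.finite_ordered 0 (m + n) m v) fun k => -(s + k - m)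
  simp only [zero_add] at f4
  simp only [h.comm_virTerm hL, neg_neg]
  rw [finsum_add_distrib (f1.union f2 |>.subset (Function.support_add _ _)) f3, finsum_add_distrib f1 f2,
    ← smul_finsum, h.finsum_snd_snd, smul_zero, add_zero, finsum_add_distrib f1 f4]
  congr 1
  rw [← finsum_comp_equiv (Equiv.subRight m)]
  refine finsum_congr fun k => ?_
  simp only [Equiv.subRight_apply, sub_nonneg, add_sub_cancel]
  rw [show n - (k - m) = m + n - k by ring]
  push_cast
  rw [add_sub_assoc s]

/-- The normally ordered expressions in the modes form a Virasoro algebra of central charge `-2`. -/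
theorem virasoro (h : ModeSystem s τ e A B) (hL : IsVirasoroOp s A B L) (m n : ℤ) (v : M) :
    L m (L n v) - L n (L m v) = ((m : ℂ) - n) • L (m + n) v
      + (if m + n = 0 then (-2 : ℂ) / 12 * ((m : ℂ) ^ 3 - m) else 0) • v := by
  have key : ∀ m : ℕ, L m (L (-m) v) - L (-m) (L m v) = (2 * (m : ℂ)) • L 0 v
      + ((-2 : ℂ) / 12 * ((m : ℂ) ^ 3 - m)) • v := by
    intro m
    rw [h.comm_eq_finsum hL]
    have e1 : ∀ k : ℤ, (s - (-m : ℤ) + k) • virTerm A B ((m : ℤ) + -m) k v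
        + (-(s + k - (m : ℤ))) • (if (m : ℤ) ≤ k then B ((m : ℤ) + -m - k) (A k v)
          else -(A k (B ((m : ℤ) + -m - k) v)))
        = (2 * (m : ℂ)) • virTerm A B 0 k v
          + (s + k - m) • (if k ∈ Finset.Ico (0 : ℤ) m then (s + k) • v else 0) := by
      intro k
      rw [add_neg_cancel, zero_sub, h.virTerm_reorder_zero]
      push_cast
      module
    simp only [e1]
    have f2 : (Function.support fun k : ℤ =>
        (s + k - m) • (if k ∈ Finset.Ico (0 : ℤ) m then (s + k) • v else 0)).Finite :=
      (Finset.finite_toSet (Finset.Ico (0 : ℤ) m)).subset fun k hk => by_contra fun h0 =>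
        hk (by simp only [if_neg (fun h => h0 (Finset.mem_coe.mpr h)), smul_zero])
    rw [finsum_add_distrib (finite_smul (h.finite_virTerm 0 v) _) f2, ← smul_finsum,
      finsum_mul_ico (fun k => s + k - m), hL 0 v, if_pos rfl]
    have := sum_central s m
    push_cast
    rw [this]
    module
  -- The anomalous case is computed for natural `m` and extended by antisymmetry of the commutator;
  -- in all other degrees the two sums combine termwise.
  by_cases hmn : m + n = 0
  · obtain rfl : n = -m := by omega
    rw [if_pos hmn, add_neg_cancel]
    rcases Int.eq_nat_or_neg m with ⟨k, rfl | rfl⟩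
    · rw [key]
      push_cast
      module
    · rw [neg_neg, ← neg_sub, key]
      push_cast
      module
  · rw [h.comm_eq_finsum hL, if_neg hmn, zero_smul, add_zero, hL, if_neg hmn, zero_smul, add_zero,
      smul_finsum]
    refine finsum_congr fun k => ?_
    rw [h.virTerm_reorder m n k hmn, ← add_smul]
    congr 1
    ring

end ModeSystem

end Virasoro

end SymplecticFermions
end

set_option linter.unusedSectionVars false
noncomputable section
namespace SymplecticFermions

/-! ### The conformal vector in twisted modules -/

section Conformal

variable {M : Type*} [AddCommGroup M] [Module ℂ M] {a b : FormalField M} {α κ κ' r τ : ℂ}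

theorem exists_add_int_iff (α m : ℂ) (i : ℤ) : (∃ j : ℤ, m = α + i + j) ↔ ∃ j : ℤ, m = α + j :=
  ⟨fun ⟨j, h⟩ => ⟨i + j, by rw [h]; push_cast; ring⟩, fun ⟨j, h⟩ => ⟨j - i, by rw [h]; push_cast; ring⟩⟩

theorem SuppCoset.add_int (h : SuppCoset α a) (i : ℤ) : SuppCoset (α + i) a := fun n k h0 => by
  rw [exists_add_int_iff]
  exact h n k h0

theorem CanonAnticomm.add_int (h : CanonAnticomm α κ κ' a b) (i : ℤ) :
    CanonAnticomm (α + i) κ κ' a b := fun m k n l v => by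
  rw [h m k n l v]
  by_cases hc : k = 0 ∧ l = 0 ∧ m + n = 0 ∧ ∃ j : ℤ, m = α + j
  · rw [if_pos hc, if_pos (by rwa [exists_add_int_iff])]
  · rw [if_neg hc, if_neg (by rwa [exists_add_int_iff])]

theorem ModePair.add_int (h : ModePair r τ a b) (i : ℤ) : ModePair (r + i) τ a b := by
  have e : -(r + i) = -r + ((-i : ℤ) : ℂ) := by push_cast; ring
  refine ⟨h.isLog_fst, h.isLog_snd, h.supp_fst.add_int i, ?_, h.fst_fst.add_int i, h.fst_snd.add_int i, ?_⟩
  · rw [e]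
    exact h.supp_snd.add_int _
  · rw [e]
    exact h.snd_snd.add_int _

theorem finsum_eq_finsum_comp {f : ℂ → M} {e : ℤ → ℂ} (he : Function.Injective e)
    (hf : ∀ m, f m ≠ 0 → m ∈ Set.range e) : ∑ᶠ m, f m = ∑ᶠ k, f (e k) := by
  rw [← finsum_mem_range he, ← finsum_mem_univ]
  exact finsum_mem_inter_support_eq' _ _ _ fun m hm => ⟨fun _ => hf m hm, fun _ => Set.mem_univ _⟩

/-- The (-1)-product is a second Taylor coefficient after multiplication by `(z - w)^2`. The
normally ordered part contributes its diagonal value, and the two monomials of the contraction add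
up to the constant. -/
theorem CanonAnticomm.nprod_neg_one (h : CanonAnticomm α κ 0 a b) (hs : SuppCoset α a)
    (ha : IsLogField a) (hb : IsLogField b) (v : M) : (fun n e => nprod (-1) a b n e v)
      = diag (normalOrder α a b v) + (κ * (α * (1 - α) / 2)) • monomial1 1 v := by
  have hn := diagFinite_normalOrder hs ha hb v
  have hm1 := ((diagFinite_monomial2 (α - 1) (-1 - α) v).smul (κ * (1 - α) - 0))
  have hm2 := ((diagFinite_monomial2 (α - 2) (-α) v).smul (κ * α + 0))
  have e2 : ((2 : ℕ) : ℤ) - 1 - -1 = ((2 : ℕ) : ℤ) := by norm_num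
  rw [nprod_apply' (h.hasOpe hs ha hb).good, h.zw_sq, e2, taylor_add _ (hn.zw_pow 2) (hm1.add hm2),
    taylor_add _ hm1 hm2, taylor_smul, taylor_smul]
  have t1 : taylor ((2 : ℕ) : ℤ) ((zw ^ 2) (normalOrder α a b v)) = diag (normalOrder α a b v) := by
    rw [taylor_zw_pow _ hn, sub_self, taylor_zero_eq]
  have t2 : ∀ p q : ℂ, taylor ((2 : ℕ) : ℤ) (monomial2 p q v)
      = ((p + 1) * (p + 2) / 2) • monomial1 (p + q + 3) v := by
    intro p q
    rw [taylor_natCast, pow_two, Module.End.mul_apply, dZ_monomial2, map_smul, dZ_monomial2, diag_smul,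
      diag_smul, diag_monomial2, smul_smul, smul_smul, show p + 1 + 1 + q + 1 = p + q + 3 by ring]
    congr 1
    simp only [Nat.factorial]
    push_cast
    ring
  rw [t1, t2, t2, show α - 1 + (-1 - α) + 3 = 1 by ring, show α - 2 + -α + 3 = 1 by ring, smul_smul,
    smul_smul, ← add_smul]
  congr 2
  ring

theorem CanonAnticomm.comp_eq_normalOrder (h : CanonAnticomm α 0 0 a b) (v : M) :
    comp a b v = normalOrder α a b v := by
  funext m k n l
  have h1 := h m k n l v
  rw [zero_mul, zero_add, zero_smul, ite_self, ← eq_neg_iff_add_eq_zero] at h1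
  rw [normalOrder, ← h1, ite_self]
  rfl

/-- The modes of `b` anticommute, so interchanging the variables changes the sign, while the
diagonal is symmetric. -/
theorem CanonAnticomm.diag_comp_self (h : CanonAnticomm α 0 0 b b) (v : M) : diag (comp b b v) = 0 := by
  have h1 : diag (comp b b v) = -diag (comp b b v) := by
    rw [← diag_neg]
    nth_rewrite 1 [← diag_swap]
    congr 1
    funext m k n l
    have h1 := h n l m k v
    rw [zero_mul, zero_add, zero_smul, ite_self, ← eq_neg_iff_add_eq_zero] at h1
    exact h1
  have h2 : (2 : ℂ) • diag (comp b b v) = 0 := by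
    rw [two_smul]
    nth_rewrite 1 [h1]
    exact neg_add_cancel _
  exact (smul_eq_zero.mp h2).resolve_left two_ne_zero

theorem CanonAnticomm.good_zero (h : CanonAnticomm α 0 0 b b) (hs : SuppCoset α b) (hb : IsLogField b) :
    Good 0 b b := fun v => by
  rw [pow_zero, Module.End.one_apply, h.comp_eq_normalOrder]
  exact diagFinite_normalOrder hs hb hb v

theorem CanonAnticomm.nprod_neg_one_self (h : CanonAnticomm α 0 0 b b) (hs : SuppCoset α b)
    (hb : IsLogField b) : nprod (-1) b b = 0 := by
  refine FormalField.ext_apply fun v => ?_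
  rw [nprod_apply' (h.good_zero hs hb), pow_zero, Module.End.one_apply, show ((0 : ℕ) : ℤ) - 1 - -1 = 0 by norm_num,
    taylor_zero_eq, h.diag_comp_self]
  rfl

theorem CanonAnticomm.nprod_neg_one_logMul (h : CanonAnticomm α 0 0 b b) (hs : SuppCoset α b)
    (hb : IsLogField b) : nprod (-1) b (logMul b) = 0 := by
  have hg : Good 0 b (logMul b) := fun v => by
    have := h.good_zero hs hb v
    rw [comp_logMul_right, zw_pow_logW]
    exact this.logW
  refine FormalField.ext_apply fun v => ?_
  rw [nprod_apply' hg, pow_zero, Module.End.one_apply, show ((0 : ℕ) : ℤ) - 1 - -1 = 0 by norm_num,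
    taylor_zero_eq, comp_logMul_right, diag_logW, h.diag_comp_self, map_zero]
  rfl

/-- The difference between `ψ` and `a` consists of multiples of `b` and `log(z) b`, whose products
with `b` vanish. Hence neither `c` nor `τ` enters the formulas for the `L_n`. -/
theorem ModePair.nprod_neg_one_pairFields (h : ModePair r τ a b) (c : ℂ) :
    nprod (-1) b (pairFields c τ a b 0) = nprod (-1) b a := by
  have oBB := h.snd_snd.hasOpe h.supp_snd h.isLog_snd h.isLog_snd
  have oBA := h.fst_snd.symm.hasOpe h.supp_snd h.isLog_snd h.isLog_fst
  rw [pairFields, if_pos rfl, nprod_add_right oBA.good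
    ((oBB.smul_right _).add_right (oBB.log_right.smul_right _)).good,
    nprod_add_right (oBB.smul_right _).good (oBB.log_right.smul_right _).good, nprod_smul_right oBB.good,
    nprod_smul_right oBB.log_right.good, h.snd_snd.nprod_neg_one_self h.supp_snd h.isLog_snd,
    h.snd_snd.nprod_neg_one_logMul h.supp_snd h.isLog_snd, smul_zero, smul_zero, add_zero, add_zero]

/-- The modes of a pair of mode fields. -/
theorem ModePair.modeSystem {s : ℂ} {e : ℤ} (h : ModePair s τ a b) (he : τ = 0 ∨ 2 * s = e) :
    ModeSystem s τ e (fun k => a (s + k) 0) (fun k => b (-s + k) 0) where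
  ann_fst v := by
    obtain ⟨C, hC⟩ := h.isLog_fst.re_bound v
    refine ⟨⌊C - s.re⌋ + 1, fun k hk => by_contra fun h0 => ?_⟩
    have h1 := hC _ _ h0
    have h2 := Int.floor_lt.mp (Int.add_one_le_iff.mp hk)
    simp at h1
    linarith
  ann_snd v := by
    obtain ⟨C, hC⟩ := h.isLog_snd.re_bound v
    refine ⟨⌊C + s.re⌋ + 1, fun k hk => by_contra fun h0 => ?_⟩
    have h1 := hC _ _ h0
    have h2 := Int.floor_lt.mp (Int.add_one_le_iff.mp hk)
    simp at h1
    linarith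
  fst_fst k l v := by
    rw [h.fst_fst, zero_mul, zero_add]
    rcases he with rfl | he
    · simp
    · by_cases hkl : e + k + l = 0
      · refine (if_pos ⟨rfl, rfl, ?_, k, rfl⟩).trans (if_pos hkl).symm
        have : (e : ℂ) + k + l = 0 := by exact_mod_cast hkl
        linear_combination this + he
      · refine (if_neg fun h0 => hkl ?_).trans (if_neg hkl).symm
        have : (e : ℂ) + k + l = 0 := by linear_combination h0.2.2.1 - he
        exact_mod_cast this
  fst_snd k l v := by
    rw [h.fst_snd, one_mul, add_zero]
    by_cases hkl : k + l = 0
    · refine (if_pos ⟨rfl, rfl, ?_, k, rfl⟩).trans (if_pos hkl).symm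
      have : (k : ℂ) + l = 0 := by exact_mod_cast hkl
      linear_combination this
    · refine (if_neg fun h0 => hkl ?_).trans (if_neg hkl).symm
      have : (k : ℂ) + l = 0 := by linear_combination h0.2.2.1
      exact_mod_cast this
  snd_snd k l v := by
    rw [h.snd_snd, zero_mul, zero_add, zero_smul, ite_self]

/-- For the reference index `1 - s` the modes `ψ̄_{-s+i}` with `i ≤ 0` stand on the left; in terms
of `i = n - k` this is `k ≥ n`. -/
theorem ModePair.diag_normalOrder {s : ℂ} (h : ModePair s τ a b) (n : ℤ) (v : M) :
    diag (normalOrder (1 - s) b a v) (n + 1) 0 = ∑ᶠ k : ℤ, if n ≤ k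
      then b (-s + (n - k : ℤ)) 0 (a (s + k) 0 v) else -(a (s + k) 0 (b (-s + (n - k : ℤ)) 0 v)) := by
  have hinj : Function.Injective fun k : ℤ => -s + ((n - k : ℤ) : ℂ) := fun k l hkl => by
    have : ((n - k : ℤ) : ℂ) = ((n - l : ℤ) : ℂ) := add_left_cancel hkl
    have : n - k = n - l := by exact_mod_cast this
    omega
  rw [diag, finsum_eq_finsum_comp hinj]
  · refine finsum_congr fun k => ?_
    rw [Finset.sum_range_one, Nat.sub_zero, normalOrder,
      show (n : ℂ) + 1 - 1 - (-s + (n - k : ℤ)) = s + k by push_cast; ring]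
    by_cases hk : n ≤ k
    · rw [if_pos hk, if_pos ⟨n - k - 1, by omega, by push_cast; ring⟩]
    · rw [if_neg hk, if_neg]
      rintro ⟨j, hj, hj'⟩
      have : ((n - k : ℤ) : ℂ) = ((1 + j : ℤ) : ℂ) := by push_cast at hj' ⊢; linear_combination hj'
      have : n - k = 1 + j := by exact_mod_cast this
      omega
  · intro m hm
    rw [Finset.sum_range_one, Nat.sub_zero, normalOrder] at hm
    have hbm : b m 0 ≠ 0 := fun h0 => hm (by simp [h0])
    obtain ⟨-, j, rfl⟩ := h.supp_snd _ _ hbm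
    exact ⟨n - j, by simp⟩

theorem ModePair.diag_normalOrder_eq_zero {s : ℂ} (h : ModePair s τ a b) {n : ℂ} {k : ℕ}
    (hn : k ≠ 0 ∨ ∀ j : ℤ, n ≠ j) (v : M) : diag (normalOrder (1 - s) b a v) n k = 0 := by
  refine finsum_eq_zero_of_forall_eq_zero fun m => Finset.sum_eq_zero fun i hi => ?_
  by_contra h0
  have hb : b m i ≠ 0 := fun hb => h0 (by simp [normalOrder, hb])
  have ha : a (n - 1 - m) (k - i) ≠ 0 := fun ha => h0 (by simp [normalOrder, ha])
  obtain ⟨hi0, j, hj⟩ := h.supp_snd _ _ hb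
  obtain ⟨hk0, l, hl⟩ := h.supp_fst _ _ ha
  rcases hn with hn | hn
  · rw [hi0] at hk0
    exact hn (by omega)
  · exact hn (1 + j + l) (by push_cast; linear_combination hj + hl)

/-! ### The representative of the coset of `r`. -/

theorem cosetRep_re_nonneg (r : ℂ) : 0 ≤ (cosetRep r).re := by
  have := Int.floor_le r.re
  simp only [cosetRep, Complex.sub_re, Complex.intCast_re]
  linarith

theorem cosetRep_re_lt_one (r : ℂ) : (cosetRep r).re < 1 := by
  have := Int.lt_floor_add_one r.re
  simp only [cosetRep, Complex.sub_re, Complex.intCast_re]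
  linarith

theorem cosetRep_eq_zero_iff (r : ℂ) : cosetRep r = 0 ↔ ∃ k : ℤ, r = k := by
  refine ⟨fun h => ⟨⌊r.re⌋, sub_eq_zero.mp h⟩, ?_⟩
  rintro ⟨k, rfl⟩
  simp [cosetRep]

/-- As the real part of the representative lies in `[0, 1)`, the integer label decides the sign; so
the summation conditions in the formula for `L_0` become conditions on integers. -/
theorem re_cosetRep_add_nonneg_iff (r : ℂ) (k : ℤ) : 0 ≤ (cosetRep r + k).re ↔ 0 ≤ k := by
  have h0 := cosetRep_re_nonneg r
  have h1 := cosetRep_re_lt_one r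
  rw [Complex.add_re, Complex.intCast_re]
  constructor
  · intro h
    by_contra hk
    have : (k : ℝ) ≤ -1 := by exact_mod_cast (by omega : k ≤ -1)
    linarith
  · intro h
    have : (0 : ℝ) ≤ k := by exact_mod_cast h
    linarith

theorem cosetRep_add_eq_zero_iff (r : ℂ) (k : ℤ) (hk : 0 ≤ k) :
    cosetRep r + k = 0 ↔ k = 0 ∧ cosetRep r = 0 := by
  refine ⟨fun h => ?_, fun ⟨h, h'⟩ => by rw [h, h']; simp⟩
  have h1 := congrArg Complex.re h
  rw [Complex.add_re, Complex.intCast_re, Complex.zero_re] at h1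
  have h2 : (k : ℝ) ≤ 0 := by linarith [cosetRep_re_nonneg r]
  have h3 : k = 0 := le_antisymm (by exact_mod_cast h2) hk
  refine ⟨h3, ?_⟩
  rwa [h3, Int.cast_zero, add_zero] at h

theorem add_eq_cosetRep_add (r : ℂ) (k : ℤ) : r + k = cosetRep r + ((k + ⌊r.re⌋ : ℤ) : ℂ) := by
  rw [cosetRep]
  push_cast
  ring

variable {π : Module.End ℂ M} {g : Matrix.SpecialLinearGroup (Fin 2) ℂ} {Y : SF →ₗ[ℂ] FormalField M}
  {t c : ℂ}

theorem exists_conformal : ∃ ω : SF, IsNProduct 1 1 (-1) SF.psibar.1 SF.psi.1 ω.1 := by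
  have h : IsNProduct 1 1 (-1) (fockFields 1) (fockFields 0) (nprod (-1) (fockFields 1) (fockFields 0)) := by
    refine isNProduct_nprod (N := 2) ?_ (freePair_fockFields.isLog 1) (freePair_fockFields.isLog 0) (-1)
    rw [mul_one, pow_one, neg_one_smul]
    exact freePair_fockFields.loc 1 0
  rw [← sfGen_val, ← sfGen_val] at h
  exact ⟨⟨_, Submodule.mem_sInf.mpr fun W hW => hW.nProduct_mem 1 1 (-1) _ _ _ hW.psibar_mem hW.psi_mem
    (hasParity_sfGen 1) (hasParity_sfGen 0) h⟩, h⟩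

theorem IsTwistedModule.conformal_eq (h : IsTwistedModule g π Y) {ω : SF}
    (hω : IsNProduct 1 1 (-1) SF.psibar.1 SF.psi.1 ω.1) :
    Y ω = nprod (-1) (Y (sfGen 1)) (Y (sfGen 0)) :=
  (h.nProduct 1 1 (-1) (sfGen 1) (sfGen 0) ω (hasParity_sfGen 1) (hasParity_sfGen 0) hω).eq_nprod
    (h.isLogField _) (h.isLogField _)

/-- With `κ = -1` and reference index `1 - s` the constant `κ(1 - s)s/2` is `s(s - 1)/2`. -/
theorem ModePair.nprod_neg_one {s : ℂ} (h : ModePair s τ a b) (v : M) :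
    (fun n e => nprod (-1) b a n e v)
      = diag (normalOrder (1 - s) b a v) + (s * (s - 1) / 2) • monomial1 1 v := by
  have h1 : CanonAnticomm (1 - s) (-1) 0 b a := by
    have := h.fst_snd.symm.add_int 1
    rwa [Int.cast_one, neg_add_eq_sub] at this
  have h2 : SuppCoset (1 - s) b := by
    have := h.supp_snd.add_int 1
    rwa [Int.cast_one, neg_add_eq_sub] at this
  rw [h1.nprod_neg_one h2 h.isLog_snd h.isLog_fst v]
  congr 2
  ring

theorem ModePair.isVirasoroOp {s : ℂ} {e : ℤ} (h : ModePair s τ a b) (he : τ = 0 ∨ 2 * s = e) :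
    IsVirasoroOp s (fun k => a (s + k) 0) (fun k => b (-s + k) 0)
      (fun n => nprod (-1) b a (n + 1) 0) := by
  intro n v
  have h3 := congrFun (congrFun (h.nprod_neg_one v) (n + 1)) 0
  have hsys := h.modeSystem he
  simp only [Pi.add_apply, Pi.smul_apply] at h3
  rw [h3, h.diag_normalOrder]
  by_cases hn : n = 0
  · subst hn
    rw [if_pos rfl, monomial1, if_pos ⟨by simp, rfl⟩]
    rfl
  · rw [if_neg hn, zero_smul, monomial1, if_neg (fun h => hn (by have := h.1; simpa using this)), smul_zero]
    congr 1
    refine finsum_congr fun k => ?_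
    -- For `n ≠ 0` the reordering at `n` that comes from the field may be replaced by the one at
    -- `0`.
    have := hsys.virTerm_reorder n 0 k (by omega) v
    rw [add_zero] at this
    exact this

theorem IsTwistedModule.isTwistedVirasoro (hπ : π * π = 1) (hg : TwistData r t g c τ)
    (h : IsTwistedModule g π Y) {ω : SF} (hω : IsNProduct 1 1 (-1) SF.psibar.1 SF.psi.1 ω.1) :
    IsTwistedVirasoro r Y ω := by
  obtain ⟨a, hab, hY, -, -⟩ := h.exists_modePair hπ hg
  set b := Y (sfGen 1) with hb
  have hYω : Y ω = nprod (-1) b a := by rw [h.conformal_eq hω, hY, hab.nprod_neg_one_pairFields]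
  -- Passing from `r` to its representative `s` only relabels the modes by `f`; the mode formulas
  -- are proved in the labels of `s`.
  set f := ⌊r.re⌋ with hf
  set s := cosetRep r with hs
  have hab' : ModePair s τ a b := by
    have := hab.add_int (-f)
    rwa [Int.cast_neg, ← sub_eq_add_neg] at this
  obtain ⟨e, he⟩ : ∃ e : ℤ, τ = 0 ∨ 2 * s = e := by
    rcases hg.cases with ⟨h0, -⟩ | ⟨-, -, n, hn⟩
    · exact ⟨0, Or.inl h0⟩
    · exact ⟨n - 2 * f, Or.inr (by rw [hs, cosetRep]; push_cast; linear_combination hn)⟩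
  have hsys := hab'.modeSystem he
  have hvir := hab'.isVirasoroOp he
  set A : ℤ → Module.End ℂ M := fun k => a (s + k) 0 with hA
  set B : ℤ → Module.End ℂ M := fun k => b (-s + k) 0 with hB
  have hL : ∀ n : ℤ, virMode Y ω n = nprod (-1) b a (n + 1) 0 := fun n => by rw [virMode, hYω]
  have hpsi : ∀ k : ℤ, psiMode Y (s + k) = A k := fun k => by
    have := hg.pairFields_apply (a := a) hab.supp_snd (k - f)
    rw [← hY, add_eq_cosetRep_add, sub_add_cancel] at this
    exact this
  have hpsibar : ∀ k : ℤ, psibarMode Y (-s + k) = B k := fun k => rfl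
  have hterm : ∀ (n : ℤ), n ≠ 0 → ∀ v k, virSummand r Y n v k = virTerm A B n (k + f) v := by
    intro n hn v k
    -- The reordering point is chosen so low that `k + f` lies above it, which yields the plain
    -- product `ψ̄ψ` of the unordered sum.
    have := hsys.virTerm_reorder (n - (|n| + |k + f|)) (|n| + |k + f|) (k + f) (by omega) v
    rw [sub_add_cancel, if_pos] at this
    · rw [← this, virSummand, add_eq_cosetRep_add, ← hf, ← hs, hpsi, ← hpsibar]
      congr 3
      push_cast
      ring
    · have h1 := le_abs_self n
      have h2 := neg_abs_le (k + f)
      omega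
  have hz : ∀ v k, virZeroSummand r Y v k
      = if 0 ≤ k + f ∧ ¬(k + f = 0 ∧ s = 0) then B (-(k + f)) (A (k + f) v) else 0 := by
    intro v k
    have hiff : (0 ≤ (r + k).re ∧ r + k ≠ 0) ↔ 0 ≤ k + f ∧ ¬(k + f = 0 ∧ s = 0) := by
      rw [add_eq_cosetRep_add, re_cosetRep_add_nonneg_iff]
      exact and_congr_right fun h0 => not_congr (cosetRep_add_eq_zero_iff r _ h0)
    by_cases hc : 0 ≤ (r + k).re ∧ r + k ≠ 0
    · rw [if_pos (hiff.mp hc), virZeroSummand, if_pos hc, add_eq_cosetRep_add, ← hf, ← hs, hpsi, ← hpsibar]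
      congr 2
      push_cast
      ring
    · rw [if_neg (fun h => hc (hiff.mpr h)), virZeroSummand, if_neg hc]
  have hz' : ∀ v k, virZeroSummand' r Y v k
      = if 0 ≤ f - k then 0 else A (f - k) (B (-(f - k)) v) := by
    intro v k
    have e1 : -r + (k : ℂ) = -(s + ((f - k : ℤ) : ℂ)) := by
      rw [hs, cosetRep]
      push_cast
      ring
    have hiff : 0 < (-r + k).re ↔ ¬ 0 ≤ f - k := by
      rw [e1, Complex.neg_re, ← re_cosetRep_add_nonneg_iff r (f - k), Left.neg_pos_iff, not_le]
    by_cases hc : 0 < (-r + k).re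
    · rw [if_neg (hiff.mp hc), virZeroSummand', if_pos hc, e1, neg_neg, hpsi, ← hpsibar]
      congr 3
      push_cast
      ring
    · rw [if_pos (not_not.mp (fun h => hc (hiff.mpr h))), virZeroSummand', if_neg hc]
  have fz : ∀ v, (Function.support fun k => if 0 ≤ k ∧ ¬(k = 0 ∧ s = 0) then B (-k) (A k v) else 0).Finite := by
    intro v
    refine (hsys.finite_virTerm 0 v).subset fun k hk h0 => hk ?_
    have h0' : virTerm A B 0 k v = 0 := h0
    by_cases hc : 0 ≤ k ∧ ¬(k = 0 ∧ s = 0)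
    · rw [virTerm, if_pos hc.1, zero_sub] at h0'
      simp only [h0', ite_self]
    · exact if_neg hc
  have fz' : ∀ v, (Function.support fun k => if 0 ≤ k then 0 else A k (B (-k) v)).Finite := by
    intro v
    refine (hsys.finite_virTerm 0 v).subset fun k hk h0 => hk ?_
    have h0' : virTerm A B 0 k v = 0 := h0
    by_cases hc : 0 ≤ k
    · exact if_pos hc
    · rw [virTerm, if_neg hc, zero_sub, neg_eq_zero] at h0'
      simp only [h0', ite_self]
  refine ⟨fun n k hn => ?_, fun m n => ?_, fun n hn v => ?_, fun v => ?_, fun v => ?_, fun n hn v => ?_,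
    fun v => ?_⟩
  · refine LinearMap.ext fun v => ?_
    have h3 := congrFun (congrFun (hab'.nprod_neg_one v) n) k
    simp only [Pi.add_apply, Pi.smul_apply] at h3
    rw [hYω, h3, hab'.diag_normalOrder_eq_zero hn, monomial1, if_neg, smul_zero, add_zero, LinearMap.zero_apply]
    rintro ⟨rfl, rfl⟩
    rcases hn with hn | hn
    · exact hn rfl
    · exact hn 1 (by simp)
  · refine LinearMap.ext fun v => ?_
    rw [hL, hL, hL]
    exact hsys.virasoro hvir m n v
  · rw [show virSummand r Y n v = (fun k => virTerm A B n k v) ∘ (· + f) from funext (hterm n hn v),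
      Function.support_comp_eq_preimage]
    exact (hsys.finite_virTerm n v).preimage (add_left_injective f).injOn
  · rw [show virZeroSummand r Y v
      = (fun k => if 0 ≤ k ∧ ¬(k = 0 ∧ s = 0) then B (-k) (A k v) else 0) ∘ (· + f) from funext (hz v),
      Function.support_comp_eq_preimage]
    exact (fz v).preimage (add_left_injective f).injOn
  · rw [show virZeroSummand' r Y v
      = (fun k => if 0 ≤ k then 0 else A k (B (-k) v)) ∘ (f - ·) from funext (hz' v),
      Function.support_comp_eq_preimage]
    exact (fz' v).preimage (sub_right_injective (b := f)).injOn
  · rw [hL, hvir, if_neg hn, zero_smul, add_zero, ← finsum_comp_equiv (Equiv.addRight f)]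
    exact finsum_congr fun k => (hterm n hn v k).symm
  · have f0 : (Function.support fun k : ℤ => if k = 0 then (if s = 0 then B 0 (A 0 v) else 0) else 0).Finite :=
      ModeSystem.finite_ite_single 0 _
    have hsum : ∀ k, virTerm A B 0 k v = ((if 0 ≤ k ∧ ¬(k = 0 ∧ s = 0) then B (-k) (A k v) else 0)
        + if k = 0 then (if s = 0 then B 0 (A 0 v) else 0) else 0)
        - if 0 ≤ k then 0 else A k (B (-k) v) := by
      intro k
      rw [virTerm, zero_sub]
      by_cases hk : 0 ≤ k
      · rw [if_pos hk, if_pos hk, sub_zero]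
        by_cases hk0 : k = 0
        · subst hk0
          by_cases hs0 : s = 0
          · simp [hs0]
          · simp [hs0]
        · rw [if_neg hk0, if_pos ⟨hk, fun h => hk0 h.1⟩, add_zero]
      · rw [if_neg hk, if_neg hk, if_neg fun h => hk h.1, if_neg (by omega), zero_add, zero_sub]
    -- For `s = 0` the zero modes anticommute, so half of their commutator equals the product `ψ̄_0
    -- ψ_0` of the ordered sum.
    have hzero : (open Classical in if ∃ k : ℤ, r = k then
        (1 / 2 : ℂ) • (psibarMode Y 0 (psiMode Y 0 v) - psiMode Y 0 (psibarMode Y 0 v)) else 0)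
        = if s = 0 then B 0 (A 0 v) else 0 := by
      by_cases hs0 : s = 0
      · have h1 := hpsi 0
        have h2 := hpsibar 0
        have h3 := hsys.fst_snd 0 0 v
        rw [if_pos (add_zero 0), hs0, Int.cast_zero, add_zero, zero_smul, ← eq_neg_iff_add_eq_zero] at h3
        rw [hs0, Int.cast_zero, add_zero] at h1
        rw [hs0, Int.cast_zero, add_zero, neg_zero] at h2
        rw [if_pos ((cosetRep_eq_zero_iff r).mp hs0), if_pos hs0, h1, h2, h3]
        module
      · rw [if_neg (fun h => hs0 ((cosetRep_eq_zero_iff r).mpr h)), if_neg hs0]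
    rw [hL, hvir, if_pos rfl, hzero]
    congr 1
    simp only [hsum]
    rw [finsum_sub_distrib (((fz v).union f0).subset (Function.support_add _ _)) (fz' v),
      finsum_add_distrib (fz v) f0, ModeSystem.finsum_ite_single]
    congr 1
    · congr 1
      rw [← finsum_comp_equiv (Equiv.addRight f)]
      exact finsum_congr fun k => (hz v k).symm
    · rw [← finsum_comp_equiv (Equiv.subLeft f)]
      exact finsum_congr fun k => (hz' v k).symm

end Conformal

end SymplecticFermions
end

/-! ### The main theorem. -/

open SymplecticFermions in
theorem mainTheorem3 (r t : ℂ) (g : Matrix.SpecialLinearGroup (Fin 2) ℂ) (hg : IsTwist r t g) :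
    -- the twisted modes of a twisted module satisfy the relations
    (∀ (M : Type*) [AddCommGroup M] [Module ℂ M] (π : Module.End ℂ M), π * π = 1 →
      ∀ Y : SF →ₗ[ℂ] FormalField M, IsTwistedModule g π Y →
        ∃ ρ : ModeAlgebra r t →ₐ[ℂ] Module.End ℂ M,
          IsModeAction r t Y ρ ∧ IsRestricted r t ρ ∧ IsSuperRep r t π ρ) ∧
    -- every restricted representation comes from a unique twisted module
    (∀ (M : Type*) [AddCommGroup M] [Module ℂ M] (π : Module.End ℂ M), π * π = 1 →
      ∀ ρ : ModeAlgebra r t →ₐ[ℂ] Module.End ℂ M, IsRestricted r t ρ → IsSuperRep r t π ρ →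
        ∃! Y : SF →ₗ[ℂ] FormalField M, IsTwistedModule g π Y ∧ IsModeAction r t Y ρ) ∧
    -- no further relations hold between the twisted modes
    (∀ a : ModeAlgebra r t,
      (∀ (M : Type) [AddCommGroup M] [Module ℂ M] (π : Module.End ℂ M), π * π = 1 →
        ∀ Y : SF →ₗ[ℂ] FormalField M, IsTwistedModule g π Y →
          ∀ ρ : ModeAlgebra r t →ₐ[ℂ] Module.End ℂ M, IsModeAction r t Y ρ → ρ a = 0) →
      a = 0) ∧
    -- the Virasoro action of the conformal vector `ψ̄_{(-1)} ψ`
    (∃ ω : SF, IsNProduct 1 1 (-1) SF.psibar.1 SF.psi.1 ω.1 ∧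
      ∀ (M : Type*) [AddCommGroup M] [Module ℂ M] (π : Module.End ℂ M), π * π = 1 →
        ∀ Y : SF →ₗ[ℂ] FormalField M, IsTwistedModule g π Y → IsTwistedVirasoro r Y ω) := by
  obtain ⟨c, τ, hd⟩ := hg.exists_data
  refine ⟨fun M _ _ π hπ Y hY => hY.exists_rep hπ hd, fun M _ _ π hπ ρ hρ hs => ?_, fun a ha => ?_, ?_⟩
  · obtain ⟨Y, hY, hYρ⟩ := hd.exists_module hπ hρ hs
    exact ⟨Y, ⟨hY, hYρ⟩, fun Y' hY' => hY'.1.eq_of_isModeAction hπ hd hY hY'.2 hYρ⟩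
  · refine eq_zero_of_restricted fun M _ _ π hπ ρ hρ hs => ?_
    obtain ⟨Y, hY, hYρ⟩ := hd.exists_module hπ hρ hs
    exact ha M π hπ Y hY ρ hYρ
  · obtain ⟨ω, hω⟩ := exists_conformal
    exact ⟨ω, hω, fun M _ _ π hπ Y hY => hY.isTwistedVirasoro hπ hd hω⟩
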